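/- **Grid and cover.** Let $K\subset S^3$ be a knot, $m\ge 1$, and let $G$ be an $n\times n$ grid diagram of $K$ (one $X$ and one $O$ in each row and column, in different squares). On the torus obtained by identifying opposite sides, $\beta_j$ is the left side of column $j$ and $\alpha_i$ the lower side of row $i$. Let $\widetilde G$ be the $m$-fold branched cover of the torus obtained from $m$ sheets (numbered modulo $m$) by cutting along the vertical segment joining the markings in each column; if $X$ is above (below) $O$, the left (right) side of the cut in sheet $k$ is glued to the right (left) side in sheet $k+1$. Each $\alpha_i,\beta_j$ has $m$ lifts; $\widetilde\beta_j^k$ is the lift in sheet $k$. A generator $\mathbf x\in\mathbf S(\widetilde G)$ is a set of intersection points with exactly one point on each lift of each $\alpha$- and each $\beta$-circle; $C(\widetilde G)$ is the free abelian group on $\mathbf S(\widetilde G)$. A rectangle from $\mathbf x$ to $\mathbf y$, where $\mathbf x,\mathbf y$ differ in two points, has lower left and upper right corners in $\mathbf x$ and the other two corners in $\mathbf y$; it is empty if it contains no markings and no point of $\mathbf x$ in its interior. **Alexander grading.** For finite planar sets let $\mathcal J(A,B)$ be the number of pairs $(a,b)\in A\times B$ with $(b_1-a_1)(b_2-a_2)>0$,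 extended bilinearly. For a generator $\mathbf x$ of $G$ itself put $A(\mathbf x)=\frac12\mathcal J(\mathbf x-\frac12(\mathbb X+\mathbb O),\mathbb X-\mathbb O)-\frac{n-1}2$. For $\mathbf x\in\mathbf S(\widetilde G)$ let $A(\mathbf x)$ be the average of $A(\mathbf x_1),\dots,A(\mathbf x_m)$ for any decomposition of $\mathbf x$ into lifts of generators $\mathbf x_1,\dots,\mathbf x_m$ of $G$. **Signs.** A formal generator of power $N$ is a pairing of $\alpha_1,\dots,\alpha_N$ with $\beta_1,\dots,\beta_N$ and a sign for each pair. A formal flow is an oriented planar bigon or rectangle (up to orientation-preserving homeomorphism) that changes one formal generator into another, the signs being local intersection numbers; the initial corners of a rectangle are SW and NE. A sign assignment $\mathcal S$ of power $N$ assigns $\pm1$ to each formal flow so that: $\mathcal S(\phi_1)\mathcal S(\phi_2)=1$ (resp. $-1$) if $\phi_1,\phi_2$ form a disk or annulus bounded by $\alpha$-circles (resp. by $\beta$-circles); and $\mathcal S(\phi_1)\mathcal S(\phi_2)+\mathcal S(\phi_3)\mathcal S(\phi_4)=0$ if $(\phi_1,\phi_2)$ and $(\phi_3,\phi_4)$ are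 the two decompositions of one planar configuration: two flows without common edges used in the two orders, or a region with one concave corner cut along either curve through that corner. **Stabilization.** Let $H$ be the $(n+1)\times(n+1)$ grid obtained from $G$ by replacing one row by two rows and inserting a column with markings $O_1$ in the upper and $X_1$ in the lower of these two rows. The $X$ of the old row is placed in the upper row, the $O$ in the lower row, and the new column is adjacent to the column of that $X$ (on its left or right). Let $\alpha_1$ be the circle between $O_1$ and $X_1$, and $\beta_1,\beta_2$ the circles to the left and right of $O_1$. Let $w_k$ be the point over $\alpha_1\cap\beta_1$ in sheet $k$, and let $\lambda_k$ be the lift in sheet $k$ of a circle around the segment $O_1X_1$. Generators of $\widetilde H$ that contain all $w_k$ are identified with generators of $\widetilde G$ by forgetting the $w_k$. Fix a sign assignment $\mathcal S$ of power $m(n+1)$ and orderings and orientations of the lifted curves for $\widetilde H$. Rectangles and punctured rectangles in $\widetilde H$ thereby have signs $\mathcal S$. An empty rectangle in $\widetilde G$ gets the sign of the rectangle with the same corners in $\widetilde H$. On $C(\widetilde H)$ and $C(\widetilde G)$ let $\partial\mathbf x$ be the signed sum, over all $\mathbf y$ and all empty rectangles from $\mathbf x$ to $\mathbf y$, of $\mathbf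 y$. **Pseudo-domains.** - A *punctured rectangle* in sheet $k$ from $\mathbf x$ to $\mathbf z$ has sides on $\widetilde\beta_1^k$ and $\widetilde\beta_2^k$, width one, corners as for a rectangle from $\mathbf x$ to $\mathbf z$, and contains the puncture $\lambda_k$. - A *punctured hexagon* in sheet $k$ from $\mathbf x$ to $\mathbf y$ is the union of a punctured rectangle $\mathfrak a$ in sheet $k$ from $\mathbf x$ to some $\mathbf z$ and an empty rectangle $r$ from $\mathbf z$ to $\mathbf y$. The right side of $r$ lies on $\widetilde\beta_1^k$, its left side on a third curve, and its upper edge on the same $\alpha$-curve as that of $\mathfrak a$. The component of $\mathbf y$ on $\widetilde\beta_1^k$ is an interior point of the left side of $\mathfrak a$, called the obtuse corner. Its sign is the product of the signs of $\mathfrak a$ and $r$. - A *$4m$-gon* $\theta$ from $\mathbf x$ to $\mathbf y$ ($\mathbf y$ containing all $w_k$) is an embedded disk whose only basepoint is $X_1$ and with no point of $\mathbf x$ in its interior. Its boundary consists, for each $k$, of the arcs: down $\widetilde\beta_1^k$ from $w_k$ to a point of $\mathbf x$, right along an $\alpha$-curve to a point of $\mathbf y$, up a $\beta$-curve to the point of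 $\mathbf x$ on the lift of $\alpha_1$ through $w_{k+1}$, and left along this lift, through the branch cut, to $w_{k+1}$. Let $a_1,b_1,\dots,a_{2m},b_{2m}$ be its edges in clockwise order, where the $\alpha$-edge $a_1$ starts at the point of $\mathbf x$ on $\widetilde\beta_1$ in a fixed sheet. Its sign is $\mu(\theta)=(-1)^{m-1}\prod_{i=1}^{2m-1}\mathcal S(R_i)$, where $R_1,\dots,R_{2m-1}$ are successive formal rectangles leading from $\mathbf x$ to $\mathbf y$; $R_i$ has edges $a_{i+1}\to b_i\to a_1\to b_{i+1}$ (north, west, south, east), and the edge $a_1$ is oriented relative to the boundary of $R_i$ as in $\theta$ for odd $i$ and oppositely for even $i$, while $a_{i+1}$ is always oriented as in $\theta$. - A *Type L* pseudo-domain from $\mathbf x$ to $\mathbf y$ is a product of punctured hexagons, one for each sheet $k$ with $w_k\notin\mathbf x$, with obtuse corner $w_k$ (trivial if there is no such $k$). A *Type R* pseudo-domain is a product of punctured hexagons, in different sheets, with obtuse corners different from the $w_k$, followed by a $4m$-gon. The sign $\mu$ is the product of the signs of the pieces; the hexagons are composed in the order of any fixed enumeration of the sheets. **Lemma.** Let $$F:C(\widetilde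 H)\to C(\widetilde G)[1]\oplus C(\widetilde G),\qquad F(\mathbf x)=\Big(\sum_{\mathbf y}\sum_{p\ \text{of Type R}}\mu(p)\,\mathbf y,\ \sum_{\mathbf y}\sum_{p\ \text{of Type L}}\mu(p)\,\mathbf y\Big),$$ where $\mathbf y$ runs over the generators of $\widetilde H$ containing all $w_k$, identified with $\mathbf S(\widetilde G)$, and $p$ over the pseudo-domains from $\mathbf x$ to $\mathbf y$. Give the target the differential $(a,b)\mapsto(-\partial a,\partial b)$ and the Alexander grading in which $\mathbf y\in\mathbf S(\widetilde G)$ has degree $A(\mathbf y)$ in the first summand and $A(\mathbf y)-1$ in the second. Then $F$ is a chain map over $\mathbb Z$ (it commutes with the differentials) and it preserves the Alexander grading. -/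

import Mathlib

namespace GridCover

/-! ## Formal flows and sign assignments -/

/-- A formal generator of power `M`: a pairing `σ` of the curves `α_i` with the curves `β_{σ i}`,
together with a sign `ε i` at the intersection point of `α_i` and `β_{σ i}`. -/
@[ext]
structure FormalGenerator (M : ℕ) where
  ε : Fin M → ℤˣ
  σ : Equiv.Perm (Fin M)

/-- The shape of a formal flow (formal bigon or formal rectangle), apart from its initial generator.

The edges of a bigon or rectangle are oriented arcs. For an arc on the boundary of a planar region
let `τ = 1` if the arc is oriented along the (counterclockwise) boundary orientation of the region
and `τ = -1` otherwise. The boundary runs along each `α`-arc from an initial corner to a terminal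
corner and along each `β`-arc from a terminal corner to an initial corner, so that the local
intersection number of an `α`-arc and a `β`-arc is `-τ_α τ_β` at an initial corner and
`τ_α τ_β` at a terminal corner.

* `bigon i τ` has its `α`-edge on `α_i`, with boundary sign `τ`.
* `rectangle s n h τs τn` has south edge on `α_s` and north edge on `α_n`, with boundary signs
  `τs` and `τn`; the initial corners are `SW` and `NE`.

The `β`-edges lie on the curves paired with these `α`-curves in the initial generator, and their
orientations are determined by the signs of the initial generator. -/
inductive FlowShape (M : ℕ) where
  | bigon (i : Fin M) (τ : ℤˣ) : FlowShape M
  | rectangle (s n : Fin M) (h : s ≠ n) (τs τn : ℤˣ) : FlowShape M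

/-- The indices of the `α`-edges. -/
def FlowShape.support {M : ℕ} : FlowShape M → Finset (Fin M)
  | .bigon i _ => {i}
  | .rectangle s n _ _ _ => {s, n}

/-- The boundary sign of the `β`-edge ending at the initial corner of `x` on `α_i`, where `τ` is the
boundary sign of the `α`-edge on `α_i`. -/
def FormalGenerator.betaSign {M : ℕ} (x : FormalGenerator M) (i : Fin M) (τ : ℤˣ) : ℤˣ :=
  -(x.ε i * τ)

/-- The terminal generator of the flow of the given shape with initial generator `x`: the
intersection sign at a terminal corner is the product of the boundary signs of its two edges. -/
def FlowShape.terminal {M : ℕ} : FlowShape M → FormalGenerator M → FormalGenerator M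
  | .bigon i τ, x => ⟨Function.update x.ε i (τ * x.betaSign i τ), x.σ⟩
  | .rectangle s n _ τs τn, x =>
      ⟨Function.update (Function.update x.ε s (τs * x.betaSign n τn)) n (τn * x.betaSign s τs),
        x.σ * Equiv.swap s n⟩

/-- A formal flow of power `M`. Rotating a rectangle by 180 degrees exchanges its south and north
edges and preserves boundary signs; the two presentations give the same formal flow (see
`SignAssignment.rotate`). -/
structure FormalFlow (M : ℕ) where
  source : FormalGenerator M
  shape : FlowShape M

/-- The terminal generator of a formal flow. -/
def FormalFlow.target {M : ℕ} (φ : FormalFlow M) : FormalGenerator M := φ.shape.terminal φ.source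

/-- Boundary degenerations of type `α`: flows `φ₁ : x → y` and `φ₂ : y → x` whose union is a disk
bounded by an `α`-circle and cut by a `β`-arc (two bigons), or an annulus bounded by two
`α`-circles and cut by two `β`-arcs (two rectangles). The `α`-edges of the two flows are
consecutive arcs of the boundary circles. -/
inductive AlphaDegeneration {M : ℕ} : FlowShape M → FlowShape M → Prop
  | bigon (i : Fin M) (τ : ℤˣ) : AlphaDegeneration (.bigon i τ) (.bigon i τ)
  | rectangle (s n : Fin M) (h : s ≠ n) (τs τn : ℤˣ) :
      AlphaDegeneration (.rectangle s n h τs τn) (.rectangle s n h τs τn)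

/-- Boundary degenerations of type `β`: as before with the roles of `α` and `β` exchanged. The
two flows lie on opposite sides of their common `α`-edges. -/
inductive BetaDegeneration {M : ℕ} : FlowShape M → FlowShape M → Prop
  | bigon (i : Fin M) (τ : ℤˣ) : BetaDegeneration (.bigon i τ) (.bigon i (-τ))
  | rectangle (s n : Fin M) (h : s ≠ n) (τs τn : ℤˣ) :
      BetaDegeneration (.rectangle s n h τs τn) (.rectangle s n h (-τs) (-τn))

/-! A bigon and a rectangle with one common corner form a quadrilateral with one concave corner.
Its corners are, in boundary order, the initial corner on `α_i`, the terminal corner on `α_i`, the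
initial corner on `α_j`, the terminal corner on `α_j`, and `τi`, `τj` are the boundary signs of its
`α`-edges. Prolonging the `α`-curve or the `β`-curve at the concave corner cuts it into a bigon and
a rectangle. -/

/-- Cuts along the `α`-curve at a concave initial corner on `α_i`. -/
inductive InitialAlphaCut {M : ℕ} (i j : Fin M) (h : i ≠ j) (τi τj : ℤˣ) :
    FlowShape M → FlowShape M → Prop
  | rectangle_bigon :
      InitialAlphaCut i j h τi τj (.rectangle i j h (-τi) τj) (.bigon i τi)
  | bigon_rectangle :
      InitialAlphaCut i j h τi τj (.bigon i (-τi)) (.rectangle i j h τi τj)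

/-- Cuts along the `β`-curve at a concave initial corner on `α_i`. -/
inductive InitialBetaCut {M : ℕ} (i j : Fin M) (h : i ≠ j) (τi τj : ℤˣ) :
    FlowShape M → FlowShape M → Prop
  | bigon_rectangle :
      InitialBetaCut i j h τi τj (.bigon i τi) (.rectangle i j h τi τj)
  | rectangle_bigon :
      InitialBetaCut i j h τi τj (.rectangle i j h τi τj) (.bigon j τj)

/-- Cuts along the `α`-curve at a concave terminal corner on `α_i`. -/
inductive TerminalAlphaCut {M : ℕ} (i j : Fin M) (h : i ≠ j) (τi τj : ℤˣ) :
    FlowShape M → FlowShape M → Prop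
  | rectangle_bigon :
      TerminalAlphaCut i j h τi τj (.rectangle i j h τi τj) (.bigon i (-τi))
  | bigon_rectangle :
      TerminalAlphaCut i j h τi τj (.bigon i τi) (.rectangle i j h (-τi) τj)

/-- Cuts along the `β`-curve at a concave terminal corner on `α_i`. -/
inductive TerminalBetaCut {M : ℕ} (i j : Fin M) (h : i ≠ j) (τi τj : ℤˣ) :
    FlowShape M → FlowShape M → Prop
  | rectangle_bigon :
      TerminalBetaCut i j h τi τj (.rectangle i j h τi τj) (.bigon i τi)
  | bigon_rectangle :
      TerminalBetaCut i j h τi τj (.bigon j τj) (.rectangle i j h τi τj)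

/-- `Square a b c d`: for every initial generator the flows of shape `a` then `b`, and `c` then `d`,
are the two decompositions of one planar configuration.

* `disjoint`: two flows without common edges, in either order.
* `hexagonInitial`, `hexagonTerminal`: a hexagon with one concave corner on `α_i` (an initial
  or a terminal one), cut along the `α`-curve and along the `β`-curve of that corner. In boundary
  order its corners lie on `α_i, α_i, α_j, α_j, α_k, α_k`, starting with the initial one on `α_i`,
  and `τi`, `τj`, `τk` are the boundary signs of the `α`-edges.
* `quadInitial`, `quadTerminal`: a quadrilateral with one concave corner. -/
inductive Square {M : ℕ} : FlowShape M → FlowShape M → FlowShape M → FlowShape M → Prop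
  | disjoint (a b : FlowShape M) (h : Disjoint a.support b.support) : Square a b b a
  | hexagonInitial (i j k : Fin M) (hij : i ≠ j) (hjk : j ≠ k) (hik : i ≠ k) (τi τj τk : ℤˣ) :
      Square (.rectangle i k hik (-τi) τk) (.rectangle i j hij τi τj)
        (.rectangle i j hij τi τj) (.rectangle j k hjk τj τk)
  | hexagonTerminal (i j k : Fin M) (hij : i ≠ j) (hjk : j ≠ k) (hik : i ≠ k) (τi τj τk : ℤˣ) :
      Square (.rectangle i k hik τi τk) (.rectangle i j hij (-τi) τj)
        (.rectangle j k hjk τj τk) (.rectangle i k hik τi τk)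
  | quadInitial (i j : Fin M) (h : i ≠ j) (τi τj : ℤˣ) (a b c d : FlowShape M)
      (hab : InitialAlphaCut i j h τi τj a b) (hcd : InitialBetaCut i j h τi τj c d) :
      Square a b c d
  | quadTerminal (i j : Fin M) (h : i ≠ j) (τi τj : ℤˣ) (a b c d : FlowShape M)
      (hab : TerminalAlphaCut i j h τi τj a b) (hcd : TerminalBetaCut i j h τi τj c d) :
      Square a b c d

/-- A sign assignment of power `M`. -/
structure SignAssignment (M : ℕ) where
  sign : FormalFlow M → ℤˣ
  rotate : ∀ (x : FormalGenerator M) (s n : Fin M) (h : s ≠ n) (τs τn : ℤˣ),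
    sign ⟨x, .rectangle s n h τs τn⟩ = sign ⟨x, .rectangle n s h.symm τn τs⟩
  alpha : ∀ (x : FormalGenerator M) (a b : FlowShape M), AlphaDegeneration a b →
    sign ⟨x, a⟩ * sign ⟨a.terminal x, b⟩ = 1
  beta : ∀ (x : FormalGenerator M) (a b : FlowShape M), BetaDegeneration a b →
    sign ⟨x, a⟩ * sign ⟨a.terminal x, b⟩ = -1
  square : ∀ (x : FormalGenerator M) (a b c d : FlowShape M), Square a b c d →
    ((sign ⟨x, a⟩ * sign ⟨a.terminal x, b⟩ : ℤˣ) : ℤ)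
      + ((sign ⟨x, c⟩ * sign ⟨c.terminal x, d⟩ : ℤˣ) : ℤ) = 0

/-- The product of the signs of consecutive flows of the given shapes, starting at `x`. -/
def SignAssignment.pathSign {M : ℕ} (S : SignAssignment M) :
    FormalGenerator M → List (FlowShape M) → ℤˣ
  | _, [] => 1
  | x, a :: l => S.sign ⟨x, a⟩ * S.pathSign (a.terminal x) l

/-! ## Grid diagrams and their cyclic branched covers -/

/-- The markings of an `n × n` grid: column `c` has its `X` in row `X c` and its `O` in row `O c`.
Columns are numbered from left to right and rows from bottom to top. The vertical circle `β_j` is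
the left side of column `j` and the horizontal circle `α_i` is the lower side of row `i`, on the
torus obtained by identifying opposite sides of the grid. -/
structure Grid (n : ℕ) where
  X : Equiv.Perm (Fin n)
  O : Equiv.Perm (Fin n)

/-- The grid is a grid diagram of a knot: no square has two markings, and the closed polygon
through the markings is connected. -/
structure Grid.IsKnotDiagram {n : ℕ} (G : Grid n) : Prop where
  X_ne_O : ∀ c, G.X c ≠ G.O c
  isCycle : (G.X⁻¹ * G.O).IsCycle

/-- `t` lies in the cyclic interval `[a, b)` of `Fin n`. -/
def CycIco {n : ℕ} (a b t : Fin n) : Prop := t - a < b - a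

/-- `t` lies in the open cyclic interval `(a, b)` of `Fin n`. -/
def CycIoo {n : ℕ} (a b t : Fin n) : Prop := t ≠ a ∧ t - a < b - a

/-- The lifts of the circles `α_i` (or of the `β_j`) to the `m`-fold cover. The pair `(j, k)`
denotes the lift of `β_j` in the `k`-th sheet, respectively the lift of `α_j` which meets the lift
of `β_0` in the `k`-th sheet. -/
abbrev Curve (n m : ℕ) : Type := Fin n × ZMod m

namespace Grid

variable {n : ℕ} (G : Grid n)

/-- The change of sheet when one moves along `α_i` from left to right through column `c`. The sheets
are cut along the vertical segment joining the markings of the column. If `X` is above `O`, the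
left side of the cut in sheet `k` is glued to the right side of the cut in sheet `k + 1`; if `X` is
below `O`, the right side in sheet `k` is glued to the left side in sheet `k + 1`. -/
def crossing (c i : Fin n) : ℤ :=
  if G.O c < i ∧ i ≤ G.X c then 1 else if G.X c < i ∧ i ≤ G.O c then -1 else 0

/-- The change of sheet along `α_i` from `β_0` to `β_j`. -/
def sheetShift (i j : Fin n) : ℤ := ∑ c, if c < j then G.crossing c i else 0

/-- The lift of `α_i` through the point over `α_i ∩ β_j` in the `k`-th sheet. -/
def alphaThrough {m : ℕ} (i : Fin n) (b : Curve n m) : Curve n m :=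
  (i, b.2 - (G.sheetShift i b.1 : ZMod m))

end Grid

/-- Generators of the `m`-fold cover of `G`: the lift `b` of a `β`-circle carries exactly one
component, which lies over row line `row b`, and every lift of an `α`-circle carries exactly one
component. -/
@[ext]
structure Generator {n : ℕ} (G : Grid n) (m : ℕ) where
  row : Curve n m → Fin n
  bijective : Function.Bijective fun b => G.alphaThrough (row b) b

noncomputable instance {n : ℕ} (G : Grid n) (m : ℕ) [NeZero m] : Fintype (Generator G m) :=
  Fintype.ofInjective Generator.row fun _ _ h => Generator.ext h

namespace Generator

variable {n m : ℕ} {G : Grid n}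

/-- The lift of an `α`-circle carrying the component of `x` on `b`. -/
def alpha (x : Generator G m) (b : Curve n m) : Curve n m := G.alphaThrough (x.row b) b

/-- The generator as a bijection from lifts of `β`-circles to lifts of `α`-circles. -/
noncomputable def equiv (x : Generator G m) : Curve n m ≃ Curve n m :=
  Equiv.ofBijective x.alpha x.bijective

/-- `y` is obtained from `x` by exchanging the rows of the components on `l` and `r`. -/
structure IsExchange (x y : Generator G m) (l r : Curve n m) : Prop where
  left : y.row l = x.row r
  right : y.row r = x.row l
  rest : ∀ b, b ≠ l → b ≠ r → y.row b = x.row b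

/-- There is an empty rectangle from `x` to `y` with left side on `l` and right side on `r`. Its
lower left and upper right corners are components of `x`, its other corners are components of
`y`, it contains no marking, and its interior contains no component of `x`. -/
structure IsRectangle (x y : Generator G m) (l r : Curve n m) : Prop where
  columns_ne : l.1 ≠ r.1
  bottom : G.alphaThrough (x.row l) r = x.alpha l
  top : G.alphaThrough (x.row r) l = x.alpha r
  no_X : ∀ c, CycIco l.1 r.1 c → ¬ CycIco (x.row l) (x.row r) (G.X c)
  no_O : ∀ c, CycIco l.1 r.1 c → ¬ CycIco (x.row l) (x.row r) (G.O c)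
  empty : ∀ b : Curve n m, CycIoo l.1 r.1 b.1 → G.alphaThrough (x.row l) b = x.alpha l →
    ¬ CycIoo (x.row l) (x.row r) (x.row b)
  exchange : IsExchange x y l r

open Classical in
/-- The set `π(x, y)` of empty rectangles from `x` to `y`, given by their left and right sides. -/
noncomputable def rectangles [NeZero m] (x y : Generator G m) :
    Finset (Curve n m × Curve n m) :=
  Finset.univ.filter fun r => IsRectangle x y r.1 r.2

end Generator

/-- The free abelian group `C(G̃)` on the generators. -/
abbrev Chains {n : ℕ} (G : Grid n) (m : ℕ) : Type := Generator G m →₀ ℤ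

/-- The boundary operator, where `sgn x s t` is the sign of a rectangle from `x` with lower edge on
`s` and upper edge on `t`. -/
noncomputable def boundary {n m : ℕ} [NeZero m] {G : Grid n}
    (sgn : Generator G m → Curve n m → Curve n m → ℤˣ) : Chains G m →ₗ[ℤ] Chains G m :=
  Finsupp.linearCombination ℤ fun x =>
    ∑ y : Generator G m, ∑ r ∈ x.rectangles y,
      Finsupp.single y (sgn x (x.alpha r.1) (x.alpha r.2) : ℤ)

/-! ## Alexander grading -/

/-- The bilinear extension to formal sums of points of the number `𝒥(A, B)` of pairs
`(a, b) ∈ A × B` with `(b₁ - a₁)(b₂ - a₂) > 0`. -/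
noncomputable def pairCount (A B : ℚ × ℚ →₀ ℚ) : ℚ :=
  A.sum fun a s => B.sum fun b t =>
    s * t * if 0 < (b.1 - a.1) * (b.2 - a.2) then 1 else 0

/-- The point `α_i ∩ β_j` of the plane. -/
def latticePoint {n : ℕ} (j i : Fin n) : ℚ × ℚ := ((j : ℕ), (i : ℕ))

/-- The centre of the square in column `c` and row `r`. -/
def centre {n : ℕ} (c r : Fin n) : ℚ × ℚ := ((c : ℕ) + 1 / 2, (r : ℕ) + 1 / 2)

/-- The formal sum of the `X`-markings. -/
noncomputable def Grid.sumX {n : ℕ} (G : Grid n) : ℚ × ℚ →₀ ℚ :=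
  ∑ c, Finsupp.single (centre c (G.X c)) 1

/-- The formal sum of the `O`-markings. -/
noncomputable def Grid.sumO {n : ℕ} (G : Grid n) : ℚ × ℚ →₀ ℚ :=
  ∑ c, Finsupp.single (centre c (G.O c)) 1

/-- The value `𝒥(P - (X + O)/2, X - O)/2 - (n - 1)/2` for a formal sum of points `P`. -/
noncomputable def Grid.alexanderValue {n : ℕ} (G : Grid n) (P : ℚ × ℚ →₀ ℚ) : ℚ :=
  1 / 2 * pairCount (P - (1 / 2 : ℚ) • (G.sumX + G.sumO)) (G.sumX - G.sumO) - ((n : ℚ) - 1) / 2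

/-- The Alexander grading of a generator of the grid diagram `G` itself, given as the permutation
which sends `j` to the row of its component on `β_j`. -/
noncomputable def Grid.alexander {n : ℕ} (G : Grid n) (x : Equiv.Perm (Fin n)) : ℚ :=
  G.alexanderValue (∑ j, Finsupp.single (latticePoint j (x j)) 1)

/-- The Alexander grading of a generator of the `m`-fold cover. It is the average of the gradings of
the parts of any decomposition of `x` into lifts of generators of `G`, see
`Generator.alexander_eq_average`; the projection of `x` is therefore weighted by `1 / m`. -/
noncomputable def Generator.alexander {n m : ℕ} [NeZero m] {G : Grid n} (x : Generator G m) : ℚ :=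
  G.alexanderValue (∑ b : Curve n m, Finsupp.single (latticePoint b.1 (x.row b)) (1 / (m : ℚ)))

theorem pairCount_add (A A' B : ℚ × ℚ →₀ ℚ) :
    pairCount (A + A') B = pairCount A B + pairCount A' B := by
  unfold pairCount
  apply Finsupp.sum_add_index'
  · intro a
    simp
  · intro a s s'
    rw [← Finsupp.sum_add]
    congr 1
    ext b t
    ring

theorem pairCount_smul (r : ℚ) (A B : ℚ × ℚ →₀ ℚ) :
    pairCount (r • A) B = r * pairCount A B := by
  unfold pairCount
  rw [Finsupp.sum_smul_index' (by intro i; simp), Finsupp.mul_sum]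
  congr 1
  ext a s
  rw [Finsupp.mul_sum]
  congr 1
  ext b t
  simp only [smul_eq_mul]
  ring

/-- If `x` is the union of lifts of the generators `xs i` of `G`, where `e j i` is the sheet of the
component on `β_j` of the `i`-th lift, its Alexander grading is the average of those of the
`xs i`. -/
theorem Generator.alexander_eq_average {n m : ℕ} [NeZero m] {G : Grid n} (x : Generator G m)
    (xs : Fin m → Equiv.Perm (Fin n)) (e : Fin n → Fin m ≃ ZMod m)
    (h : ∀ j i, x.row (j, e j i) = xs i j) :
    x.alexander = (1 / (m : ℚ)) * ∑ i, G.alexander (xs i) := by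
  have hm : (m : ℚ) ≠ 0 := Nat.cast_ne_zero.mpr (NeZero.ne m)
  have hP : (∑ b : Curve n m, Finsupp.single (latticePoint b.1 (x.row b)) (1 / (m : ℚ)))
      = (1 / (m : ℚ)) • ∑ i, ∑ j, Finsupp.single (latticePoint j (xs i j)) (1 : ℚ) := by
    rw [Finset.sum_comm, Fintype.sum_prod_type, Finset.smul_sum]
    refine Finset.sum_congr rfl fun j _ => ?_
    rw [← Equiv.sum_comp (e j), Finset.smul_sum]
    refine Finset.sum_congr rfl fun i _ => ?_
    simp [h]
  have hsum : ∀ (s : Finset (Fin m)) (f : Fin m → (ℚ × ℚ →₀ ℚ)) (B : ℚ × ℚ →₀ ℚ),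
      pairCount (∑ i ∈ s, f i) B = ∑ i ∈ s, pairCount (f i) B := by
    intro s f B
    induction s using Finset.cons_induction with
    | empty => simp [pairCount]
    | cons a s ha ih => rw [Finset.sum_cons, Finset.sum_cons, pairCount_add, ih]
  have hsub : ∀ A A' B : ℚ × ℚ →₀ ℚ, pairCount (A - A') B = pairCount A B - pairCount A' B := by
    intro A A' B
    have := pairCount_add (A - A') A' B
    rw [sub_add_cancel] at this
    linarith
  unfold Generator.alexander Grid.alexander Grid.alexanderValue
  rw [hP, hsub, pairCount_smul, hsum]
  simp only [hsub, Finset.sum_sub_distrib, ← Finset.mul_sum, Finset.sum_const, Finset.card_univ,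
    Fintype.card_fin, nsmul_eq_mul]
  field_simp

/-! ## Formal flows of the Heegaard diagram -/

/-- An ordering and an orientation of the lifts of the `α`- and `β`-circles. The value `1` of
`αSign` (`βSign`) means that the curve is oriented to the right (upwards). -/
structure Framing (n m : ℕ) where
  αOrder : Curve n m ≃ Fin (m * n)
  βOrder : Curve n m ≃ Fin (m * n)
  αSign : Curve n m → ℤˣ
  βSign : Curve n m → ℤˣ

namespace Framing

variable {n m : ℕ} (φ : Framing n m)

/-- The formal generator associated with a generator; the intersection of a rightward `α`-curve
with an upward `β`-curve is positive. -/
noncomputable def formal {G : Grid n} (x : Generator G m) : FormalGenerator (m * n) where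
  ε i := φ.αSign (φ.αOrder.symm i) * φ.βSign (x.equiv.symm (φ.αOrder.symm i))
  σ := φ.αOrder.symm.trans (x.equiv.symm.trans φ.βOrder)

open Classical in
/-- The shape of the formal rectangle with `α`-edges on `s` and `t` whose boundary signs are `τs`
and `τt`. It is given as a list with one element; for `s = t`, which does not occur for
rectangles, the list is empty. -/
noncomputable def edgePair (s t : Curve n m) (τs τt : ℤˣ) : List (FlowShape (m * n)) :=
  if h : s ≠ t then
    [.rectangle (φ.αOrder s) (φ.αOrder t) (fun h' => h (φ.αOrder.injective h')) τs τt]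
  else []

/-- The shape of the formal rectangle of a rectangle on the surface with lower edge on `s` and upper
edge on `t`. The boundary orientation is rightward on the lower edge and leftward on the upper
edge. -/
noncomputable def rectangle (s t : Curve n m) : List (FlowShape (m * n)) :=
  φ.edgePair s t (φ.αSign s) (-φ.αSign t)

end Framing

/-! ## Stabilization -/

/-- The grid `H` is a stabilization of the `n × n` grid `G`: row `q` of `G` is replaced by the rows
`q` and `q + 1`, and a new column `c₀` is inserted. The new column has its `O` in row `q + 1` and
its `X` just below, in row `q`. The `X` of the old row `q` is in row `q + 1` of `H`, and the `O` of
the old row `q` is in row `q`. The new column is adjacent to the column of the `X` in row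
`q + 1`. -/
structure Stabilization (n : ℕ) where
  G : Grid n
  H : Grid (n + 1)
  c₀ : Fin (n + 1)
  q : Fin n
  X_new : H.X c₀ = q.castSucc
  O_new : H.O c₀ = q.succ
  X_old : ∀ c, q.predAbove (H.X (c₀.succAbove c)) = G.X c
  O_old : ∀ c, q.predAbove (H.O (c₀.succAbove c)) = G.O c
  adjacent : ∃ c₁, H.X c₁ = q.succ ∧ ((c₁ : ℕ) = c₀ + 1 ∨ (c₁ : ℕ) + 1 = c₀)

namespace Stabilization

variable {n m : ℕ} (T : Stabilization n)

/-- The index of the horizontal circle between the two new markings. -/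
def p : Fin (n + 1) := T.q.succ

/-- The lift to sheet `k` of the circle to the left of the new markings. -/
def left (k : ZMod m) : Curve (n + 1) m := (T.c₀, k)

/-- The lift to sheet `k` of the circle to the right of the new markings. -/
def right (k : ZMod m) : Curve (n + 1) m := (T.c₀ + 1, k)

/-- The cover of `G` is obtained from that of `H` by deleting the lifts of `α_p` and `β_{c₀}`. This is
the lift of an `α`-circle of the cover of `H` which corresponds to the lift `a` for `G`. -/
def alphaCurve (a : Curve n m) : Curve (n + 1) m := (T.p.succAbove a.1, a.2)

/-- The lift of a `β`-circle of the cover of `H` which corresponds to the lift `b` for `G`. -/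
def betaCurve (b : Curve n m) : Curve (n + 1) m := (T.c₀.succAbove b.1, b.2)

theorem lt_succAbove_iff (r : Fin (n + 1)) (i : Fin n) :
    r < T.p.succAbove i ↔ T.q.predAbove r < i := by
  have h1 : ((T.p.succAbove i : Fin (n + 1)) : ℕ) = if (i : ℕ) < T.q + 1 then (i : ℕ) else i + 1 := by
    simp only [p, Fin.succAbove, Fin.lt_def, Fin.val_castSucc, Fin.val_succ]
    split <;> simp
  have h2 : ((T.q.predAbove r : Fin n) : ℕ) = if (T.q : ℕ) < r then (r : ℕ) - 1 else r := by
    simp only [Fin.predAbove, Fin.lt_def, Fin.val_castSucc]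
    split <;> rfl
  rw [Fin.lt_def, Fin.lt_def, h1, h2]
  split_ifs <;> omega

theorem crossing_old (c i : Fin n) :
    T.H.crossing (T.c₀.succAbove c) (T.p.succAbove i) = T.G.crossing c i := by
  unfold Grid.crossing
  simp only [← not_lt, T.lt_succAbove_iff, T.X_old, T.O_old]

theorem crossing_new (i : Fin n) : T.H.crossing T.c₀ (T.p.succAbove i) = 0 := by
  unfold Grid.crossing
  simp only [← not_lt, T.lt_succAbove_iff, T.X_new, T.O_new, Fin.predAbove_castSucc_self,
    Fin.predAbove_succ_self]
  have h : ¬ (T.q < i ∧ ¬ T.q < i) := fun h => h.2 h.1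
  simp only [if_neg h]

theorem sheetShift_old (i j : Fin n) :
    T.H.sheetShift (T.p.succAbove i) (T.c₀.succAbove j) = T.G.sheetShift i j := by
  unfold Grid.sheetShift
  rw [Fin.sum_univ_succAbove _ T.c₀]
  simp [T.crossing_new, T.crossing_old]

theorem alphaThrough_old (i : Fin n) (b : Curve n m) :
    T.H.alphaThrough (T.p.succAbove i) (T.betaCurve b) = T.alphaCurve (T.G.alphaThrough i b) := by
  simp [Grid.alphaThrough, betaCurve, alphaCurve, T.sheetShift_old]

/-- The inverse of the identification of the generators which contain all points over
`α_p ∩ β_{c₀}` with the generators for `G`: the points over `α_p ∩ β_{c₀}` are added. -/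
def extend [NeZero m] (y : Generator T.G m) : Generator T.H m where
  row b := T.c₀.insertNth (α := fun _ => Fin (n + 1)) T.p
    (fun j => T.p.succAbove (y.row (j, b.2))) b.1
  bijective := by
    refine (Finite.injective_iff_bijective).mp ?_
    have hold : ∀ b : Curve n m, T.H.alphaThrough (T.p.succAbove (y.row b)) (T.betaCurve b)
        = T.alphaCurve (y.alpha b) := fun b => T.alphaThrough_old _ b
    have key : ∀ (j : Fin n) (k : ZMod m),
        T.H.alphaThrough (T.p.succAbove (y.row (j, k))) (T.c₀.succAbove j, k)
          = T.alphaCurve (y.alpha (j, k)) := fun j k => hold (j, k)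
    rintro ⟨j, k⟩ ⟨j', k'⟩ h
    rcases Fin.eq_self_or_eq_succAbove T.c₀ j with rfl | ⟨i, rfl⟩ <;>
      rcases Fin.eq_self_or_eq_succAbove T.c₀ j' with rfl | ⟨i', rfl⟩
    · simpa [Grid.alphaThrough] using h
    · simp only [Fin.insertNth_apply_same, Fin.insertNth_apply_succAbove] at h
      rw [key] at h
      exact absurd (congrArg Prod.fst h).symm (Fin.succAbove_ne _ _)
    · simp only [Fin.insertNth_apply_same, Fin.insertNth_apply_succAbove] at h
      rw [key] at h
      exact absurd (congrArg Prod.fst h) (Fin.succAbove_ne _ _)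
    · simp only [Fin.insertNth_apply_succAbove] at h
      rw [key, key] at h
      have h2 : y.alpha (i, k) = y.alpha (i', k') := by
        have h3 := Prod.ext_iff.mp h
        exact Prod.ext (Fin.succAbove_right_injective h3.1) h3.2
      have h4 := Prod.ext_iff.mp (y.bijective.1 h2)
      simp only at h4
      rw [h4.1, h4.2]

/-! ### Punctured rectangles and hexagons -/

/-- There is a punctured rectangle from `x` to `z` in sheet `k`: its left and right sides lie on the
lifts to sheet `k` of the two circles next to the new markings, its lower left and upper right
corners are components of `x`, and it contains the puncture, a circle around the segment joining
the new markings, which crosses `α_p`. -/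
structure IsPuncturedRectangle (x z : Generator T.H m) (k : ZMod m) : Prop where
  bottom : T.H.alphaThrough (x.row (T.left k)) (T.right k) = x.alpha (T.left k)
  top : T.H.alphaThrough (x.row (T.right k)) (T.left k) = x.alpha (T.right k)
  puncture : CycIoo (x.row (T.left k)) (x.row (T.right k)) T.p
  exchange : x.IsExchange z (T.left k) (T.right k)

/-- There is a punctured hexagon from `x` to `y` with puncture in sheet `k`. It is the union of a
punctured rectangle from `x` to a generator `z` and an empty rectangle from `z` to `y`. The right
side of the latter is an arc of the left circle in sheet `k`, its left side `l` is on a third curve,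
and its upper edge is on the same `α`-curve as the upper edge of the punctured rectangle. The obtuse
corner is the component of `y` on the left circle in sheet `k`; it is an interior point of the left
side of the punctured rectangle. -/
def IsPuncturedHexagon (x y : Generator T.H m) (k : ZMod m) : Prop :=
  ∃ (z : Generator T.H m) (l : Curve (n + 1) m),
    T.IsPuncturedRectangle x z k ∧ z.IsRectangle y l (T.left k) ∧
      l ≠ T.left k ∧ l ≠ T.right k ∧ z.alpha (T.left k) = x.alpha (T.right k) ∧
      CycIoo (x.row (T.left k)) (x.row (T.right k)) (y.row (T.left k))

/-- The sign of a punctured hexagon: the product of the signs of the formal rectangles of the punctured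
rectangle and of the empty rectangle. -/
noncomputable def hexagonSign (S : SignAssignment (m * (n + 1))) (φ : Framing (n + 1) m)
    (x y : Generator T.H m) (k : ZMod m) : ℤˣ :=
  S.pathSign (φ.formal x)
    (φ.rectangle (x.alpha (T.left k)) (x.alpha (T.right k)) ++
      φ.rectangle (y.alpha (T.left k)) (x.alpha (T.right k)))

/-! ### `4m`-gons -/

/-- There is a `4m`-gon from `x` to `y`. It is a disk around the preimage of the new `X`-marking,
which consists of `m` sectors. Write `w_k` for the point over `α_p ∩ β_{c₀}` in sheet `k`. The
boundary of the `k`-th sector starts at `w_k`, runs down the left circle in sheet `k` to the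
component of `x` on it, then to the right along an `α`-curve to a component of `y` on the curve
`e k`, then up along `e k` to the component of `x` on the lift of `α_p` through `w_{k+1}`, and
finally to the left along this lift, through the branch cut, to `w_{k+1}`. The sector projects to the
rectangle between these circles. Its only marking is the new `X`, and there are no components of `x`
in the interior. -/
structure IsPolygon (x y : Generator T.H m) (e : ZMod m → Curve (n + 1) m) : Prop where
  row_ne : ∀ k, x.row (T.left k) ≠ T.p
  column_ne : ∀ k, (e k).1 ≠ T.c₀
  bottom : ∀ k, T.H.alphaThrough (x.row (T.left k)) (e k) = x.alpha (T.left k)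
  top : ∀ k, x.alpha (e k) = T.H.alphaThrough T.p (T.left (k + 1))
  no_O : ∀ k c, CycIco T.c₀ (e k).1 c → ¬ CycIco (x.row (T.left k)) T.p (T.H.O c)
  only_X : ∀ k c, CycIco T.c₀ (e k).1 c → (CycIco (x.row (T.left k)) T.p (T.H.X c) ↔ c = T.c₀)
  empty : ∀ (k : ZMod m) (b : Curve (n + 1) m), CycIoo T.c₀ (e k).1 b.1 →
    T.H.alphaThrough (x.row (T.left k)) b = x.alpha (T.left k) →
      ¬ CycIoo (x.row (T.left k)) T.p (x.row b)
  target_left : ∀ k, y.row (T.left k) = T.p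
  target_right : ∀ k, y.row (e k) = x.row (T.left k)
  rest : ∀ b, (∀ k, b ≠ T.left k) → (∀ k, b ≠ e k) → y.row b = x.row b

/-- The `α`-edges `a_1, a_2, …, a_{2m}` of a `4m`-gon from `x` to `y`, in clockwise order and
indexed from `0`. The first one starts at the component of `x` on the left circle in sheet `0`. With
the `β`-edges `b_i` the clockwise order is `a_1, b_1, a_2, b_2, …`; the corner of `a_i` and `b_i`
belongs to `x` and the corner of `b_i` and `a_{i+1}` belongs to `y`. -/
noncomputable def polygonEdge (x y : Generator T.H m) (i : ℕ) : Curve (n + 1) m :=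
  (fun a => y.equiv (x.equiv.symm a))^[i] (x.alpha (T.left 0))

/-- The boundary sign of an `α`-edge of a `4m`-gon: the edges on lifts of `α_p` are traversed to the
left, the others to the right. -/
def polygonEdgeSign (φ : Framing (n + 1) m) (a : Curve (n + 1) m) : ℤˣ :=
  if a.1 = T.p then -φ.αSign a else φ.αSign a

/-- The sign of a `4m`-gon, by a finger move on `a_1`. It is `(-1) ^ (m - 1)` times the product of
the signs of the consecutive formal rectangles `a_{i+1} → b_i → a_1 → b_{i+1}` for
`i = 1, …, 2m - 1`. For odd `i` this is the rectangle which appears after the finger move. For even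
`i` it is the rectangle with the same edges whose initial corner on `a_1` is the terminal corner of
the previous one; here the intersection signs at both corners on `a_1`, and so the boundary sign of
`a_1`, are opposite. -/
noncomputable def polygonSign (S : SignAssignment (m * (n + 1))) (φ : Framing (n + 1) m)
    (x y : Generator T.H m) : ℤˣ :=
  (-1) ^ (m - 1) * S.pathSign (φ.formal x)
    ((List.range (2 * m - 1)).flatMap fun i =>
      φ.edgePair (T.polygonEdge x y 0) (T.polygonEdge x y (i + 1))
        ((-1) ^ i * T.polygonEdgeSign φ (T.polygonEdge x y 0))
        (T.polygonEdgeSign φ (T.polygonEdge x y (i + 1))))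

/-! ### Pseudo-domains of type `L` and `R`

Each sheet contributes at most one punctured hexagon, and the order of the hexagons is immaterial. A
pseudo-domain is therefore given by the sequence `z 0, …, z m` of generators for which `z i` and
`z (i + 1)` are equal or connected by the hexagon with puncture in the `i`-th sheet, with respect to
an enumeration `e` of the sheets. -/

/-- A pseudo-domain of type `L` from `x` to `y`: a product of punctured hexagons, one for each
sheet `k` with `w_k ∉ x`, with obtuse corner at `w_k`. -/
structure IsTypeL (e : Fin m ≃ ZMod m) (x y : Generator T.H m)
    (z : Fin (m + 1) → Generator T.H m) : Prop where
  first : z 0 = x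
  last : z (Fin.last m) = y
  trivial : ∀ i : Fin m, x.row (T.left (e i)) = T.p → z i.succ = z i.castSucc
  hexagon : ∀ i : Fin m, x.row (T.left (e i)) ≠ T.p →
    T.IsPuncturedHexagon (z i.castSucc) (z i.succ) (e i) ∧
      (z i.succ).row (T.left (e i)) = T.p
  target : ∀ k, y.row (T.left k) = T.p

/-- A pseudo-domain of type `R` from `x` to `y`: a product of punctured hexagons with obtuse corners
different from the points `w_k`, followed by a `4m`-gon. -/
structure IsTypeR (e : Fin m ≃ ZMod m) (x y : Generator T.H m)
    (z : Fin (m + 1) → Generator T.H m) : Prop where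
  first : z 0 = x
  step : ∀ i : Fin m, z i.succ = z i.castSucc ∨
    (T.IsPuncturedHexagon (z i.castSucc) (z i.succ) (e i) ∧
      (z i.succ).row (T.left (e i)) ≠ T.p)
  polygon : ∃ c, T.IsPolygon (z (Fin.last m)) y c

open Classical in
/-- The product of the signs of the punctured hexagons of a pseudo-domain. -/
noncomputable def hexagonsSign (S : SignAssignment (m * (n + 1))) (φ : Framing (n + 1) m)
    (e : Fin m ≃ ZMod m) (z : Fin (m + 1) → Generator T.H m) : ℤˣ :=
  ∏ i : Fin m, if z i.succ = z i.castSucc then 1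
    else T.hexagonSign S φ (z i.castSucc) (z i.succ) (e i)

open Classical in
/-- The set of pseudo-domains of type `L` from `x` to `y`. -/
noncomputable def typeL [NeZero m] (e : Fin m ≃ ZMod m) (x y : Generator T.H m) :
    Finset (Fin (m + 1) → Generator T.H m) :=
  Finset.univ.filter (T.IsTypeL e x y)

open Classical in
/-- The set of pseudo-domains of type `R` from `x` to `y`. -/
noncomputable def typeR [NeZero m] (e : Fin m ≃ ZMod m) (x y : Generator T.H m) :
    Finset (Fin (m + 1) → Generator T.H m) :=
  Finset.univ.filter (T.IsTypeR e x y)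

/-! ### The complexes and the stabilization map -/

variable [NeZero m]

/-- The sign of a rectangle from `x` with lower edge on `s` and upper edge on `t`. -/
noncomputable def signH (S : SignAssignment (m * (n + 1))) (φ : Framing (n + 1) m)
    (x : Generator T.H m) (s t : Curve (n + 1) m) : ℤˣ :=
  S.pathSign (φ.formal x) (φ.rectangle s t)

/-- The sign of a rectangle in the cover of `G` is the sign of the rectangle with the same corners
in the cover of `H`. -/
noncomputable def signG (S : SignAssignment (m * (n + 1))) (φ : Framing (n + 1) m)
    (y : Generator T.G m) (s t : Curve n m) : ℤˣ :=
  T.signH S φ (T.extend y) (T.alphaCurve s) (T.alphaCurve t)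

/-- The boundary operator of `C(H̃)`. -/
noncomputable def boundaryH (S : SignAssignment (m * (n + 1))) (φ : Framing (n + 1) m) :
    Chains T.H m →ₗ[ℤ] Chains T.H m :=
  boundary (T.signH S φ)

/-- The boundary operator of `C(G̃)`. -/
noncomputable def boundaryG (S : SignAssignment (m * (n + 1))) (φ : Framing (n + 1) m) :
    Chains T.G m →ₗ[ℤ] Chains T.G m :=
  boundary (T.signG S φ)

/-- The differential `(a, b) ↦ (-∂a, ∂b)` of `C(G̃)[1] ⊕ C(G̃)`. -/
noncomputable def boundarySum (S : SignAssignment (m * (n + 1))) (φ : Framing (n + 1) m) :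
    Chains T.G m × Chains T.G m →ₗ[ℤ] Chains T.G m × Chains T.G m :=
  LinearMap.prodMap (-T.boundaryG S φ) (T.boundaryG S φ)

/-- The stabilization map `F : C(H̃) → C(G̃)[1] ⊕ C(G̃)`. Its first component counts pseudo-domains
of type `R` and its second component those of type `L`. -/
noncomputable def stabilizationMap (S : SignAssignment (m * (n + 1))) (φ : Framing (n + 1) m)
    (e : Fin m ≃ ZMod m) : Chains T.H m →ₗ[ℤ] Chains T.G m × Chains T.G m :=
  Finsupp.linearCombination ℤ fun x =>
    (∑ y : Generator T.G m, ∑ z ∈ T.typeR e x (T.extend y),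
        Finsupp.single y
          ((T.hexagonsSign S φ e z * T.polygonSign S φ (z (Fin.last m)) (T.extend y) : ℤˣ) : ℤ),
      ∑ y : Generator T.G m, ∑ z ∈ T.typeL e x (T.extend y),
        Finsupp.single y (T.hexagonsSign S φ e z : ℤ))

/-- The part of `C(H̃)` of Alexander grading `d`. -/
noncomputable def gradedH (m : ℕ) [NeZero m] (d : ℚ) : Submodule ℤ (Chains T.H m) :=
  Finsupp.supported ℤ ℤ {x | x.alexander = d}

/-- The part of `C(G̃)[1] ⊕ C(G̃)` of Alexander grading `d`. A generator `y` has grading `A(y)` in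
the first summand and `A(y) - 1` in the second one; the latter is the grading of the corresponding
generator for `H`, and the first summand is shifted against it by one. -/
noncomputable def gradedSum (m : ℕ) [NeZero m] (d : ℚ) :
    Submodule ℤ (Chains T.G m × Chains T.G m) :=
  (Finsupp.supported ℤ ℤ {y : Generator T.G m | y.alexander = d}).prod
    (Finsupp.supported ℤ ℤ {y : Generator T.G m | y.alexander - 1 = d})

end Stabilization

end GridCover

namespace GridCover

theorem cycIco_iff {n : ℕ} (a b t : Fin n) :
    CycIco a b t ↔ ((a : ℕ) ≤ t ∧ (t : ℕ) < b) ∨ ((t : ℕ) < b ∧ (b : ℕ) < a) ∨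
      ((b : ℕ) < a ∧ (a : ℕ) ≤ t) := by
  unfold CycIco
  rw [Fin.lt_def, Fin.sub_def, Fin.sub_def]
  have ha := a.2
  have hb := b.2
  have ht := t.2
  simp only
  have h1 : (n - (a : ℕ) + t) % n = if (a : ℕ) ≤ t then (t : ℕ) - a else n - a + t := by
    split_ifs with h
    · have : n - (a : ℕ) + t = n + (t - a) := by omega
      rw [this, Nat.add_mod_left, Nat.mod_eq_of_lt (by omega)]
    · exact Nat.mod_eq_of_lt (by omega)
  have h2 : (n - (a : ℕ) + b) % n = if (a : ℕ) ≤ b then (b : ℕ) - a else n - a + b := by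
    split_ifs with h
    · have : n - (a : ℕ) + b = n + (b - a) := by omega
      rw [this, Nat.add_mod_left, Nat.mod_eq_of_lt (by omega)]
    · exact Nat.mod_eq_of_lt (by omega)
  rw [h1, h2]
  split_ifs <;> omega

theorem cycIoo_iff {n : ℕ} (a b t : Fin n) :
    CycIoo a b t ↔ ((a : ℕ) < t ∧ (t : ℕ) < b) ∨ ((t : ℕ) < b ∧ (b : ℕ) < a) ∨
      ((b : ℕ) < a ∧ (a : ℕ) < t) := by
  unfold CycIoo
  have := cycIco_iff a b t
  unfold CycIco at this
  rw [this, Ne, Fin.ext_iff]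
  omega

/-- A cyclic structure of sheets: `disp i a b` is the change of sheet along row line `i` from column
line `a` to the right to column line `b`, and `M` is a set of squares that contains all squares
around which the sheets change. -/
structure Sheets (N m : ℕ) where
  disp : Fin N → Fin N → Fin N → ZMod m
  M : Fin N → Fin N → Prop
  disp_add : ∀ i a b d, CycIoo a d b → disp i a b + disp i b d = disp i a d
  flat : ∀ i i' a b, (∀ c, CycIco a b c → ∀ r, CycIco i i' r → ¬ M c r) → disp i a b = disp i' a b

namespace Sheets

variable {N m : ℕ} (Z : Sheets N m)

/-- The points of `l` and `b` on row line `i` are joined by a path to the right along a lift. -/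
def Joined (i : Fin N) (l b : Curve N m) : Prop := b.2 = l.2 + Z.disp i l.1 b.1

/-- A rectangle with corners at the points of `ρ` on `l` and `r`, without squares of `M` and
without further points of `ρ` in the interior or on the horizontal edges. -/
structure Rect (ρ : Curve N m → Fin N) (l r : Curve N m) : Prop where
  col : l.1 ≠ r.1
  row : ρ l ≠ ρ r
  base : Z.Joined (ρ l) l r
  free : ∀ c, CycIco l.1 r.1 c → ∀ i, CycIco (ρ l) (ρ r) i → ¬ Z.M c i
  empty : ∀ b, CycIoo l.1 r.1 b.1 → Z.Joined (ρ l) l b →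
    ρ b ≠ ρ l ∧ ρ b ≠ ρ r ∧ ¬ CycIoo (ρ l) (ρ r) (ρ b)

/-- The points of `ρ` after exchanging the rows on `l` and `r`. -/
def exch (ρ : Curve N m → Fin N) (l r : Curve N m) : Curve N m → Fin N :=
  fun b => ρ (Equiv.swap l r b)

theorem exch_left (ρ : Curve N m → Fin N) (l r : Curve N m) : exch ρ l r l = ρ r := by
  simp [exch]

theorem exch_right (ρ : Curve N m → Fin N) (l r : Curve N m) : exch ρ l r r = ρ l := by
  simp [exch]

theorem exch_ne (ρ : Curve N m → Fin N) {l r b : Curve N m} (hl : b ≠ l) (hr : b ≠ r) :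
    exch ρ l r b = ρ b := by
  simp [exch, Equiv.swap_apply_of_ne_of_ne hl hr]

variable {Z}

theorem Joined.trans {i : Fin N} {a b d : Curve N m} (h1 : Z.Joined i a b) (h2 : Z.Joined i b d)
    (h : CycIoo a.1 d.1 b.1) : Z.Joined i a d := by
  unfold Joined at *
  rw [h2, h1, add_assoc, Z.disp_add _ _ _ _ h]

theorem Joined.cancel_left {i : Fin N} {a b d : Curve N m} (h1 : Z.Joined i a b)
    (h2 : Z.Joined i a d) (h : CycIoo a.1 d.1 b.1) : Z.Joined i b d := by
  unfold Joined at *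
  rw [h2, h1, add_assoc, Z.disp_add _ _ _ _ h]

theorem Joined.cancel_right {i : Fin N} {a b d : Curve N m} (h1 : Z.Joined i a d)
    (h2 : Z.Joined i b d) (h : CycIoo a.1 d.1 b.1) : Z.Joined i a b := by
  unfold Joined at *
  rw [← Z.disp_add _ _ _ _ h, h2, ← add_assoc] at h1
  exact add_right_cancel h1

theorem Joined.unique {i : Fin N} {a b d : Curve N m} (h1 : Z.Joined i a b)
    (h2 : Z.Joined i a d) (h : b.1 = d.1) : b = d := by
  unfold Joined at *
  rw [h] at h1
  exact Prod.ext h (h1.trans h2.symm)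

theorem Joined.unique_left {i : Fin N} {a b d : Curve N m} (h1 : Z.Joined i a d)
    (h2 : Z.Joined i b d) (h : a.1 = b.1) : a = b := by
  unfold Joined at *
  rw [h] at h1
  exact Prod.ext h (add_right_cancel (h1.symm.trans h2))

theorem Joined.flat {i j : Fin N} {a b : Curve N m} (h : Z.Joined i a b)
    (hf : ∀ c, CycIco a.1 b.1 c → ∀ r, CycIco i j r → ¬ Z.M c r) : Z.Joined j a b := by
  unfold Joined at *
  rw [h, Z.flat _ _ _ _ hf]

theorem Joined.flat_down {i j : Fin N} {a b : Curve N m} (h : Z.Joined j a b)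
    (hf : ∀ c, CycIco a.1 b.1 c → ∀ r, CycIco i j r → ¬ Z.M c r) : Z.Joined i a b := by
  unfold Joined at *
  rw [h, Z.flat _ _ _ _ hf]

end Sheets

end GridCover

namespace GridCover
namespace Sheets

variable {N m : ℕ} {Z : Sheets N m}



theorem ne_of_cycIoo_left {a b t : Fin N} (h : CycIoo a b t) : a ≠ t := fun h' => h.1 h'.symm

theorem ne_of_cycIoo_right {a b t : Fin N} (h : CycIoo a b t) : t ≠ b := by
  rintro rfl
  exact lt_irrefl _ h.2

/-- Two rectangles with a common lower left column, the upper one being wider. -/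
theorem Rect.lowerLeft_wide {ρ : Curve N m → Fin N} {l a r : Curve N m}
    (h : CycIoo l.1 r.1 a.1) (hr : CycIoo (ρ l) (ρ r) (ρ a)) :
    (Z.Rect ρ l a ∧ Z.Rect (exch ρ l a) l r) ↔ (Z.Rect ρ a r ∧ Z.Rect (exch ρ a r) l a) := by
  have hla : l.1 ≠ a.1 := ne_of_cycIoo_left h
  have har : a.1 ≠ r.1 := ne_of_cycIoo_right h
  have hlr : l.1 ≠ r.1 := by
    intro h'
    rw [h', cycIoo_iff] at h
    omega
  have nla : l ≠ a := fun h' => hla (congrArg _ h')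
  have nar : a ≠ r := fun h' => har (congrArg _ h')
  have nlr : l ≠ r := fun h' => hlr (congrArg _ h')
  have e1 : exch ρ l a l = ρ a := exch_left ..
  have e2 : exch ρ l a r = ρ r := exch_ne _ nlr.symm nar.symm
  have e3 : exch ρ a r l = ρ l := exch_ne _ nla nlr
  have e4 : exch ρ a r a = ρ r := exch_left ..
  have hla' := ne_of_cycIoo_left hr
  have har' := ne_of_cycIoo_right hr
  have e5 : ∀ b : Curve N m, b.1 ≠ l.1 → b.1 ≠ a.1 → exch ρ l a b = ρ b := fun b h1 h2 =>
    exch_ne _ (fun h => h1 (congrArg _ h)) (fun h => h2 (congrArg _ h))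
  have e6 : ∀ b : Curve N m, b.1 ≠ a.1 → b.1 ≠ r.1 → exch ρ a r b = ρ b := fun b h1 h2 =>
    exch_ne _ (fun h => h1 (congrArg _ h)) (fun h => h2 (congrArg _ h))
  have hlr' : ρ l ≠ ρ r := by
    intro h'
    rw [h', cycIoo_iff] at hr
    omega
  have c1 : ∀ c, CycIco l.1 a.1 c → CycIco l.1 r.1 c := by
    intro c; simp only [cycIco_iff, cycIoo_iff] at *; omega
  have c2 : ∀ c, CycIco a.1 r.1 c → CycIco l.1 r.1 c := by
    intro c; simp only [cycIco_iff, cycIoo_iff] at *; omega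
  have c3 : ∀ c, CycIoo l.1 a.1 c → CycIoo l.1 r.1 c ∧ c ≠ l.1 ∧ c ≠ a.1 ∧ c ≠ r.1 := by
    intro c; simp only [cycIco_iff, cycIoo_iff, Fin.ext_iff, ne_eq] at *; omega
  have c4 : ∀ c, CycIoo a.1 r.1 c → CycIoo l.1 r.1 c ∧ CycIoo l.1 c a.1 ∧ c ≠ l.1 ∧ c ≠ a.1 ∧ c ≠ r.1 := by
    intro c; simp only [cycIco_iff, cycIoo_iff, Fin.ext_iff, ne_eq] at *; omega
  have c5 : ∀ c, CycIco l.1 r.1 c → CycIco l.1 a.1 c ∨ CycIco a.1 r.1 c := by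
    intro c; simp only [cycIco_iff, cycIoo_iff] at *; omega
  have c6 : ∀ c, CycIoo l.1 r.1 c → CycIoo l.1 a.1 c ∨ c = a.1 ∨ CycIoo a.1 r.1 c := by
    intro c; simp only [cycIco_iff, cycIoo_iff, Fin.ext_iff] at *; omega
  have r1 : ∀ i, CycIco (ρ l) (ρ r) i ↔ CycIco (ρ l) (ρ a) i ∨ CycIco (ρ a) (ρ r) i := by
    intro i; simp only [cycIco_iff, cycIoo_iff] at *; omega
  have r2 : ∀ i, i ≠ ρ l → i ≠ ρ r → ¬ CycIoo (ρ l) (ρ r) i →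
      i ≠ ρ a ∧ ¬ CycIoo (ρ l) (ρ a) i ∧ ¬ CycIoo (ρ a) (ρ r) i := by
    intro i; simp only [cycIco_iff, cycIoo_iff, Fin.ext_iff, ne_eq] at *; omega
  have r3 : ∀ i, i ≠ ρ l → i ≠ ρ r → i ≠ ρ a → ¬ CycIoo (ρ l) (ρ a) i → ¬ CycIoo (ρ a) (ρ r) i →
      ¬ CycIoo (ρ l) (ρ r) i := by
    intro i; simp only [cycIco_iff, cycIoo_iff, Fin.ext_iff, ne_eq] at *; omega
  have r4 : ¬ CycIoo (ρ a) (ρ r) (ρ l) := by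
    simp only [cycIco_iff, cycIoo_iff, Fin.ext_iff, ne_eq] at *; omega
  constructor
  · rintro ⟨h1, h2⟩
    have b1 := h1.base
    have b2 := h2.base
    have f1 := h1.free
    have f2 := h2.free
    have m1 := h1.empty
    have m2 := h2.empty
    rw [e1] at b2
    rw [e1, e2] at f2 m2
    have la := b1.flat f1
    have ar : Z.Joined (ρ a) a r := la.cancel_left b2 h
    refine ⟨⟨har, har', ar, fun c hc => f2 c (c2 c hc), fun b hb jb => ?_⟩, ?_⟩
    · obtain ⟨k1, k2, k3, k4, k5⟩ := c4 _ hb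
      have := m2 b k1 (la.trans jb k2)
      rwa [e5 _ k3 k4] at this
    · refine ⟨hla, by rw [e3, e4]; exact hlr', by rw [e3]; exact b1, ?_, ?_⟩
      · intro c hc i hi
        rw [e3, e4, r1] at hi
        exact hi.elim (f1 c hc i) (f2 c (c1 c hc) i)
      · intro b hb jb
        obtain ⟨k1, k2, k3, k4⟩ := c3 _ hb
        rw [e3] at jb
        rw [e3, e4, e6 b k3 k4]
        have jb' : Z.Joined (ρ a) l b := by
          refine jb.flat fun c hc => f1 c ?_
          simp only [cycIco_iff, cycIoo_iff] at *; omega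
        have p1 := m1 b hb jb
        have p2 := m2 b k1 jb'
        rw [e5 _ k2 k3] at p2
        exact ⟨p1.1, p2.2.1, r3 _ p1.1 p2.2.1 p1.2.1 p1.2.2 p2.2.2⟩
  · rintro ⟨h1, h2⟩
    have b1 := h1.base
    have b2 := h2.base
    have f1 := h1.free
    have f2 := h2.free
    have m1 := h1.empty
    have m2 := h2.empty
    rw [e3] at b2
    rw [e3, e4] at f2 m2
    have la : Z.Joined (ρ a) l a := b2.flat fun c hc i hi => f2 c hc i ((r1 i).2 (Or.inl hi))
    refine ⟨⟨hla, hla', b2, fun c hc i hi => f2 c hc i ((r1 i).2 (Or.inl hi)), fun b hb jb => ?_⟩, ?_⟩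
    · obtain ⟨k1, k2, k3, k4⟩ := c3 _ hb
      have := m2 b hb jb
      rw [e6 b k3 k4] at this
      have := r2 _ this.1 this.2.1 this.2.2
      refine ⟨by have := m2 b hb jb; rw [e6 b k3 k4] at this; exact this.1, this.1, this.2.1⟩
    · refine ⟨hlr, by rw [e1, e2]; exact har', by rw [e1]; exact la.trans b1 h, ?_, ?_⟩
      · intro c hc i hi
        rw [e1, e2] at hi
        exact (c5 c hc).elim (fun hc => f2 c hc i ((r1 i).2 (Or.inr hi))) (fun hc => f1 c hc i hi)
      · intro b hb jb
        rw [e1] at jb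
        rw [e1, e2]
        rcases c6 _ hb with hb' | hb' | hb'
        · obtain ⟨k1, k2, k3, k4⟩ := c3 _ hb'
          rw [e5 b k2 k3]
          have jb' : Z.Joined (ρ l) l b := by
            refine jb.flat_down fun c hc i hi => f2 c ?_ i ((r1 i).2 (Or.inl hi))
            simp only [cycIco_iff, cycIoo_iff] at *; omega
          have := m2 b hb' jb'
          rw [e6 b k3 k4] at this
          have h3 := r2 _ this.1 this.2.1 this.2.2
          exact ⟨h3.1, this.2.1, h3.2.2⟩
        · obtain rfl := jb.unique la hb'
          rw [exch_right]
          exact ⟨hla', hlr', r4⟩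
        · obtain ⟨k1, k2, k3, k4, k5⟩ := c4 _ hb'
          rw [e5 b k3 k4]
          exact m1 b hb' (la.cancel_left jb k2)

end Sheets
end GridCover

namespace GridCover
namespace Sheets

variable {N m : ℕ} {Z : Sheets N m}

/-- Two rectangles with a common left column, the upper one being narrower. -/
theorem Rect.lowerLeft_narrow {ρ : Curve N m → Fin N} {l a r : Curve N m}
    (h : CycIoo l.1 r.1 a.1) (hr : CycIoo (ρ l) (ρ a) (ρ r)) :
    (Z.Rect ρ l r ∧ Z.Rect (exch ρ l r) l a) ↔ (Z.Rect ρ l a ∧ Z.Rect (exch ρ l a) a r) := by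
  have hla : l.1 ≠ a.1 := ne_of_cycIoo_left h
  have har : a.1 ≠ r.1 := ne_of_cycIoo_right h
  have hlr : l.1 ≠ r.1 := by
    intro h'
    rw [h', cycIoo_iff] at h
    omega
  have nla : l ≠ a := fun h' => hla (congrArg _ h')
  have nar : a ≠ r := fun h' => har (congrArg _ h')
  have nlr : l ≠ r := fun h' => hlr (congrArg _ h')
  have e1 : exch ρ l r l = ρ r := exch_left ..
  have e2 : exch ρ l r a = ρ a := exch_ne _ nla.symm nar
  have e3 : exch ρ l a r = ρ r := exch_ne _ nlr.symm nar.symm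
  have e4 : exch ρ l a a = ρ l := exch_right ..
  have e5 : ∀ b : Curve N m, b.1 ≠ l.1 → b.1 ≠ r.1 → exch ρ l r b = ρ b := fun b h1 h2 =>
    exch_ne _ (fun h => h1 (congrArg _ h)) (fun h => h2 (congrArg _ h))
  have e6 : ∀ b : Curve N m, b.1 ≠ l.1 → b.1 ≠ a.1 → exch ρ l a b = ρ b := fun b h1 h2 =>
    exch_ne _ (fun h => h1 (congrArg _ h)) (fun h => h2 (congrArg _ h))
  have hlr' := ne_of_cycIoo_left hr
  have har' := (ne_of_cycIoo_right hr).symm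
  have hla' : ρ l ≠ ρ a := by
    intro h'
    rw [h', cycIoo_iff] at hr
    omega
  have c1 : ∀ c, CycIco l.1 a.1 c → CycIco l.1 r.1 c := by
    intro c; simp only [cycIco_iff, cycIoo_iff] at *; omega
  have c2 : ∀ c, CycIco a.1 r.1 c → CycIco l.1 r.1 c := by
    intro c; simp only [cycIco_iff, cycIoo_iff] at *; omega
  have c3 : ∀ c, CycIoo l.1 a.1 c → CycIoo l.1 r.1 c ∧ c ≠ l.1 ∧ c ≠ a.1 ∧ c ≠ r.1 := by
    intro c; simp only [cycIco_iff, cycIoo_iff, Fin.ext_iff, ne_eq] at *; omega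
  have c4 : ∀ c, CycIoo a.1 r.1 c → CycIoo l.1 r.1 c ∧ CycIoo l.1 c a.1 ∧ c ≠ l.1 ∧ c ≠ a.1 ∧
      c ≠ r.1 := by
    intro c; simp only [cycIco_iff, cycIoo_iff, Fin.ext_iff, ne_eq] at *; omega
  have c5 : ∀ c, CycIco l.1 r.1 c → CycIco l.1 a.1 c ∨ CycIco a.1 r.1 c := by
    intro c; simp only [cycIco_iff, cycIoo_iff] at *; omega
  have c6 : ∀ c, CycIoo l.1 r.1 c → CycIoo l.1 a.1 c ∨ c = a.1 ∨ CycIoo a.1 r.1 c := by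
    intro c; simp only [cycIco_iff, cycIoo_iff, Fin.ext_iff] at *; omega
  have r1 : ∀ i, CycIco (ρ l) (ρ a) i ↔ CycIco (ρ l) (ρ r) i ∨ CycIco (ρ r) (ρ a) i := by
    intro i; simp only [cycIco_iff, cycIoo_iff] at *; omega
  have r2 : ∀ i, i ≠ ρ l → i ≠ ρ a → ¬ CycIoo (ρ l) (ρ a) i →
      i ≠ ρ r ∧ ¬ CycIoo (ρ l) (ρ r) i ∧ ¬ CycIoo (ρ r) (ρ a) i := by
    intro i; simp only [cycIco_iff, cycIoo_iff, Fin.ext_iff, ne_eq] at *; omega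
  have r3 : ∀ i, i ≠ ρ l → i ≠ ρ r → i ≠ ρ a → ¬ CycIoo (ρ l) (ρ r) i → ¬ CycIoo (ρ r) (ρ a) i →
      ¬ CycIoo (ρ l) (ρ a) i := by
    intro i; simp only [cycIco_iff, cycIoo_iff, Fin.ext_iff, ne_eq] at *; omega
  have r4 : ¬ CycIoo (ρ l) (ρ r) (ρ a) := by
    simp only [cycIco_iff, cycIoo_iff, Fin.ext_iff, ne_eq] at *; omega
  constructor
  · rintro ⟨h1, h2⟩
    have b1 := h1.base
    have b2 := h2.base
    have f1 := h1.free
    have f2 := h2.free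
    have m1 := h1.empty
    have m2 := h2.empty
    rw [e1] at b2
    rw [e1, e2] at f2 m2
    have la : Z.Joined (ρ l) l a := b2.flat_down fun c hc => f1 c (c1 c hc)
    refine ⟨⟨hla, hla', la, ?_, fun b hb jb => ?_⟩, ?_⟩
    · intro c hc i hi
      exact ((r1 i).1 hi).elim (f1 c (c1 c hc) i) (f2 c hc i)
    · obtain ⟨k1, k2, k3, k4⟩ := c3 _ hb
      have jb' : Z.Joined (ρ r) l b := by
        refine jb.flat fun c hc => f1 c ?_
        simp only [cycIco_iff, cycIoo_iff] at *; omega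
      have p1 := m1 b k1 jb
      have p2 := m2 b hb jb'
      rw [e5 _ k2 k4] at p2
      exact ⟨p1.1, p2.2.1, r3 _ p1.1 p1.2.1 p2.2.1 p1.2.2 p2.2.2⟩
    · refine ⟨har, by rw [e3, e4]; exact hlr', by rw [e4]; exact la.cancel_left b1 h, ?_, ?_⟩
      · intro c hc i hi
        rw [e3, e4] at hi
        exact f1 c (c2 c hc) i hi
      · intro b hb jb
        obtain ⟨k1, k2, k3, k4, k5⟩ := c4 _ hb
        rw [e4] at jb
        rw [e3, e4, e6 b k3 k4]
        exact m1 b k1 (la.trans jb k2)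
  · rintro ⟨h1, h2⟩
    have b1 := h1.base
    have b2 := h2.base
    have f1 := h1.free
    have f2 := h2.free
    have m1 := h1.empty
    have m2 := h2.empty
    rw [e4] at b2
    rw [e3, e4] at f2 m2
    have la : Z.Joined (ρ r) l a := b1.flat fun c hc i hi => f1 c hc i ((r1 i).2 (Or.inl hi))
    have lr : Z.Joined (ρ l) l r := b1.trans b2 h
    refine ⟨⟨hlr, hlr', lr, ?_, fun b hb jb => ?_⟩, ?_⟩
    · intro c hc i hi
      exact (c5 c hc).elim (fun hc => f1 c hc i ((r1 i).2 (Or.inl hi))) (fun hc => f2 c hc i hi)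
    · rcases c6 _ hb with hb' | hb' | hb'
      · obtain ⟨k1, k2, k3, k4⟩ := c3 _ hb'
        have := m1 b hb' jb
        have h3 := r2 _ this.1 this.2.1 this.2.2
        exact ⟨this.1, h3.1, h3.2.1⟩
      · obtain rfl := jb.unique b1 hb'
        exact ⟨hla'.symm, har', r4⟩
      · obtain ⟨k1, k2, k3, k4, k5⟩ := c4 _ hb'
        have := m2 b hb' (b1.cancel_left jb k2)
        rwa [e6 b k3 k4] at this
    · refine ⟨hla, by rw [e1, e2]; exact har'.symm, by rw [e1]; exact la, ?_, ?_⟩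
      · intro c hc i hi
        rw [e1, e2] at hi
        exact f1 c hc i ((r1 i).2 (Or.inr hi))
      · intro b hb jb
        rw [e1] at jb
        obtain ⟨k1, k2, k3, k4⟩ := c3 _ hb
        rw [e1, e2, e5 b k2 k4]
        have jb' : Z.Joined (ρ l) l b := by
          refine jb.flat_down fun c hc i hi => f1 c ?_ i ((r1 i).2 (Or.inl hi))
          simp only [cycIco_iff, cycIoo_iff] at *; omega
        have := m1 b hb jb'
        have h3 := r2 _ this.1 this.2.1 this.2.2
        exact ⟨h3.1, this.2.1, h3.2.2⟩

/-! ### Rotation by 180 degrees -/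

theorem neg_val (a : Fin N) [NeZero N] : ((-a : Fin N) : ℕ) = if (a : ℕ) = 0 then 0 else N - a := by
  rw [Fin.val_neg]
  congr 1
  rw [← Fin.val_eq_zero_iff]

theorem cycIco_rev [NeZero N] (a b c : Fin N) : CycIco (-a) (-b) c ↔ CycIco b a c.rev := by
  have := a.2
  have := b.2
  have := c.2
  simp only [cycIco_iff, neg_val, Fin.val_rev]
  split_ifs <;> omega

theorem cycIoo_neg [NeZero N] (a b c : Fin N) : CycIoo (-a) (-b) (-c) ↔ CycIoo b a c := by
  have := a.2
  have := b.2
  have := c.2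
  simp only [cycIoo_iff, neg_val]
  split_ifs <;> omega

/-- The sheets seen after a rotation by 180 degrees. -/
def rot [NeZero N] (Z : Sheets N m) : Sheets N m where
  disp i a b := -Z.disp (-i) (-b) (-a)
  M c i := Z.M c.rev i.rev
  disp_add i a b d h := by
    rw [← neg_add, add_comm, Z.disp_add _ _ _ _ ((cycIoo_neg _ _ _).2 h)]
  flat i i' a b h := by
    rw [Z.flat (-i') (-i) (-b) (-a)]
    intro c hc r hr
    rw [cycIco_rev] at hc hr
    simpa using h _ hc _ hr

/-- The rotation of the curves. -/
def rotCurve [NeZero N] (b : Curve N m) : Curve N m := (-b.1, b.2)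

/-- The rotation of a set of points. -/
def rotRow [NeZero N] (ρ : Curve N m → Fin N) : Curve N m → Fin N := fun b => -ρ (rotCurve b)

@[simp] theorem rotCurve_rotCurve [NeZero N] (b : Curve N m) : rotCurve (rotCurve b) = b := by
  simp [rotCurve]

@[simp] theorem rotCurve_fst [NeZero N] (b : Curve N m) : (rotCurve b).1 = -b.1 := rfl

theorem rotCurve_injective [NeZero N] : Function.Injective (rotCurve : Curve N m → Curve N m) :=
  fun a b h => by simpa using congrArg rotCurve h

theorem joined_rot [NeZero N] (i : Fin N) (a b : Curve N m) :
    Z.rot.Joined i (rotCurve a) (rotCurve b) ↔ Z.Joined (-i) b a := by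
  unfold Joined rot rotCurve
  simp only [neg_neg]
  constructor
  · intro h; rw [h]; ring
  · intro h; rw [h]; ring

theorem rotRow_exch [NeZero N] (ρ : Curve N m → Fin N) (l r : Curve N m) :
    rotRow (exch ρ l r) = exch (rotRow ρ) (rotCurve r) (rotCurve l) := by
  funext b
  unfold rotRow exch
  congr 2
  rw [Equiv.swap_comm, Equiv.swap_apply_def, Equiv.swap_apply_def]
  by_cases h1 : b = rotCurve r
  · subst h1; simp
  · by_cases h2 : b = rotCurve l
    · subst h2
      by_cases h3 : l = r <;> simp [h3, rotCurve_injective.eq_iff]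
    · have h1' : rotCurve b ≠ r := fun h => h1 (by rw [← h]; simp)
      have h2' : rotCurve b ≠ l := fun h => h2 (by rw [← h]; simp)
      simp [h1, h2, h1', h2']

theorem Rect.rot [NeZero N] {ρ : Curve N m → Fin N} {l r : Curve N m} (h : Z.Rect ρ l r) :
    Z.rot.Rect (rotRow ρ) (rotCurve r) (rotCurve l) := by
  have b1 := h.base.flat h.free
  have er : rotRow ρ (rotCurve r) = -ρ r := by simp [rotRow]
  have el : rotRow ρ (rotCurve l) = -ρ l := by simp [rotRow]
  refine ⟨?_, ?_, ?_, ?_, ?_⟩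
  · simpa using h.col.symm
  · rw [er, el]; simpa using h.row.symm
  · rw [er, joined_rot]; simpa using b1
  · intro c hc i hi
    rw [er, el, cycIco_rev] at hi
    rw [rotCurve_fst, rotCurve_fst, cycIco_rev] at hc
    exact h.free _ hc _ hi
  · intro b hb jb
    obtain ⟨b, rfl⟩ : ∃ b', b = rotCurve b' := ⟨rotCurve b, by simp⟩
    rw [rotCurve_fst, rotCurve_fst, rotCurve_fst, cycIoo_neg] at hb
    rw [er, joined_rot, neg_neg] at jb
    have jl : Z.Joined (ρ r) l b := b1.cancel_right jb hb
    have hs : ∀ c, CycIco l.1 b.1 c → CycIco l.1 r.1 c := by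
      intro c; simp only [cycIco_iff, cycIoo_iff] at *; omega
    have := h.empty b hb (jl.flat_down fun c hc => h.free c (hs c hc))
    have eb : rotRow ρ (rotCurve b) = -ρ b := by simp [rotRow]
    rw [er, el, eb, cycIoo_neg]
    exact ⟨by simpa using this.2.1, by simpa using this.1, this.2.2⟩

theorem rot_rot [NeZero N] (Z : Sheets N m) : Z.rot.rot = Z := by
  simp [Sheets.rot]

@[simp] theorem rotRow_rotRow [NeZero N] (ρ : Curve N m → Fin N) : rotRow (rotRow ρ) = ρ := by
  funext b; simp [rotRow]

theorem rect_rot [NeZero N] {ρ : Curve N m → Fin N} {l r : Curve N m} :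
    Z.rot.Rect (rotRow ρ) (rotCurve r) (rotCurve l) ↔ Z.Rect ρ l r :=
  ⟨fun h => by simpa [rot_rot] using h.rot, fun h => h.rot⟩

/-- Two rectangles with a common right column, the lower one being wider. -/
theorem Rect.upperRight_wide {ρ : Curve N m → Fin N} {l a r : Curve N m}
    (h : CycIoo l.1 r.1 a.1) (hr : CycIoo (ρ l) (ρ r) (ρ a)) :
    (Z.Rect ρ a r ∧ Z.Rect (exch ρ a r) l r) ↔ (Z.Rect ρ l a ∧ Z.Rect (exch ρ l a) a r) := by
  have : NeZero N := ⟨by have := l.1.2; omega⟩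
  have key := Rect.lowerLeft_wide (Z := Z.rot) (ρ := rotRow ρ) (l := rotCurve r) (a := rotCurve a)
    (r := rotCurve l) ((cycIoo_neg _ _ _).2 h) (by simpa [cycIoo_neg, rotRow] using hr)
  rwa [← rotRow_exch, ← rotRow_exch, rect_rot, rect_rot, rect_rot, rect_rot] at key

/-- Two rectangles with a common right column, the lower one being narrower. -/
theorem Rect.upperRight_narrow {ρ : Curve N m → Fin N} {l a r : Curve N m}
    (h : CycIoo l.1 r.1 a.1) (hr : CycIoo (ρ a) (ρ r) (ρ l)) :
    (Z.Rect ρ l r ∧ Z.Rect (exch ρ l r) a r) ↔ (Z.Rect ρ a r ∧ Z.Rect (exch ρ a r) l a) := by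
  have : NeZero N := ⟨by have := l.1.2; omega⟩
  have key := Rect.lowerLeft_narrow (Z := Z.rot) (ρ := rotRow ρ) (l := rotCurve r) (a := rotCurve a)
    (r := rotCurve l) ((cycIoo_neg _ _ _).2 h) (by simpa [cycIoo_neg, rotRow] using hr)
  rwa [← rotRow_exch, ← rotRow_exch, rect_rot, rect_rot, rect_rot, rect_rot] at key

/-- Two rectangles without common curves can be exchanged: the corner of the first one. -/
theorem Rect.corner_first {ρ : Curve N m → Fin N} {l r l' r' : Curve N m} (h : Z.Rect ρ l r)
    (h' : Z.Rect (exch ρ l r) l' r') (h1 : l ≠ l') (h2 : l ≠ r') (h3 : r ≠ l') (h4 : r ≠ r')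
    (hc : CycIoo l'.1 r'.1 l.1) (hj : Z.Joined (ρ l') l' l) :
    ρ l ≠ ρ l' ∧ ρ l ≠ ρ r' ∧ ¬ CycIoo (ρ l') (ρ r') (ρ l) := by
  have el' : exch ρ l r l' = ρ l' := exch_ne _ h1.symm h3.symm
  have er' : exch ρ l r r' = ρ r' := exch_ne _ h2.symm h4.symm
  have f' := h'.free
  have f := h.free
  have b' := h'.base
  have b := h.base
  have hl := h'.empty l hc (by rw [el']; exact hj)
  rw [el'] at b'
  rw [el', er', exch_left] at hl
  rw [el', er'] at f'
  by_contra hcon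
  -- the row of `l` lies in the closed interval of `h'`
  have hin : ρ l = ρ l' ∨ ρ l = ρ r' ∨ CycIoo (ρ l') (ρ r') (ρ l) := by tauto
  have hrow := h.row
  have hrow' := h'.row
  rw [el', er'] at hrow'
  have sub1 : ∀ i, CycIco (ρ l') (ρ l) i → CycIco (ρ l') (ρ r') i := by
    intro i; simp only [cycIco_iff, cycIoo_iff, Fin.ext_iff, ne_eq] at *; omega
  have c1 : ∀ c, CycIco l'.1 l.1 c → CycIco l'.1 r'.1 c := by
    intro c; simp only [cycIco_iff, cycIoo_iff] at *; omega
  have jl : Z.Joined (ρ l) l' l := hj.flat fun c hc' i hi => f' c (c1 c hc') i (sub1 i hi)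
  have jr : Z.Joined (ρ l) l' r' := b'.flat fun c hc' i hi => f' c hc' i (sub1 i hi)
  have jlr : Z.Joined (ρ l) l r' := jl.cancel_left jr hc
  -- compare the right sides
  by_cases hrr : r'.1 = r.1
  · exact h4 (b.unique jlr hrr.symm)
  · by_cases ho : CycIoo l.1 r.1 r'.1
    · have := h.empty r' ho jlr
      simp only [cycIco_iff, cycIoo_iff, Fin.ext_iff, ne_eq] at *
      omega
    · have hcol := h.col
      have hr1 : CycIoo l'.1 r'.1 r.1 ∧ CycIoo l'.1 r.1 l.1 := by
        simp only [cycIco_iff, cycIoo_iff, Fin.ext_iff, ne_eq] at *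
        omega
      have c2 : ∀ c, CycIco l'.1 r.1 c → CycIco l'.1 r'.1 c := by
        intro c; simp only [cycIco_iff, cycIoo_iff] at *; omega
      have jr2 : Z.Joined (ρ l') l' r :=
        (jl.trans b hr1.2).flat_down fun c hc' i hi => f' c (c2 c hc') i (sub1 i hi)
      have := h'.empty r hr1.1 (by rw [el']; exact jr2)
      rw [el', er', exch_right] at this
      tauto

/-- Two rectangles without common curves can be exchanged: the corner of the second one. -/
theorem Rect.corner_second {ρ : Curve N m → Fin N} {l r l' r' : Curve N m} (h : Z.Rect ρ l r)
    (h' : Z.Rect (exch ρ l r) l' r') (h1 : l ≠ l') (h2 : l ≠ r') (h3 : r ≠ l') (h4 : r ≠ r')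
    (hc : CycIoo l.1 r.1 l'.1) (hj : Z.Joined (ρ l) l l') :
    ρ r' ≠ ρ l ∧ ρ r' ≠ ρ r ∧ ¬ CycIoo (ρ l) (ρ r) (ρ r') := by
  have el' : exch ρ l r l' = ρ l' := exch_ne _ h1.symm h3.symm
  have er' : exch ρ l r r' = ρ r' := exch_ne _ h2.symm h4.symm
  have f' := h'.free
  have f := h.free
  have b' := h'.base
  have b := h.base
  have hl := h.empty l' hc hj
  rw [el'] at b'
  rw [el', er'] at f'
  by_contra hcon
  have hin : ρ r' = ρ l ∨ ρ r' = ρ r ∨ CycIoo (ρ l) (ρ r) (ρ r') := by tauto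
  have hrow := h.row
  have hrow' := h'.row
  rw [el', er'] at hrow'
  -- the bottom edge of `h` crosses `l'` inside `h'`
  have hbot : ρ l = ρ r' ∨ CycIoo (ρ l') (ρ r') (ρ l) := by
    simp only [cycIoo_iff, Fin.ext_iff, ne_eq] at *
    omega
  have sub1 : ∀ i, CycIco (ρ l') (ρ l) i → CycIco (ρ l') (ρ r') i := by
    intro i; simp only [cycIco_iff, cycIoo_iff, Fin.ext_iff, ne_eq] at *; omega
  have jr' : Z.Joined (ρ l) l' r' := b'.flat fun c hc' i hi => f' c hc' i (sub1 i hi)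
  have jr : Z.Joined (ρ l) l' r := hj.cancel_left b hc
  by_cases hrr : r'.1 = r.1
  · exact h4 (jr.unique jr' hrr.symm)
  · by_cases ho : CycIoo l'.1 r'.1 r.1
    · have c2 : ∀ c, CycIco l'.1 r.1 c → CycIco l'.1 r'.1 c := by
        intro c; simp only [cycIco_iff, cycIoo_iff] at *; omega
      have := h'.empty r ho (by
        rw [el']
        exact jr.flat_down fun c hc' i hi => f' c (c2 c hc') i (sub1 i hi))
      rw [el', er', exch_right] at this
      simp only [cycIco_iff, cycIoo_iff, Fin.ext_iff, ne_eq] at *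
      omega
    · have hcol' := h'.col
      have hr1 : CycIoo l.1 r.1 r'.1 ∧ CycIoo l.1 r'.1 l'.1 := by
        simp only [cycIco_iff, cycIoo_iff, Fin.ext_iff, ne_eq] at *
        omega
      have := h.empty r' hr1.1 (hj.trans jr' hr1.2)
      tauto

theorem Rect.exchange_first {ρ : Curve N m → Fin N} {l r l' r' : Curve N m} (h : Z.Rect ρ l r)
    (h' : Z.Rect (exch ρ l r) l' r') (h1 : l ≠ l') (h2 : l ≠ r') (h3 : r ≠ l') (h4 : r ≠ r') :
    Z.Rect ρ l' r' := by
  have : NeZero N := ⟨by have := l.1.2; omega⟩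
  have el' : exch ρ l r l' = ρ l' := exch_ne _ h1.symm h3.symm
  have er' : exch ρ l r r' = ρ r' := exch_ne _ h2.symm h4.symm
  have hrow := h'.row
  have hbase := h'.base
  have hfree := h'.free
  rw [el', er'] at hrow hfree
  rw [el'] at hbase
  refine ⟨h'.col, hrow, hbase, hfree, fun b hb jb => ?_⟩
  by_cases hbl : b = l
  · subst hbl
    exact h.corner_first h' h1 h2 h3 h4 hb jb
  · by_cases hbr : b = r
    · subst hbr
      have key := h.rot.corner_first (l' := rotCurve r') (r' := rotCurve l')
        (by rw [← rotRow_exch]; exact h'.rot)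
        (fun e => h4 (rotCurve_injective e)) (fun e => h3 (rotCurve_injective e))
        (fun e => h2 (rotCurve_injective e)) (fun e => h1 (rotCurve_injective e))
        ((cycIoo_neg _ _ _).2 hb) (by
          rw [joined_rot]
          have c2 : ∀ c, CycIco l'.1 b.1 c → CycIco l'.1 r'.1 c := by
            intro c; simp only [cycIco_iff, cycIoo_iff] at *; omega
          have := (jb.flat fun c hc => hfree c (c2 c hc)).cancel_left (hbase.flat hfree) hb
          simpa [rotRow] using this)
      simp only [rotRow, rotCurve_rotCurve, cycIoo_neg, ne_eq, neg_inj] at key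
      tauto
    · have := h'.empty b hb (by rw [el']; exact jb)
      rwa [el', er', exch_ne _ hbl hbr] at this

theorem Rect.exchange_second {ρ : Curve N m → Fin N} {l r l' r' : Curve N m} (h : Z.Rect ρ l r)
    (h' : Z.Rect (exch ρ l r) l' r') (h1 : l ≠ l') (h2 : l ≠ r') (h3 : r ≠ l') (h4 : r ≠ r') :
    Z.Rect (exch ρ l' r') l r := by
  have : NeZero N := ⟨by have := l.1.2; omega⟩
  have el : exch ρ l' r' l = ρ l := exch_ne _ h1 h2
  have er : exch ρ l' r' r = ρ r := exch_ne _ h3 h4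
  refine ⟨h.col, by rw [el, er]; exact h.row, by rw [el]; exact h.base, by
    rw [el, er]; exact h.free, fun b hb jb => ?_⟩
  rw [el] at jb
  rw [el, er]
  by_cases hbl : b = l'
  · subst hbl
    rw [exch_left]
    exact h.corner_second h' h1 h2 h3 h4 hb jb
  · by_cases hbr : b = r'
    · subst hbr
      rw [exch_right]
      have key := h.rot.corner_second (l' := rotCurve b) (r' := rotCurve l')
        (by rw [← rotRow_exch]; exact h'.rot)
        (fun e => h4 (rotCurve_injective e)) (fun e => h3 (rotCurve_injective e))
        (fun e => h2 (rotCurve_injective e)) (fun e => h1 (rotCurve_injective e))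
        ((cycIoo_neg _ _ _).2 hb) (by
          rw [joined_rot]
          have c2 : ∀ c, CycIco l.1 b.1 c → CycIco l.1 r.1 c := by
            intro c; simp only [cycIco_iff, cycIoo_iff] at *; omega
          have := (jb.flat fun c hc => h.free c (c2 c hc)).cancel_left (h.base.flat h.free) hb
          simpa [rotRow] using this)
      simp only [rotRow, rotCurve_rotCurve, cycIoo_neg, ne_eq, neg_inj] at key
      tauto
    · have := h.empty b hb jb
      rwa [exch_ne _ hbl hbr]

end Sheets
end GridCover

namespace GridCover

/-- Formal sums of bijections from the lifts of the `β`-circles to those of the `α`-circles. -/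
abbrev States (n m : ℕ) : Type := (Curve n m ≃ Curve n m) →₀ ℤ

namespace Framing

variable {n m : ℕ} (φ : Framing n m)

/-- The formal generator associated with a bijection. -/
def formalState (f : Curve n m ≃ Curve n m) : FormalGenerator (m * n) where
  ε i := φ.αSign (φ.αOrder.symm i) * φ.βSign (f.symm (φ.αOrder.symm i))
  σ := φ.αOrder.symm.trans (f.symm.trans φ.βOrder)

/-- The shape of the formal rectangle with lower edge on `a` and upper edge on `b`. -/
def shape {a b : Curve n m} (h : a ≠ b) : FlowShape (m * n) :=
  .rectangle (φ.αOrder a) (φ.αOrder b) (fun h' => h (φ.αOrder.injective h'))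
    (φ.αSign a) (-φ.αSign b)

theorem rectangle_eq {a b : Curve n m} (h : a ≠ b) : φ.rectangle a b = [φ.shape h] := by
  unfold rectangle edgePair shape
  rw [dif_pos h]

theorem shape_terminal (f : Curve n m ≃ Curve n m) {a b : Curve n m} (h : a ≠ b) :
    (φ.shape h).terminal (φ.formalState f) = φ.formalState (f.trans (Equiv.swap a b)) := by
  have hab : φ.αOrder a ≠ φ.αOrder b := fun h' => h (φ.αOrder.injective h')
  ext i
  · simp only [shape, FlowShape.terminal, formalState, FormalGenerator.betaSign]
    obtain ⟨c, rfl⟩ := φ.αOrder.surjective i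
    by_cases hb : c = b
    · subst hb
      rw [Function.update_self]
      simp only [Equiv.symm_apply_apply, Equiv.symm_trans_apply, Equiv.symm_swap,
        Equiv.swap_apply_right]
      congr 1
      rw [mul_comm (φ.αSign a) (φ.βSign _), mul_assoc, Int.units_mul_self, mul_one, neg_mul_neg]
    · rw [Function.update_of_ne (fun h' => hb (φ.αOrder.injective h'))]
      by_cases ha : c = a
      · subst ha
        rw [Function.update_self]
        simp only [Equiv.symm_apply_apply, Equiv.symm_trans_apply, Equiv.symm_swap,
          Equiv.swap_apply_left]
        congr 1
        rw [mul_neg, mul_neg, mul_neg, neg_neg, mul_comm (φ.αSign b) (φ.βSign _), mul_assoc,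
          Int.units_mul_self, mul_one]
      · rw [Function.update_of_ne (fun h' => ha (φ.αOrder.injective h'))]
        simp [Equiv.swap_apply_of_ne_of_ne ha hb]
  · simp only [shape, FlowShape.terminal, formalState]
    obtain ⟨c, rfl⟩ := φ.αOrder.surjective i
    simp only [Equiv.Perm.coe_mul, Function.comp_apply, Equiv.trans_apply, Equiv.symm_trans_apply,
      Equiv.symm_swap, Equiv.symm_apply_apply]
    have key : φ.αOrder.symm (Equiv.swap (φ.αOrder a) (φ.αOrder b) (φ.αOrder c)) =
        Equiv.swap a b c := by
      rw [Equiv.symm_apply_eq]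
      exact (Function.Injective.swap_apply φ.αOrder.injective a b c)
    rw [key]

end Framing

namespace SignAssignment

variable {n m : ℕ} (S : SignAssignment (m * n)) (φ : Framing n m)

/-- The sign of the formal rectangle with lower edge on `a` and upper edge on `b`. -/
noncomputable def rectSign (f : Curve n m ≃ Curve n m) (a b : Curve n m) : ℤˣ :=
  S.pathSign (φ.formalState f) (φ.rectangle a b)

variable {φ}

theorem rectSign_eq (f : Curve n m ≃ Curve n m) {a b : Curve n m} (h : a ≠ b) :
    S.rectSign φ f a b = S.sign ⟨φ.formalState f, φ.shape h⟩ := by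
  rw [rectSign, φ.rectangle_eq h]
  simp [pathSign]

theorem rectSign_mul_self (f : Curve n m ≃ Curve n m) {a b : Curve n m} (h : a ≠ b) :
    S.rectSign φ f a b * S.rectSign φ (f.trans (Equiv.swap a b)) a b = 1 := by
  rw [rectSign_eq S f h, rectSign_eq S _ h, ← φ.shape_terminal f h]
  exact S.alpha _ _ _ (AlphaDegeneration.rectangle ..)

theorem rectSign_swap (f : Curve n m ≃ Curve n m) {a b : Curve n m} (h : a ≠ b) :
    S.rectSign φ f b a = -S.rectSign φ f a b := by
  have hf : f = (f.trans (Equiv.swap a b)).trans (Equiv.swap a b) := by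
    ext x <;> simp
  have h1 := S.rectSign_mul_self (φ := φ) (f.trans (Equiv.swap a b)) h
  rw [← hf] at h1
  have h2 : S.rectSign φ (f.trans (Equiv.swap a b)) a b * S.rectSign φ f b a = -1 := by
    rw [rectSign_eq S _ h, rectSign_eq S f h.symm]
    have hr : S.sign ⟨φ.formalState f, φ.shape h.symm⟩ = S.sign ⟨φ.formalState f, .rectangle (φ.αOrder a)
      (φ.αOrder b) (fun h' => h (φ.αOrder.injective h')) (-φ.αSign a) (φ.αSign b)⟩ :=
      S.rotate _ _ _ _ _ _
    rw [hr]
    have := S.beta (φ.formalState (f.trans (Equiv.swap a b))) _ _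
      (BetaDegeneration.rectangle (φ.αOrder a) (φ.αOrder b)
        (fun h' => h (φ.αOrder.injective h')) (φ.αSign a) (-φ.αSign b))
    have h3 := φ.shape_terminal (f.trans (Equiv.swap a b)) h
    rw [← hf, Framing.shape] at h3
    rw [h3, neg_neg] at this
    exact this
  rcases Int.units_eq_one_or (S.rectSign φ (f.trans (Equiv.swap a b)) a b) with h3 | h3 <;>
    rw [h3] at h1 h2
  · rw [one_mul] at h1 h2; rw [h1, h2]
  · rw [neg_one_mul] at h1 h2
    rw [neg_inj] at h2
    rw [h2, h1]

theorem rectSign_square {f : Curve n m ≃ Curve n m} {a b c d a' b' c' d' : Curve n m}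
    (h1 : a ≠ b) (h2 : c ≠ d) (h3 : a' ≠ b') (h4 : c' ≠ d')
    (h : Square (φ.shape h1) (φ.shape h2) (φ.shape h3) (φ.shape h4)) :
    S.rectSign φ f a b * S.rectSign φ (f.trans (Equiv.swap a b)) c d =
      -(S.rectSign φ f a' b' * S.rectSign φ (f.trans (Equiv.swap a' b')) c' d') := by
  rw [rectSign_eq S _ h1, rectSign_eq S _ h2, rectSign_eq S _ h3, rectSign_eq S _ h4]
  have := S.square (φ.formalState f) _ _ _ _ h
  rw [φ.shape_terminal, φ.shape_terminal] at this
  rw [← Units.val_inj]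
  rw [Units.val_neg]
  linarith

theorem rectSign_disjoint (f : Curve n m ≃ Curve n m) {a b c d : Curve n m}
    (h1 : a ≠ b) (h2 : c ≠ d) (hac : a ≠ c) (had : a ≠ d) (hbc : b ≠ c) (hbd : b ≠ d) :
    S.rectSign φ f a b * S.rectSign φ (f.trans (Equiv.swap a b)) c d =
      -(S.rectSign φ f c d * S.rectSign φ (f.trans (Equiv.swap c d)) a b) := by
  refine S.rectSign_square h1 h2 h2 h1 (Square.disjoint _ _ ?_)
  simp [Framing.shape, FlowShape.support, hac.symm, had.symm, hbc.symm, hbd.symm]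

theorem rectSign_hexagon (f : Curve n m ≃ Curve n m) {a b c : Curve n m}
    (hab : a ≠ b) (hbc : b ≠ c) (hac : a ≠ c) :
    S.rectSign φ f c a * S.rectSign φ (f.trans (Equiv.swap c a)) a b =
      -(S.rectSign φ f a b * S.rectSign φ (f.trans (Equiv.swap a b)) c b) := by
  have ho : ∀ {x y : Curve n m}, x ≠ y → φ.αOrder x ≠ φ.αOrder y :=
    fun h h' => h (φ.αOrder.injective h')
  have hr : ∀ (g : Curve n m ≃ Curve n m) {x y : Curve n m} (h : x ≠ y),
      S.rectSign φ g x y = S.sign ⟨φ.formalState g, .rectangle (φ.αOrder y) (φ.αOrder x)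
        (ho h.symm) (-φ.αSign y) (φ.αSign x)⟩ := by
    intro g x y h
    rw [rectSign_eq S g h, Framing.shape, S.rotate]
  have key := S.square (φ.formalState f) _ _ _ _
    (Square.hexagonInitial (φ.αOrder a) (φ.αOrder b) (φ.αOrder c) (ho hab) (ho hbc) (ho hac)
      (φ.αSign a) (-φ.αSign b) (φ.αSign c))
  have t1 := φ.shape_terminal f hac.symm
  have t2 := φ.shape_terminal f hab
  have t1' : (FlowShape.rectangle (φ.αOrder a) (φ.αOrder c) (ho hac) (-φ.αSign a)
      (φ.αSign c)).terminal (φ.formalState f) = φ.formalState (f.trans (Equiv.swap c a)) := by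
    rw [← t1]
    simp only [Framing.shape, FlowShape.terminal, FormalGenerator.betaSign]
    rw [Equiv.swap_comm, Function.update_comm (ho hac)]
  rw [t1'] at key
  rw [Framing.shape] at t2
  rw [t2] at key
  rw [hr f hac.symm, hr _ hbc.symm, rectSign_eq S _ hab, rectSign_eq S _ hab]
  rw [← Units.val_inj, Units.val_neg]
  simp only [Framing.shape]
  linarith


variable (φ) in
/-- The operator which exchanges the points on `l` and `r`, with the sign of the rectangle with left
side on `l` and right side on `r`. -/
noncomputable def exchange (l r : Curve n m) : States n m →ₗ[ℤ] States n m :=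
  Finsupp.linearCombination ℤ fun f =>
    Finsupp.single ((Equiv.swap l r).trans f) (S.rectSign φ f (f l) (f r) : ℤ)

theorem exchange_single (l r : Curve n m) (f : Curve n m ≃ Curve n m) :
    S.exchange φ l r (Finsupp.single f 1) =
      (S.rectSign φ f (f l) (f r) : ℤ) • Finsupp.single ((Equiv.swap l r).trans f) 1 := by
  rw [exchange, Finsupp.linearCombination_single, one_smul, Finsupp.smul_single, smul_eq_mul,
    mul_one]

theorem trans_swap (f : Curve n m ≃ Curve n m) (l r : Curve n m) :
    (Equiv.swap l r).trans f = f.trans (Equiv.swap (f l) (f r)) := by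
  ext x : 1
  exact (f.injective.swap_apply l r x).symm

theorem exchange_exchange_single (l r l' r' : Curve n m) (f : Curve n m ≃ Curve n m) :
    S.exchange φ l' r' (S.exchange φ l r (Finsupp.single f 1)) =
      ((S.rectSign φ f (f l) (f r) * S.rectSign φ (f.trans (Equiv.swap (f l) (f r)))
        (f (Equiv.swap l r l')) (f (Equiv.swap l r r')) : ℤˣ) : ℤ) •
        Finsupp.single ((Equiv.swap l' r').trans ((Equiv.swap l r).trans f)) 1 := by
  rw [exchange_single, map_smul, exchange_single, smul_smul, Units.val_mul, ← trans_swap]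
  rfl

theorem exchange_swap {l r : Curve n m} (h : l ≠ r) :
    S.exchange φ r l = -S.exchange φ l r := by
  refine Finsupp.lhom_ext' fun f => LinearMap.ext_ring ?_
  have hf : f l ≠ f r := fun h' => h (f.injective h')
  simp only [LinearMap.comp_apply, Finsupp.lsingle_apply, LinearMap.neg_apply]
  rw [exchange_single, exchange_single, S.rectSign_swap f hf, Equiv.swap_comm]
  simp

theorem exchange_self {l r : Curve n m} (h : l ≠ r) :
    S.exchange φ l r ∘ₗ S.exchange φ l r = -LinearMap.id := by
  refine Finsupp.lhom_ext' fun f => LinearMap.ext_ring ?_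
  have hf : f l ≠ f r := fun h' => h (f.injective h')
  simp only [LinearMap.comp_apply, Finsupp.lsingle_apply, LinearMap.neg_apply, LinearMap.id_apply]
  rw [exchange_exchange_single]
  have h1 := S.rectSign_mul_self (φ := φ) f hf
  rw [Equiv.swap_apply_left, Equiv.swap_apply_right, S.rectSign_swap _ hf, mul_neg, h1,
    ← Equiv.trans_assoc, Equiv.swap_swap, Equiv.refl_trans]
  simp

theorem exchange_disjoint {a b c d : Curve n m} (h1 : a ≠ b) (h2 : c ≠ d) (hac : a ≠ c)
    (had : a ≠ d) (hbc : b ≠ c) (hbd : b ≠ d) :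
    S.exchange φ a b ∘ₗ S.exchange φ c d = -(S.exchange φ c d ∘ₗ S.exchange φ a b) := by
  refine Finsupp.lhom_ext' fun f => LinearMap.ext_ring ?_
  have hf : ∀ {x y}, x ≠ y → f x ≠ f y := fun h h' => h (f.injective h')
  simp only [LinearMap.comp_apply, Finsupp.lsingle_apply, LinearMap.neg_apply]
  rw [exchange_exchange_single, exchange_exchange_single,
    Equiv.swap_apply_of_ne_of_ne hac had, Equiv.swap_apply_of_ne_of_ne hbc hbd,
    Equiv.swap_apply_of_ne_of_ne hac.symm hbc.symm, Equiv.swap_apply_of_ne_of_ne had.symm hbd.symm,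
    S.rectSign_disjoint f (hf h1) (hf h2) (hf hac) (hf had) (hf hbc) (hf hbd), Units.val_neg,
    neg_smul, neg_neg]
  congr 2
  ext x : 1
  have : Equiv.swap a b * Equiv.swap c d = Equiv.swap c d * Equiv.swap a b :=
    (Equiv.Perm.disjoint_swap_swap (by simp [*])).commute
  exact congrArg f (congrArg (fun g : Equiv.Perm _ => g x) this).symm

/-- The sign rule for the two ways to cut a hexagon, for the hexagon with corners on the columns
`a`, `b`, `c`. -/
theorem exchange_hexagon {a b c : Curve n m} (hab : a ≠ b) (hbc : b ≠ c) (hac : a ≠ c) :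
    S.exchange φ a c ∘ₗ S.exchange φ a b = -(S.exchange φ a b ∘ₗ S.exchange φ b c) := by
  refine Finsupp.lhom_ext' fun f => LinearMap.ext_ring ?_
  have hf : ∀ {x y}, x ≠ y → f x ≠ f y := fun h h' => h (f.injective h')
  simp only [LinearMap.comp_apply, Finsupp.lsingle_apply, LinearMap.neg_apply]
  rw [exchange_exchange_single, exchange_exchange_single, Equiv.swap_apply_left,
    Equiv.swap_apply_of_ne_of_ne hac.symm hbc.symm, Equiv.swap_apply_of_ne_of_ne hab hac,
    Equiv.swap_apply_left]
  rw [S.rectSign_hexagon f (hf hbc) (hf hac.symm) (hf hab.symm), Units.val_neg, neg_smul]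
  congr 3
  ext x : 1
  simp only [Equiv.trans_apply]
  congr 1
  by_cases hxa : x = a
  · subst hxa; simp [Equiv.swap_apply_of_ne_of_ne hac.symm hbc.symm]
  · by_cases hxb : x = b
    · subst hxb; simp [Equiv.swap_apply_of_ne_of_ne hxa hbc, Equiv.swap_apply_of_ne_of_ne hab hac]
    · by_cases hxc : x = c
      · subst hxc; simp [Equiv.swap_apply_of_ne_of_ne hxa hxb]
      · simp [Equiv.swap_apply_of_ne_of_ne, *]

/-- The sign rule for two rectangles. -/
theorem exchange_exchange {a b c d : Curve n m} (h1 : a ≠ b) (h2 : c ≠ d) :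
    S.exchange φ c d ∘ₗ S.exchange φ a b =
      -(S.exchange φ a b ∘ₗ S.exchange φ (Equiv.swap a b c) (Equiv.swap a b d)) := by
  by_cases hca : c = a
  · subst hca
    by_cases hdb : d = b
    · subst hdb
      rw [Equiv.swap_apply_left, Equiv.swap_apply_right, S.exchange_swap h2, LinearMap.comp_neg,
        neg_neg]
    · rw [Equiv.swap_apply_left, Equiv.swap_apply_of_ne_of_ne h2.symm hdb,
        S.exchange_hexagon h1 (Ne.symm hdb) h2]
  by_cases hcb : c = b
  · subst hcb
    by_cases hda : d = a
    · subst hda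
      rw [Equiv.swap_apply_left, Equiv.swap_apply_right, S.exchange_swap h1, LinearMap.neg_comp]
    · have := S.exchange_hexagon (φ := φ) h1.symm (Ne.symm hda) h2
      rw [S.exchange_swap h1, LinearMap.neg_comp, LinearMap.comp_neg, neg_neg] at this
      rw [Equiv.swap_apply_right, Equiv.swap_apply_of_ne_of_ne hda h2.symm, ← this, neg_neg]
  by_cases hda : d = a
  · subst hda
    have := S.exchange_hexagon (φ := φ) h1 (Ne.symm hcb) h2.symm
    rw [Equiv.swap_apply_left, Equiv.swap_apply_of_ne_of_ne hca hcb, S.exchange_swap h2.symm,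
      LinearMap.neg_comp, this, S.exchange_swap (Ne.symm hcb), LinearMap.comp_neg]
  by_cases hdb : d = b
  · subst hdb
    have := S.exchange_hexagon (φ := φ) h1.symm (Ne.symm hca) h2.symm
    rw [Equiv.swap_apply_right, Equiv.swap_apply_of_ne_of_ne hca hcb, S.exchange_swap h2.symm,
      LinearMap.neg_comp, S.exchange_swap (Ne.symm hca)]
    rw [S.exchange_swap h1, LinearMap.neg_comp, LinearMap.comp_neg, neg_neg] at this
    rw [LinearMap.comp_neg, ← this, neg_neg]
  rw [Equiv.swap_apply_of_ne_of_ne hca hcb, Equiv.swap_apply_of_ne_of_ne hda hdb,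
    S.exchange_disjoint h2 h1 hca hcb hda hdb]

end SignAssignment
end GridCover

namespace GridCover

open Classical in
/-- A sum over pairs of successive rectangles vanishes up to annuli if the pairs with disjoint
sides occur in both orders and each L-shaped region is cut in two ways. -/
theorem sum_pairs {K ι : Type*} [Fintype K] (A : K → K → K → K → Prop) (ord : K → K → K → Prop)
    (w : K → K → K → K → (ι →₀ ℤ))
    (hA : ∀ a b c d, A a b c d → a ≠ b ∧ c ≠ d)
    (w_disjoint : ∀ a b c d, a ≠ b → c ≠ d → a ≠ c → a ≠ d → b ≠ c → b ≠ d →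
      w a b c d = -w c d a b)
    (w_LR : ∀ l m r, l ≠ m → m ≠ r → l ≠ r → w m r l m = -w l m l r)
    (w_RR : ∀ l m r, l ≠ m → m ≠ r → l ≠ r → w l r m r = w l m l r)
    (w_RL : ∀ l m r, l ≠ m → m ≠ r → l ≠ r → w l m m r = -w l r l m)
    (w_RR' : ∀ l m r, l ≠ m → m ≠ r → l ≠ r → w m r l r = w l r l m)
    (disjoint : ∀ a b c d, a ≠ b → c ≠ d → a ≠ c → a ≠ d → b ≠ c → b ≠ d →
      A a b c d → A c d a b)
    (RL : ∀ l m r, l ≠ m → m ≠ r → l ≠ r →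
      (A l m m r ↔ ord l m r ∧ (A l r l m ∨ A m r l r)))
    (RL_excl : ∀ l m r, l ≠ m → m ≠ r → l ≠ r → ord l m r → A l r l m → ¬ A m r l r)
    (LR : ∀ l m r, l ≠ m → m ≠ r → l ≠ r →
      (A m r l m ↔ ord l m r ∧ (A l m l r ∨ A l r m r)))
    (LR_excl : ∀ l m r, l ≠ m → m ≠ r → l ≠ r → ord l m r → A l m l r → ¬ A l r m r)
    (LL : ∀ l m r, l ≠ m → m ≠ r → l ≠ r → A l m l r → (ord l m r ↔ ¬ ord l r m))
    (RR : ∀ l m r, l ≠ m → m ≠ r → l ≠ r → A l r m r → (ord l m r ↔ ¬ ord m l r)) :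
    ∑ a, ∑ b, ∑ c, ∑ d, (if A a b c d then w a b c d else 0) =
      ∑ a, ∑ b, ((if A a b a b then w a b a b else 0) + if A a b b a then w a b b a else 0) := by
  set g : K → K → K → K → (ι →₀ ℤ) := fun a b c d => if A a b c d then w a b c d else 0 with hg
  have g0 : ∀ a b c d, a = b ∨ c = d → g a b c d = 0 := fun a b c d h => by
    rw [hg]
    simp only
    rw [if_neg]
    intro h'
    obtain ⟨h1, h2⟩ := hA _ _ _ _ h'
    exact h.elim h1 h2
  let D : K → K → K → K → (ι →₀ ℤ) := fun a b c d =>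
    if a ≠ b ∧ c ≠ d ∧ a ≠ c ∧ a ≠ d ∧ b ≠ c ∧ b ≠ d then g a b c d else 0
  let dist : K → K → K → Prop := fun l m r => l ≠ m ∧ m ≠ r ∧ l ≠ r
  let on : Prop → (ι →₀ ℤ) → (ι →₀ ℤ) := fun P v => if P then v else 0
  have split : ∀ a b c d, g a b c d = D a b c d
      + (if c = a then on (dist a b d) (g a b a d) else 0)
      + (if d = b then on (dist a c b) (g a b c b) else 0)
      + (if c = b then on (dist a b d) (g a b b d) else 0)
      + (if d = a then on (dist c a b) (g a b c a) else 0)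
      + (if c = a then (if d = b then g a b a b else 0) else 0)
      + (if c = b then (if d = a then g a b b a else 0) else 0) := by
    intro a b c d
    by_cases hab : a = b
    · simp [D, on, g0 a b _ _ (.inl hab)]
    by_cases hcd : c = d
    · subst hcd
      rw [g0 a b c c (.inr rfl)]
      by_cases h1 : c = a
      · subst h1
        simp [D, on, dist, hab]
      · by_cases h2 : c = b
        · subst h2; simp [D, on, dist, h1]
        · simp [D, h1, h2]
    by_cases h1 : c = a
    · subst h1
      by_cases h2 : d = b
      · subst h2
        simp [D, on, dist, hab, Ne.symm hab]
      · simp [D, on, dist, hab, h2, Ne.symm h2, hcd, Ne.symm hcd]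
    · by_cases h2 : c = b
      · subst h2
        by_cases h3 : d = a
        · subst h3
          simp [D, on, dist, hab, h1]
        · simp [D, on, dist, h1, Ne.symm h1, h3, Ne.symm h3, hcd, Ne.symm hcd]
      · by_cases h3 : d = a
        · subst h3
          simp [D, on, dist, h1, hab, h2, Ne.symm h2]
        · by_cases h4 : d = b
          · subst h4; simp [D, on, dist, Ne.symm h1, Ne.symm h3, Ne.symm h2, h1, h2, h3]
          · simp [D, h1, h2, h3, h4, hab, hcd, Ne.symm h1, Ne.symm h2, Ne.symm h3, Ne.symm h4]
  have hD : ∑ a, ∑ b, ∑ c, ∑ d, D a b c d = 0 := by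
    have h1 : ∀ a b c d, D a b c d = -D c d a b := by
      intro a b c d
      by_cases h : a ≠ b ∧ c ≠ d ∧ a ≠ c ∧ a ≠ d ∧ b ≠ c ∧ b ≠ d
      · have h' : c ≠ d ∧ a ≠ b ∧ c ≠ a ∧ c ≠ b ∧ d ≠ a ∧ d ≠ b :=
          ⟨h.2.1, h.1, h.2.2.1.symm, h.2.2.2.2.1.symm, h.2.2.2.1.symm, h.2.2.2.2.2.symm⟩
        simp only [D, if_pos h, if_pos h', hg]
        have h2 : A a b c d ↔ A c d a b :=
          ⟨disjoint a b c d h.1 h.2.1 h.2.2.1 h.2.2.2.1 h.2.2.2.2.1 h.2.2.2.2.2,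
            disjoint c d a b h'.1 h'.2.1 h'.2.2.1 h'.2.2.2.1 h'.2.2.2.2.1 h'.2.2.2.2.2⟩
        by_cases h3 : A a b c d
        · rw [if_pos h3, if_pos (h2.1 h3),
            w_disjoint a b c d h.1 h.2.1 h.2.2.1 h.2.2.2.1 h.2.2.2.2.1 h.2.2.2.2.2]
        · rw [if_neg h3, if_neg (fun h4 => h3 (h2.2 h4)), neg_zero]
      · have h' : ¬ (c ≠ d ∧ a ≠ b ∧ c ≠ a ∧ c ≠ b ∧ d ≠ a ∧ d ≠ b) := fun h2 =>
          h ⟨h2.2.1, h2.1, h2.2.2.1.symm, h2.2.2.2.2.1.symm, h2.2.2.2.1.symm, h2.2.2.2.2.2.symm⟩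
        simp only [D, if_neg h, if_neg h', neg_zero]
    have h2 : ∑ a, ∑ b, ∑ c, ∑ d, D a b c d = -∑ a, ∑ b, ∑ c, ∑ d, D a b c d := by
      have h3 : ∑ p : (K × K), ∑ q : (K × K), D p.1 p.2 q.1 q.2
          = -∑ p : (K × K), ∑ q : (K × K), D p.1 p.2 q.1 q.2 := by
        conv_rhs => rw [Finset.sum_comm]
        simp_rw [← Finset.sum_neg_distrib, ← h1]
      simpa only [Fintype.sum_prod_type] using h3
    ext i
    have h4 := DFunLike.congr_fun h2 i
    simp only [Finsupp.neg_apply, Finsupp.zero_apply] at h4 ⊢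
    omega
  let b : K → K → K → (ι →₀ ℤ) := fun l m r => on (dist l m r ∧ ord l m r ∧ A l r l m) (w l r l m)
  let e : K → K → K → (ι →₀ ℤ) := fun l m r => on (dist l m r ∧ ord l m r ∧ A m r l r) (w m r l r)
  have three : ∀ l m r, on (dist l m r) (g l m l r) + on (dist l m r) (g l r m r)
      + on (dist l m r) (g l m m r) + on (dist l m r) (g m r l m)
      = (b l r m - b l m r) + (e m l r - e l m r) := by
    intro l m r
    by_cases hd : dist l m r
    · obtain ⟨h1, h2, h3⟩ := hd
      have hd : dist l m r := ⟨h1, h2, h3⟩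
      have hd' : dist l r m := ⟨h3, h2.symm, h1⟩
      have hd'' : dist m l r := ⟨h1.symm, h3, h2⟩
      simp only [b, e, on, hd, hd', hd'', if_true, true_and, hg]
      rw [w_RR l m r h1 h2 h3, w_RL l m r h1 h2 h3, w_LR l m r h1 h2 h3, w_RR' l m r h1 h2 h3]
      have k1 := RL l m r h1 h2 h3
      have k2 := LR l m r h1 h2 h3
      have k3 := RL_excl l m r h1 h2 h3
      have k4 := LR_excl l m r h1 h2 h3
      have k5 := LL l m r h1 h2 h3
      have k6 := RR l m r h1 h2 h3
      by_cases o1 : ord l m r <;> by_cases o2 : A l m l r <;> by_cases o3 : A l r m r <;>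
      by_cases o4 : A l r l m <;> by_cases o5 : A m r l r <;> by_cases o6 : ord l r m <;>
      by_cases o7 : ord m l r <;>
      simp only [o1, o2, o3, o4, o5, o6, o7, and_true, and_false, or_true,
        or_false, not_true_eq_false, not_false_eq_true,
        iff_true, iff_false, imp_false, imp_self, iff_self, implies_true] at k1 k2 k3 k4 k5 k6 <;>
      simp [o1, o2, o3, o4, o5, o6, o7, k1, k2]
    · have hd' : ¬ dist l r m := fun h => hd ⟨h.2.2, h.2.1.symm, h.1⟩
      have hd'' : ¬ dist m l r := fun h => hd ⟨h.1.symm, h.2.2, h.2.1⟩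
      simp [b, e, on, hd, hd', hd'']
  have hb : ∑ l, ∑ m, ∑ r, (b l r m - b l m r) = 0 := by
    refine Finset.sum_eq_zero fun l _ => ?_
    simp only [Finset.sum_sub_distrib]
    rw [Finset.sum_comm, sub_self]
  have he : ∑ l, ∑ m, ∑ r, (e m l r - e l m r) = 0 := by
    simp only [Finset.sum_sub_distrib]
    rw [Finset.sum_comm, sub_self]
  have hsum : ∑ l, ∑ m, ∑ r, (on (dist l m r) (g l m l r) + on (dist l m r) (g l r m r)
      + on (dist l m r) (g l m m r) + on (dist l m r) (g m r l m)) = 0 := by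
    simp only [three]
    simp only [Finset.sum_add_distrib, hb, he, add_zero]
  simp only [Finset.sum_add_distrib] at hsum
  calc ∑ a, ∑ b, ∑ c, ∑ d, g a b c d
      = ∑ a, ∑ b, ∑ c, ∑ d, D a b c d
        + ∑ a, ∑ b, ∑ d, on (dist a b d) (g a b a d)
        + ∑ a, ∑ b, ∑ c, on (dist a c b) (g a b c b)
        + ∑ a, ∑ b, ∑ d, on (dist a b d) (g a b b d)
        + ∑ a, ∑ b, ∑ c, on (dist c a b) (g a b c a)
        + ∑ a, ∑ b, g a b a b + ∑ a, ∑ b, g a b b a := by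
        refine (Finset.sum_congr rfl fun a _ => Finset.sum_congr rfl fun b _ =>
          Finset.sum_congr rfl fun c _ => Finset.sum_congr rfl fun d _ => split a b c d).trans ?_
        simp only [Finset.sum_add_distrib]
        congr 1
        · congr 1
          · congr 1
            · congr 1
              · congr 1
                · congr 1
                  refine Finset.sum_congr rfl fun a _ => Finset.sum_congr rfl fun b _ => ?_
                  rw [Finset.sum_comm]
                  simp
                · simp
              · refine Finset.sum_congr rfl fun a _ => Finset.sum_congr rfl fun b _ => ?_
                rw [Finset.sum_comm]
                simp
            · simp
          · simp
        · simp
    _ = _ := by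
        rw [hD, zero_add]
        have s1 : ∑ a, ∑ b, ∑ c, on (dist a c b) (g a b c b)
            = ∑ a, ∑ c, ∑ b, on (dist a c b) (g a b c b) :=
          Finset.sum_congr rfl fun a _ => Finset.sum_comm
        have s2 : ∑ a, ∑ b, ∑ c, on (dist c a b) (g a b c a)
            = ∑ c, ∑ a, ∑ b, on (dist c a b) (g a b c a) := by
          rw [Finset.sum_comm' (t' := Finset.univ) (s' := fun _ => Finset.univ) (by simp)]
          have : ∀ b, ∑ a, ∑ c, on (dist c a b) (g a b c a) = ∑ c, ∑ a, on (dist c a b) (g a b c a) :=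
            fun b => Finset.sum_comm
          simp only [this]
          rw [Finset.sum_comm]
          exact Finset.sum_congr rfl fun a _ => Finset.sum_comm
        rw [s1, s2, hsum, zero_add]
        simp only [Finset.sum_add_distrib]
        rfl

end GridCover

namespace GridCover
namespace Sheets

variable {N m : ℕ} {Z : Sheets N m}

theorem exch_exch (ρ : Curve N m → Fin N) (a b c d : Curve N m) :
    exch (exch ρ a b) c d = exch (exch ρ (Equiv.swap a b c) (Equiv.swap a b d)) a b := by
  funext x
  have h := Equiv.swap_mul_eq_mul_swap (Equiv.swap a b) c d
  have h2 := Equiv.mul_swap_eq_swap_mul (Equiv.swap a b) c d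
  exact congrArg ρ (congrArg (fun g : Equiv.Perm _ => g x) h2)

/-- The horizontal strip of a pair of rectangles whose lower or upper edges are consecutive does
not wrap around. -/
theorem cycIoo_of_strip (rowM : ∀ i, ∃ c, Z.M c i) {a b d i : Fin N} (hab : a ≠ b) (hbd : b ≠ d)
    (h1 : ∀ c, CycIco a b c → ¬ Z.M c i) (h2 : ∀ c, CycIco b d c → ¬ Z.M c i) : CycIoo a d b := by
  by_contra h
  obtain ⟨c, hc⟩ := rowM i
  have h3 : ¬ CycIco a b c := fun h => h1 c h hc
  have h4 : ¬ CycIco b d c := fun h => h2 c h hc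
  clear h1 h2 hc rowM
  simp only [cycIco_iff, cycIoo_iff, Fin.ext_iff, ne_eq] at *
  omega

theorem exists_cycIco_pred (b : Fin N) : ∃ i, ∀ a, a ≠ b → CycIco a b i := by
  have hb := b.2
  by_cases h : (b : ℕ) = 0
  · refine ⟨⟨N - 1, by omega⟩, fun a ha => ?_⟩
    have := a.2
    simp only [cycIco_iff, Fin.ext_iff, ne_eq] at *
    omega
  · refine ⟨⟨b - 1, by omega⟩, fun a ha => ?_⟩
    have := a.2
    simp only [cycIco_iff, Fin.ext_iff, ne_eq] at *
    omega

theorem cycIco_self {a b : Fin N} (h : a ≠ b) : CycIco a b a := by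
  simp only [cycIco_iff, Fin.ext_iff, ne_eq] at *
  omega

theorem cycIoo_trichotomy {a b c : Fin N} (hab : a ≠ b) (hac : a ≠ c) :
    CycIoo a b c ∨ CycIoo a c b ∨ b = c := by
  simp only [cycIoo_iff, Fin.ext_iff, ne_eq] at *
  omega

theorem cycIoo_iff_not {a b c : Fin N} (hab : a ≠ b) (hac : a ≠ c) (hbc : b ≠ c) :
    CycIoo a c b ↔ ¬ CycIoo a b c := by
  simp only [cycIoo_iff, Fin.ext_iff, ne_eq] at *
  omega

theorem cycIoo_iff_not' {a b c : Fin N} (hab : a ≠ b) (hac : a ≠ c) (hbc : b ≠ c) :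
    CycIoo a c b ↔ ¬ CycIoo b c a := by
  simp only [cycIoo_iff, Fin.ext_iff, ne_eq] at *
  omega

theorem cycIoo_asymm {a b c : Fin N} (h : CycIoo a b c) : ¬ CycIoo a c b := by
  simp only [cycIoo_iff] at *
  omega

theorem cycIoo_asymm' {a b c : Fin N} (h : CycIoo a b c) : ¬ CycIoo c b a := by
  simp only [cycIoo_iff] at *
  omega

/-- Two successive rectangles. -/
def Pair (Z : Sheets N m) (ρ : Curve N m → Fin N) (a b c d : Curve N m) : Prop :=
  Z.Rect ρ a b ∧ Z.Rect (exch ρ a b) c d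

variable {ρ : Curve N m → Fin N} {l k r : Curve N m}

theorem Rect.ne (h : Z.Rect ρ l r) : l ≠ r := fun h' => h.col (congrArg _ h')

theorem Pair.row_RL (rowM : ∀ i, ∃ c, Z.M c i) (h : Z.Pair ρ l k k r) : CycIoo l.1 r.1 k.1 := by
  refine cycIoo_of_strip (i := ρ l) rowM h.1.col h.2.col (fun c hc => h.1.free c hc _ ?_)
    (fun c hc => h.2.free c hc _ ?_)
  · exact cycIco_self h.1.row
  · have h2 := h.2.row
    rw [exch_right] at h2 ⊢
    exact cycIco_self h2

theorem Pair.row_LR (rowM : ∀ i, ∃ c, Z.M c i) (h : Z.Pair ρ k r l k) : CycIoo l.1 r.1 k.1 := by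
  obtain ⟨i, hi⟩ := exists_cycIco_pred (ρ r)
  refine cycIoo_of_strip (i := i) rowM h.2.col h.1.col (fun c hc => h.2.free c hc _ ?_)
    (fun c hc => h.1.free c hc _ (hi _ h.1.row))
  have h2 := h.2.row
  rw [exch_left] at h2 ⊢
  exact hi _ h2

theorem Pair.col_LL (h : Z.Pair ρ l k l r) (hkr : k ≠ r) : k.1 ≠ r.1 := by
  intro h'
  have h2 := h.2.base
  rw [exch_left] at h2
  exact hkr ((h.1.base.flat h.1.free).unique h2 h')

theorem Pair.col_RR (h : Z.Pair ρ l r k r) (hlk : l ≠ k) :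
    l.1 ≠ k.1 := by
  intro h'
  have h2 := h.2.base.flat h.2.free
  rw [exch_right] at h2
  exact hlk (h.1.base.unique_left h2 h')

theorem Pair.rows_LL (h : Z.Pair ρ l k l r) (hkr : k ≠ r) : CycIoo (ρ l) (ρ r) (ρ k) := by
  have er : exch ρ l k r = ρ r := exch_ne _ h.2.ne.symm hkr.symm
  have ek : exch ρ l k k = ρ l := exch_right ..
  have el : exch ρ l k l = ρ k := exch_left ..
  have c0 := h.col_LL hkr
  have c1 := h.1.col
  have c2 := h.2.col
  have b2 := h.2.base
  rw [el] at b2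
  by_cases ho : CycIoo l.1 k.1 r.1
  · have e := h.1.empty r ho (b2.flat_down fun c hc => h.1.free c (by
      simp only [cycIco_iff, cycIoo_iff] at *; omega))
    obtain ⟨e1, e2, e3⟩ := e
    have h1 := h.1.row
    simp only [cycIoo_iff, Fin.ext_iff, ne_eq] at *
    omega
  · have ho' := (cycIoo_iff_not c1 c2 c0).2 ho
    have e := h.2.empty k ho' (by rw [el]; exact h.1.base.flat h.1.free)
    rw [ek, el, er] at e
    obtain ⟨e1, e2, e3⟩ := e
    have h2 := h.2.row
    rw [el, er] at h2
    simp only [cycIoo_iff, Fin.ext_iff, ne_eq] at *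
    omega

theorem Pair.rows_RR (h : Z.Pair ρ l r k r) (hlk : l ≠ k) : CycIoo (ρ k) (ρ r) (ρ l) := by
  have er : exch ρ l r r = ρ l := exch_right ..
  have ek : exch ρ l r k = ρ k := exch_ne _ hlk.symm h.2.ne
  have el : exch ρ l r l = ρ r := exch_left ..
  have c0 := h.col_RR hlk
  have c1 := h.1.col
  have c2 := h.2.col
  have f2 := h.2.free
  rw [ek, er] at f2
  have b2 := h.2.base
  rw [ek] at b2
  by_cases ho : CycIoo l.1 r.1 k.1
  · have e := h.1.empty k ho (h.1.base.cancel_right (b2.flat f2) ho)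
    obtain ⟨e1, e2, e3⟩ := e
    have h1 := h.1.row
    simp only [cycIoo_iff, Fin.ext_iff, ne_eq] at *
    omega
  · have ho' : CycIoo k.1 r.1 l.1 := by
      by_contra h'
      exact ho ((cycIoo_iff_not' c0 c1 c2).2 h')
    have e := h.2.empty l ho' (by
      rw [ek]
      refine b2.cancel_right (h.1.base.flat_down fun c hc => f2 c ?_) ho'
      simp only [cycIco_iff, cycIoo_iff] at *
      omega)
    rw [ek, el, er] at e
    obtain ⟨e1, e2, e3⟩ := e
    have h2 := h.2.row
    rw [ek, er] at h2
    simp only [cycIoo_iff, Fin.ext_iff, ne_eq] at *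
    omega

theorem Pair.not_annulus (rowM : ∀ i, ∃ c, Z.M c i) : ¬ Z.Pair ρ l r r l := by
  intro h
  have := h.row_RL rowM
  simp only [cycIoo_iff] at this
  omega

end Sheets

open Sheets

/-- The rows of the points of a state. -/
def rows {N m : ℕ} (f : Curve N m ≃ Curve N m) : Curve N m → Fin N := fun b => (f b).1

theorem rows_trans_swap {N m : ℕ} (f : Curve N m ≃ Curve N m) (l r : Curve N m) :
    rows ((Equiv.swap l r).trans f) = exch (rows f) l r := rfl

namespace SignAssignment

variable {N m : ℕ} [NeZero m] (S : SignAssignment (m * N)) (φ : Framing N m)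

open Classical in
/-- The signed count of the rectangles which satisfy `P`. -/
noncomputable def op (P : (Curve N m → Fin N) → Curve N m → Curve N m → Prop) :
    States N m →ₗ[ℤ] States N m :=
  Finsupp.linearCombination ℤ fun f =>
    ∑ l, ∑ r, if P (rows f) l r then S.exchange φ l r (Finsupp.single f 1) else 0

variable {φ}

open Classical in
theorem op_single (P : (Curve N m → Fin N) → Curve N m → Curve N m → Prop)
    (f : Curve N m ≃ Curve N m) : S.op φ P (Finsupp.single f 1) =
      ∑ l, ∑ r, if P (rows f) l r then S.exchange φ l r (Finsupp.single f 1) else 0 := by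
  rw [op, Finsupp.linearCombination_single, one_smul]

open Classical in
theorem op_op_single (P Q : (Curve N m → Fin N) → Curve N m → Curve N m → Prop)
    (f : Curve N m ≃ Curve N m) : S.op φ Q (S.op φ P (Finsupp.single f 1)) =
      ∑ a, ∑ b, ∑ c, ∑ d, if P (rows f) a b ∧ Q (exch (rows f) a b) c d then
        S.exchange φ c d (S.exchange φ a b (Finsupp.single f 1)) else 0 := by
  rw [op_single, map_sum]
  refine Finset.sum_congr rfl fun a _ => ?_
  rw [map_sum]
  refine Finset.sum_congr rfl fun b _ => ?_
  by_cases h : P (rows f) a b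
  · rw [if_pos h]
    simp only [h, true_and]
    rw [exchange_single, map_smul, op_single, rows_trans_swap, Finset.smul_sum]
    refine Finset.sum_congr rfl fun c _ => ?_
    rw [Finset.smul_sum]
    refine Finset.sum_congr rfl fun d _ => ?_
    split_ifs
    · rw [map_smul]
    · rw [smul_zero]
  · simp [h]

omit [NeZero m] in
theorem exchange_exchange_mem (G : (Curve N m → Fin N) → Prop) (f : Curve N m ≃ Curve N m)
    (a b c d : Curve N m) (h : G (exch (exch (rows f) a b) c d)) :
    S.exchange φ c d (S.exchange φ a b (Finsupp.single f 1)) ∈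
      Finsupp.supported ℤ ℤ {g : Curve N m ≃ Curve N m | G (rows g)} := by
  rw [exchange_exchange_single]
  exact Submodule.smul_mem _ _ (Finsupp.single_mem_supported ℤ _ h)

open Classical in
/-- The two ways `P₁` then `P₂` and `P₃` then `P₄` to compose rectangles cancel up to annuli and up
to states without the property `G`. -/
theorem op_op_add_op_op (Z : Sheets N m) (rowM : ∀ i, ∃ c, Z.M c i) (f : Curve N m ≃ Curve N m)
    (P₁ P₂ P₃ P₄ : (Curve N m → Fin N) → Curve N m → Curve N m → Prop)
    (G : (Curve N m → Fin N) → Prop) (Ψ : Curve N m → Curve N m → Curve N m → Curve N m → Prop)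
    (hΨ : ∀ a b c d, Ψ a b c d ↔ (P₁ (rows f) a b ∧ P₂ (exch (rows f) a b) c d) ∨
      (P₃ (rows f) a b ∧ P₄ (exch (rows f) a b) c d))
    (excl : ∀ a b, P₁ (rows f) a b → ¬ P₃ (rows f) a b)
    (pair : ∀ a b c d, Ψ a b c d → Z.Pair (rows f) a b c d)
    (disjoint : ∀ a b c d, a ≠ b → c ≠ d → a ≠ c → a ≠ d → b ≠ c → b ≠ d →
      Z.Pair (rows f) c d a b → Ψ a b c d → Ψ c d a b)
    (RL_ne : ∀ l k r, l ≠ k → k ≠ r → l ≠ r → CycIoo l.1 r.1 k.1 → Ψ l k k r →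
      G (exch (exch (rows f) l k) k r) → rows f k ≠ rows f r)
    (LR_ne : ∀ l k r, l ≠ k → k ≠ r → l ≠ r → CycIoo l.1 r.1 k.1 → Ψ k r l k →
      G (exch (exch (rows f) k r) l k) → rows f l ≠ rows f k)
    (RL_LL : ∀ l k r, l ≠ k → k ≠ r → l ≠ r → CycIoo l.1 r.1 k.1 →
      CycIoo (rows f l) (rows f k) (rows f r) → Z.Pair (rows f) l r l k →
      Z.Pair (rows f) l k k r → G (exch (exch (rows f) l k) k r) → (Ψ l r l k ↔ Ψ l k k r))
    (RL_RR : ∀ l k r, l ≠ k → k ≠ r → l ≠ r → CycIoo l.1 r.1 k.1 →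
      CycIoo (rows f l) (rows f r) (rows f k) → Z.Pair (rows f) k r l r →
      Z.Pair (rows f) l k k r → G (exch (exch (rows f) l k) k r) → (Ψ k r l r ↔ Ψ l k k r))
    (LR_LL : ∀ l k r, l ≠ k → k ≠ r → l ≠ r → CycIoo l.1 r.1 k.1 →
      CycIoo (rows f l) (rows f r) (rows f k) → Z.Pair (rows f) l k l r →
      Z.Pair (rows f) k r l k → G (exch (exch (rows f) k r) l k) → (Ψ l k l r ↔ Ψ k r l k))
    (LR_RR : ∀ l k r, l ≠ k → k ≠ r → l ≠ r → CycIoo l.1 r.1 k.1 →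
      CycIoo (rows f k) (rows f r) (rows f l) → Z.Pair (rows f) l r k r →
      Z.Pair (rows f) k r l k → G (exch (exch (rows f) k r) l k) → (Ψ l r k r ↔ Ψ k r l k)) :
    S.op φ P₂ (S.op φ P₁ (Finsupp.single f 1)) + S.op φ P₄ (S.op φ P₃ (Finsupp.single f 1)) +
      (∑ a, ∑ b, if Ψ a b a b ∧ G (rows f) then Finsupp.single f 1 else 0) ∈
      Finsupp.supported ℤ ℤ {g : Curve N m ≃ Curve N m | ¬ G (rows g)} := by
  set ρ := rows f with hρ
  set w : Curve N m → Curve N m → Curve N m → Curve N m → States N m := fun a b c d =>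
    S.exchange φ c d (S.exchange φ a b (Finsupp.single f 1)) with hw
  have total : S.op φ P₂ (S.op φ P₁ (Finsupp.single f 1))
      + S.op φ P₄ (S.op φ P₃ (Finsupp.single f 1))
      = ∑ a, ∑ b, ∑ c, ∑ d, if Ψ a b c d then w a b c d else 0 := by
    rw [op_op_single, op_op_single, ← hρ]
    simp only [← Finset.sum_add_distrib]
    refine Finset.sum_congr rfl fun a _ => Finset.sum_congr rfl fun b _ =>
      Finset.sum_congr rfl fun c _ => Finset.sum_congr rfl fun d _ => ?_
    have := excl a b
    simp only [hΨ]
    by_cases h1 : P₁ ρ a b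
    · simp [h1, this h1, hw]
    · simp [h1, hw]
  have law : ∀ {a b c d : Curve N m}, a ≠ b → c ≠ d →
      w a b c d = -w (Equiv.swap a b c) (Equiv.swap a b d) a b := by
    intro a b c d h1 h2
    have := congrArg (fun g => g (Finsupp.single f 1)) (S.exchange_exchange (φ := φ) h1 h2)
    simpa using this
  have law' : ∀ {a b c d : Curve N m}, c ≠ d → w a b d c = -w a b c d := by
    intro a b c d h
    simp only [hw]
    rw [S.exchange_swap h]
    rfl
  have law'' : ∀ {a b c d : Curve N m}, a ≠ b → w b a c d = -w a b c d := by
    intro a b c d h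
    simp only [hw]
    rw [S.exchange_swap h]
    simp
  obtain ⟨A, hA⟩ : ∃ A : Curve N m → Curve N m → Curve N m → Curve N m → Prop,
      ∀ a b c d, A a b c d ↔ Ψ a b c d ∧ G (exch (exch ρ a b) c d) :=
    ⟨_, fun _ _ _ _ => Iff.rfl⟩
  have split : ∑ a, ∑ b, ∑ c, ∑ d, (if Ψ a b c d then w a b c d else 0)
      = ∑ a, ∑ b, ∑ c, ∑ d, (if A a b c d then w a b c d else 0)
        + ∑ a, ∑ b, ∑ c, ∑ d,
          (if Ψ a b c d ∧ ¬ G (exch (exch ρ a b) c d) then w a b c d else 0) := by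
    simp only [← Finset.sum_add_distrib]
    refine Finset.sum_congr rfl fun a _ => Finset.sum_congr rfl fun b _ =>
      Finset.sum_congr rfl fun c _ => Finset.sum_congr rfl fun d _ => ?_
    by_cases h1 : Ψ a b c d <;> by_cases h2 : G (exch (exch ρ a b) c d) <;> simp [hA, h1, h2]
  have e1 : ∀ {l k r : Curve N m}, l ≠ k → k ≠ r → l ≠ r →
      exch (exch ρ l r) l k = exch (exch ρ l k) k r := by
    intro l k r h1 h2 h3
    rw [exch_exch ρ l k k r, Equiv.swap_apply_right, Equiv.swap_apply_of_ne_of_ne h3.symm h2.symm]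
  have e2 : ∀ {l k r : Curve N m}, l ≠ k → k ≠ r → l ≠ r →
      exch (exch ρ k r) l r = exch (exch ρ l k) k r := by
    intro l k r h1 h2 h3
    rw [exch_exch ρ k r l r, Equiv.swap_apply_right, Equiv.swap_apply_of_ne_of_ne h1 h3]
  have e3 : ∀ {l k r : Curve N m}, l ≠ k → k ≠ r → l ≠ r →
      exch (exch ρ l k) l r = exch (exch ρ k r) l k := by
    intro l k r h1 h2 h3
    rw [exch_exch ρ l k l r, Equiv.swap_apply_left, Equiv.swap_apply_of_ne_of_ne h3.symm h2.symm]
  have e4 : ∀ {l k r : Curve N m}, l ≠ k → k ≠ r → l ≠ r →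
      exch (exch ρ l r) k r = exch (exch ρ k r) l k := by
    intro l k r h1 h2 h3
    rw [exch_exch ρ k r l k, Equiv.swap_apply_left, Equiv.swap_apply_of_ne_of_ne h1 h3]
  have e5 : ∀ {a b c d : Curve N m}, a ≠ c → a ≠ d → b ≠ c → b ≠ d →
      exch (exch ρ a b) c d = exch (exch ρ c d) a b := by
    intro a b c d h1 h2 h3 h4
    rw [exch_exch ρ a b c d, Equiv.swap_apply_of_ne_of_ne h1.symm h3.symm,
      Equiv.swap_apply_of_ne_of_ne h2.symm h4.symm]
  have main := sum_pairs A (fun l k r => CycIoo l.1 r.1 k.1) w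
    (fun a b c d h => ⟨(pair _ _ _ _ ((hA _ _ _ _).1 h).1).1.ne, (pair _ _ _ _ ((hA _ _ _ _).1 h).1).2.ne⟩)
    (fun a b c d h1 h2 h3 h4 h5 h6 => by
      rw [law h1 h2, Equiv.swap_apply_of_ne_of_ne h3.symm h5.symm,
        Equiv.swap_apply_of_ne_of_ne h4.symm h6.symm])
    (fun l k r h1 h2 h3 => by
      rw [law h1 h3, Equiv.swap_apply_left, Equiv.swap_apply_of_ne_of_ne h3.symm h2.symm, neg_neg])
    (fun l k r h1 h2 h3 => by
      rw [law h3 h2, Equiv.swap_apply_right, Equiv.swap_apply_of_ne_of_ne h1.symm h2,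
        law'' h1, neg_neg])
    (fun l k r h1 h2 h3 => by
      rw [law h1 h2, Equiv.swap_apply_right, Equiv.swap_apply_of_ne_of_ne h3.symm h2.symm])
    (fun l k r h1 h2 h3 => by
      rw [law h2 h3, Equiv.swap_apply_right, Equiv.swap_apply_of_ne_of_ne h1 h3, law h1 h2,
        Equiv.swap_apply_right, Equiv.swap_apply_of_ne_of_ne h3.symm h2.symm, neg_neg])
    (by
      simp only [hA]
      rintro a b c d h1 h2 h3 h4 h5 h6 ⟨h7, h8⟩
      obtain ⟨p1, p2⟩ := pair _ _ _ _ h7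
      refine ⟨disjoint a b c d h1 h2 h3 h4 h5 h6 ⟨p1.exchange_first p2 h3 h4 h5 h6,
        p1.exchange_second p2 h3 h4 h5 h6⟩ h7, ?_⟩
      rwa [e5 h3 h4 h5 h6] at h8)
    (by
      simp only [hA]
      intro l k r h1 h2 h3
      constructor
      · rintro ⟨h4, h5⟩
        have hp := pair _ _ _ _ h4
        have ho := hp.row_RL rowM
        refine ⟨ho, ?_⟩
        have r1 := hp.1.row
        have r2 := hp.2.row
        rw [exch_right, exch_ne _ h3.symm h2.symm] at r2
        rcases cycIoo_trichotomy r1 r2 with h6 | h6 | h6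
        · have hp' := (Rect.lowerLeft_narrow ho h6).2 hp
          left
          exact ⟨(RL_LL l k r h1 h2 h3 ho h6 hp' hp h5).2 h4, by rwa [e1 h1 h2 h3]⟩
        · have hp' := (Rect.upperRight_wide ho h6).2 hp
          right
          exact ⟨(RL_RR l k r h1 h2 h3 ho h6 hp' hp h5).2 h4, by rwa [e2 h1 h2 h3]⟩
        · exact absurd h6 (RL_ne l k r h1 h2 h3 ho h4 h5)
      · rintro ⟨ho, ⟨h4, h5⟩ | ⟨h4, h5⟩⟩
        · have hp := pair _ _ _ _ h4
          have h6 := hp.rows_LL h2.symm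
          have hp' := (Rect.lowerLeft_narrow ho h6).1 hp
          rw [e1 h1 h2 h3] at h5
          exact ⟨(RL_LL l k r h1 h2 h3 ho h6 hp hp' h5).1 h4, h5⟩
        · have hp := pair _ _ _ _ h4
          have h6 := hp.rows_RR h1.symm
          have hp' := (Rect.upperRight_wide ho h6).1 hp
          rw [e2 h1 h2 h3] at h5
          exact ⟨(RL_RR l k r h1 h2 h3 ho h6 hp hp' h5).1 h4, h5⟩)
    (by
      simp only [hA]
      rintro l k r h1 h2 h3 ho ⟨h4, -⟩ ⟨h5, -⟩
      have h6 := (pair _ _ _ _ h4).rows_LL h2.symm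
      have h7 := (pair _ _ _ _ h5).rows_RR h1.symm
      exact cycIoo_asymm h6 h7)
    (by
      simp only [hA]
      intro l k r h1 h2 h3
      constructor
      · rintro ⟨h4, h5⟩
        have hp := pair _ _ _ _ h4
        have ho := hp.row_LR rowM
        refine ⟨ho, ?_⟩
        have r1 := hp.1.row
        have r2 := hp.2.row
        rw [exch_left, exch_ne _ h1 h3] at r2
        have h6 : CycIoo (ρ l) (ρ r) (ρ k) ∨ CycIoo (ρ k) (ρ r) (ρ l) ∨ ρ l = ρ k := by
          simp only [cycIoo_iff, Fin.ext_iff, ne_eq] at r1 r2 ⊢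
          omega
        rcases h6 with h6 | h6 | h6
        · have hp' := (Rect.lowerLeft_wide ho h6).2 hp
          left
          exact ⟨(LR_LL l k r h1 h2 h3 ho h6 hp' hp h5).2 h4, by rwa [e3 h1 h2 h3]⟩
        · have hp' := (Rect.upperRight_narrow ho h6).2 hp
          right
          exact ⟨(LR_RR l k r h1 h2 h3 ho h6 hp' hp h5).2 h4, by rwa [e4 h1 h2 h3]⟩
        · exact absurd h6 (LR_ne l k r h1 h2 h3 ho h4 h5)
      · rintro ⟨ho, ⟨h4, h5⟩ | ⟨h4, h5⟩⟩
        · have hp := pair _ _ _ _ h4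
          have h6 := hp.rows_LL h2
          have hp' := (Rect.lowerLeft_wide ho h6).1 hp
          rw [e3 h1 h2 h3] at h5
          exact ⟨(LR_LL l k r h1 h2 h3 ho h6 hp hp' h5).1 h4, h5⟩
        · have hp := pair _ _ _ _ h4
          have h6 := hp.rows_RR h1
          have hp' := (Rect.upperRight_narrow ho h6).1 hp
          rw [e4 h1 h2 h3] at h5
          exact ⟨(LR_RR l k r h1 h2 h3 ho h6 hp hp' h5).1 h4, h5⟩)
    (by
      simp only [hA]
      rintro l k r h1 h2 h3 ho ⟨h4, -⟩ ⟨h5, -⟩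
      have h6 := (pair _ _ _ _ h4).rows_LL h2
      have h7 := (pair _ _ _ _ h5).rows_RR h1
      exact cycIoo_asymm' h6 h7)
    (by
      simp only [hA]
      rintro l k r h1 h2 h3 ⟨h4, -⟩
      have hp := pair _ _ _ _ h4
      have c1 := hp.1.col
      have c2 := hp.2.col
      exact cycIoo_iff_not c1 c2 (hp.col_LL h2))
    (by
      simp only [hA]
      rintro l k r h1 h2 h3 ⟨h4, -⟩
      have hp := pair _ _ _ _ h4
      have c1 := hp.1.col
      have c2 := hp.2.col
      exact cycIoo_iff_not' (hp.col_RR h1) c1 c2)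
  have annuli : ∑ a, ∑ b, ((if A a b a b then w a b a b else 0) + if A a b b a then w a b b a else 0)
      = -∑ a, ∑ b, if Ψ a b a b ∧ G ρ then Finsupp.single f 1 else 0 := by
    simp only [← Finset.sum_neg_distrib]
    refine Finset.sum_congr rfl fun a _ => Finset.sum_congr rfl fun b _ => ?_
    rw [if_neg (fun h : A a b b a => (pair _ _ _ _ ((hA _ _ _ _).1 h).1).not_annulus rowM), add_zero]
    have e6 : exch (exch ρ a b) a b = ρ := by
      funext x
      simp [exch]
    simp only [hA, e6]
    by_cases h : Ψ a b a b ∧ G ρ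
    · rw [if_pos h, if_pos h]
      have := congrArg (fun g => g (Finsupp.single f 1))
        (S.exchange_self (φ := φ) (pair _ _ _ _ h.1).1.ne)
      simpa using this
    · rw [if_neg h, if_neg h, neg_zero]
  rw [total, split, main, annuli, add_assoc, add_comm, add_assoc, add_neg_cancel, add_zero]
  refine Submodule.sum_mem _ fun a _ => Submodule.sum_mem _ fun b _ =>
    Submodule.sum_mem _ fun c _ => Submodule.sum_mem _ fun d _ => ?_
  split_ifs with h
  · exact S.exchange_exchange_mem (fun ρ => ¬ G ρ) f a b c d h.2
  · exact Submodule.zero_mem _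

end SignAssignment
end GridCover

namespace GridCover
namespace Sheets

variable {N m : ℕ} {Z : Sheets N m} {ρ : Curve N m → Fin N} {l k r : Curve N m}

/-- The sheets with one more forbidden square. -/
def mark (Z : Sheets N m) (c i : Fin N) : Sheets N m where
  disp := Z.disp
  M a j := Z.M a j ∨ (a = c ∧ j = i)
  disp_add := Z.disp_add
  flat i i' a b h := Z.flat i i' a b fun c hc r hr h' => h c hc r hr (.inl h')

/-- The square in column `c` and row `i` is not contained in the rectangle. -/
def Avoid (c i : Fin N) (ρ : Curve N m → Fin N) (l r : Curve N m) : Prop :=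
  CycIco l.1 r.1 c → ¬ CycIco (ρ l) (ρ r) i

theorem rect_mark {c i : Fin N} : (Z.mark c i).Rect ρ l r ↔ Z.Rect ρ l r ∧ Avoid c i ρ l r := by
  constructor
  · intro h
    exact ⟨⟨h.col, h.row, h.base, fun c hc i hi h' => h.free c hc i hi (.inl h'), h.empty⟩,
      fun hc hi => h.free _ hc _ hi (.inr ⟨rfl, rfl⟩)⟩
  · rintro ⟨h, h'⟩
    refine ⟨h.col, h.row, h.base, ?_, h.empty⟩
    rintro c hc i hi (h1 | ⟨rfl, rfl⟩)
    · exact h.free c hc i hi h1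
    · exact h' hc hi

/-- The neighbourhood of a column `c` without forbidden squares and of the horizontal circle `p`
above the row `q`; `c'` is the column to the right of `c`. -/
structure Corner (Z : Sheets N m) (c c' p q : Fin N) : Prop where
  col : (c' : ℕ) = c + 1 ∨ ((c : ℕ) + 1 = N ∧ (c' : ℕ) = 0)
  row : (p : ℕ) = q + 1 ∨ ((q : ℕ) + 1 = N ∧ (p : ℕ) = 0)
  rowM : ∀ i, ∃ a, Z.M a i
  colM : ∀ a, a ≠ c → ∃ i, Z.M a i
  col_c : ∀ i, ¬ Z.M c i

theorem Corner.mark_rowM {c c' p q : Fin N} (C : Z.Corner c c' p q) (j : Fin N) (i : Fin N) :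
    ∃ a, (Z.mark c j).M a i :=
  (C.rowM i).imp fun _ h => .inl h

theorem not_cycIco_of_cycIoo {a b d : Fin N} (h : CycIoo a d b) : ¬ CycIco b d a := by
  simp only [cycIco_iff, cycIoo_iff] at *
  omega

theorem not_cycIco_right {a b : Fin N} : ¬ CycIco a b b := by
  simp only [cycIco_iff] at *
  omega

theorem Corner.not_cycIco {c c' p q x y : Fin N} (C : Z.Corner c c' p q) (h : CycIoo x p y) :
    ¬ CycIco x y q := by
  have := C.row
  have := x.2
  simp only [cycIco_iff, cycIoo_iff] at *
  omega

theorem Corner.cycIco {c c' p q x y : Fin N} (C : Z.Corner c c' p q) (h : CycIoo x y p) :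
    CycIco x y q ∧ CycIco x y p := by
  have := C.row
  have := x.2
  have := y.2
  simp only [cycIco_iff, cycIoo_iff] at *
  omega

theorem Corner.cycIco_q {c c' p q x : Fin N} (C : Z.Corner c c' p q) (h : x ≠ p) :
    CycIco x p q := by
  have := C.row
  have := x.2
  simp only [cycIco_iff, Fin.ext_iff, ne_eq] at *
  omega

/-- The sides do not lie on the lifts of `c` in the sheets of `J`. -/
def Off (c : Fin N) (J : Set (ZMod m)) (l r : Curve N m) : Prop :=
  (l.1 = c → l.2 ∉ J) ∧ (r.1 = c → r.2 ∉ J)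

/-- A rectangle which contains none of the squares in rows `p` and `q` of the column `c`. -/
def Plain (Z : Sheets N m) (c p q : Fin N) (ρ : Curve N m → Fin N) (l r : Curve N m) : Prop :=
  Z.Rect ρ l r ∧ Avoid c p ρ l r ∧ Avoid c q ρ l r

/-- A sector of a `4m`-gon. -/
def Sector (Z : Sheets N m) (c p : Fin N) (k : ZMod m) (ρ : Curve N m → Fin N) (l r : Curve N m) :
    Prop :=
  l = (c, k) ∧ Z.Rect ρ l r ∧ ρ r = p

theorem Sector.mark {c p : Fin N} {j : ZMod m} (h : Z.Sector c p j ρ l r) :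
    (Z.mark c p).Rect ρ l r := by
  refine rect_mark.2 ⟨h.2.1, fun _ h2 => ?_⟩
  rw [h.2.2] at h2
  exact not_cycIco_right h2

/-- A point over `p` which lies, to the right from `c'`, behind the column `d`. -/
def Bad (c c' p d : Fin N) (J : Set (ZMod m)) (ρ : Curve N m → Fin N) : Prop :=
  ∃ b : Curve N m, (b.1 = c → b.2 ∉ J) ∧ ρ b = p ∧ CycIco c' b.1 d

/-- Points on the same row line are not joined, except around the column `c` on the line `p`, where
the points on the lifts of `s` in the sheets of `J` are disregarded. -/
def Separated (Z : Sheets N m) (s c p : Fin N) (J : Set (ZMod m)) (ρ : Curve N m → Fin N) : Prop :=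
  ∀ a b : Curve N m, (a.1 = s → a.2 ∉ J) → (b.1 = s → b.2 ∉ J) → a.1 ≠ b.1 → ρ a = ρ b →
    Z.Joined (ρ a) a b → ρ a = p ∧ CycIco a.1 b.1 c

end Sheets

open Sheets

namespace SignAssignment

variable {N m : ℕ} [NeZero m] (S : SignAssignment (m * N)) {φ : Framing N m}

theorem op_sector_add {Z : Sheets N m} {c c' p q : Fin N} (C : Z.Corner c c' p q) {d : Fin N}
    (hd : Z.M d q) (hblock : ∀ a, a ≠ c → (∀ b, b ≠ c → CycIco b c a) → Z.M a p ∨ Z.M a q)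
    (f : Curve N m ≃ Curve N m) (J : Set (ZMod m)) {j : ZMod m} (hj : j ∉ J)
    (hsep : Z.Separated c c p J (rows f)) :
    S.op φ (Z.Sector c p j)
        (S.op φ (fun ρ l r => Z.Plain c p q ρ l r ∧ Off c J l r) (Finsupp.single f 1)) +
      S.op φ (fun ρ l r => Z.Plain c p q ρ l r ∧ Off c (insert j J) l r)
        (S.op φ (Z.Sector c p j) (Finsupp.single f 1)) ∈
      Finsupp.supported ℤ ℤ {g : Curve N m ≃ Curve N m | Bad c c' p d (insert j J) (rows g)} := by
  classical
  let Ψ : Curve N m → Curve N m → Curve N m → Curve N m → Prop := fun a b a' b' =>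
    ((Z.Plain c p q (rows f) a b ∧ Off c J a b) ∧ Z.Sector c p j (exch (rows f) a b) a' b') ∨
    (Z.Sector c p j (rows f) a b ∧ (Z.Plain c p q (exch (rows f) a b) a' b' ∧ Off c (insert j J) a' b'))
  have pair : ∀ a b a' b', Ψ a b a' b' → (Z.mark c p).Pair (rows f) a b a' b' := by
    rintro a b a' b' (⟨⟨h1, h2⟩, h3⟩ | ⟨h1, h2, h3⟩)
    · exact ⟨rect_mark.2 ⟨h1.1, h1.2.1⟩, h3.mark⟩
    · exact ⟨h1.mark, rect_mark.2 ⟨h2.1, h2.2.1⟩⟩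
  have off_ne : ∀ {a b : Curve N m}, Off c (insert j J) a b →
      a ≠ (c, j) ∧ b ≠ (c, j) := by
    rintro a b ⟨h1, h2⟩
    refine ⟨?_, ?_⟩ <;> rintro rfl
    · exact h1 rfl (Set.mem_insert _ _)
    · exact h2 rfl (Set.mem_insert _ _)
  have key := S.op_op_add_op_op (φ := φ) (Z.mark c p) (C.mark_rowM p) f
    (fun ρ l r => Z.Plain c p q ρ l r ∧ Off c J l r) (Z.Sector c p j) (Z.Sector c p j)
    (fun ρ l r => Z.Plain c p q ρ l r ∧ Off c (insert j J) l r)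
    (fun ρ => ¬ Bad c c' p d (insert j J) ρ) Ψ (fun _ _ _ _ => Iff.rfl)
    (by
      rintro a b ⟨h1, h2⟩ ⟨rfl, h4, h5⟩
      refine h1.2.2 (cycIco_self h4.col) ?_
      rw [h5]
      exact C.cycIco_q (by rw [← h5]; exact h4.row))
    pair
    (by
      rintro a b a' b' h1 h2 h3 h4 h5 h6 hp (⟨⟨h7, h8⟩, h9, h10, h11⟩ | ⟨⟨h9, h10, h11⟩, h7, h8⟩)
      · have q1 := rect_mark.1 hp.1
        have q2 := rect_mark.1 hp.2
        rw [exch_ne _ h4.symm h6.symm] at h11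
        refine .inr ⟨⟨h9, q1.1, h11⟩, ⟨q2.1, q2.2, ?_⟩, ?_, ?_⟩
        · have := h7.2.2
          unfold Avoid at this ⊢
          rwa [exch_ne _ h3 h4, exch_ne _ h5 h6]
        · rintro h12 (h13 | h13)
          · exact h3 (h9 ▸ Prod.ext h12 h13)
          · exact h8.1 h12 h13
        · rintro h12 (h13 | h13)
          · exact h5 (h9 ▸ Prod.ext h12 h13)
          · exact h8.2 h12 h13
      · have q1 := rect_mark.1 hp.1
        have q2 := rect_mark.1 hp.2
        refine .inl ⟨⟨⟨q1.1, q1.2, ?_⟩, fun h h' => h8.1 h (.inr h'), fun h h' => h8.2 h (.inr h')⟩,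
          h9, q2.1, by rw [exch_ne _ h5 h6]; exact h11⟩
        have := h7.2.2
        unfold Avoid at this ⊢
        rwa [exch_ne _ h3.symm h5.symm, exch_ne _ h4.symm h6.symm] at this)
    (by
      rintro l k r h1 h2 h3 ho (⟨⟨h4, h5⟩, h6, h7, h8⟩ | ⟨⟨h4, h5, h6⟩, h7, h8⟩) hG he
      · rw [exch_ne _ h3.symm h2.symm] at h8
        have hk : k.1 = c := by rw [h6]
        refine hG ⟨l, fun h => absurd (h.trans hk.symm) h4.1.col, ?_, ?_⟩
        · rw [exch_ne _ h1 h3, exch_left, he, h8]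
        · have n1 : ¬ CycIco l.1 k.1 d := fun h => h4.1.free _ h q
            (by rw [he, h8]; exact C.cycIco_q (by rw [← h8, ← he]; exact h4.1.row)) hd
          have n2 : d ≠ c := fun h => C.col_c _ (h ▸ hd)
          have n3 := C.col
          have n4 := h4.1.col
          rw [hk] at n1 n4
          have := d.2
          simp only [cycIco_iff, Fin.ext_iff, ne_eq] at *
          omega
      · have hl : l.1 = c := by rw [h4]
        have f2 := h7.1.base.flat h7.1.free
        rw [exch_ne _ h3.symm h2.symm, ← he] at f2
        have c1 : k.1 ≠ c := fun h => h5.col (hl.trans h.symm)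
        have c2 : r.1 ≠ c := fun h => (by
          rw [h, hl, cycIoo_iff] at ho; omega)
        have := (hsep k r (fun h => absurd h c1) (fun h => absurd h c2) h7.1.col he f2).2
        rw [← hl] at this
        exact not_cycIco_of_cycIoo ho this)
    (by
      rintro l k r h1 h2 h3 ho (⟨⟨h4, h5⟩, h6, h7, h8⟩ | ⟨⟨h4, h5, h6⟩, h7, h8⟩) hG he
      · have b2 := h7.base
        have r2 := h7.row
        rw [exch_ne _ h1 h3] at b2
        rw [exch_ne _ h1 h3, h8] at r2
        have hl : l.1 = c := by rw [h6]
        exact r2 (hsep l k (fun _ => by rw [h6]; exact hj)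
          (fun h => absurd (hl.trans h.symm) h7.col) h7.col he b2).1
      · exact (off_ne h8).2 h4)
    (by
      rintro l k r h1 h2 h3 ho hs hp hp' hG
      have q1 := rect_mark.1 hp.1
      have q2 := rect_mark.1 hp.2
      have q1' := rect_mark.1 hp'.1
      have q2' := rect_mark.1 hp'.2
      constructor
      · rintro (⟨⟨h4, h5⟩, h6, h7, h8⟩ | ⟨⟨h4, h5, h6⟩, h7, h8⟩)
        · rw [exch_ne _ h1.symm h2] at h8
          have hl : l.1 = c := by rw [h6]
          have nc : ¬ CycIco k.1 r.1 c := by rw [← hl]; exact not_cycIco_of_cycIoo ho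
          refine .inr ⟨⟨h6, q1'.1, h8⟩, ⟨q2'.1, fun h => absurd h nc, fun h => absurd h nc⟩,
            fun h => absurd (hl.trans h.symm) q1'.1.col, fun h => absurd (hl.trans h.symm) q1.1.col⟩
        · exact absurd h4 (off_ne h8).1
      · rintro (⟨⟨h4, h5⟩, h6, h7, h8⟩ | ⟨⟨h4, h5, h6⟩, h7, h8⟩)
        · exfalso
          have hk : k.1 = c := by rw [h6]
          rw [exch_ne _ h3.symm h2.symm] at h8
          rw [h8] at hs
          obtain ⟨a, ha⟩ := exists_cycIco_pred c
          have hac : a ≠ c := by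
            rintro rfl
            exact not_cycIco_right (ha l.1 (hk ▸ h4.1.col))
          have hla := ha l.1 (hk ▸ h4.1.col)
          rw [← hk] at hla
          rcases hblock a hac ha with h | h
          · exact h4.1.free _ hla _ (C.cycIco hs).2 h
          · exact h4.1.free _ hla _ (C.cycIco hs).1 h
        · have hl : l.1 = c := by rw [h4]
          rw [h6] at hs
          refine .inl ⟨⟨⟨q1.1, q1.2, fun _ => C.not_cycIco hs⟩, fun _ => by rw [h4]; exact hj,
            fun h => absurd (hl.trans h.symm) q1.1.col⟩, h4, q2.1, ?_⟩
          rw [exch_ne _ h1.symm h2, h6])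
    (by
      rintro l k r h1 h2 h3 ho hs hp hp' hG
      have q1 := rect_mark.1 hp.1
      have q2 := rect_mark.1 hp.2
      have q1' := rect_mark.1 hp'.1
      have q2' := rect_mark.1 hp'.2
      constructor
      · rintro (⟨⟨h4, h5⟩, h6, h7, h8⟩ | ⟨⟨h4, h5, h6⟩, h7, h8⟩)
        · have hl : l.1 = c := by rw [h6]
          have nc : ¬ CycIco k.1 r.1 c := by rw [← hl]; exact not_cycIco_of_cycIoo ho
          rw [exch_right] at h8
          exact .inr ⟨⟨h6, q1'.1, h8⟩, ⟨q2'.1, fun h => absurd h nc, fun h => absurd h nc⟩,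
            fun h => absurd (hl.trans h.symm) q1'.1.col, fun h => absurd (hl.trans h.symm) q2.1.col⟩
        · have hk : k.1 = c := by rw [h4]
          refine .inl ⟨⟨⟨q1'.1, q1'.2, fun h => ?_⟩, fun h => absurd (h.trans hk.symm) q1'.1.col,
            fun _ => by rw [h4]; exact hj⟩, h4, q2'.1, ?_⟩
          · rw [hk] at h
            exact absurd h not_cycIco_right
          · rw [exch_ne _ h3.symm h2.symm, h6]
      · rintro (⟨⟨h4, h5⟩, h6, h7, h8⟩ | ⟨⟨h4, h5, h6⟩, h7, h8⟩)
        · have hk : k.1 = c := by rw [h6]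
          rw [exch_ne _ h3.symm h2.symm] at h8
          rw [h8] at hs
          refine .inr ⟨⟨h6, q1.1, h8⟩, ⟨q2.1, q2.2, fun _ => ?_⟩,
            fun h => absurd (h.trans hk.symm) q1'.1.col, fun h => absurd (hk.trans h.symm) q1.1.col⟩
          rw [exch_ne _ h1 h3, exch_right]
          exact C.not_cycIco hs
        · have hl : l.1 = c := by rw [h4]
          have nc : ¬ CycIco k.1 r.1 c := by rw [← hl]; exact not_cycIco_of_cycIoo ho
          refine .inl ⟨⟨⟨q1.1, q1.2, fun h => absurd h nc⟩,
            fun h => absurd (hl.trans h.symm) q1'.1.col, fun h => absurd (hl.trans h.symm) q2.1.col⟩,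
            h4, q2.1, ?_⟩
          rw [exch_right, h6])
    (by
      rintro l k r h1 h2 h3 ho hs hp hp' hG
      have q1 := rect_mark.1 hp.1
      have q2 := rect_mark.1 hp.2
      have q1' := rect_mark.1 hp'.1
      have q2' := rect_mark.1 hp'.2
      constructor
      · rintro (⟨⟨h4, h5⟩, h6, h7, h8⟩ | ⟨⟨h4, h5, h6⟩, h7, h8⟩)
        · have hl : l.1 = c := by rw [h6]
          have nc : ¬ CycIco k.1 r.1 c := by rw [← hl]; exact not_cycIco_of_cycIoo ho
          rw [exch_ne _ h3.symm h2.symm] at h8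
          refine .inl ⟨⟨⟨q1'.1, q1'.2, fun h => absurd h nc⟩,
            fun h => absurd (hl.trans h.symm) q1.1.col, fun h => absurd (hl.trans h.symm) q2.1.col⟩,
            h6, q2'.1, ?_⟩
          rw [exch_left, h8]
        · exact absurd h4 (off_ne h8).1
      · rintro (⟨⟨h4, h5⟩, h6, h7, h8⟩ | ⟨⟨h4, h5, h6⟩, h7, h8⟩)
        · have hl : l.1 = c := by rw [h6]
          rw [exch_left] at h8
          rw [h8] at hs
          refine .inl ⟨⟨⟨q1.1, q1.2, fun _ => C.not_cycIco hs⟩, fun _ => by rw [h6]; exact hj,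
            fun h => absurd (hl.trans h.symm) q1.1.col⟩, h6, q2.1, ?_⟩
          rw [exch_ne _ h3.symm h2.symm, h8]
        · exact absurd h4 (off_ne h8).2)
    (by
      rintro l k r h1 h2 h3 ho hs hp hp' hG
      have q1 := rect_mark.1 hp.1
      have q2 := rect_mark.1 hp.2
      have q1' := rect_mark.1 hp'.1
      have q2' := rect_mark.1 hp'.2
      constructor
      · rintro (⟨⟨h4, h5⟩, h6, h7, h8⟩ | ⟨⟨h4, h5, h6⟩, h7, h8⟩)
        · exfalso
          have hk : k.1 = c := by rw [h6]
          rw [exch_right] at h8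
          refine h4.2.1 ?_ (by rw [← h8]; exact cycIco_self h4.1.row)
          rw [← hk]
          exact ho.2
        · have hl : l.1 = c := by rw [h4]
          have nc : ¬ CycIco k.1 r.1 c := by rw [← hl]; exact not_cycIco_of_cycIoo ho
          refine .inl ⟨⟨⟨q1'.1, q1'.2, fun h => absurd h nc⟩,
            fun h => absurd (hl.trans h.symm) q2'.1.col, fun h => absurd (hl.trans h.symm) q1.1.col⟩,
            h4, q2'.1, ?_⟩
          rw [exch_left, h6]
      · rintro (⟨⟨h4, h5⟩, h6, h7, h8⟩ | ⟨⟨h4, h5, h6⟩, h7, h8⟩)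
        · have hl : l.1 = c := by rw [h6]
          have nc : ¬ CycIco k.1 r.1 c := by rw [← hl]; exact not_cycIco_of_cycIoo ho
          rw [exch_left] at h8
          exact .inr ⟨⟨h6, q1.1, h8⟩, ⟨q2.1, q2.2, fun h => absurd h nc⟩,
            fun h => absurd (hl.trans h.symm) q2'.1.col, fun h => absurd (hl.trans h.symm) q1.1.col⟩
        · exact absurd h4 (off_ne h8).2)
  have hann : ∀ a b, ¬ Ψ a b a b := by
    rintro a b (⟨⟨h4, h5⟩, h6, h7, h8⟩ | ⟨⟨h4, h5, h6⟩, h7, h8⟩)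
    · rw [exch_right] at h8
      have ha : a.1 = c := by rw [h6]
      refine h4.2.1 (by rw [← ha]; exact cycIco_self h4.1.col) ?_
      rw [← h8]
      exact cycIco_self h4.1.row
    · exact absurd h4 (off_ne h8).1
  simpa [hann] using key

end SignAssignment
end GridCover

namespace GridCover
namespace Sheets

variable {N m : ℕ} {Z : Sheets N m} {ρ : Curve N m → Fin N} {l k r : Curve N m}

theorem Corner.not_cycIco_c {c c' p q : Fin N} (C : Z.Corner c c' p q) {x : Fin N} :
    ¬ CycIco c' x c := by
  have := C.col
  have := x.2
  simp only [cycIco_iff] at *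
  omega

theorem Corner.cycIco_c {c c' p q : Fin N} (C : Z.Corner c c' p q) {x : Fin N} (h : x ≠ c') :
    CycIco x c' c := by
  have := C.col
  have := x.2
  simp only [cycIco_iff, Fin.ext_iff, ne_eq] at *
  omega

theorem Corner.not_cycIco_left {c c' p q : Fin N} (C : Z.Corner c c' p q) {x y : Fin N}
    (h : CycIoo x c' y) : ¬ CycIco x y c := by
  have := C.col
  have := x.2
  have := y.2
  simp only [cycIco_iff, cycIoo_iff] at *
  omega

theorem not_cycIco_start {p x y : Fin N} (h : CycIoo p y x) : ¬ CycIco x y p := by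
  simp only [cycIco_iff, cycIoo_iff] at *
  omega

theorem Corner.not_cycIco_q {c c' p q x : Fin N} (C : Z.Corner c c' p q) (h : p ≠ x) :
    ¬ CycIco p x q := by
  have := C.row
  have := x.2
  simp only [cycIco_iff, Fin.ext_iff, ne_eq] at *
  omega

/-- A rectangle whose lower left corner is on `p` and whose right side is on the lift of `c'` in the
sheet `j`. -/
def Cosector (Z : Sheets N m) (c' p : Fin N) (j : ZMod m) (ρ : Curve N m → Fin N)
    (l r : Curve N m) : Prop :=
  r = (c', j) ∧ Z.Rect ρ l r ∧ ρ l = p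

theorem Cosector.mark {c c' p q : Fin N} (C : Z.Corner c c' p q) {j : ZMod m}
    (h : Z.Cosector c' p j ρ l r) : (Z.mark c q).Rect ρ l r := by
  refine rect_mark.2 ⟨h.2.1, fun _ h2 => ?_⟩
  rw [h.2.2] at h2
  exact C.not_cycIco_q (by rw [← h.2.2]; exact h.2.1.row) h2

/-- A point over `p` which lies, to the left from `c`, behind the column `d`. -/
def Cobad (c c' p d : Fin N) (J : Set (ZMod m)) (ρ : Curve N m → Fin N) : Prop :=
  ∃ b : Curve N m, (b.1 = c' → b.2 ∉ J) ∧ ρ b = p ∧ CycIco b.1 c d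

end Sheets

open Sheets

namespace SignAssignment

variable {N m : ℕ} [NeZero m] (S : SignAssignment (m * N)) {φ : Framing N m}

theorem op_cosector_add {Z : Sheets N m} {c c' p q : Fin N} (C : Z.Corner c c' p q) {d : Fin N}
    (hd : Z.M d p) (hblock : Z.M c' p ∨ Z.M c' q)
    (f : Curve N m ≃ Curve N m) (J : Set (ZMod m)) {j : ZMod m} (hj : j ∉ J)
    (hsep : Z.Separated c' c p J (rows f)) :
    S.op φ (Z.Cosector c' p j)
        (S.op φ (fun ρ l r => Z.Plain c p q ρ l r ∧ Off c' J l r) (Finsupp.single f 1)) +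
      S.op φ (fun ρ l r => Z.Plain c p q ρ l r ∧ Off c' (insert j J) l r)
        (S.op φ (Z.Cosector c' p j) (Finsupp.single f 1)) ∈
      Finsupp.supported ℤ ℤ {g : Curve N m ≃ Curve N m | Cobad c c' p d (insert j J) (rows g)} := by
  classical
  let Ψ : Curve N m → Curve N m → Curve N m → Curve N m → Prop := fun a b a' b' =>
    ((Z.Plain c p q (rows f) a b ∧ Off c' J a b) ∧ Z.Cosector c' p j (exch (rows f) a b) a' b') ∨
    (Z.Cosector c' p j (rows f) a b ∧
      (Z.Plain c p q (exch (rows f) a b) a' b' ∧ Off c' (insert j J) a' b'))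
  have pair : ∀ a b a' b', Ψ a b a' b' → (Z.mark c q).Pair (rows f) a b a' b' := by
    rintro a b a' b' (⟨⟨h1, h2⟩, h3⟩ | ⟨h1, h2, h3⟩)
    · exact ⟨rect_mark.2 ⟨h1.1, h1.2.2⟩, h3.mark C⟩
    · exact ⟨h1.mark C, rect_mark.2 ⟨h2.1, h2.2.2⟩⟩
  have off_ne : ∀ {a b : Curve N m}, Off c' (insert j J) a b → a ≠ (c', j) ∧ b ≠ (c', j) := by
    rintro a b ⟨h1, h2⟩
    refine ⟨?_, ?_⟩ <;> rintro rfl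
    · exact h1 rfl (Set.mem_insert _ _)
    · exact h2 rfl (Set.mem_insert _ _)
  have cols : ∀ {l k r : Curve N m}, CycIoo l.1 r.1 k.1 → l.1 ≠ r.1 ∧ k.1 ≠ r.1 := by
    intro l k r h
    simp only [cycIoo_iff, Fin.ext_iff, ne_eq] at *
    omega
  have key := S.op_op_add_op_op (φ := φ) (Z.mark c q) (C.mark_rowM q) f
    (fun ρ l r => Z.Plain c p q ρ l r ∧ Off c' J l r) (Z.Cosector c' p j) (Z.Cosector c' p j)
    (fun ρ l r => Z.Plain c p q ρ l r ∧ Off c' (insert j J) l r)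
    (fun ρ => ¬ Cobad c c' p d (insert j J) ρ) Ψ (fun _ _ _ _ => Iff.rfl)
    (by
      rintro a b ⟨h1, h2⟩ ⟨rfl, h4, h5⟩
      refine h1.2.1 (C.cycIco_c h4.col) ?_
      have := cycIco_self h4.row
      rwa [h5] at this ⊢)
    pair
    (by
      rintro a b a' b' h1 h2 h3 h4 h5 h6 hp (⟨⟨h7, h8⟩, h9, h10, h11⟩ | ⟨⟨h9, h10, h11⟩, h7, h8⟩)
      · have q1 := rect_mark.1 hp.1
        have q2 := rect_mark.1 hp.2
        rw [exch_ne _ h3.symm h5.symm] at h11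
        refine .inr ⟨⟨h9, q1.1, h11⟩, ⟨q2.1, ?_, q2.2⟩, ?_, ?_⟩
        · have := h7.2.1
          unfold Avoid at this ⊢
          rwa [exch_ne _ h3 h4, exch_ne _ h5 h6]
        · rintro h12 (h13 | h13)
          · exact h4 (h9 ▸ Prod.ext h12 h13)
          · exact h8.1 h12 h13
        · rintro h12 (h13 | h13)
          · exact h6 (h9 ▸ Prod.ext h12 h13)
          · exact h8.2 h12 h13
      · have q1 := rect_mark.1 hp.1
        have q2 := rect_mark.1 hp.2
        refine .inl ⟨⟨⟨q1.1, ?_, q1.2⟩, fun h h' => h8.1 h (.inr h'), fun h h' => h8.2 h (.inr h')⟩,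
          h9, q2.1, by rw [exch_ne _ h3 h4]; exact h11⟩
        have := h7.2.1
        unfold Avoid at this ⊢
        rwa [exch_ne _ h3.symm h5.symm, exch_ne _ h4.symm h6.symm] at this)
    (by
      rintro l k r h1 h2 h3 ho (⟨⟨h4, h5⟩, h6, h7, h8⟩ | ⟨⟨h4, h5, h6⟩, h7, h8⟩) hG he
      · have b2 := h7.base.flat h7.free
        have r2 := h7.row
        have hr : r.1 = c' := by rw [h6]
        rw [exch_ne _ h3.symm h2.symm, ← he] at b2
        rw [h8, exch_ne _ h3.symm h2.symm] at r2
        exact r2.symm (he.symm.trans (hsep k r (fun h => absurd (h.trans hr.symm) h7.col)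
          (fun _ => by rw [h6]; exact hj) h7.col he b2).1)
      · exact (off_ne h8).1 h4)
    (by
      rintro l k r h1 h2 h3 ho (⟨⟨h4, h5⟩, h6, h7, h8⟩ | ⟨⟨h4, h5, h6⟩, h7, h8⟩) hG he
      · rw [exch_ne _ h1 h3] at h8
        have hk : k.1 = c' := by rw [h6]
        refine hG ⟨r, fun h => absurd (hk.trans h.symm) h4.1.col, ?_, ?_⟩
        · rw [exch_ne _ h3.symm h2.symm, exch_right, ← he, h8]
        · have n1 : ¬ CycIco k.1 r.1 d := fun h => h4.1.free _ h p
            (by rw [← h8, he]; exact cycIco_self h4.1.row) hd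
          have n2 : d ≠ c := fun h => C.col_c _ (h ▸ hd)
          have n3 := C.col
          have n4 := h4.1.col
          rw [hk] at n1 n4
          have := d.2
          simp only [cycIco_iff, Fin.ext_iff, ne_eq] at *
          omega
      · have hr : r.1 = c' := by rw [h4]
        have b2 := h7.1.base
        rw [exch_ne _ h1 h3] at b2
        have := (hsep l k (fun h => absurd (h.trans hr.symm) (cols ho).1)
          (fun h => absurd (h.trans hr.symm) (cols ho).2) h7.1.col he b2).2
        rw [hr] at ho
        exact C.not_cycIco_left ho this)
    (by
      rintro l k r h1 h2 h3 ho hs hp hp' hG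
      have q1 := rect_mark.1 hp.1
      have q2 := rect_mark.1 hp.2
      have q1' := rect_mark.1 hp'.1
      have q2' := rect_mark.1 hp'.2
      constructor
      · rintro (⟨⟨h4, h5⟩, h6, h7, h8⟩ | ⟨⟨h4, h5, h6⟩, h7, h8⟩)
        · exfalso
          have hk : k.1 = c' := by rw [h6]
          rw [exch_left] at h8
          refine h4.2.2 ?_ (by rw [h8]; exact C.cycIco_q (by rw [← h8]; exact h4.1.row))
          have := C.cycIco_c (x := l.1) (by rw [← hk]; exact h7.col)
          rw [← hk] at this
          simp only [cycIco_iff, cycIoo_iff] at this ho ⊢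
          omega
        · have hr : r.1 = c' := by rw [h4]
          have nc : ¬ CycIco l.1 k.1 c := C.not_cycIco_left (hr ▸ ho)
          refine .inl ⟨⟨⟨q1'.1, fun h => absurd h nc, q1'.2⟩,
            fun h => absurd (h.trans hr.symm) (cols ho).1,
            fun h => absurd (h.trans hr.symm) (cols ho).2⟩, h4, q2'.1, ?_⟩
          rw [exch_right, h6]
      · rintro (⟨⟨h4, h5⟩, h6, h7, h8⟩ | ⟨⟨h4, h5, h6⟩, h7, h8⟩)
        · have hr : r.1 = c' := by rw [h6]
          have nc : ¬ CycIco l.1 k.1 c := C.not_cycIco_left (hr ▸ ho)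
          rw [exch_right] at h8
          exact .inr ⟨⟨h6, q1.1, h8⟩, ⟨q2.1, fun h => absurd h nc, q2.2⟩,
            fun h => absurd (h.trans hr.symm) (cols ho).1,
            fun h => absurd (h.trans hr.symm) (cols ho).2⟩
        · exact absurd h4 (off_ne h8).1)
    (by
      rintro l k r h1 h2 h3 ho hs hp hp' hG
      have q1 := rect_mark.1 hp.1
      have q2 := rect_mark.1 hp.2
      have q1' := rect_mark.1 hp'.1
      have q2' := rect_mark.1 hp'.2
      constructor
      · rintro (⟨⟨h4, h5⟩, h6, h7, h8⟩ | ⟨⟨h4, h5, h6⟩, h7, h8⟩)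
        · have hr : r.1 = c' := by rw [h6]
          have nc : ¬ CycIco l.1 k.1 c := C.not_cycIco_left (hr ▸ ho)
          rw [exch_ne _ h1 h3] at h8
          refine .inl ⟨⟨⟨q1'.1, fun h => absurd h nc, q1'.2⟩,
            fun h => absurd (h.trans hr.symm) (cols ho).1,
            fun h => absurd (h.trans hr.symm) (cols ho).2⟩, h6, q2'.1, ?_⟩
          rw [exch_right, h8]
        · exact absurd h4 (off_ne h8).2
      · rintro (⟨⟨h4, h5⟩, h6, h7, h8⟩ | ⟨⟨h4, h5, h6⟩, h7, h8⟩)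
        · have hr : r.1 = c' := by rw [h6]
          rw [exch_right] at h8
          rw [h8] at hs
          refine .inl ⟨⟨⟨q1.1, fun _ => not_cycIco_start hs, q1.2⟩,
            fun h => absurd (h.trans hr.symm) (cols ho).2,
            fun _ => by rw [h6]; exact hj⟩, h6, q2.1, ?_⟩
          rw [exch_ne _ h1 h3, h8]
        · exact absurd h4 (off_ne h8).1)
    (by
      rintro l k r h1 h2 h3 ho hs hp hp' hG
      have q1 := rect_mark.1 hp.1
      have q2 := rect_mark.1 hp.2
      have q1' := rect_mark.1 hp'.1
      have q2' := rect_mark.1 hp'.2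
      constructor
      · rintro (⟨⟨h4, h5⟩, h6, h7, h8⟩ | ⟨⟨h4, h5, h6⟩, h7, h8⟩)
        · have hr : r.1 = c' := by rw [h6]
          have nc : ¬ CycIco l.1 k.1 c := C.not_cycIco_left (hr ▸ ho)
          rw [exch_left] at h8
          exact .inr ⟨⟨h6, q1'.1, h8⟩, ⟨q2'.1, fun h => absurd h nc, q2'.2⟩,
            fun h => absurd (h.trans hr.symm) (cols ho).1,
            fun h => absurd (h.trans hr.symm) (cols ho).2⟩
        · have hk : k.1 = c' := by rw [h4]
          refine .inl ⟨⟨⟨q1'.1, fun h => absurd (hk ▸ h) C.not_cycIco_c, q1'.2⟩,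
            fun _ => by rw [h4]; exact hj, fun h => absurd (hk.trans h.symm) (cols ho).2⟩,
            h4, q2'.1, ?_⟩
          rw [exch_ne _ h1 h3, h6]
      · rintro (⟨⟨h4, h5⟩, h6, h7, h8⟩ | ⟨⟨h4, h5, h6⟩, h7, h8⟩)
        · have hk : k.1 = c' := by rw [h6]
          rw [exch_ne _ h1 h3] at h8
          rw [h8] at hs
          refine .inr ⟨⟨h6, q1.1, h8⟩, ⟨q2.1, fun _ => ?_, q2.2⟩,
            fun h => absurd (h.trans hk.symm) q1.1.col, fun h => absurd (hk.trans h.symm) (cols ho).2⟩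
          rw [exch_left, exch_ne _ h3.symm h2.symm]
          exact not_cycIco_start hs
        · have hr : r.1 = c' := by rw [h4]
          have nc : ¬ CycIco l.1 k.1 c := C.not_cycIco_left (hr ▸ ho)
          refine .inl ⟨⟨⟨q1.1, fun h => absurd h nc, q1.2⟩,
            fun h => absurd (h.trans hr.symm) (cols ho).1,
            fun h => absurd (h.trans hr.symm) (cols ho).2⟩, h4, q2.1, ?_⟩
          rw [exch_left, h6])
    (by
      rintro l k r h1 h2 h3 ho hs hp hp' hG
      have q1 := rect_mark.1 hp.1
      have q2 := rect_mark.1 hp.2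
      have q1' := rect_mark.1 hp'.1
      have q2' := rect_mark.1 hp'.2
      constructor
      · rintro (⟨⟨h4, h5⟩, h6, h7, h8⟩ | ⟨⟨h4, h5, h6⟩, h7, h8⟩)
        · have hr : r.1 = c' := by rw [h6]
          have nc : ¬ CycIco l.1 k.1 c := C.not_cycIco_left (hr ▸ ho)
          rw [exch_ne _ h1.symm h2] at h8
          exact .inr ⟨⟨h6, q1'.1, h8⟩, ⟨q2'.1, fun h => absurd h nc, q2'.2⟩,
            fun h => absurd (h.trans hr.symm) (cols ho).1,
            fun h => absurd (h.trans hr.symm) (cols ho).2⟩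
        · exact absurd h4 (off_ne h8).2
      · rintro (⟨⟨h4, h5⟩, h6, h7, h8⟩ | ⟨⟨h4, h5, h6⟩, h7, h8⟩)
        · exfalso
          have hk : k.1 = c' := by rw [h6]
          rw [exch_ne _ h1 h3] at h8
          rw [h8] at hs
          have hkr := cycIco_self h4.1.col
          rw [hk] at hkr
          rcases hblock with h | h
          · exact h4.1.free _ (hk ▸ hkr) _ (C.cycIco hs).2 h
          · exact h4.1.free _ (hk ▸ hkr) _ (C.cycIco hs).1 h
        · have hr : r.1 = c' := by rw [h4]
          rw [h6] at hs
          refine .inl ⟨⟨⟨q1.1, fun _ => not_cycIco_start hs, q1.2⟩,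
            fun h => absurd (h.trans hr.symm) (cols ho).1,
            fun _ => by rw [h4]; exact hj⟩, h4, q2.1, ?_⟩
          rw [exch_ne _ h1.symm h2, h6])
  have hann : ∀ a b, ¬ Ψ a b a b := by
    rintro a b (⟨⟨h4, h5⟩, h6, h7, h8⟩ | ⟨⟨h4, h5, h6⟩, h7, h8⟩)
    · rw [exch_left] at h8
      have hb : b.1 = c' := by rw [h6]
      refine h4.2.2 (by rw [hb]; exact C.cycIco_c (hb ▸ h4.1.col)) ?_
      rw [h8]
      exact C.cycIco_q (by rw [← h8]; exact h4.1.row)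
    · exact absurd h4 (off_ne h8).2
  simpa [hann] using key

end SignAssignment
end GridCover

namespace GridCover
namespace Sheets

variable {N m : ℕ} {Z : Sheets N m} {ρ : Curve N m → Fin N} {l k r : Curve N m}

/-- A rectangle with right side on the lift of `c'` in the sheet `j` and with the line `p` in its
interior. -/
def Puncture (Z : Sheets N m) (c' p : Fin N) (j : ZMod m) (ρ : Curve N m → Fin N)
    (l r : Curve N m) : Prop :=
  r = (c', j) ∧ Z.Rect ρ l r ∧ CycIoo (ρ l) (ρ r) p

theorem plain_iff {c p q : Fin N} :
    Z.Plain c p q ρ l r ↔ ((Z.mark c p).mark c q).Rect ρ l r := by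
  rw [rect_mark, rect_mark, Plain, and_assoc]

theorem Corner.ne {c c' p q : Fin N} (C : Z.Corner c c' p q) : c ≠ c' := by
  obtain ⟨a, ha⟩ := C.rowM p
  have h : a ≠ c := fun h => C.col_c _ (h ▸ ha)
  have := C.col
  have := a.2
  simp only [Fin.ext_iff, ne_eq] at *
  omega

theorem Corner.eq_of_cycIco {c c' p q : Fin N} (C : Z.Corner c c' p q) {x : Fin N}
    (h : CycIco c c' x) : x = c := by
  have := C.col
  have := x.2
  simp only [cycIco_iff, Fin.ext_iff] at *
  omega

theorem Corner.rect_side {c c' p q : Fin N} (C : Z.Corner c c' p q) {j : ZMod m}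
    (h : ρ (c, j) ≠ ρ (c', j)) (hj : Z.Joined (ρ (c, j)) (c, j) (c', j)) :
    Z.Rect ρ (c, j) (c', j) :=
  ⟨C.ne, h, hj, fun _ hx i _ hM => C.col_c i (C.eq_of_cycIco hx ▸ hM),
    fun _ hb => absurd (C.eq_of_cycIco hb.2) hb.1⟩

theorem Corner.not_cycIco_compl {c c' p q x y : Fin N} (C : Z.Corner c c' p q)
    (h : CycIoo x y p) : ¬ CycIco y x p ∧ ¬ CycIco y x q := by
  have := (C.cycIco h).1
  simp only [cycIco_iff, cycIoo_iff] at *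
  omega

end Sheets

open Sheets

namespace SignAssignment

variable {N m : ℕ} [NeZero m] (S : SignAssignment (m * N)) {φ : Framing N m}

theorem op_plain_op_plain {Z : Sheets N m} {c c' p q : Fin N} (C : Z.Corner c c' p q)
    (f : Curve N m ≃ Curve N m) (hsep : Z.Separated c c p ∅ (rows f)) :
    S.op φ (Z.Plain c p q) (S.op φ (Z.Plain c p q) (Finsupp.single f 1)) = 0 := by
  classical
  let Z' := (Z.mark c p).mark c q
  have rowM : ∀ i, ∃ a, Z'.M a i := fun i => (C.mark_rowM p i).imp fun _ h => .inl h
  have key := S.op_op_add_op_op (φ := φ) Z' rowM f (Z.Plain c p q) (Z.Plain c p q)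
    (fun _ _ _ => False) (fun _ _ _ => False) (fun _ => True) (Z'.Pair (rows f))
    (fun a b a' b' => by simp only [plain_iff, Pair, false_and, or_false]; rfl)
    (fun _ _ _ h => h) (fun _ _ _ _ h => h) (fun _ _ _ _ _ _ _ _ _ _ h _ => h)
    (by
      intro l k r h1 h2 h3 ho h hG he
      have f2 := h.2.base.flat h.2.free
      rw [exch_ne _ h3.symm h2.symm, ← he] at f2
      obtain ⟨e1, e2⟩ := hsep k r (fun _ h => h) (fun _ h => h) h.2.col he f2
      have := (plain_iff.2 h.2).2.2 e2
      rw [exch_right, exch_ne _ h3.symm h2.symm, ← he, e1] at this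
      exact this (C.cycIco_q (e1 ▸ h.1.row)))
    (by
      intro l k r h1 h2 h3 ho h hG he
      have f2 := h.2.base
      rw [exch_ne _ h1 h3] at f2
      obtain ⟨e1, e2⟩ := hsep l k (fun _ h => h) (fun _ h => h) h.2.col he f2
      have := (plain_iff.2 h.2).2.1 e2
      have hr := h.2.row
      rw [exch_left, exch_ne _ h1 h3, e1] at this hr
      exact this (cycIco_self hr))
    (fun _ _ _ _ _ _ _ _ h1 h2 _ => ⟨fun _ => h2, fun _ => h1⟩)
    (fun _ _ _ _ _ _ _ _ h1 h2 _ => ⟨fun _ => h2, fun _ => h1⟩)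
    (fun _ _ _ _ _ _ _ _ h1 h2 _ => ⟨fun _ => h2, fun _ => h1⟩)
    (fun _ _ _ _ _ _ _ _ h1 h2 _ => ⟨fun _ => h2, fun _ => h1⟩)
  have hcol : ∀ a, ∃ i, Z'.M a i := by
    intro a
    by_cases h : a = c
    · exact ⟨q, .inr ⟨h, rfl⟩⟩
    · exact (C.colM a h).imp fun _ h => .inl (.inl h)
  have hann : ∀ a b, ¬ Z'.Pair (rows f) a b a b := by
    intro a b h
    obtain ⟨i, hi⟩ := hcol a.1
    have h1 := fun h' => h.1.free _ (cycIco_self h.1.col) i h' hi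
    have h2 := fun h' => h.2.free _ (cycIco_self h.1.col) i h' hi
    rw [exch_left, exch_right] at h2
    have h3 := h.1.row
    replace h1 : ¬ CycIco (rows f a) (rows f b) i := h1
    replace h2 : ¬ CycIco (rows f b) (rows f a) i := h2
    clear key hsep rowM hcol
    simp only [cycIco_iff, Fin.ext_iff, ne_eq] at *
    omega
  have h0 : S.op φ (fun _ _ _ => False) (Finsupp.single f 1) = 0 := by simp [op_single]
  rw [h0, map_zero, add_zero] at key
  simpa [hann] using key

theorem op_puncture_add {Z : Sheets N m} {c c' p q : Fin N} (C : Z.Corner c c' p q)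
    (hc : Z.M c' p) {d : Fin N} (hd : Z.M d q)
    (f : Curve N m ≃ Curve N m) {j : ZMod m}
    (hsep : Z.Separated c c p ∅ (rows f)) (hjoin : ∀ i, Z.Joined i (c, j) (c', j))
    (hl : rows f (c, j) ≠ p) (hr : rows f (c', j) ≠ p) :
    S.op φ (Z.Puncture c' p j) (S.op φ (Z.Plain c p q) (Finsupp.single f 1)) +
      S.op φ (Z.Plain c p q) (S.op φ (Z.Puncture c' p j) (Finsupp.single f 1)) +
      Finsupp.single f 1 ∈
      Finsupp.supported ℤ ℤ {g : Curve N m ≃ Curve N m |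
        ¬ (¬ Bad c c' p d ∅ (rows g) ∧ rows g (c', j) ≠ p)} := by
  classical
  let Ψ : Curve N m → Curve N m → Curve N m → Curve N m → Prop := fun a b a' b' =>
    (Z.Plain c p q (rows f) a b ∧ Z.Puncture c' p j (exch (rows f) a b) a' b') ∨
    (Z.Puncture c' p j (rows f) a b ∧ Z.Plain c p q (exch (rows f) a b) a' b')
  have pair : ∀ a b a' b', Ψ a b a' b' → Z.Pair (rows f) a b a' b' := by
    rintro a b a' b' (⟨h1, h2⟩ | ⟨h1, h2⟩)
    · exact ⟨h1.1, h2.2.1⟩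
    · exact ⟨h1.2.1, h2.1⟩
  have cols : ∀ {l k r : Curve N m}, CycIoo l.1 r.1 k.1 → l.1 ≠ r.1 ∧ k.1 ≠ r.1 := by
    intro l k r h
    simp only [cycIoo_iff, Fin.ext_iff, ne_eq] at *
    omega
  have bad : ∀ {a : Fin N}, a ≠ c' → ¬ CycIco a c' d → CycIco c' a d := by
    intro a h1 h2
    have := d.2
    clear hsep hjoin
    simp only [cycIco_iff, Fin.ext_iff, ne_eq] at *
    omega
  have block : ∀ {ρ : Curve N m → Fin N} {a b : Curve N m}, Z.Rect ρ a b →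
      a.1 = c' → ¬ CycIco (ρ a) (ρ b) p := by
    intro ρ a b h h1 h2
    exact h.free a.1 (cycIco_self h.col) p h2 (h1 ▸ hc)
  have key := S.op_op_add_op_op (φ := φ) Z C.rowM f (Z.Plain c p q) (Z.Puncture c' p j)
    (Z.Puncture c' p j) (Z.Plain c p q)
    (fun ρ => ¬ Bad c c' p d ∅ ρ ∧ ρ (c', j) ≠ p) Ψ (fun _ _ _ _ => Iff.rfl)
    (by
      rintro a b h1 ⟨rfl, h4, h5⟩
      exact h1.2.1 (C.cycIco_c h4.col) (C.cycIco h5).2)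
    pair
    (by
      rintro a b a' b' h1 h2 h3 h4 h5 h6 hp (⟨h7, h8, h9, h10⟩ | ⟨⟨h8, h9, h10⟩, h7⟩)
      · rw [exch_ne _ h3.symm h5.symm, exch_ne _ h4.symm h6.symm] at h10
        refine .inr ⟨⟨h8, hp.1, h10⟩, ⟨hp.2, ?_, ?_⟩⟩
        · have := h7.2.1
          unfold Avoid at this ⊢
          rwa [exch_ne _ h3 h4, exch_ne _ h5 h6]
        · have := h7.2.2
          unfold Avoid at this ⊢
          rwa [exch_ne _ h3 h4, exch_ne _ h5 h6]
      · refine .inl ⟨⟨hp.1, ?_, ?_⟩, h8, hp.2, by rwa [exch_ne _ h3 h4, exch_ne _ h5 h6]⟩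
        · have := h7.2.1
          unfold Avoid at this ⊢
          rwa [exch_ne _ h3.symm h5.symm, exch_ne _ h4.symm h6.symm] at this
        · have := h7.2.2
          unfold Avoid at this ⊢
          rwa [exch_ne _ h3.symm h5.symm, exch_ne _ h4.symm h6.symm] at this)
    (by
      rintro l k r h1 h2 h3 ho (⟨h4, h6, h7, h8⟩ | ⟨⟨h6, h4, h8⟩, h7⟩) hG he
      · have b2 := h7.base.flat h7.free
        rw [exch_ne _ h3.symm h2.symm, ← he] at b2
        rw [exch_right, exch_ne _ h3.symm h2.symm] at h8
        have := (hsep k r (fun _ h => h) (fun _ h => h) h7.col he b2).1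
        rw [← this, he, cycIoo_iff] at h8
        omega
      · have := block h7.1 (by rw [h6])
        rw [exch_right, exch_ne _ h3.symm h2.symm, ← he] at this
        exact this (C.cycIco h8).2)
    (by
      rintro l k r h1 h2 h3 ho (⟨h4, h6, h7, h8⟩ | ⟨⟨h6, h4, h8⟩, h7⟩) hG he
      · have := block h4.1 (by rw [h6])
        rw [exch_ne _ h1 h3, exch_left, he] at h8
        exact this (C.cycIco h8).2
      · have b2 := h7.1.base
        rw [exch_ne _ h1 h3] at b2
        have := (hsep l k (fun _ h => h) (fun _ h => h) h7.1.col he b2).1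
        rw [← he, this] at h8
        exact h8.1 rfl)
    (by
      rintro l k r h1 h2 h3 ho hs hp hp' hG
      have hrow : exch (exch (rows f) l k) k r k = rows f r := by
        rw [exch_left, exch_ne _ h3.symm h2.symm]
      constructor
      · rintro (⟨h4, h6, h7, h8⟩ | ⟨⟨h6, h4, h8⟩, h7⟩)
        · rw [exch_left, exch_ne _ h1.symm h2] at h8
          have hk : k.1 = c' := by rw [h6]
          have : CycIoo (rows f l) (rows f k) p := by
            simp only [cycIoo_iff] at hs h8 ⊢; omega
          exact .inr ⟨⟨h6, hp'.1, this⟩, hp'.2, fun h => absurd (hk ▸ h) C.not_cycIco_c,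
            fun h => absurd (hk ▸ h) C.not_cycIco_c⟩
        · have hr : r.1 = c' := by rw [h6]
          have nc : ¬ CycIco l.1 k.1 c := C.not_cycIco_left (hr ▸ ho)
          refine .inl ⟨⟨hp'.1, fun h => absurd h nc, fun h => absurd h nc⟩, h6, hp'.2, ?_⟩
          rwa [exch_right, exch_ne _ h3.symm h2.symm]
      · rintro (⟨h4, h6, h7, h8⟩ | ⟨⟨h6, h4, h8⟩, h7⟩)
        · have hr : r.1 = c' := by rw [h6]
          have nc : ¬ CycIco l.1 k.1 c := C.not_cycIco_left (hr ▸ ho)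
          rw [exch_right, exch_ne _ h3.symm h2.symm] at h8
          exact .inr ⟨⟨h6, hp.1, h8⟩, hp.2, fun h => absurd h nc, fun h => absurd h nc⟩
        · have hk : k.1 = c' := by rw [h6]
          have n1 := block h7.1 hk
          rw [exch_right, exch_ne _ h3.symm h2.symm] at n1
          have n2 := hG.2
          rw [← h6, hrow] at n2
          have n3 : CycIoo (rows f r) (rows f k) p := by
            simp only [cycIoo_iff, cycIco_iff, Fin.ext_iff, ne_eq] at hs h8 n1 n2 ⊢; omega
          have n4 : ¬ CycIco (rows f l) (rows f r) q := by
            have := (C.cycIco n3).1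
            simp only [cycIoo_iff, cycIco_iff] at hs this ⊢; omega
          refine .inl ⟨⟨hp.1, fun _ => n1, fun _ => n4⟩, h6, hp.2, ?_⟩
          rwa [exch_left, exch_ne _ h1.symm h2])
    (by
      rintro l k r h1 h2 h3 ho hs hp hp' hG
      have hrow : exch (exch (rows f) l k) k r l = rows f k := by
        rw [exch_ne _ h1 h3, exch_left]
      constructor
      · rintro (⟨h4, h6, h7, h8⟩ | ⟨⟨h6, h4, h8⟩, h7⟩)
        · have hr : r.1 = c' := by rw [h6]
          have nc : ¬ CycIco l.1 k.1 c := C.not_cycIco_left (hr ▸ ho)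
          rw [exch_right, exch_ne _ h1 h3] at h8
          refine .inl ⟨⟨hp'.1, fun h => absurd h nc, fun h => absurd h nc⟩, h6, hp'.2, ?_⟩
          rw [exch_right, exch_ne _ h3.symm h2.symm]
          simp only [cycIoo_iff] at hs h8 ⊢; omega
        · have hr : r.1 = c' := by rw [h6]
          have nc : ¬ CycIco l.1 k.1 c := C.not_cycIco_left (hr ▸ ho)
          refine .inl ⟨⟨hp'.1, fun h => absurd h nc, fun h => absurd h nc⟩, h6, hp'.2, ?_⟩
          rw [exch_right, exch_ne _ h3.symm h2.symm]
          simp only [cycIoo_iff] at hs h8 ⊢; omega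
      · rintro (⟨h4, h6, h7, h8⟩ | ⟨⟨h6, h4, h8⟩, h7⟩)
        · have hr : r.1 = c' := by rw [h6]
          rw [exch_right, exch_ne _ h3.symm h2.symm] at h8
          have hkp : rows f k ≠ p := by
            intro h
            refine hG.1 ⟨l, fun _ h => h, by rw [hrow, h], bad (hr ▸ (cols ho).1) fun h' => ?_⟩
            have h'' : CycIco l.1 k.1 d ∨ CycIco k.1 r.1 d := by
              rw [← hr] at h'
              simp only [cycIco_iff, cycIoo_iff] at h' ho ⊢; omega
            have hq := (C.cycIco h8).1
            rcases h'' with h'' | h''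
            · exact h4.1.free _ h'' q (by rw [h]; exact C.cycIco_q (h ▸ h4.1.row)) hd
            · refine h7.free _ h'' q ?_ hd
              rwa [exch_right, exch_ne _ h3.symm h2.symm]
          have h9 : CycIoo (rows f l) (rows f k) p ∨ CycIoo (rows f k) (rows f r) p := by
            simp only [cycIoo_iff, Fin.ext_iff, ne_eq] at hs h8 hkp ⊢; omega
          rcases h9 with h9 | h9
          · have n := (C.cycIco h9)
            refine .inl ⟨⟨hp.1, fun _ => ?_, fun _ => ?_⟩, h6, hp.2, ?_⟩
            · simp only [cycIoo_iff, cycIco_iff] at hs n ⊢; omega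
            · simp only [cycIoo_iff, cycIco_iff] at hs n ⊢; omega
            · rwa [exch_right, exch_ne _ h1 h3]
          · have n := (C.cycIco h9)
            refine .inr ⟨⟨h6, hp.1, h9⟩, hp.2, fun _ => ?_, fun _ => ?_⟩ <;>
              rw [exch_right, exch_ne _ h1 h3] <;>
              simp only [cycIoo_iff, cycIco_iff] at hs n ⊢ <;> omega
        · have hk : k.1 = c' := by rw [h6]
          have n1 := block h7.1 hk
          rw [exch_right, exch_ne _ h3.symm h2.symm] at n1
          refine absurd ?_ n1
          have := (C.cycIco h8).2
          simp only [cycIoo_iff, cycIco_iff] at hs this ⊢; omega)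
    (by
      rintro l k r h1 h2 h3 ho hs hp hp' hG
      constructor
      · rintro (⟨h4, h6, h7, h8⟩ | ⟨⟨h6, h4, h8⟩, h7⟩)
        · have hr : r.1 = c' := by rw [h6]
          have nc : ¬ CycIco l.1 k.1 c := C.not_cycIco_left (hr ▸ ho)
          rw [exch_left, exch_ne _ h3.symm h2.symm] at h8
          exact .inr ⟨⟨h6, hp'.1, h8⟩, hp'.2, fun h => absurd h nc, fun h => absurd h nc⟩
        · have hk : k.1 = c' := by rw [h6]
          refine .inl ⟨⟨hp'.1, fun h => absurd (hk ▸ h) C.not_cycIco_c,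
            fun h => absurd (hk ▸ h) C.not_cycIco_c⟩, h6, hp'.2, ?_⟩
          rw [exch_left, exch_ne _ h1 h3]
          simp only [cycIoo_iff] at hs h8 ⊢; omega
      · rintro (⟨h4, h6, h7, h8⟩ | ⟨⟨h6, h4, h8⟩, h7⟩)
        · have hk : k.1 = c' := by rw [h6]
          have n1 := block h4.1 hk
          rw [exch_left, exch_ne _ h1 h3] at h8
          have n3 : CycIoo (rows f l) (rows f k) p := by
            simp only [cycIoo_iff, cycIco_iff] at hs h8 n1 ⊢; omega
          have n4 : ¬ CycIco (rows f k) (rows f r) q := by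
            have := (C.cycIco n3).1
            simp only [cycIoo_iff, cycIco_iff] at hs this ⊢; omega
          refine .inr ⟨⟨h6, hp.1, n3⟩, hp.2, fun _ => ?_, fun _ => ?_⟩ <;>
            rwa [exch_left, exch_ne _ h3.symm h2.symm]
        · have hr : r.1 = c' := by rw [h6]
          have nc : ¬ CycIco l.1 k.1 c := C.not_cycIco_left (hr ▸ ho)
          refine .inl ⟨⟨hp.1, fun h => absurd h nc, fun h => absurd h nc⟩, h6, hp.2, ?_⟩
          rwa [exch_left, exch_ne _ h3.symm h2.symm])
    (by
      rintro l k r h1 h2 h3 ho hs hp hp' hG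
      have hrow : exch (exch (rows f) k r) l k k = rows f l := by
        rw [exch_right, exch_ne _ h1 h3]
      constructor
      · rintro (⟨h4, h6, h7, h8⟩ | ⟨⟨h6, h4, h8⟩, h7⟩)
        · have hr : r.1 = c' := by rw [h6]
          have nc : ¬ CycIco l.1 k.1 c := C.not_cycIco_left (hr ▸ ho)
          rw [exch_right, exch_ne _ h1.symm h2] at h8
          refine .inr ⟨⟨h6, hp'.1, ?_⟩, hp'.2, fun h => absurd h nc, fun h => absurd h nc⟩
          simp only [cycIoo_iff] at hs h8 ⊢; omega
        · have hr : r.1 = c' := by rw [h6]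
          have nc : ¬ CycIco l.1 k.1 c := C.not_cycIco_left (hr ▸ ho)
          refine .inr ⟨⟨h6, hp'.1, ?_⟩, hp'.2, fun h => absurd h nc, fun h => absurd h nc⟩
          simp only [cycIoo_iff] at hs h8 ⊢; omega
      · rintro (⟨h4, h6, h7, h8⟩ | ⟨⟨h6, h4, h8⟩, h7⟩)
        · have hk : k.1 = c' := by rw [h6]
          have n1 := block h4.1 hk
          rw [exch_left, exch_ne _ h1 h3] at h8
          refine absurd ?_ n1
          have := (C.cycIco h8).2
          simp only [cycIoo_iff, cycIco_iff] at hs this ⊢; omega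
        · have hr : r.1 = c' := by rw [h6]
          have hlp : rows f l ≠ p := by
            intro h
            refine hG.1 ⟨k, fun _ h => h, by rw [hrow, h], bad (hr ▸ (cols ho).2) fun h' => ?_⟩
            exact h4.free _ (hr ▸ h') q (C.cycIco h8).1 hd
          have h9 : CycIoo (rows f k) (rows f l) p ∨ CycIoo (rows f l) (rows f r) p := by
            simp only [cycIoo_iff, Fin.ext_iff, ne_eq] at hs h8 hlp ⊢; omega
          rcases h9 with h9 | h9
          · have n := (C.cycIco h9)
            refine .inl ⟨⟨hp.1, fun _ => ?_, fun _ => ?_⟩, h6, hp.2, ?_⟩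
            · simp only [cycIoo_iff, cycIco_iff] at hs n ⊢; omega
            · simp only [cycIoo_iff, cycIco_iff] at hs n ⊢; omega
            · rwa [exch_right, exch_ne _ h1.symm h2]
          · have n := (C.cycIco h9)
            refine .inr ⟨⟨h6, hp.1, h9⟩, hp.2, fun _ => ?_, fun _ => ?_⟩ <;>
              rw [exch_right, exch_ne _ h1.symm h2] <;>
              simp only [cycIoo_iff, cycIco_iff] at hs n ⊢ <;> omega)
  have hann : ∀ a b, Ψ a b a b ↔ b = (c', j) ∧ a = (c, j) := by
    intro a b
    constructor
    · intro h
      have hp := pair _ _ _ _ h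
      have hb : b = (c', j) := by
        rcases h with ⟨_, h, _⟩ | ⟨⟨h, _⟩, _⟩ <;> exact h
      refine ⟨hb, ?_⟩
      have ha : a.1 = c := by
        by_contra ha
        obtain ⟨i, hi⟩ := C.colM _ ha
        have h1 : ¬ CycIco (rows f a) (rows f b) i :=
          fun h' => hp.1.free _ (cycIco_self hp.1.col) i h' hi
        have h2 := fun h' => hp.2.free _ (cycIco_self hp.1.col) i h' hi
        rw [exch_left, exch_right] at h2
        replace h2 : ¬ CycIco (rows f b) (rows f a) i := h2
        have h3 := hp.1.row
        simp only [cycIco_iff, Fin.ext_iff, ne_eq] at h1 h2 h3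
        omega
      have h1 := hp.1.base
      rw [hb] at h1
      exact h1.unique_left (hjoin _) ha
    · rintro ⟨rfl, rfl⟩
      have hne : rows f (c, j) ≠ rows f (c', j) := fun h =>
        hl (hsep _ _ (fun _ h => h) (fun _ h => h) C.ne h (hjoin _)).1
      have R1 := C.rect_side hne (hjoin _)
      have R2 := C.rect_side (ρ := exch (rows f) (c, j) (c', j))
        (by rw [exch_left, exch_right]; exact hne.symm) (hjoin _)
      rcases cycIoo_trichotomy hl hne with h | h | h
      · have n := C.not_cycIco_compl (x := rows f (c', j)) (y := rows f (c, j)) (by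
          simp only [cycIoo_iff] at h ⊢; omega)
        refine .inl ⟨⟨R1, fun _ => n.1, fun _ => n.2⟩, rfl, R2, ?_⟩
        rw [exch_left, exch_right]
        simp only [cycIoo_iff] at h ⊢; omega
      · have n := C.not_cycIco_compl h
        refine .inr ⟨⟨rfl, R1, h⟩, R2, fun _ => ?_, fun _ => ?_⟩ <;>
          rw [exch_left, exch_right]
        exacts [n.1, n.2]
      · exact absurd h.symm hr
  simp only [hann, and_assoc] at key
  by_cases hG : ¬ Bad c c' p d ∅ (rows f) ∧ rows f (c', j) ≠ p
  · convert key using 2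
    rw [Finset.sum_eq_single (c, j), Finset.sum_eq_single (c', j)]
    · rw [if_pos ⟨rfl, rfl, hG⟩]
    · intro b _ hb
      rw [if_neg fun h => hb h.1]
    · simp
    · intro a _ ha
      exact Finset.sum_eq_zero fun b _ => if_neg fun h => ha h.2.1
    · simp
  · refine Submodule.add_mem _ ?_ (Finsupp.single_mem_supported ℤ _ hG)
    have h0 : ∑ a : Curve N m, ∑ b : Curve N m, (if b = (c', j) ∧ a = (c, j) ∧
        ¬ Bad c c' p d ∅ (rows f) ∧ rows f (c', j) ≠ p then Finsupp.single f (1 : ℤ) else 0) = 0 :=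
      Finset.sum_eq_zero fun a _ => Finset.sum_eq_zero fun b _ => if_neg fun h => hG h.2.2
    rwa [h0, add_zero] at key

end SignAssignment
end GridCover

namespace GridCover

namespace Grid

variable {n : ℕ} (G : Grid n)

theorem sum_crossing (i : Fin n) : ∑ c, G.crossing c i = 0 := by
  have h : ∀ c, G.crossing c i = (if i ≤ G.X c then 1 else 0) - (if i ≤ G.O c then 1 else 0) := by
    intro c
    unfold crossing
    simp only [Fin.le_def, Fin.lt_def]
    split_ifs <;> first | rfl | omega
  simp only [h, Finset.sum_sub_distrib]
  rw [Equiv.sum_comp G.X (fun r => if i ≤ r then (1 : ℤ) else 0),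
    Equiv.sum_comp G.O (fun r => if i ≤ r then (1 : ℤ) else 0), sub_self]

open Classical in
theorem sheetShift_sub (i a b : Fin n) : G.sheetShift i b - G.sheetShift i a =
    ∑ c, if CycIco a b c then G.crossing c i else 0 := by
  unfold sheetShift
  rcases le_or_gt a b with h | h
  · rw [← Finset.sum_sub_distrib]
    refine Finset.sum_congr rfl fun c _ => ?_
    have h' := Fin.le_def.1 h
    simp only [cycIco_iff, Fin.lt_def]
    split_ifs <;> omega
  · rw [← add_zero (_ - _), ← G.sum_crossing i, ← Finset.sum_sub_distrib, ← Finset.sum_add_distrib]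
    refine Finset.sum_congr rfl fun c _ => ?_
    have h' := Fin.lt_def.1 h
    simp only [cycIco_iff, Fin.lt_def]
    split_ifs <;> omega

open Classical in
theorem alphaThrough_eq_iff {m : ℕ} (i : Fin n) (a b : Curve n m) :
    G.alphaThrough i a = G.alphaThrough i b ↔
      b.2 = a.2 + ((∑ c, if CycIco a.1 b.1 c then G.crossing c i else 0 : ℤ) : ZMod m) := by
  rw [← sheetShift_sub, alphaThrough, alphaThrough, Prod.ext_iff]
  push_cast
  simp only [true_and]
  constructor
  · intro h
    linear_combination -h
  · intro h
    linear_combination -h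

theorem crossing_eq {x i i' : Fin n} (hX : ¬ CycIco i i' (G.X x)) (hO : ¬ CycIco i i' (G.O x)) :
    G.crossing x i = G.crossing x i' := by
  have h1 := (G.X x).2
  have h2 := (G.O x).2
  unfold crossing
  simp only [cycIco_iff, Fin.le_def, Fin.lt_def] at *
  split_ifs <;> first | rfl | omega

end Grid

open Sheets

namespace Stabilization

variable {n : ℕ} (T : Stabilization n)

open Classical in
/-- The sheets of the cover of `H`, cut along the segments in the columns other than `c₀`. -/
noncomputable def sheets (m : ℕ) : Sheets (n + 1) m where
  disp i a b := ((∑ x, if CycIco a b x ∧ x ≠ T.c₀ then T.H.crossing x i else 0 : ℤ) : ZMod m)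
  M x i := x ≠ T.c₀ ∧ (T.H.X x = i ∨ T.H.O x = i)
  disp_add i a b d h := by
    rw [← Int.cast_add, ← Finset.sum_add_distrib]
    congr 1
    refine Finset.sum_congr rfl fun x _ => ?_
    have h1 : CycIco a d x ↔ CycIco a b x ∨ CycIco b d x := by
      simp only [cycIco_iff, cycIoo_iff] at *; omega
    have h2 : ¬ (CycIco a b x ∧ CycIco b d x) := by
      simp only [cycIco_iff, cycIoo_iff] at *; omega
    by_cases h3 : CycIco a b x <;> by_cases h4 : CycIco b d x <;> by_cases h5 : x = T.c₀ <;>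
      simp [h1, h3, h4, h5]; exact absurd ⟨h3, h4⟩ h2
  flat i i' a b h := by
    congr 1
    refine Finset.sum_congr rfl fun x _ => ?_
    split_ifs with hx
    · exact T.H.crossing_eq (fun h' => h x hx.1 _ h' ⟨hx.2, .inl rfl⟩)
        (fun h' => h x hx.1 _ h' ⟨hx.2, .inr rfl⟩)
    · rfl

theorem crossing_c₀ (i : Fin (n + 1)) : T.H.crossing T.c₀ i = if i = T.p then -1 else 0 := by
  unfold Grid.crossing p
  rw [T.X_new, T.O_new]
  simp only [Fin.lt_def, Fin.le_def, Fin.ext_iff, Fin.val_succ, Fin.val_castSucc]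
  split_ifs <;> first | rfl | omega

variable {m : ℕ}

open Classical in
theorem alphaThrough_eq_iff_joined {i : Fin (n + 1)} {a b : Curve (n + 1) m}
    (h : ¬ (i = T.p ∧ CycIco a.1 b.1 T.c₀)) :
    T.H.alphaThrough i a = T.H.alphaThrough i b ↔ (T.sheets m).Joined i a b := by
  rw [Grid.alphaThrough_eq_iff, Sheets.Joined, sheets]
  have : ∀ x, (if CycIco a.1 b.1 x then T.H.crossing x i else 0) =
      if CycIco a.1 b.1 x ∧ x ≠ T.c₀ then T.H.crossing x i else 0 := by
    intro x
    by_cases hx : x = T.c₀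
    · subst hx
      rw [T.crossing_c₀]
      by_cases hi : i = T.p
      · rw [if_neg fun h' => h ⟨hi, h'⟩, if_neg fun h' => h'.2 rfl]
      · simp [hi]
    · simp [hx]
  simp only [this]

theorem corner : (T.sheets m).Corner T.c₀ (T.c₀ + 1) T.p T.q.castSucc where
  col := by
    rw [Fin.val_add_one]
    have := T.c₀.2
    split_ifs with h
    · right; simp [h]
    · left; rfl
  row := by left; simp [p]
  rowM i := by
    by_cases h : T.H.X.symm i = T.c₀
    · refine ⟨T.H.O.symm i, fun h' => ?_, .inr (by simp)⟩
      rw [Equiv.symm_apply_eq, T.X_new] at h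
      rw [Equiv.symm_apply_eq, T.O_new, h, Fin.ext_iff] at h'
      simp at h'
    · exact ⟨_, h, .inl (by simp)⟩
  colM a ha := ⟨_, ha, .inl rfl⟩
  col_c i h := h.1 rfl

theorem joined_left_right (i : Fin (n + 1)) (k : ZMod m) :
    (T.sheets m).Joined i (T.left k) (T.right k) := by
  classical
  have h : (∑ x, if CycIco T.c₀ (T.c₀ + 1) x ∧ x ≠ T.c₀ then T.H.crossing x i else 0) = 0 :=
    Finset.sum_eq_zero fun x _ => if_neg fun hx => hx.2 ((T.corner (m := m)).eq_of_cycIco hx.1)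
  change k = k + ((∑ x, if CycIco T.c₀ (T.c₀ + 1) x ∧ x ≠ T.c₀ then T.H.crossing x i else 0 : ℤ) :
    ZMod m)
  simp [h]

theorem alphaThrough_p_right (k : ZMod m) :
    T.H.alphaThrough T.p (T.right k) = T.H.alphaThrough T.p (T.left (k + 1)) := by
  classical
  symm
  rw [Grid.alphaThrough_eq_iff]
  have h : ∀ x, (if CycIco (T.left (k + 1)).1 (T.right k).1 x then T.H.crossing x T.p else 0) =
      if x = T.c₀ then -1 else 0 := by
    intro x
    by_cases hx : x = T.c₀
    · subst hx
      change (if CycIco T.c₀ (T.c₀ + 1) T.c₀ then _ else _) = _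
      rw [T.crossing_c₀, if_pos (cycIco_self (T.corner (m := m)).ne), if_pos rfl, if_pos rfl]
    · rw [if_neg, if_neg hx]
      exact fun h => hx ((T.corner (m := m)).eq_of_cycIco h)
  simp only [h]
  simp [left, right]

/-- The label of each component of a state is determined by its position, where the points on the
lifts of `s` in the sheets of `J` are on the lifts `e j` of the line `p`. -/
def Labelled (s : Fin (n + 1)) (e : ZMod m → Curve (n + 1) m) (J : Set (ZMod m))
    (f : Curve (n + 1) m ≃ Curve (n + 1) m) : Prop :=
  ∀ b, (b.1 = s → b.2 ∈ J → f b = e b.2) ∧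
    ((b.1 = s → b.2 ∉ J) → f b = T.H.alphaThrough (f b).1 b)

theorem Labelled.separated {T : Stabilization n} {s : Fin (n + 1)} {e : ZMod m → Curve (n + 1) m}
    {J : Set (ZMod m)} {f : Curve (n + 1) m ≃ Curve (n + 1) m} (h : T.Labelled s e J f) :
    (T.sheets m).Separated s T.c₀ T.p J (rows f) := by
  intro a b ha hb hab he hj
  by_contra h'
  have h1 := (T.alphaThrough_eq_iff_joined h').2 hj
  have h2 := (h a).2 ha
  have h3 := (h b).2 hb
  unfold rows at h1 he
  have h4 : f a = f b := by
    rw [h2, h1, h3, he]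
  exact hab (congrArg _ (f.injective h4))

/-- Exchanging two points with joined labels preserves labels. -/
theorem Labelled.exchange {T : Stabilization n} {s : Fin (n + 1)} {e : ZMod m → Curve (n + 1) m}
    {J : Set (ZMod m)} {f : Curve (n + 1) m ≃ Curve (n + 1) m} (h : T.Labelled s e J f)
    {l r : Curve (n + 1) m} (ho : Off s J l r) 
    (hl : T.H.alphaThrough (rows f l) l = T.H.alphaThrough (rows f l) r)
    (hr : T.H.alphaThrough (rows f r) l = T.H.alphaThrough (rows f r) r) :
    T.Labelled s e J ((Equiv.swap l r).trans f) := by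
  intro b
  have h1 := (h l).2 ho.1
  have h2 := (h r).2 ho.2
  by_cases hbl : b = l
  · subst hbl
    refine ⟨fun h3 h4 => absurd h4 (ho.1 h3), fun _ => ?_⟩
    rw [Equiv.trans_apply, Equiv.swap_apply_left]
    exact h2.trans hr.symm
  by_cases hbr : b = r
  · subst hbr
    refine ⟨fun h3 h4 => absurd h4 (ho.2 h3), fun _ => ?_⟩
    rw [Equiv.trans_apply, Equiv.swap_apply_right]
    exact h1.trans hl
  rw [Equiv.trans_apply, Equiv.swap_apply_of_ne_of_ne hbl hbr]
  exact h b

theorem Labelled.plain {T : Stabilization n} {s : Fin (n + 1)} {e : ZMod m → Curve (n + 1) m}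
    {J : Set (ZMod m)} {f : Curve (n + 1) m ≃ Curve (n + 1) m} (h : T.Labelled s e J f)
    {l r : Curve (n + 1) m} (ho : Off s J l r)
    (hP : (T.sheets m).Plain T.c₀ T.p T.q.castSucc (rows f) l r) :
    T.Labelled s e J ((Equiv.swap l r).trans f) := by
  have C := T.corner (m := m)
  refine h.exchange ho ((T.alphaThrough_eq_iff_joined ?_).2 hP.1.base)
    ((T.alphaThrough_eq_iff_joined ?_).2 (hP.1.base.flat hP.1.free))
  · rintro ⟨h1, h2⟩
    exact hP.2.1 h2 (h1 ▸ cycIco_self hP.1.row)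
  · rintro ⟨h1, h2⟩
    exact hP.2.2 h2 (h1 ▸ C.cycIco_q (h1 ▸ hP.1.row))

/-- The labels after the sectors of the sheets in `J` have been used. -/
abbrev SectorLabelled (J : Set (ZMod m)) (f : Curve (n + 1) m ≃ Curve (n + 1) m) : Prop :=
  T.Labelled T.c₀ (fun j => T.H.alphaThrough T.p (T.right j)) J f

/-- The labels after the cosectors of the sheets in `J` have been used. -/
abbrev CosectorLabelled (J : Set (ZMod m)) (f : Curve (n + 1) m ≃ Curve (n + 1) m) : Prop :=
  T.Labelled (T.c₀ + 1) (fun j => T.H.alphaThrough T.p (T.left j)) J f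

/-- The upper edge of a sector lies on the lift of the line `p` through the next point over
`α_p ∩ β_{c₀}`. -/
theorem alphaThrough_of_sector {T : Stabilization n} {ρ : Curve (n + 1) m → Fin (n + 1)}
    {j : ZMod m} {l r : Curve (n + 1) m} (hS : (T.sheets m).Sector T.c₀ T.p j ρ l r) :
    T.H.alphaThrough T.p r = T.H.alphaThrough T.p (T.right j) := by
  have C := T.corner (m := m)
  obtain ⟨rfl, hR, hp⟩ := hS
  by_cases hr : r.1 = T.c₀ + 1
  · rw [(hR.base.unique (T.joined_left_right _ j) hr : r = T.right j)]
  · symm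
    rw [T.alphaThrough_eq_iff_joined fun h' => C.not_cycIco_c h'.2, ← hp]
    refine Sheets.Joined.cancel_left (T.joined_left_right _ j) (hR.base.flat hR.free) ?_
    have := C.col
    have := hR.col
    have := r.1.2
    simp only [left, right, cycIoo_iff, Fin.ext_iff, ne_eq] at *
    omega

theorem SectorLabelled.sector {T : Stabilization n} {J : Set (ZMod m)}
    {f : Curve (n + 1) m ≃ Curve (n + 1) m} (h : T.SectorLabelled J f) {j : ZMod m} (hj : j ∉ J)
    {l r : Curve (n + 1) m} (hS : (T.sheets m).Sector T.c₀ T.p j (rows f) l r) :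
    T.SectorLabelled (insert j J) ((Equiv.swap l r).trans f) := by
  have h3 := alphaThrough_of_sector hS
  obtain ⟨rfl, hR, hp⟩ := hS
  have h1 := (h (T.c₀, j)).2 fun _ => hj
  have h2 := (h r).2 fun h' => absurd h'.symm hR.col
  have h4 : T.H.alphaThrough (rows f (T.c₀, j)) (T.c₀, j) =
      T.H.alphaThrough (rows f (T.c₀, j)) r :=
    (T.alphaThrough_eq_iff_joined fun h' => hR.row (h'.1.trans hp.symm)).2 hR.base
  intro b
  by_cases hbl : b = (T.c₀, j)
  · subst hbl
    refine ⟨fun _ _ => ?_, fun h' => absurd (Set.mem_insert _ _) (h' rfl)⟩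
    rw [Equiv.trans_apply, Equiv.swap_apply_left, h2]
    unfold rows at hp
    rw [hp, h3]
  by_cases hbr : b = r
  · subst hbr
    refine ⟨fun h' _ => absurd h'.symm hR.col, fun _ => ?_⟩
    rw [Equiv.trans_apply, Equiv.swap_apply_right]
    exact h1.trans h4
  rw [Equiv.trans_apply, Equiv.swap_apply_of_ne_of_ne hbl hbr]
  refine ⟨fun h5 h6 => (h b).1 h5 (h6.resolve_left fun h7 => hbl (Prod.ext h5 h7)),
    fun h5 => (h b).2 fun h6 h7 => h5 h6 (.inr h7)⟩

theorem CosectorLabelled.cosector {T : Stabilization n} {J : Set (ZMod m)}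
    {f : Curve (n + 1) m ≃ Curve (n + 1) m} (h : T.CosectorLabelled J f) {j : ZMod m} (hj : j ∉ J)
    {l r : Curve (n + 1) m} (hS : (T.sheets m).Cosector (T.c₀ + 1) T.p j (rows f) l r) :
    T.CosectorLabelled (insert j J) ((Equiv.swap l r).trans f) := by
  have C := T.corner (m := m)
  obtain ⟨rfl, hR, hp⟩ := hS
  have h1 := (h (T.c₀ + 1, j)).2 fun _ => hj
  have h2 := (h l).2 fun h' => absurd h' hR.col
  have h3 : T.H.alphaThrough T.p l = T.H.alphaThrough T.p (T.left j) := by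
    by_cases hl : l.1 = T.c₀
    · rw [(hR.base.unique_left (T.joined_left_right _ j) hl : l = T.left j)]
    · rw [T.alphaThrough_eq_iff_joined fun h' => not_cycIco_right h'.2, ← hp]
      refine Sheets.Joined.cancel_right hR.base (T.joined_left_right _ j) ?_
      have := C.col
      have := hR.col
      have := l.1.2
      simp only [left, cycIoo_iff, Fin.ext_iff, ne_eq] at *
      omega
  have h4 : T.H.alphaThrough (rows f (T.c₀ + 1, j)) l =
      T.H.alphaThrough (rows f (T.c₀ + 1, j)) (T.c₀ + 1, j) :=
    (T.alphaThrough_eq_iff_joined fun h' => hR.row (hp.trans h'.1.symm)).2 (hR.base.flat hR.free)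
  intro b
  by_cases hbr : b = (T.c₀ + 1, j)
  · subst hbr
    refine ⟨fun _ _ => ?_, fun h' => absurd (Set.mem_insert _ _) (h' rfl)⟩
    rw [Equiv.trans_apply, Equiv.swap_apply_right, h2]
    unfold rows at hp
    rw [hp, h3]
  by_cases hbl : b = l
  · subst hbl
    refine ⟨fun h' _ => absurd h' hR.col, fun _ => ?_⟩
    rw [Equiv.trans_apply, Equiv.swap_apply_left]
    exact h1.trans h4.symm
  rw [Equiv.trans_apply, Equiv.swap_apply_of_ne_of_ne hbl hbr]
  refine ⟨fun h5 h6 => (h b).1 h5 (h6.resolve_left fun h7 => hbr (Prod.ext h5 h7)),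
    fun h5 => (h b).2 fun h6 h7 => h5 h6 (.inr h7)⟩

end Stabilization
end GridCover

namespace GridCover

open Sheets

namespace SignAssignment

variable {N m : ℕ} (S : SignAssignment (m * N)) {φ : Framing N m}

/-- The states whose pairing belongs to `A`. -/
abbrev span (A : Set (Curve N m ≃ Curve N m)) : Submodule ℤ (States N m) :=
  Finsupp.supported ℤ ℤ A

theorem span_induction {V : Type*} [AddCommGroup V] {A : Set (Curve N m ≃ Curve N m)}
    (F : States N m →ₗ[ℤ] V) (W : Submodule ℤ V) (h : ∀ f ∈ A, F (Finsupp.single f 1) ∈ W)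
    {x : States N m} (hx : x ∈ span A) : F x ∈ W := by
  have : span A ≤ W.comap F := by
    rw [span, Finsupp.supported_eq_span_single, Submodule.span_le]
    rintro _ ⟨f, hf, rfl⟩
    exact h f hf
  exact this hx

theorem span_eq {V : Type*} [AddCommGroup V] {A : Set (Curve N m ≃ Curve N m)}
    (F F' : States N m →ₗ[ℤ] V) (h : ∀ f ∈ A, F (Finsupp.single f 1) = F' (Finsupp.single f 1))
    {x : States N m} (hx : x ∈ span A) : F x = F' x := by
  have := span_induction (F - F') ⊥ (fun f hf => by simp [h f hf]) hx
  rwa [Submodule.mem_bot, LinearMap.sub_apply, sub_eq_zero] at this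

theorem hom_ext {F F' : States N m →ₗ[ℤ] States N m}
    (h : ∀ f, F (Finsupp.single f 1) = F' (Finsupp.single f 1)) : F = F' :=
  Finsupp.lhom_ext' fun f => LinearMap.ext_ring (h f)

variable [NeZero m]

variable (φ) in
theorem op_mem {P : (Curve N m → Fin N) → Curve N m → Curve N m → Prop}
    {A B : Set (Curve N m ≃ Curve N m)}
    (h : ∀ f ∈ A, ∀ l r, P (rows f) l r → (Equiv.swap l r).trans f ∈ B) {x : States N m}
    (hx : x ∈ span A) : S.op φ P x ∈ span B := by
  refine span_induction (S.op φ P) _ (fun f hf => ?_) hx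
  classical
  rw [op_single]
  refine Submodule.sum_mem _ fun l _ => Submodule.sum_mem _ fun r _ => ?_
  split_ifs with h1
  · rw [exchange_single]
    exact Submodule.smul_mem _ _ (Finsupp.single_mem_supported ℤ _ (h f hf l r h1))
  · exact Submodule.zero_mem _

theorem op_congr {P Q : (Curve N m → Fin N) → Curve N m → Curve N m → Prop}
    {f : Curve N m ≃ Curve N m} (h : ∀ l r, P (rows f) l r ↔ Q (rows f) l r) :
    S.op φ P (Finsupp.single f 1) = S.op φ Q (Finsupp.single f 1) := by
  classical
  simp only [op_single, h]

theorem op_eq_zero {P : (Curve N m → Fin N) → Curve N m → Curve N m → Prop}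
    {f : Curve N m ≃ Curve N m} (h : ∀ l r, ¬ P (rows f) l r) :
    S.op φ P (Finsupp.single f 1) = 0 := by
  classical
  simp [op_single, h]

theorem op_unique {P : (Curve N m → Fin N) → Curve N m → Curve N m → Prop}
    {f : Curve N m ≃ Curve N m} {a b : Curve N m} (h : ∀ l r, P (rows f) l r ↔ l = a ∧ r = b) :
    S.op φ P (Finsupp.single f 1) = S.exchange φ a b (Finsupp.single f 1) := by
  classical
  rw [op_single, Finset.sum_eq_single a, Finset.sum_eq_single b]
  · rw [if_pos ((h _ _).2 ⟨rfl, rfl⟩)]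
  · intro r _ hr
    rw [if_neg fun h' => hr ((h _ _).1 h').2]
  · simp
  · intro l _ hl
    refine Finset.sum_eq_zero fun r _ => ?_
    rw [if_neg fun h' => hl ((h _ _).1 h').1]
  · simp

/-- Rectangles without common sides anticommute. -/
theorem op_anticomm {P Q : (Curve N m → Fin N) → Curve N m → Curve N m → Prop}
    (h : ∀ ρ l r l' r', P ρ l r → Q (exch ρ l r) l' r' →
      (l ≠ r ∧ l' ≠ r' ∧ l ≠ l' ∧ l ≠ r' ∧ r ≠ l' ∧ r ≠ r') ∧ Q ρ l' r' ∧ P (exch ρ l' r') l r)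
    (h' : ∀ ρ l r l' r', Q ρ l r → P (exch ρ l r) l' r' →
      (l ≠ r ∧ l' ≠ r' ∧ l ≠ l' ∧ l ≠ r' ∧ r ≠ l' ∧ r ≠ r') ∧ P ρ l' r' ∧ Q (exch ρ l' r') l r) :
    S.op φ Q ∘ₗ S.op φ P = -(S.op φ P ∘ₗ S.op φ Q) := by
  classical
  refine hom_ext fun f => ?_
  rw [LinearMap.neg_apply, LinearMap.comp_apply, LinearMap.comp_apply, op_op_single, op_op_single,
    ← Finset.sum_neg_distrib]
  have swap : ∀ F : Curve N m → Curve N m → Curve N m → Curve N m → States N m,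
      ∑ a, ∑ b, ∑ c, ∑ d, F a b c d = ∑ a, ∑ b, ∑ c, ∑ d, F c d a b := by
    intro F
    rw [Finset.sum_congr rfl fun a _ => Finset.sum_comm, Finset.sum_comm]
    refine Finset.sum_congr rfl fun c _ => ?_
    rw [Finset.sum_congr rfl fun a _ => Finset.sum_comm, Finset.sum_comm]
  rw [swap]
  refine Finset.sum_congr rfl fun a _ => ?_
  rw [← Finset.sum_neg_distrib]
  refine Finset.sum_congr rfl fun b _ => ?_
  rw [← Finset.sum_neg_distrib]
  refine Finset.sum_congr rfl fun c _ => ?_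
  rw [← Finset.sum_neg_distrib]
  refine Finset.sum_congr rfl fun d _ => ?_
  by_cases h1 : P (rows f) c d ∧ Q (exch (rows f) c d) a b
  · have h2 := h _ _ _ _ _ h1.1 h1.2
    rw [if_pos h1, if_pos h2.2]
    exact congrArg (fun F : States N m →ₗ[ℤ] States N m => F (Finsupp.single f 1))
      (S.exchange_disjoint h2.1.2.1 h2.1.1 h2.1.2.2.1.symm h2.1.2.2.2.2.1.symm h2.1.2.2.2.1.symm
        h2.1.2.2.2.2.2.symm)
  · rw [if_neg h1, if_neg fun h2 => h1 (h' _ _ _ _ _ h2.1 h2.2).2, neg_zero]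

theorem op_side (a b : Curve N m) : S.op φ (fun _ l r => l = a ∧ r = b) = S.exchange φ a b :=
  hom_ext fun _ => S.op_unique fun _ _ => Iff.rfl

theorem op_anticomm_exchange {P : (Curve N m → Fin N) → Curve N m → Curve N m → Prop}
    {a b : Curve N m} (hab : a ≠ b)
    (h : ∀ ρ l r, P ρ l r → (l ≠ r ∧ a ≠ l ∧ a ≠ r ∧ b ≠ l ∧ b ≠ r) ∧ P (exch ρ a b) l r) :
    S.op φ P ∘ₗ S.exchange φ a b = -(S.exchange φ a b ∘ₗ S.op φ P) := by
  rw [← S.op_side a b]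
  refine S.op_anticomm ?_ ?_
  · rintro ρ l' r' l r ⟨rfl, rfl⟩ h2
    have h3 := h _ _ _ h2
    refine ⟨⟨hab, h3.1⟩, ?_, rfl, rfl⟩
    rw [show exch (exch ρ l' r') l' r' = ρ by funext x; simp [exch]] at h3
    exact h3.2
  · rintro ρ l r _ _ h2 ⟨rfl, rfl⟩
    have h3 := h _ _ _ h2
    exact ⟨⟨h3.1.1, hab, h3.1.2.1.symm, h3.1.2.2.2.1.symm, h3.1.2.2.1.symm, h3.1.2.2.2.2.symm⟩,
      ⟨rfl, rfl⟩, h3.2⟩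

end SignAssignment

/-- The product of the operators `Y k` over a list. -/
noncomputable def chain {K V : Type*} [AddCommGroup V] (Y : K → V →ₗ[ℤ] V) :
    List K → V →ₗ[ℤ] V
  | [] => LinearMap.id
  | k :: L => Y k ∘ₗ chain Y L

section Chain

variable {K V : Type*} [AddCommGroup V] {Y X : K → V →ₗ[ℤ] V}

theorem chain_mem {A : Set K → Submodule ℤ V} (hA : ∀ k J, k ∉ J → ∀ x ∈ A J, Y k x ∈ A (insert k J))
    {L : List K} (hL : L.Nodup) {x : V} (hx : x ∈ A ∅) : chain Y L x ∈ A {k | k ∈ L} := by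
  induction L with
  | nil => simpa [chain] using hx
  | cons a L ih =>
    rw [List.nodup_cons] at hL
    have := hA a _ hL.1 _ (ih hL.2)
    rwa [show {k | k ∈ a :: L} = insert a {k | k ∈ L} by ext k; simp]

theorem chain_comm_mem {A B : Set K → Submodule ℤ V} {d : Set K → V →ₗ[ℤ] V} (s : ℤ)
    (hA : ∀ k J, k ∉ J → ∀ x ∈ A J, Y k x ∈ A (insert k J))
    (hB : ∀ k J, k ∉ J → ∀ x ∈ B J, Y k x ∈ B (insert k J))
    (hd : ∀ k J, k ∉ J → ∀ x ∈ A J, Y k (d J x) - s • d (insert k J) (Y k x) ∈ B (insert k J))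
    {L : List K} (hL : L.Nodup) {x : V} (hx : x ∈ A ∅) :
    chain Y L (d ∅ x) - s ^ L.length • d {k | k ∈ L} (chain Y L x) ∈ B {k | k ∈ L} := by
  induction L with
  | nil => simp [chain]
  | cons a L ih =>
    rw [List.nodup_cons] at hL
    have h1 := hB a _ hL.1 _ (ih hL.2)
    have h2 := hd a _ hL.1 _ (chain_mem hA hL.2 hx)
    have h3 : {k | k ∈ a :: L} = insert a {k | k ∈ L} := by ext k; simp
    rw [h3]
    have h4 := Submodule.add_mem _ h1 (Submodule.smul_mem _ (s ^ L.length) h2)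
    simpa [chain, pow_succ, smul_sub, mul_smul] using h4

/-- Operators that anticommute with `D` in a product. -/
theorem chain_anticomm {D : V →ₗ[ℤ] V} (s : ℤ) {L : List K}
    (h : ∀ k ∈ L, Y k ∘ₗ D = s • (D ∘ₗ Y k)) :
    chain Y L ∘ₗ D = s ^ L.length • (D ∘ₗ chain Y L) := by
  induction L with
  | nil => simp [chain]
  | cons a L ih =>
    rw [chain, LinearMap.comp_assoc, ih fun k hk => h k (by simp [hk]), LinearMap.comp_smul,
      ← LinearMap.comp_assoc, h a (by simp), LinearMap.smul_comp, LinearMap.comp_assoc, smul_smul,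
      List.length_cons, pow_succ]

/-- A product of products of operators that commute up to a sign. -/
theorem chain_comp (s : ℤ) (h : ∀ j k, j ≠ k → Y j ∘ₗ X k = s • (X k ∘ₗ Y j)) {L : List K}
    (hL : L.Nodup) : ∃ i : ℕ, chain Y L ∘ₗ chain X L = s ^ i • chain (fun k => Y k ∘ₗ X k) L := by
  induction L with
  | nil => exact ⟨0, by simp [chain]⟩
  | cons a L ih =>
    rw [List.nodup_cons] at hL
    obtain ⟨i, hi⟩ := ih hL.2
    refine ⟨L.length + i, ?_⟩
    rw [chain, chain, LinearMap.comp_assoc, ← LinearMap.comp_assoc (chain X L),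
      chain_anticomm (D := X a) s fun k hk => h k a fun h' => hL.1 (h' ▸ hk), LinearMap.smul_comp,
      LinearMap.comp_smul, LinearMap.comp_assoc, hi, LinearMap.comp_smul, LinearMap.comp_smul,
      smul_smul, ← pow_add]
    rfl

theorem chain_perm (h : ∀ j k, j ≠ k → Y j ∘ₗ Y k = -(Y k ∘ₗ Y j)) {L L' : List K}
    (hp : L.Perm L') (hL : L.Nodup) : ∃ i : ℕ, chain Y L = (-1 : ℤ) ^ i • chain Y L' := by
  induction hp with
  | nil => exact ⟨0, by simp⟩
  | cons a _ ih =>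
    obtain ⟨i, hi⟩ := ih (List.nodup_cons.1 hL).2
    exact ⟨i, by rw [chain, hi, LinearMap.comp_smul, chain]⟩
  | swap a b L =>
    refine ⟨1, ?_⟩
    have hab : b ≠ a := fun h => by simp [h] at hL
    rw [chain, chain, chain, chain, ← LinearMap.comp_assoc, h b a hab, LinearMap.neg_comp,
      LinearMap.comp_assoc]
    simp
  | trans h1 _ ih1 ih2 =>
    obtain ⟨i, hi⟩ := ih1 hL
    obtain ⟨j, hj⟩ := ih2 (h1.nodup_iff.1 hL)
    exact ⟨i + j, by rw [hi, hj, smul_smul, pow_add]⟩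

theorem chain_congr {L : List K} (h : ∀ k ∈ L, Y k = X k) : chain Y L = chain X L := by
  induction L with
  | nil => rfl
  | cons a L ih => rw [chain, chain, h a (by simp), ih fun k hk => h k (by simp [hk])]

end Chain

end GridCover

namespace GridCover

namespace Sheets

variable {N m : ℕ} {Z : Sheets N m} {ρ : Curve N m → Fin N} {l r : Curve N m} {c c' p q : Fin N}

theorem Corner.not_around (C : Z.Corner c c' p q) (h : Z.Rect ρ l r) (hl : l.1 = c') : r.1 ≠ c := by
  intro hr
  obtain ⟨a, ha⟩ := C.rowM (ρ l)
  refine h.free a ?_ _ (cycIco_self h.row) ha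
  have h1 : a ≠ c := fun h => C.col_c _ (h ▸ ha)
  have := C.col
  have := a.2
  rw [hl, hr]
  simp only [cycIco_iff, Fin.ext_iff, ne_eq] at *
  omega

theorem eq_of_joined (hj : ∀ i k, Z.Joined i (c, k) (c', k)) {i : Fin N} {j k : ZMod m}
    (h : Z.Joined i (c, j) (c', k)) : j = k :=
  congrArg Prod.snd ((hj i j).unique h rfl)

theorem exch_exch_self (ρ : Curve N m → Fin N) (a b : Curve N m) : exch (exch ρ a b) a b = ρ := by
  funext x; simp [exch]

theorem Corner.rect_exch_side (C : Z.Corner c c' p q) (hj : ∀ i k, Z.Joined i (c, k) (c', k))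
    {j : ZMod m} (h : Z.Rect ρ l r) (h1 : (c, j) ≠ l) (h2 : (c, j) ≠ r) (h3 : (c', j) ≠ l)
    (h4 : (c', j) ≠ r) : Z.Rect (exch ρ (c, j) (c', j)) l r := by
  by_cases hs : ρ (c, j) = ρ (c', j)
  · convert h
    funext x
    rcases eq_or_ne x (c, j) with rfl | h5
    · rw [exch_left, hs]
    rcases eq_or_ne x (c', j) with rfl | h6
    · rw [exch_right, hs]
    rw [exch_ne _ h5 h6]
  · refine (C.rect_side (j := j) ?_ (hj _ _)).exchange_first (l' := l) (r' := r) ?_ h1 h2 h3 h4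
    · rw [exch_left, exch_right]
      exact Ne.symm hs
    · rw [exch_exch_self]
      exact h

/-- The two lifts next to the column `c` in sheet `k`, if the line `p` separates their points. -/
def Dent (c c' p : Fin N) (k : ZMod m) (ρ : Curve N m → Fin N) (l r : Curve N m) : Prop :=
  l = (c, k) ∧ r = (c', k) ∧ CycIoo (ρ l) (ρ r) p

/-- A rectangle which completes a punctured rectangle in sheet `k` to a punctured hexagon; `R` is
a condition on the row of the obtuse corner. -/
def Flap (Z : Sheets N m) (c c' p : Fin N) (R : Fin N → Prop) (k : ZMod m) (ρ : Curve N m → Fin N)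
    (l r : Curve N m) : Prop :=
  r = (c, k) ∧ Z.Rect ρ l r ∧ CycIoo (ρ (c', k)) (ρ r) (ρ l) ∧ CycIoo (ρ (c', k)) (ρ r) p ∧ R (ρ l)

theorem mk_ne_left {j k : ZMod m} (h : j ≠ k) : ((c, j) : Curve N m) ≠ (c, k) :=
  fun h' => h (congrArg Prod.snd h')

theorem ne_of_col {a b : Curve N m} (h : a.1 ≠ b.1) : a ≠ b := fun h' => h (congrArg _ h')

theorem Corner.mk_ne (C : Z.Corner c c' p q) {j k : ZMod m} :
    ((c, j) : Curve N m) ≠ (c', k) := fun h' => C.ne (congrArg Prod.fst h')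

theorem sector_sector {j k : ZMod m} (h : j ≠ k)
    {l r l' r' : Curve N m} (h1 : Z.Sector c p j ρ l r) (h2 : Z.Sector c p k (exch ρ l r) l' r') :
    (l ≠ r ∧ l' ≠ r' ∧ l ≠ l' ∧ l ≠ r' ∧ r ≠ l' ∧ r ≠ r') ∧ Z.Sector c p k ρ l' r' ∧
      Z.Sector c p j (exch ρ l' r') l r := by
  obtain ⟨rfl, R1, e1⟩ := h1
  obtain ⟨rfl, R2, e2⟩ := h2
  have h3 : ((c, j) : Curve N m) ≠ (c, k) := mk_ne_left h
  have h4 : ((c, j) : Curve N m) ≠ r' := ne_of_col R2.col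
  have h5 : r ≠ (c, k) := ne_of_col R1.col.symm
  have h6 : r ≠ r' := by
    rintro rfl
    rw [exch_right] at e2
    exact R1.row (e2.trans e1.symm)
  rw [exch_ne _ h4.symm h6.symm] at e2
  exact ⟨⟨R1.ne, R2.ne, h3, h4, h5, h6⟩, ⟨rfl, R1.exchange_first R2 h3 h4 h5 h6, e2⟩, rfl,
    R1.exchange_second R2 h3 h4 h5 h6, by rwa [exch_ne _ h5 h6]⟩

theorem Corner.sector_dent (C : Z.Corner c c' p q) (hj : ∀ i k, Z.Joined i (c, k) (c', k))
    {j k : ZMod m} (h : j ≠ k)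
    {l r l' r' : Curve N m} (h1 : Z.Sector c p j ρ l r) (h2 : Dent c c' p k (exch ρ l r) l' r') :
    (l ≠ r ∧ l' ≠ r' ∧ l ≠ l' ∧ l ≠ r' ∧ r ≠ l' ∧ r ≠ r') ∧ Dent c c' p k ρ l' r' ∧
      Z.Sector c p j (exch ρ l' r') l r := by
  obtain ⟨rfl, R1, e1⟩ := h1
  obtain ⟨rfl, rfl, e2⟩ := h2
  have h3 : ((c, j) : Curve N m) ≠ (c, k) := mk_ne_left h
  have h4 : ((c, j) : Curve N m) ≠ (c', k) := C.mk_ne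
  have h5 : r ≠ (c, k) := ne_of_col R1.col.symm
  have h6 : r ≠ (c', k) := by
    rintro rfl
    exact h (eq_of_joined hj R1.base)
  rw [exch_ne _ h4.symm h6.symm, exch_ne _ h3.symm h5.symm] at e2
  exact ⟨⟨R1.ne, C.mk_ne, h3, h4, h5, h6⟩, ⟨rfl, rfl, e2⟩, rfl,
    C.rect_exch_side hj R1 h3.symm h5.symm h4.symm h6.symm, by rwa [exch_ne _ h5 h6]⟩

theorem Corner.dent_sector (C : Z.Corner c c' p q) (hj : ∀ i k, Z.Joined i (c, k) (c', k))
    {j k : ZMod m} (h : j ≠ k)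
    {l r l' r' : Curve N m} (h1 : Dent c c' p k ρ l r) (h2 : Z.Sector c p j (exch ρ l r) l' r') :
    (l ≠ r ∧ l' ≠ r' ∧ l ≠ l' ∧ l ≠ r' ∧ r ≠ l' ∧ r ≠ r') ∧ Z.Sector c p j ρ l' r' ∧
      Dent c c' p k (exch ρ l' r') l r := by
  obtain ⟨rfl, rfl, e1⟩ := h1
  obtain ⟨rfl, R2, e2⟩ := h2
  have h3 : ((c, k) : Curve N m) ≠ (c, j) := mk_ne_left h.symm
  have h4 : ((c, k) : Curve N m) ≠ r' := ne_of_col R2.col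
  have h5 : ((c', k) : Curve N m) ≠ (c, j) := C.mk_ne.symm
  have h6 : (c', k) ≠ r' := by
    rintro rfl
    exact h (eq_of_joined hj R2.base)
  rw [exch_ne _ h4.symm h6.symm] at e2
  refine ⟨⟨C.mk_ne, R2.ne, h3, h4, h5, h6⟩, ⟨rfl, ?_, e2⟩, rfl, rfl, ?_⟩
  · rw [← exch_exch_self ρ (c, k) (c', k)]
    exact C.rect_exch_side hj R2 h3 h4 h5 h6
  · rwa [exch_ne _ h3 h4, exch_ne _ h5 h6]

theorem Corner.sector_flap (C : Z.Corner c c' p q) (hj : ∀ i k, Z.Joined i (c, k) (c', k))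
    {R : Fin N → Prop} {j k : ZMod m} (h : j ≠ k)
    {l r l' r' : Curve N m} (h1 : Z.Sector c p j ρ l r) (h2 : Z.Flap c c' p R k (exch ρ l r) l' r') :
    (l ≠ r ∧ l' ≠ r' ∧ l ≠ l' ∧ l ≠ r' ∧ r ≠ l' ∧ r ≠ r') ∧ Z.Flap c c' p R k ρ l' r' ∧
      Z.Sector c p j (exch ρ l' r') l r := by
  obtain ⟨rfl, R1, e1⟩ := h1
  obtain ⟨rfl, R2, e2⟩ := h2
  have h3 : ((c, j) : Curve N m) ≠ l' := ne_of_col R2.col.symm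
  have h4 : ((c, j) : Curve N m) ≠ (c, k) := mk_ne_left h
  have h6 : r ≠ (c, k) := ne_of_col R1.col.symm
  have h7 : r ≠ (c', k) := by
    rintro rfl
    exact h (eq_of_joined hj R1.base)
  have h5 : r ≠ l' := by
    rintro rfl
    obtain ⟨a, ha⟩ := C.rowM (ρ (c, j))
    have h8 : ¬ CycIco c r.1 a := fun h => R1.free _ h _ (cycIco_self R1.row) ha
    have h9 : ¬ CycIco r.1 c a := fun h => R2.free _ h _ (by
      rw [← exch_right ρ (c, j) r]; exact cycIco_self R2.row) ha
    have h10 := R1.col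
    simp only [cycIco_iff, Fin.ext_iff, ne_eq] at *
    omega
  rw [exch_ne _ h4.symm h6.symm, exch_ne _ h3.symm h5.symm, exch_ne _ C.mk_ne.symm h7.symm] at e2
  exact ⟨⟨R1.ne, R2.ne, h3, h4, h5, h6⟩, ⟨rfl, R1.exchange_first R2 h3 h4 h5 h6, e2⟩, rfl,
    R1.exchange_second R2 h3 h4 h5 h6, by rwa [exch_ne _ h5 h6]⟩

theorem Corner.flap_sector (C : Z.Corner c c' p q) (hj : ∀ i k, Z.Joined i (c, k) (c', k))
    {R : Fin N → Prop} {j k : ZMod m} (h : j ≠ k)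
    {l r l' r' : Curve N m} (h1 : Z.Flap c c' p R k ρ l r) (h2 : Z.Sector c p j (exch ρ l r) l' r') :
    (l ≠ r ∧ l' ≠ r' ∧ l ≠ l' ∧ l ≠ r' ∧ r ≠ l' ∧ r ≠ r') ∧ Z.Sector c p j ρ l' r' ∧
      Z.Flap c c' p R k (exch ρ l' r') l r := by
  obtain ⟨rfl, R1, e1⟩ := h1
  obtain ⟨rfl, R2, e2⟩ := h2
  have h3 : l ≠ (c, j) := ne_of_col R1.col
  have h5 : ((c, k) : Curve N m) ≠ (c, j) := mk_ne_left h.symm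
  have h6 : (c, k) ≠ r' := ne_of_col R2.col
  have h7 : (c', k) ≠ r' := by
    rintro rfl
    exact h (eq_of_joined hj R2.base)
  have h4 : l ≠ r' := by
    rintro rfl
    rw [exch_left] at e2
    rw [e2] at e1
    exact ne_of_cycIoo_right e1.2.1 rfl
  rw [exch_ne _ h4.symm h6.symm] at e2
  refine ⟨⟨R1.ne, R2.ne, h3, h4, h5, h6⟩, ⟨rfl, R1.exchange_first R2 h3 h4 h5 h6, e2⟩, rfl,
    R1.exchange_second R2 h3 h4 h5 h6, ?_⟩
  rwa [exch_ne _ h5 h6, exch_ne _ h3 h4, exch_ne _ C.mk_ne.symm h7]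

end Sheets

open Sheets

namespace SignAssignment

variable {N m : ℕ} [NeZero m] (S : SignAssignment (m * N)) {φ : Framing N m} {Z : Sheets N m}
  {c c' p q : Fin N}

theorem op_sector_op_sector {j k : ZMod m} (h : j ≠ k) :
    S.op φ (Z.Sector c p k) ∘ₗ S.op φ (Z.Sector c p j) =
      -(S.op φ (Z.Sector c p j) ∘ₗ S.op φ (Z.Sector c p k)) :=
  S.op_anticomm (fun _ _ _ _ _ h1 h2 => sector_sector h h1 h2)
    (fun _ _ _ _ _ h1 h2 => sector_sector h.symm h1 h2)

variable (φ Z) in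
/-- The signed count of the punctured hexagons in sheet `k`. -/
noncomputable def hexagon (c c' p : Fin N) (R : Fin N → Prop) (k : ZMod m) :
    States N m →ₗ[ℤ] States N m :=
  S.op φ (Z.Flap c c' p R k) ∘ₗ S.op φ (Dent c c' p k)

theorem op_sector_hexagon (C : Z.Corner c c' p q) (hj : ∀ i k, Z.Joined i (c, k) (c', k))
    {R : Fin N → Prop} {j k : ZMod m} (h : j ≠ k) :
    S.op φ (Z.Sector c p j) ∘ₗ S.hexagon φ Z c c' p R k =
      S.hexagon φ Z c c' p R k ∘ₗ S.op φ (Z.Sector c p j) := by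
  have h1 : S.op φ (Dent c c' p k) ∘ₗ S.op φ (Z.Sector c p j) =
      -(S.op φ (Z.Sector c p j) ∘ₗ S.op φ (Dent c c' p k)) :=
    S.op_anticomm (fun _ _ _ _ _ h1 h2 => C.sector_dent hj h h1 h2)
      (fun _ _ _ _ _ h1 h2 => C.dent_sector hj h h1 h2)
  have h2 : S.op φ (Z.Flap c c' p R k) ∘ₗ S.op φ (Z.Sector c p j) =
      -(S.op φ (Z.Sector c p j) ∘ₗ S.op φ (Z.Flap c c' p R k)) :=
    S.op_anticomm (fun _ _ _ _ _ h1 h2 => C.sector_flap hj h h1 h2)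
      (fun _ _ _ _ _ h1 h2 => C.flap_sector hj h h1 h2)
  rw [hexagon, LinearMap.comp_assoc, h1, LinearMap.comp_neg, ← LinearMap.comp_assoc,
    ← LinearMap.comp_assoc (S.op φ (Dent c c' p k)) (S.op φ (Z.Sector c p j)), h2,
    LinearMap.neg_comp, neg_neg]

/-- A rectangle with one side on the lift of `c'` in sheet `k` and the other side on no lift of `c`
anticommutes with the exchange in another sheet. -/
theorem op_exchange_side (C : Z.Corner c c' p q) (hj : ∀ i k, Z.Joined i (c, k) (c', k))
    {P : (Curve N m → Fin N) → Curve N m → Curve N m → Prop} {j k : ZMod m} (h : j ≠ k)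
    (hP : ∀ ρ l r, P ρ l r → Z.Rect ρ l r ∧ (l = (c', k) ∨ r = (c', k)))
    (hP' : ∀ ρ ρ' l r, P ρ l r → Z.Rect ρ' l r → ρ l = ρ' l → ρ r = ρ' r → P ρ' l r) :
    S.op φ P ∘ₗ S.exchange φ (c, j) (c', j) = -(S.exchange φ (c, j) (c', j) ∘ₗ S.op φ P) := by
  refine S.op_anticomm_exchange C.mk_ne fun ρ l r h1 => ?_
  obtain ⟨h2, h3⟩ := hP _ _ _ h1
  have h4 : l ≠ r ∧ (c, j) ≠ l ∧ (c, j) ≠ r ∧ (c', j) ≠ l ∧ (c', j) ≠ r := by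
    rcases h3 with rfl | rfl
    · refine ⟨h2.ne, C.mk_ne, ?_, mk_ne_left h, ne_of_col h2.col⟩
      exact ne_of_col (C.not_around h2 rfl).symm
    · refine ⟨h2.ne, ?_, C.mk_ne, ne_of_col h2.col.symm, mk_ne_left h⟩
      rintro rfl
      exact h (eq_of_joined hj h2.base)
  refine ⟨h4, hP' _ _ _ _ h1 (C.rect_exch_side hj h2 h4.2.1 h4.2.2.1 h4.2.2.2.1 h4.2.2.2.2) ?_ ?_⟩
  · rw [exch_ne _ h4.2.1.symm h4.2.2.2.1.symm]
  · rw [exch_ne _ h4.2.2.1.symm h4.2.2.2.2.symm]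

theorem op_puncture_exchange (C : Z.Corner c c' p q) (hj : ∀ i k, Z.Joined i (c, k) (c', k))
    {j k : ZMod m} (h : j ≠ k) :
    S.op φ (Z.Puncture c' p k) ∘ₗ S.exchange φ (c, j) (c', j) =
      -(S.exchange φ (c, j) (c', j) ∘ₗ S.op φ (Z.Puncture c' p k)) :=
  S.op_exchange_side C hj h (fun _ _ _ h => ⟨h.2.1, .inr h.1⟩)
    (fun _ _ _ _ h h' h1 h2 => ⟨h.1, h', by rw [← h1, ← h2]; exact h.2.2⟩)

theorem op_sector_exchange (C : Z.Corner c c' p q) (hj : ∀ i k, Z.Joined i (c, k) (c', k))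
    {j k : ZMod m} (h : j ≠ k) :
    S.op φ (Z.Sector c' p k) ∘ₗ S.exchange φ (c, j) (c', j) =
      -(S.exchange φ (c, j) (c', j) ∘ₗ S.op φ (Z.Sector c' p k)) :=
  S.op_exchange_side C hj h (fun _ _ _ h => ⟨h.2.1, .inl h.1⟩)
    (fun _ _ _ _ h h' _ h2 => ⟨h.1, h', by rw [← h2]; exact h.2.2⟩)

theorem op_cosector_exchange (C : Z.Corner c c' p q) (hj : ∀ i k, Z.Joined i (c, k) (c', k))
    {j k : ZMod m} (h : j ≠ k) :
    S.op φ (Z.Cosector c' p k) ∘ₗ S.exchange φ (c, j) (c', j) =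
      -(S.exchange φ (c, j) (c', j) ∘ₗ S.op φ (Z.Cosector c' p k)) :=
  S.op_exchange_side C hj h (fun _ _ _ h => ⟨h.2.1, .inr h.1⟩)
    (fun _ _ _ _ h h' h1 _ => ⟨h.1, h', by rw [← h1]; exact h.2.2⟩)

end SignAssignment
end GridCover

namespace GridCover

namespace Sheets

variable {N m : ℕ} {Z : Sheets N m} {ρ : Curve N m → Fin N} {l r : Curve N m} {c c' p q : Fin N}
  {k : ZMod m}

theorem Corner.cycIoo_c (C : Z.Corner c c' p q) {x : Fin N} (h : x ≠ c) (h' : x ≠ c') :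
    CycIoo x c' c :=
  ⟨h.symm, C.cycIco_c h'⟩

theorem Corner.cycIoo_c' (C : Z.Corner c c' p q) {x : Fin N} (h : x ≠ c) (h' : x ≠ c') :
    CycIoo c x c' := by
  have := C.col
  have := x.2
  simp only [cycIoo_iff, Fin.ext_iff, ne_eq] at *
  omega

theorem cycIoo_of_not {a b t : Fin N} (h1 : a ≠ b) (h2 : t ≠ a) (h3 : t ≠ b)
    (h : ¬ CycIoo a b t) : CycIoo t b a := by
  simp only [cycIoo_iff, Fin.ext_iff, ne_eq] at *
  omega

theorem cycIoo_of_not' {a b t : Fin N} (h1 : a ≠ b) (h2 : t ≠ a) (h3 : t ≠ b)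
    (h : ¬ CycIoo a b t) : CycIoo a t b := by
  simp only [cycIoo_iff, Fin.ext_iff, ne_eq] at *
  omega

theorem Corner.rect_right (C : Z.Corner c c' p q) (hj : ∀ i k, Z.Joined i (c, k) (c', k))
    (h : Z.Rect ρ l (c', k)) (hl : l.1 ≠ c) :
    Z.Rect (exch ρ (c, k) (c', k)) l (c, k) ∧ CycIoo (ρ (c, k)) (ρ (c', k)) (ρ l) := by
  have h1 := C.cycIoo_c hl h.col
  have h2 := h.base.cancel_right (hj _ k) h1
  obtain ⟨e1, e2, e3⟩ := h.empty (c, k) h1 h2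
  have el : exch ρ (c, k) (c', k) l = ρ l := exch_ne _ (ne_of_col hl) h.ne
  refine ⟨⟨hl, ?_, ?_, ?_, ?_⟩, cycIoo_of_not h.row e1 e2 e3⟩
  · rw [el, exch_left]; exact h.row
  · rw [el]; exact h2
  · rw [el, exch_left]
    refine fun x hx => h.free x ?_
    have := C.col
    have := x.2
    simp only [cycIco_iff, cycIoo_iff, Fin.ext_iff, ne_eq] at *
    omega
  · rw [el, exch_left]
    intro b hb jb
    have h3 : b.1 ≠ c := ne_of_cycIoo_right hb
    have h4 : b.1 ≠ c' := by
      intro h5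
      rw [h5] at hb
      exact cycIoo_asymm hb h1
    rw [exch_ne _ (ne_of_col h3) (ne_of_col h4)]
    refine h.empty b ?_ jb
    simp only [cycIoo_iff, Fin.ext_iff, ne_eq] at *
    omega

theorem Corner.rect_right_of (C : Z.Corner c c' p q) (hj : ∀ i k, Z.Joined i (c, k) (c', k))
    (h : Z.Rect (exch ρ (c, k) (c', k)) l (c, k)) (hl : CycIoo (ρ (c, k)) (ρ (c', k)) (ρ l)) :
    Z.Rect ρ l (c', k) := by
  have h0 : l.1 ≠ c' := fun h' => C.not_around h h' rfl
  have h1 := C.cycIoo_c h.col h0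
  have el : exch ρ (c, k) (c', k) l = ρ l := exch_ne _ h.ne (ne_of_col h0)
  have hrow := h.row
  have hbase := h.base
  have hfree := h.free
  have hempty := h.empty
  rw [el, exch_left] at hrow hfree hempty
  rw [el] at hbase
  refine ⟨h0, hrow, hbase.trans (hj _ k) h1, fun x hx => ?_, fun b hb jb => ?_⟩
  · by_cases h3 : x = c
    · subst h3
      exact fun i _ => C.col_c i
    · refine hfree x ?_
      have := C.col
      have := x.2
      simp only [cycIco_iff, cycIoo_iff, Fin.ext_iff, ne_eq] at *
      omega
  · by_cases h3 : b.1 = c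
    · rw [jb.unique hbase h3]
      simp only [cycIoo_iff, Fin.ext_iff, ne_eq] at *
      omega
    · have h4 : b.1 ≠ c' := ne_of_cycIoo_right hb
      rw [← exch_ne ρ (ne_of_col h3 : b ≠ (c, k)) (ne_of_col h4 : b ≠ (c', k))]
      refine hempty b ?_ jb
      have := C.col
      have := b.1.2
      simp only [cycIoo_iff, Fin.ext_iff, ne_eq] at *
      omega

theorem Corner.rect_left (C : Z.Corner c c' p q) (hj : ∀ i k, Z.Joined i (c, k) (c', k))
    (h : Z.Rect ρ (c, k) r) (hr : r.1 ≠ c') :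
    Z.Rect (exch ρ (c, k) (c', k)) (c', k) r ∧ CycIoo (ρ (c, k)) (ρ (c', k)) (ρ r) := by
  have h1 := C.cycIoo_c' h.col.symm hr
  have h2 := (hj (ρ (c, k)) k).cancel_left h.base h1
  obtain ⟨e1, e2, e3⟩ := h.empty (c', k) h1 (hj _ k)
  have er : exch ρ (c, k) (c', k) r = ρ r := exch_ne _ h.ne.symm (ne_of_col hr)
  refine ⟨⟨hr.symm, ?_, ?_, ?_, ?_⟩, cycIoo_of_not' h.row e1 e2 e3⟩
  · rw [er, exch_right]; exact h.row
  · rw [exch_right]; exact h2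
  · rw [er, exch_right]
    refine fun x hx => h.free x ?_
    have := C.col
    have := x.2
    simp only [cycIco_iff, cycIoo_iff, Fin.ext_iff, ne_eq] at *
    omega
  · rw [er, exch_right]
    intro b hb jb
    have h4 : b.1 ≠ c' := (ne_of_cycIoo_left hb).symm
    have h5 : CycIoo c r.1 b.1 := by
      have := C.col
      have := b.1.2
      simp only [cycIoo_iff, Fin.ext_iff, ne_eq] at *
      omega
    have h3 : b.1 ≠ c := (ne_of_cycIoo_left h5).symm
    rw [exch_ne _ (ne_of_col h3) (ne_of_col h4)]
    refine h.empty b h5 ((hj _ k).trans jb ?_)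
    exact C.cycIoo_c' h3 h4

theorem Corner.rect_left_of (C : Z.Corner c c' p q) (hj : ∀ i k, Z.Joined i (c, k) (c', k))
    (h : Z.Rect (exch ρ (c, k) (c', k)) (c', k) r) (hr : CycIoo (ρ (c, k)) (ρ (c', k)) (ρ r)) :
    Z.Rect ρ (c, k) r := by
  have h0 : r.1 ≠ c := C.not_around h rfl
  have h1 := C.cycIoo_c' h0 h.col.symm
  have er : exch ρ (c, k) (c', k) r = ρ r := exch_ne _ (ne_of_col h0) h.ne.symm
  have hrow := h.row
  have hbase := h.base
  have hfree := h.free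
  have hempty := h.empty
  rw [er, exch_right] at hrow hfree hempty
  rw [exch_right] at hbase
  refine ⟨h0.symm, hrow, (hj _ k).trans hbase h1, fun x hx => ?_, fun b hb jb => ?_⟩
  · by_cases h3 : x = c
    · subst h3
      exact fun i _ => C.col_c i
    · refine hfree x ?_
      have := C.col
      have := x.2
      simp only [cycIco_iff, cycIoo_iff, Fin.ext_iff, ne_eq] at *
      omega
  · by_cases h3 : b.1 = c'
    · rw [jb.unique (hj _ k) h3]
      simp only [cycIoo_iff, Fin.ext_iff, ne_eq] at *
      omega
    · have h4 : b.1 ≠ c := (ne_of_cycIoo_left hb).symm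
      rw [← exch_ne ρ (ne_of_col h4 : b ≠ (c, k)) (ne_of_col h3 : b ≠ (c', k))]
      refine hempty b ?_ ((hj _ k).cancel_left jb (C.cycIoo_c' h4 h3))
      have := C.col
      have := b.1.2
      simp only [cycIoo_iff, Fin.ext_iff, ne_eq] at *
      omega

end Sheets

open Sheets

namespace SignAssignment

variable {N m : ℕ} [NeZero m] (S : SignAssignment (m * N)) {φ : Framing N m} {Z : Sheets N m}
  {c c' p q : Fin N}

/-- Exchanging two points before rectangles are counted. -/
theorem op_exchange_single {P Q : (Curve N m → Fin N) → Curve N m → Curve N m → Prop}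
    {a b : Curve N m} (hab : a ≠ b) {f : Curve N m ≃ Curve N m}
    (h : ∀ l r, P (rows f) l r ↔
      l ≠ r ∧ Q (exch (rows f) a b) (Equiv.swap a b l) (Equiv.swap a b r))
    (hQ : ∀ l r, Q (exch (rows f) a b) l r → l ≠ r) :
    S.op φ Q (S.exchange φ a b (Finsupp.single f 1)) =
      -S.exchange φ a b (S.op φ P (Finsupp.single f 1)) := by
  classical
  rw [exchange_single, map_smul, op_single, op_single, map_sum, Finset.smul_sum,
    ← Equiv.sum_comp (Equiv.swap a b), ← Finset.sum_neg_distrib]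
  refine Finset.sum_congr rfl fun l _ => ?_
  rw [map_sum, Finset.smul_sum, ← Equiv.sum_comp (Equiv.swap a b), ← Finset.sum_neg_distrib]
  refine Finset.sum_congr rfl fun r _ => ?_
  rw [rows_trans_swap]
  by_cases h1 : P (rows f) l r
  · have h2 := (h l r).1 h1
    rw [if_pos h1, if_pos h2.2, ← map_smul, ← exchange_single]
    have := congrArg (fun F : States N m →ₗ[ℤ] States N m => F (Finsupp.single f 1))
      (S.exchange_exchange (φ := φ) hab (hQ _ _ h2.2))
    simpa using this
  · rw [if_neg h1, if_neg, smul_zero, map_zero, neg_zero]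
    exact fun h2 => h1 ((h l r).2 ⟨fun h3 => hQ _ _ h2 (h3 ▸ rfl), h2⟩)

omit [NeZero m] in
theorem exchange_exchange_self {a b : Curve N m} (hab : a ≠ b) (x : States N m) :
    S.exchange φ a b (S.exchange φ a b x) = -x :=
  congrArg (fun F : States N m →ₗ[ℤ] States N m => F x) (S.exchange_self hab)

theorem op_add_op_not (P Q : (Curve N m → Fin N) → Curve N m → Curve N m → Prop)
    (f : Curve N m ≃ Curve N m) :
    S.op φ P (Finsupp.single f 1) = S.op φ (fun ρ l r => P ρ l r ∧ Q ρ l r) (Finsupp.single f 1) +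
      S.op φ (fun ρ l r => P ρ l r ∧ ¬ Q ρ l r) (Finsupp.single f 1) := by
  classical
  simp only [op_single, ← Finset.sum_add_distrib]
  refine Finset.sum_congr rfl fun l _ => Finset.sum_congr rfl fun r _ => ?_
  by_cases h1 : P (rows f) l r <;> by_cases h2 : Q (rows f) l r <;> simp [h1, h2]

variable {k : ZMod m}

theorem op_sector_of_cycIoo (C : Z.Corner c c' p q) (hj : ∀ i k, Z.Joined i (c, k) (c', k))
    {f : Curve N m ≃ Curve N m} (h : CycIoo (rows f (c, k)) (rows f (c', k)) p) :
    S.op φ (Z.Sector c p k) (Finsupp.single f 1) = S.exchange φ (c, k) (c', k)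
      (S.op φ (Z.Sector c' p k) (S.exchange φ (c, k) (c', k) (Finsupp.single f 1))) := by
  have hp := ne_of_cycIoo_right h
  rw [S.op_exchange_single (P := Z.Sector c p k) C.mk_ne (fun l r => ?_)
    (fun l r h' => h'.2.1.ne), map_neg, S.exchange_exchange_self C.mk_ne, neg_neg]
  constructor
  · rintro ⟨rfl, R, e⟩
    have h1 : r ≠ (c', k) := by
      rintro rfl
      exact hp e.symm
    have h2 : r.1 ≠ c' := fun h2 => h1 (R.base.unique (hj _ k) h2)
    rw [Equiv.swap_apply_left, Equiv.swap_apply_of_ne_of_ne R.ne.symm h1]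
    exact ⟨R.ne, rfl, (C.rect_left hj R h2).1, by rwa [exch_ne _ R.ne.symm h1]⟩
  · rintro ⟨h0, h1, R, e⟩
    have h2 : l = (c, k) :=
      (Equiv.swap (c, k) (c', k)).injective (h1.trans (Equiv.swap_apply_left _ _).symm)
    subst h2
    rw [Equiv.swap_apply_left] at R
    have h1 : r ≠ (c', k) := by
      rintro rfl
      rw [Equiv.swap_apply_right] at R
      exact C.not_around R rfl rfl
    rw [Equiv.swap_apply_of_ne_of_ne h0.symm h1] at R e
    rw [exch_ne _ h0.symm h1] at e
    exact ⟨rfl, C.rect_left_of hj R (e ▸ h), e⟩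

theorem op_sector_of_not_cycIoo (C : Z.Corner c c' p q) (hj : ∀ i k, Z.Joined i (c, k) (c', k))
    {f : Curve N m ≃ Curve N m} (h : ¬ CycIoo (rows f (c, k)) (rows f (c', k)) p)
    (hp : rows f (c', k) ≠ p) : S.op φ (Z.Sector c p k) (Finsupp.single f 1) = 0 := by
  refine S.op_eq_zero ?_
  rintro l r ⟨rfl, R, e⟩
  have h2 : r.1 ≠ c' := fun h2 => hp (by rw [← R.base.unique (hj _ k) h2]; exact e)
  exact h (e ▸ (C.rect_left hj R h2).2)

theorem op_flap_exchange (C : Z.Corner c c' p q) (hj : ∀ i k, Z.Joined i (c, k) (c', k))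
    {R : Fin N → Prop} {f : Curve N m ≃ Curve N m}
    (h : CycIoo (rows f (c, k)) (rows f (c', k)) p) :
    S.op φ (Z.Flap c c' p R k) (S.exchange φ (c, k) (c', k) (Finsupp.single f 1)) =
      -S.exchange φ (c, k) (c', k) (S.op φ (fun ρ l r => r = (c', k) ∧ Z.Rect ρ l r ∧ l.1 ≠ c ∧
        R (ρ l)) (Finsupp.single f 1)) := by
  refine S.op_exchange_single C.mk_ne (fun l r => ?_) fun l r h' => h'.2.1.ne
  constructor
  · rintro ⟨rfl, h1, h2, h3⟩
    have h4 := C.rect_right hj h1 h2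
    rw [Equiv.swap_apply_right, Equiv.swap_apply_of_ne_of_ne (ne_of_col h2) h1.ne]
    refine ⟨h1.ne, rfl, h4.1, ?_⟩
    rw [exch_left, exch_right, exch_ne _ (ne_of_col h2) h1.ne]
    exact ⟨h4.2, h, h3⟩
  · rintro ⟨h0, h1, h2, h3, -, h4⟩
    have h5 : r = (c', k) :=
      (Equiv.swap (c, k) (c', k)).injective (h1.trans (Equiv.swap_apply_right _ _).symm)
    subst h5
    rw [Equiv.swap_apply_right] at h2 h3
    have h6 : l ≠ (c, k) := by
      rintro rfl
      rw [Equiv.swap_apply_left] at h2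
      exact C.not_around h2 rfl rfl
    rw [Equiv.swap_apply_of_ne_of_ne h6 h0] at h2 h3 h4
    rw [exch_left, exch_right, exch_ne _ h6 h0] at h3
    rw [exch_ne _ h6 h0] at h4
    exact ⟨rfl, C.rect_right_of hj h2 h3, h2.col, h4⟩

theorem op_dent {f : Curve N m ≃ Curve N m} (h : CycIoo (rows f (c, k)) (rows f (c', k)) p) :
    S.op φ (Dent c c' p k) (Finsupp.single f 1) =
      S.exchange φ (c, k) (c', k) (Finsupp.single f 1) :=
  S.op_unique fun l r => ⟨fun h' => ⟨h'.1, h'.2.1⟩, by rintro ⟨rfl, rfl⟩; exact ⟨rfl, rfl, h⟩⟩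

theorem op_dent_of_not {f : Curve N m ≃ Curve N m}
    (h : ¬ CycIoo (rows f (c, k)) (rows f (c', k)) p) :
    S.op φ (Dent c c' p k) (Finsupp.single f 1) = 0 :=
  S.op_eq_zero fun l r h' => h (by obtain ⟨rfl, rfl, h'⟩ := h'; exact h')

open Classical in
/-- The projection onto the states with the property `G`. -/
noncomputable def proj (G : (Curve N m → Fin N) → Prop) : States N m →ₗ[ℤ] States N m :=
  Finsupp.linearCombination ℤ fun f => if G (rows f) then Finsupp.single f 1 else 0

omit [NeZero m] in
theorem proj_of {G : (Curve N m → Fin N) → Prop} {f : Curve N m ≃ Curve N m} (h : G (rows f)) :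
    proj G (Finsupp.single f 1) = Finsupp.single f 1 := by
  rw [proj, Finsupp.linearCombination_single, if_pos h, one_smul]

omit [NeZero m] in
theorem proj_of_not {G : (Curve N m → Fin N) → Prop} {f : Curve N m ≃ Curve N m}
    (h : ¬ G (rows f)) : proj G (Finsupp.single f 1) = 0 := by
  rw [proj, Finsupp.linearCombination_single, if_neg h, smul_zero]

variable (φ Z) in
/-- The states with a point over `p` on the lift of `c'` in sheet `k` are preserved, the others are
moved to such states through the punctured rectangles. -/
noncomputable def retract (c c' p : Fin N) (k : ZMod m) : States N m →ₗ[ℤ] States N m :=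
  proj (fun ρ => ρ (c', k) = p ∧ ρ (c, k) ≠ p) +
    S.op φ (Z.Sector c' p k) ∘ₗ S.op φ (Z.Puncture c' p k)

theorem op_puncture_of_not (C : Z.Corner c c' p q) (hj : ∀ i k, Z.Joined i (c, k) (c', k))
    {f : Curve N m ≃ Curve N m} (h : ¬ CycIoo (rows f (c, k)) (rows f (c', k)) p) :
    S.op φ (Z.Puncture c' p k) (Finsupp.single f 1) = 0 := by
  refine S.op_eq_zero ?_
  rintro l r ⟨rfl, R, e⟩
  by_cases h1 : l.1 = c
  · rw [(R.base.unique_left (hj _ k) h1 : l = (c, k))] at e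
    exact h e
  · have h2 := (C.rect_right hj R h1).2
    refine h ?_
    simp only [cycIoo_iff] at *
    omega

theorem op_sector_add_hexagon (C : Z.Corner c c' p q) (hj : ∀ i k, Z.Joined i (c, k) (c', k)) :
    S.op φ (Z.Sector c p k) ∘ₗ (LinearMap.id + S.hexagon φ Z c c' p (· ≠ p) k) =
      S.exchange φ (c, k) (c', k) ∘ₗ S.retract φ Z c c' p k := by
  refine hom_ext fun f => ?_
  simp only [LinearMap.comp_apply, LinearMap.add_apply, LinearMap.id_apply, hexagon, retract]
  by_cases hp : rows f (c', k) = p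
  · have h0 : ¬ CycIoo (rows f (c, k)) (rows f (c', k)) p := fun h => ne_of_cycIoo_right h hp.symm
    rw [S.op_dent_of_not h0, S.op_puncture_of_not C hj h0]
    by_cases hs : rows f (c, k) = p
    · rw [proj_of_not (by tauto), map_zero, map_zero, add_zero, add_zero, map_zero, S.op_eq_zero]
      · rintro l r ⟨rfl, R, e⟩
        exact R.row (hs.trans e.symm)
    · rw [proj_of ⟨hp, hs⟩]
      simp only [map_zero, add_zero]
      refine S.op_unique fun l r => ⟨?_, ?_⟩
      · rintro ⟨rfl, R, e⟩
        refine ⟨rfl, ?_⟩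
        by_contra h1
        have h2 : r.1 ≠ c' := fun h2 => h1 (R.base.unique (hj _ k) h2)
        exact (R.empty (c', k) (C.cycIoo_c' R.col.symm h2) (hj _ _)).2.1 (hp.trans e.symm)
      · rintro ⟨rfl, rfl⟩
        exact ⟨rfl, C.rect_side (by rw [hp]; exact hs) (hj _ _), hp⟩
  rw [proj_of_not (by tauto), zero_add]
  by_cases h : CycIoo (rows f (c, k)) (rows f (c', k)) p
  swap
  · rw [S.op_dent_of_not h, S.op_puncture_of_not C hj h, map_zero, map_zero, add_zero,
      S.op_sector_of_not_cycIoo C hj h hp, map_zero]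
  have hs : rows f (c, k) ≠ p := ne_of_cycIoo_left h
  rw [S.op_dent h, S.op_flap_exchange C hj h,
    S.op_add_op_not _ (fun ρ l _ => CycIoo (ρ l) (ρ (c, k)) p),
    S.op_add_op_not (Z.Puncture c' p k) fun _ l _ => l = (c, k)]
  rw [S.op_unique (P := fun ρ l r => Z.Puncture c' p k ρ l r ∧ l = (c, k))
    (a := (c, k)) (b := (c', k))]
  swap
  · intro l r
    constructor
    · rintro ⟨h1, rfl⟩
      exact ⟨rfl, h1.1⟩
    · rintro ⟨rfl, rfl⟩
      refine ⟨⟨rfl, C.rect_side (fun h' => ?_) (hj _ _), h⟩, rfl⟩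
      rw [h'] at h
      simp only [cycIoo_iff] at h
      omega
  rw [S.op_congr (P := fun ρ l r => Z.Puncture c' p k ρ l r ∧ ¬ l = (c, k))
    (Q := fun ρ l r => (r = (c', k) ∧ Z.Rect ρ l r ∧ l.1 ≠ c ∧ ρ l ≠ p) ∧
      CycIoo (ρ l) (ρ (c, k)) p)]
  swap
  · intro l r
    constructor
    · rintro ⟨⟨rfl, R, e⟩, h1⟩
      have h2 : l.1 ≠ c := fun h2 => h1 (R.base.unique_left (hj _ k) h2)
      have h3 := (C.rect_right hj R h2).2
      refine ⟨⟨rfl, R, h2, (ne_of_cycIoo_left e)⟩, ?_⟩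
      simp only [cycIoo_iff] at *
      omega
    · rintro ⟨⟨rfl, R, h2, h1⟩, e⟩
      have h3 := (C.rect_right hj R h2).2
      refine ⟨⟨rfl, R, ?_⟩, ne_of_col h2⟩
      simp only [cycIoo_iff, Fin.ext_iff, ne_eq] at *
      omega
  rw [map_add, map_add, map_add, map_neg, map_add, map_add]
  rw [S.op_sector_of_cycIoo C hj h]
  congr 1
  have key : ∀ {A : Set (Curve N m ≃ Curve N m)} {x : States N m}, x ∈ span A →
      (∀ g ∈ A, rows g (c, k) ≠ p) → (∀ g ∈ A, CycIoo (rows g (c', k)) (rows g (c, k)) p) →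
      S.op φ (Z.Sector c p k) (S.exchange φ (c, k) (c', k) x) =
        -S.exchange φ (c, k) (c', k) (S.op φ (Z.Sector c' p k) x) := by
    intro A x hx h1 h2
    refine span_eq (S.op φ (Z.Sector c p k) ∘ₗ S.exchange φ (c, k) (c', k))
      (-(S.exchange φ (c, k) (c', k) ∘ₗ S.op φ (Z.Sector c' p k))) (fun g hg => ?_) hx
    simp only [LinearMap.comp_apply, LinearMap.neg_apply]
    rw [exchange_single, map_smul, S.op_sector_of_cycIoo C hj, ← map_smul, ← map_smul, ← map_smul,
      ← exchange_single, S.exchange_exchange_self C.mk_ne, map_neg, map_neg]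
    rw [rows_trans_swap, exch_left, exch_right]
    exact h2 g hg
  have key' : ∀ {A : Set (Curve N m ≃ Curve N m)} {x : States N m}, x ∈ span A →
      (∀ g ∈ A, rows g (c, k) ≠ p) → (∀ g ∈ A, ¬ CycIoo (rows g (c', k)) (rows g (c, k)) p) →
      S.op φ (Z.Sector c p k) (S.exchange φ (c, k) (c', k) x) = 0 := by
    intro A x hx h1 h2
    refine span_eq (S.op φ (Z.Sector c p k) ∘ₗ S.exchange φ (c, k) (c', k)) 0 (fun g hg => ?_) hx
    simp only [LinearMap.comp_apply, LinearMap.zero_apply]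
    rw [exchange_single, map_smul, S.op_sector_of_not_cycIoo C hj, smul_zero]
    · rw [rows_trans_swap, exch_left, exch_right]
      exact h2 g hg
    · rw [rows_trans_swap, exch_right]
      exact h1 g hg
  have hf : Finsupp.single f 1 ∈ span {f} := Finsupp.single_mem_supported ℤ _ rfl
  have h1 := S.op_mem φ (P := fun ρ l r => (r = (c', k) ∧ Z.Rect ρ l r ∧ l.1 ≠ c ∧ ρ l ≠ p) ∧
      CycIoo (ρ l) (ρ (c, k)) p)
    (B := {g | rows g (c, k) ≠ p ∧ CycIoo (rows g (c', k)) (rows g (c, k)) p}) (by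
      rintro g rfl l r ⟨⟨rfl, R, h2, h3⟩, h4⟩
      rw [Set.mem_ofPred_eq, rows_trans_swap, exch_right, exch_ne _ (ne_of_col (Ne.symm h2)) C.mk_ne]
      exact ⟨hs, h4⟩) hf
  have h2 := S.op_mem φ (P := fun ρ l r => (r = (c', k) ∧ Z.Rect ρ l r ∧ l.1 ≠ c ∧ ρ l ≠ p) ∧
      ¬ CycIoo (ρ l) (ρ (c, k)) p)
    (B := {g | rows g (c, k) ≠ p ∧ ¬ CycIoo (rows g (c', k)) (rows g (c, k)) p}) (by
      rintro g rfl l r ⟨⟨rfl, R, h2, h3⟩, h4⟩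
      rw [Set.mem_ofPred_eq, rows_trans_swap, exch_right, exch_ne _ (ne_of_col (Ne.symm h2)) C.mk_ne]
      exact ⟨hs, h4⟩) hf
  rw [key h1 (fun g hg => hg.1) fun g hg => hg.2,
    key' h2 (fun g hg => hg.1) fun g hg => hg.2, add_zero, neg_neg]

end SignAssignment
end GridCover

namespace GridCover

open Sheets

namespace Sheets

variable {N m : ℕ} {Z : Sheets N m} {ρ : Curve N m → Fin N} {l r : Curve N m} {c c' p q d : Fin N}
  {k : ZMod m}

/-- A rectangle with upper edge on `p` does not cross the column `d`. -/
theorem Corner.not_cycIco_col (C : Z.Corner c c' p q) (hd : Z.M d q) (h : Z.Rect ρ l r)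
    (hr : ρ r = p) : ¬ CycIco l.1 r.1 d :=
  fun h' => h.free d h' q (by rw [hr]; exact C.cycIco_q (hr ▸ h.row)) hd

theorem Corner.col_ne (C : Z.Corner c c' p q) {i : Fin N} (hd : Z.M d i) : d ≠ c :=
  fun h => C.col_c _ (h ▸ hd)

theorem Corner.cycIco_c_d (C : Z.Corner c c' p q) {i : Fin N} (hd : Z.M d i) : CycIco c' c d := by
  have := C.col
  have := C.col_ne hd
  have := d.2
  simp only [cycIco_iff, Fin.ext_iff, ne_eq] at *
  omega

theorem Corner.plain_left_bad (C : Z.Corner c c' p q) (hd : Z.M d q) (h : Z.Plain c p q ρ l r)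
    (hk : ρ (c, k) = p) : Bad c c' p d ∅ (exch ρ l r) := by
  by_cases hl : (c, k) = l
  · subst hl
    exact absurd (cycIco_self h.1.row) (hk ▸ h.2.1 (cycIco_self h.1.col))
  by_cases hr : (c, k) = r
  · subst hr
    refine ⟨l, fun h' => absurd h' h.1.col, by rw [exch_left, hk], ?_⟩
    have h1 := C.not_cycIco_col hd h.1 hk
    have h2 := C.col_ne hd
    have h3 : l.1 ≠ c' := fun h' => C.not_around h.1 h' rfl
    have := h.1.col
    have := C.col
    have := d.2
    have := l.1.2
    simp only [cycIco_iff, Fin.ext_iff, ne_eq] at *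
    omega
  · exact ⟨(c, k), fun _ => Set.notMem_empty _, by rw [exch_ne _ hl hr, hk], C.cycIco_c_d hd⟩

theorem Corner.puncture_bad (hd : Bad c c' p d ∅ ρ) (h : Z.Puncture c' p k ρ l r) :
    Bad c c' p d ∅ (exch ρ l r) := by
  obtain ⟨b, h1, h2, h3⟩ := hd
  obtain ⟨rfl, R, e⟩ := h
  refine ⟨b, h1, ?_, h3⟩
  rw [exch_ne, h2]
  · rintro rfl
    exact ne_of_cycIoo_left e h2
  · rintro rfl
    simp only [cycIco_iff] at h3
    omega

theorem Corner.sector_bad (C : Z.Corner c c' p q) (hM : Z.M d q) (hd : Bad c c' p d ∅ ρ)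
    (h : Z.Sector c' p k ρ l r) : Bad c c' p d ∅ (exch ρ l r) := by
  obtain ⟨b, h1, h2, h3⟩ := hd
  obtain ⟨rfl, R, e⟩ := h
  refine ⟨b, h1, ?_, h3⟩
  rw [exch_ne, h2]
  · rintro rfl
    exact R.row (h2.trans e.symm)
  · rintro rfl
    exact C.not_cycIco_col hM R e h3

theorem Corner.plain_ne_right (C : Z.Corner c c' p q) (hc : Z.M c' p) (h : Z.Plain c p q ρ l r)
    (hk : ρ (c', k) = p) : (c', k) ≠ l ∧ (c', k) ≠ r := by
  constructor
  · rintro rfl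
    exact h.1.free _ (cycIco_self h.1.col) _ (hk ▸ cycIco_self h.1.row) hc
  · rintro rfl
    exact h.2.2 (C.cycIco_c h.1.col) (hk ▸ C.cycIco_q (hk ▸ h.1.row))

theorem Corner.plain_right_iff (C : Z.Corner c c' p q) (hk : ρ (c', k) ≠ p) :
    Z.Plain c p q ρ l r ∧ exch ρ l r (c', k) = p ↔ Z.Sector c' p k ρ l r := by
  constructor
  · rintro ⟨h, h1⟩
    by_cases hl : (c', k) = l
    · subst hl
      rw [exch_left] at h1
      exact ⟨rfl, h.1, h1⟩
    by_cases hr : (c', k) = r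
    · subst hr
      rw [exch_right] at h1
      exact absurd (cycIco_self h.1.row) (h1 ▸ h.2.1 (C.cycIco_c h.1.col))
    · rw [exch_ne _ hl hr] at h1
      exact absurd h1 hk
  · rintro ⟨rfl, h, h1⟩
    exact ⟨⟨h, fun h' => absurd h' C.not_cycIco_c, fun h' => absurd h' C.not_cycIco_c⟩, by
      rw [exch_left, h1]⟩

end Sheets

namespace SignAssignment

variable {N m : ℕ} [NeZero m] (S : SignAssignment (m * N)) {φ : Framing N m} {Z : Sheets N m}
  {c c' p q d : Fin N} {k : ZMod m}

theorem proj_op (G : (Curve N m → Fin N) → Prop)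
    (P : (Curve N m → Fin N) → Curve N m → Curve N m → Prop) (f : Curve N m ≃ Curve N m) :
    proj G (S.op φ P (Finsupp.single f 1)) =
      S.op φ (fun ρ l r => P ρ l r ∧ G (exch ρ l r)) (Finsupp.single f 1) := by
  classical
  rw [op_single, op_single, map_sum]
  refine Finset.sum_congr rfl fun l _ => ?_
  rw [map_sum]
  refine Finset.sum_congr rfl fun r _ => ?_
  by_cases h1 : P (rows f) l r
  · by_cases h2 : G (exch (rows f) l r)
    · rw [if_pos h1, if_pos ⟨h1, h2⟩, exchange_single, map_smul, proj_of]
      exact h2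
    · rw [if_pos h1, if_neg fun h => h2 h.2, exchange_single, map_smul, proj_of_not, smul_zero]
      exact h2
  · rw [if_neg h1, if_neg fun h => h1 h.1, map_zero]

omit [NeZero m] in
theorem proj_mem (G : (Curve N m → Fin N) → Prop) {A B : Set (Curve N m ≃ Curve N m)}
    (h : ∀ f ∈ A, G (rows f) → f ∈ B) {x : States N m} (hx : x ∈ span A) : proj G x ∈ span B := by
  refine span_induction (proj G) _ (fun f hf => ?_) hx
  by_cases h1 : G (rows f)
  · rw [proj_of h1]
    exact Finsupp.single_mem_supported ℤ _ (h f hf h1)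
  · rw [proj_of_not h1]
    exact Submodule.zero_mem _

theorem retract_mem {A A' B : Set (Curve N m ≃ Curve N m)}
    (h : ∀ f ∈ A, rows f (c', k) = p → rows f (c, k) ≠ p → f ∈ B)
    (h1 : ∀ f ∈ A, ∀ l r, Z.Puncture c' p k (rows f) l r → (Equiv.swap l r).trans f ∈ A')
    (h2 : ∀ f ∈ A', ∀ l r, Z.Sector c' p k (rows f) l r → (Equiv.swap l r).trans f ∈ B)
    {x : States N m} (hx : x ∈ span A) : S.retract φ Z c c' p k x ∈ span B :=
  Submodule.add_mem _ (proj_mem _ (fun f hf hG => h f hf hG.1 hG.2) hx)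
    (S.op_mem φ h2 (S.op_mem φ h1 hx))

theorem retract_bad (C : Z.Corner c c' p q) (hd : Z.M d q) {x : States N m}
    (hx : x ∈ span {f : Curve N m ≃ Curve N m | Bad c c' p d ∅ (rows f)}) :
    S.retract φ Z c c' p k x ∈ span {f : Curve N m ≃ Curve N m | Bad c c' p d ∅ (rows f)} :=
  S.retract_mem (fun _ hf _ _ => hf) (fun _ hf _ _ h => Corner.puncture_bad hf h)
    (fun _ hf _ _ h => C.sector_bad hd hf h) hx

theorem op_puncture_of_right {f : Curve N m ≃ Curve N m} (h : rows f (c', k) = p) :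
    S.op φ (Z.Puncture c' p k) (Finsupp.single f 1) = 0 := by
  refine S.op_eq_zero ?_
  rintro l r ⟨rfl, R, e⟩
  exact ne_of_cycIoo_right e h.symm

/-- The boundary operator squares to zero, and the part which leads to the points over `p` on the
lift of `c'` anticommutes with it. -/
theorem op_sector_op_plain (C : Z.Corner c c' p q) (hc : Z.M c' p)
    {x : States N m} (hx : x ∈ span {f : Curve N m ≃ Curve N m |
      Z.Separated c c p ∅ (rows f) ∧ rows f (c', k) ≠ p}) :
    S.op φ (Z.Sector c' p k) (S.op φ (Z.Plain c p q) x) =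
      -S.op φ (Z.Plain c p q) (S.op φ (Z.Sector c' p k) x) := by
  refine span_eq (S.op φ (Z.Sector c' p k) ∘ₗ S.op φ (Z.Plain c p q))
    (-(S.op φ (Z.Plain c p q) ∘ₗ S.op φ (Z.Sector c' p k))) (fun f hf => ?_) hx
  have h1 : ∀ g : Curve N m ≃ Curve N m, rows g (c', k) ≠ p →
      proj (fun ρ => ρ (c', k) = p) (S.op φ (Z.Plain c p q) (Finsupp.single g 1)) =
        S.op φ (Z.Sector c' p k) (Finsupp.single g 1) := by
    intro g hg
    rw [S.proj_op]
    exact S.op_congr fun l r => C.plain_right_iff hg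
  have h2 : ∀ g : Curve N m ≃ Curve N m, rows g (c', k) = p →
      proj (fun ρ => ρ (c', k) = p) (S.op φ (Z.Plain c p q) (Finsupp.single g 1)) =
        S.op φ (Z.Plain c p q) (Finsupp.single g 1) := by
    intro g hg
    rw [S.proj_op]
    refine S.op_congr fun l r => ⟨fun h => h.1, fun h => ⟨h, ?_⟩⟩
    have := C.plain_ne_right hc h hg
    rw [exch_ne _ this.1 this.2, hg]
  have h3 : ∀ g : Curve N m ≃ Curve N m, rows g (c', k) = p →
      S.op φ (Z.Sector c' p k) (Finsupp.single g 1) = 0 := by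
    intro g hg
    refine S.op_eq_zero ?_
    rintro l r ⟨rfl, R, e⟩
    exact R.row (hg.trans e.symm)
  have h4 : proj (fun ρ => ρ (c', k) = p) ∘ₗ S.op φ (Z.Plain c p q) =
      S.op φ (Z.Sector c' p k) + S.op φ (Z.Plain c p q) ∘ₗ proj (fun ρ => ρ (c', k) = p) := by
    refine hom_ext fun g => ?_
    simp only [LinearMap.comp_apply, LinearMap.add_apply]
    by_cases hg : rows g (c', k) = p
    · rw [h2 g hg, h3 g hg, proj_of hg, zero_add]
    · rw [h1 g hg, proj_of_not hg, map_zero, add_zero]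
  have h5 := congrArg (fun F : States N m →ₗ[ℤ] States N m =>
    F (S.op φ (Z.Plain c p q) (Finsupp.single f 1))) h4
  simp only [LinearMap.comp_apply, LinearMap.add_apply] at h5
  rw [S.op_plain_op_plain C f hf.1, map_zero, h1 f hf.2] at h5
  exact eq_neg_of_add_eq_zero_left h5.symm

theorem retract_op_plain (C : Z.Corner c c' p q) (hj : ∀ i k, Z.Joined i (c, k) (c', k))
    (hc : Z.M c' p) (hd : Z.M d q) {f : Curve N m ≃ Curve N m}
    (hf : Z.Separated c c p ∅ (rows f))
    (hP : ∀ l r, Z.Puncture c' p k (rows f) l r → Z.Separated c c p ∅ (exch (rows f) l r)) :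
    S.retract φ Z c c' p k (S.op φ (Z.Plain c p q) (Finsupp.single f 1)) -
        S.op φ (Z.Plain c p q) (S.retract φ Z c c' p k (Finsupp.single f 1)) ∈
      span {g : Curve N m ≃ Curve N m | Bad c c' p d ∅ (rows g)} := by
  have hself : Finsupp.single f 1 ∈ span {f} := Finsupp.single_mem_supported ℤ _ rfl
  have hw : ∀ {x : States N m}, x ∈ span {g | rows g (c, k) = p} →
      S.op φ (Z.Plain c p q) x ∈ span {g : Curve N m ≃ Curve N m | Bad c c' p d ∅ (rows g)} :=
    fun hx => S.op_mem φ (fun g hg l r h => C.plain_left_bad hd h hg) hx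
  by_cases hs : rows f (c, k) = p
  · refine Submodule.sub_mem _ (S.retract_bad C hd (hw (Finsupp.single_mem_supported ℤ _ hs)))
      (hw (S.retract_mem (A := {g | rows g (c, k) = p}) (A' := {g | rows g (c, k) = p})
        (fun _ hg _ _ => hg) ?_ ?_ (Finsupp.single_mem_supported ℤ _ hs)))
    · rintro g hg l r ⟨rfl, R, e⟩
      rw [Set.mem_ofPred_eq, rows_trans_swap, exch_ne _ _ C.mk_ne, hg]
      rintro rfl
      exact ne_of_cycIoo_left e hg
    · rintro g hg l r ⟨rfl, R, e⟩
      rw [Set.mem_ofPred_eq, rows_trans_swap, exch_ne _ C.mk_ne, hg]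
      exact ne_of_col (C.not_around R rfl).symm
  by_cases hp : rows f (c', k) = p
  · have h1 : S.retract φ Z c c' p k (Finsupp.single f 1) = Finsupp.single f 1 := by
      rw [retract, LinearMap.add_apply, LinearMap.comp_apply, S.op_puncture_of_right hp, map_zero,
        add_zero, proj_of ⟨hp, hs⟩]
    have h2 : S.op φ (Z.Plain c p q) (Finsupp.single f 1) ∈ span {g | rows g (c', k) = p} := by
      refine S.op_mem φ (A := {g | rows g (c', k) = p}) (fun g hg l r h => ?_)
        (Finsupp.single_mem_supported ℤ _ hp)
      have := C.plain_ne_right hc h hg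
      rw [Set.mem_ofPred_eq, rows_trans_swap, exch_ne _ this.1 this.2]
      exact hg
    rw [h1]
    refine span_induction (S.retract φ Z c c' p k - LinearMap.id) _ (fun g hg => ?_) h2
    rw [LinearMap.sub_apply, retract, LinearMap.add_apply, LinearMap.comp_apply,
      S.op_puncture_of_right hg, map_zero, add_zero, LinearMap.id_apply]
    by_cases h3 : rows g (c, k) = p
    · rw [proj_of_not (by tauto), zero_sub, Submodule.neg_mem_iff]
      exact Finsupp.single_mem_supported ℤ _ ⟨(c, k), fun _ => Set.notMem_empty _, h3,
        C.cycIco_c_d hd⟩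
    · rw [proj_of ⟨hg, h3⟩, sub_self]
      exact Submodule.zero_mem _
  have key := S.op_puncture_add (φ := φ) C hc hd f (j := k) hf (fun i => hj i k) hs hp
  have k1 := S.op_mem φ (P := Z.Sector c' p k)
    (B := {g : Curve N m ≃ Curve N m | Bad c c' p d ∅ (rows g)}) (fun g hg l r h => (by
      by_contra h1
      refine hg ⟨fun h2 => h1 (C.sector_bad hd h2 h), fun h2 => ?_⟩
      obtain ⟨rfl, R, e⟩ := h
      exact R.row (h2.trans e.symm))) key
  rw [map_add, map_add] at k1
  have k2 := S.op_sector_op_plain (φ := φ) (k := k) C hc (x := S.op φ (Z.Puncture c' p k)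
    (Finsupp.single f 1)) (S.op_mem φ (A := {f}) (by
      rintro g rfl l r h
      refine ⟨hP l r h, ?_⟩
      rw [rows_trans_swap]
      obtain ⟨rfl, R, e⟩ := h
      rw [exch_right]
      exact ne_of_cycIoo_left e) hself)
  have k3 : proj (fun ρ => ρ (c', k) = p ∧ ρ (c, k) ≠ p)
      (S.op φ (Z.Plain c p q) (Finsupp.single f 1)) - S.op φ (Z.Sector c' p k) (Finsupp.single f 1) ∈
        span {g : Curve N m ≃ Curve N m | Bad c c' p d ∅ (rows g)} := by
    have h1 : S.op φ (Z.Sector c' p k) (Finsupp.single f 1) =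
        proj (fun ρ => ρ (c', k) = p) (S.op φ (Z.Plain c p q) (Finsupp.single f 1)) := by
      rw [S.proj_op]
      exact S.op_congr fun l r => (C.plain_right_iff hp).symm
    rw [h1, ← LinearMap.sub_apply]
    refine span_induction (A := Set.univ) _ _ (fun g _ => ?_) (by simp [span])
    rw [LinearMap.sub_apply]
    by_cases h2 : rows g (c', k) = p
    · by_cases h3 : rows g (c, k) = p
      · rw [proj_of_not (by tauto), zero_sub, Submodule.neg_mem_iff, proj_of h2]
        exact Finsupp.single_mem_supported ℤ _ ⟨(c, k), fun _ => Set.notMem_empty _, h3,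
          C.cycIco_c_d hd⟩
      · rw [proj_of ⟨h2, h3⟩, proj_of h2, sub_self]
        exact Submodule.zero_mem _
    · rw [proj_of_not (by tauto), proj_of_not h2, sub_self]
      exact Submodule.zero_mem _
  rw [retract]
  simp only [LinearMap.add_apply, LinearMap.comp_apply]
  rw [proj_of_not (G := fun ρ => ρ (c', k) = p ∧ ρ (c, k) ≠ p) (by tauto), zero_add]
  have := Submodule.add_mem _ k3 k1
  rw [k2] at this
  convert this using 1
  abel

end SignAssignment

namespace Stabilization

variable {n : ℕ} (T : Stabilization n) {m : ℕ}

/-- The states in which each component lies on the lift through its position. -/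
def IsReal (f : Curve (n + 1) m ≃ Curve (n + 1) m) : Prop :=
  ∀ b, f b = T.H.alphaThrough (f b).1 b

variable {T}

theorem labelled_empty {s : Fin (n + 1)} {e : ZMod m → Curve (n + 1) m}
    {f : Curve (n + 1) m ≃ Curve (n + 1) m} : T.Labelled s e ∅ f ↔ T.IsReal f :=
  ⟨fun h b => (h b).2 fun _ => Set.notMem_empty _, fun h b =>
    ⟨fun _ h' => absurd h' (Set.notMem_empty _), fun _ => h b⟩⟩

theorem off_empty {s : Fin (n + 1)} {l r : Curve (n + 1) m} : Off s ∅ l r :=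
  ⟨fun _ => Set.notMem_empty _, fun _ => Set.notMem_empty _⟩

theorem IsReal.separated {f : Curve (n + 1) m ≃ Curve (n + 1) m} (h : T.IsReal f)
    {s : Fin (n + 1)} : (T.sheets m).Separated s T.c₀ T.p ∅ (rows f) :=
  Labelled.separated (e := T.left) (labelled_empty.2 h)

theorem IsReal.exchange {f : Curve (n + 1) m ≃ Curve (n + 1) m} (h : T.IsReal f)
    {l r : Curve (n + 1) m} (hR : (T.sheets m).Rect (rows f) l r)
    (hl : ¬ (rows f l = T.p ∧ CycIco l.1 r.1 T.c₀))
    (hr : ¬ (rows f r = T.p ∧ CycIco l.1 r.1 T.c₀)) : T.IsReal ((Equiv.swap l r).trans f) :=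
  labelled_empty.1 ((labelled_empty (s := T.c₀) (e := T.left).2 h).exchange off_empty
    ((T.alphaThrough_eq_iff_joined hl).2 hR.base)
    ((T.alphaThrough_eq_iff_joined hr).2 (hR.base.flat hR.free)))

theorem IsReal.plain {f : Curve (n + 1) m ≃ Curve (n + 1) m} (h : T.IsReal f)
    {l r : Curve (n + 1) m} (hP : (T.sheets m).Plain T.c₀ T.p T.q.castSucc (rows f) l r) :
    T.IsReal ((Equiv.swap l r).trans f) :=
  labelled_empty.1 (((labelled_empty (s := T.c₀) (e := T.left)).2 h).plain off_empty hP)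

theorem IsReal.puncture {f : Curve (n + 1) m ≃ Curve (n + 1) m} (h : T.IsReal f) {k : ZMod m}
    {l r : Curve (n + 1) m} (hP : (T.sheets m).Puncture (T.c₀ + 1) T.p k (rows f) l r) :
    T.IsReal ((Equiv.swap l r).trans f) :=
  h.exchange hP.2.1 (fun h' => ne_of_cycIoo_left hP.2.2 h'.1)
    fun h' => ne_of_cycIoo_right hP.2.2 h'.1.symm

theorem IsReal.sector {f : Curve (n + 1) m ≃ Curve (n + 1) m} (h : T.IsReal f) {k : ZMod m}
    {l r : Curve (n + 1) m} (hP : (T.sheets m).Sector (T.c₀ + 1) T.p k (rows f) l r) :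
    T.IsReal ((Equiv.swap l r).trans f) := by
  obtain ⟨rfl, R, e⟩ := hP
  have C := T.corner (m := m)
  exact h.exchange R (fun h' => C.not_cycIco_c h'.2) fun h' => C.not_cycIco_c h'.2

/-- If points on the curves `g k` have the labels over `p` of all sheets, then every point whose label
is the one of its position on `p` is one of them. -/
theorem eq_of_label {f : Curve (n + 1) m ≃ Curve (n + 1) m} {g : ZMod m → Curve (n + 1) m}
    {s : Fin (n + 1)} (h : ∀ k, f (g k) = T.H.alphaThrough T.p (s, k)) {b : Curve (n + 1) m}
    (hb : f b = T.H.alphaThrough T.p b) : ∃ k, b = g k := by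
  refine ⟨(T.H.alphaThrough T.p b).2 + (T.H.sheetShift T.p s : ZMod m), f.injective ?_⟩
  rw [h, hb]
  simp [Grid.alphaThrough]

theorem IsReal.row_iff {f : Curve (n + 1) m ≃ Curve (n + 1) m} (h : T.IsReal f)
    (hv : ∀ k, rows f (T.right k) = T.p) (b : Curve (n + 1) m) :
    rows f b = T.p ↔ b.1 = T.c₀ + 1 := by
  constructor
  · intro hb
    obtain ⟨k, rfl⟩ := eq_of_label (T := T) (g := T.right) (s := T.c₀ + 1)
      (fun k => by rw [h (T.right k), ← hv k]; rfl) (by rw [h b, ← hb]; rfl)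
    rfl
  · intro hb
    rw [(Prod.ext hb rfl : b = T.right b.2)]
    exact hv _

theorem IsReal.not_bad {f : Curve (n + 1) m ≃ Curve (n + 1) m} (h : T.IsReal f) {d : Fin (n + 1)}
    (hv : ∀ k, rows f (T.right k) = T.p) : ¬ Bad T.c₀ (T.c₀ + 1) T.p d ∅ (rows f) := by
  rintro ⟨b, -, h1, h2⟩
  rw [(h.row_iff hv b).1 h1] at h2
  simp only [cycIco_iff] at h2
  omega

variable [NeZero m] (S : SignAssignment (m * (n + 1))) {φ : Framing (n + 1) m}

open SignAssignment

/-- The real states with points over `p` on the right circles in the sheets of `J`. -/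
def rightStates (T : Stabilization n) (J : Set (ZMod m)) : Set (Curve (n + 1) m ≃ Curve (n + 1) m) :=
  {f | T.IsReal f ∧ ∀ k ∈ J, rows f (T.right k) = T.p}

theorem retract_rightStates {k : ZMod m} {J : Set (ZMod m)} {x : States (n + 1) m}
    (hx : x ∈ span (T.rightStates J)) :
    S.retract φ (T.sheets m) T.c₀ (T.c₀ + 1) T.p k x ∈ span (T.rightStates (insert k J)) := by
  refine S.retract_mem (A' := T.rightStates (J \ {k})) ?_ ?_ ?_ hx
  · rintro f ⟨hf, hf'⟩ h1 h2
    refine ⟨hf, ?_⟩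
    rintro j (rfl | hj)
    exacts [h1, hf' j hj]
  · rintro f ⟨hf, hf'⟩ l r h
    refine ⟨hf.puncture h, fun j hj => ?_⟩
    obtain ⟨rfl, R, e⟩ := h
    rw [rows_trans_swap, exch_ne, hf' j hj.1]
    · exact ne_of_col R.col.symm
    · exact fun h' => hj.2 (congrArg Prod.snd h')
  · rintro f ⟨hf, hf'⟩ l r h
    refine ⟨hf.sector h, ?_⟩
    obtain ⟨rfl, R, e⟩ := h
    rw [rows_trans_swap]
    intro j hj
    by_cases hjk : j = k
    · subst hjk
      exact (exch_left _ _ _).trans e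
    · rw [exch_ne, hf' j ⟨hj.resolve_left hjk, hjk⟩]
      · exact fun h' => hjk (congrArg Prod.snd h')
      · exact ne_of_col R.col

variable (φ) in
/-- The boundary operator on states. -/
noncomputable def plainOp (T : Stabilization n) : States (n + 1) m →ₗ[ℤ] States (n + 1) m :=
  S.op φ ((T.sheets m).Plain T.c₀ T.p T.q.castSucc)

variable (φ) in
/-- The operator `retract` for the sheet `k`. -/
noncomputable def retractOp (T : Stabilization n) (k : ZMod m) :
    States (n + 1) m →ₗ[ℤ] States (n + 1) m :=
  S.retract φ (T.sheets m) T.c₀ (T.c₀ + 1) T.p k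

omit [NeZero m] in
theorem mem_rightStates {x : States (n + 1) m} (hx : x ∈ span {f | T.IsReal f}) :
    x ∈ span (T.rightStates ∅) :=
  Finsupp.supported_mono (s := {f | T.IsReal f}) (t := T.rightStates ∅)
    (fun _ hf => ⟨hf, fun _ hk => absurd hk (Set.notMem_empty _)⟩) hx

theorem retractOp_plainOp {d : Fin (n + 1)} (hd : (T.sheets m).M d T.q.castSucc)
    (hc : (T.sheets m).M (T.c₀ + 1) T.p) (k : ZMod m) {x : States (n + 1) m}
    (hx : x ∈ span {f | T.IsReal f}) :
    T.retractOp S φ k (T.plainOp S φ x) - T.plainOp S φ (T.retractOp S φ k x) ∈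
      span {f : Curve (n + 1) m ≃ Curve (n + 1) m | Bad T.c₀ (T.c₀ + 1) T.p d ∅ (rows f)} := by
  refine span_induction (T.retractOp S φ k ∘ₗ T.plainOp S φ - T.plainOp S φ ∘ₗ T.retractOp S φ k) _
    (fun f hf => ?_) hx
  have hP : ∀ l r, (T.sheets m).Puncture (T.c₀ + 1) T.p k (rows f) l r →
      (T.sheets m).Separated T.c₀ T.c₀ T.p ∅ (exch (rows f) l r) := by
    intro l r h
    rw [← rows_trans_swap]
    exact (IsReal.puncture hf h).separated
  have hj : ∀ (i : Fin (n + 1)) (k : ZMod m), (T.sheets m).Joined i (T.c₀, k) (T.c₀ + 1, k) :=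
    T.joined_left_right
  have hs : (T.sheets m).Separated T.c₀ T.c₀ T.p ∅ (rows f) := IsReal.separated hf
  have key := S.retract_op_plain (φ := φ) (k := k) T.corner hj hc hd hs hP
  rw [LinearMap.sub_apply, LinearMap.comp_apply, LinearMap.comp_apply]
  exact key

/-- The operators `retract` together commute with the boundary operator. -/
theorem chain_retractOp_plainOp (hc : (T.sheets m).M (T.c₀ + 1) T.p) {L : List (ZMod m)}
    (hL : L.Nodup) (hL' : ∀ k, k ∈ L) {x : States (n + 1) m} (hx : x ∈ span {f | T.IsReal f}) :
    chain (T.retractOp S φ) L (T.plainOp S φ x) = T.plainOp S φ (chain (T.retractOp S φ) L x) := by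
  have C := T.corner (m := m)
  obtain ⟨d, hd⟩ := C.rowM T.q.castSucc
  have hA : ∀ (k : ZMod m) (J : Set (ZMod m)), k ∉ J → ∀ x ∈ span (T.rightStates J),
      T.retractOp S φ k x ∈ span (T.rightStates (insert k J)) :=
    fun k J _ x hx => retract_rightStates S hx
  have h1 := chain_comm_mem (A := fun J => span (T.rightStates J))
    (B := fun _ => span {f : Curve (n + 1) m ≃ Curve (n + 1) m |
      Bad T.c₀ (T.c₀ + 1) T.p d ∅ (rows f)})
    (d := fun _ => T.plainOp S φ) 1 hA (fun k J _ x hx => S.retract_bad C hd hx)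
    (fun k J _ x hx => by
      rw [one_smul]
      exact retractOp_plainOp S hd hc k (Finsupp.supported_mono (fun f hf => hf.1) hx))
    hL (mem_rightStates hx)
  have h2 : span (T.rightStates {k | k ∈ L}) ⊓ span {f : Curve (n + 1) m ≃ Curve (n + 1) m |
      Bad T.c₀ (T.c₀ + 1) T.p d ∅ (rows f)} = ⊥ := by
    rw [span, span, ← Finsupp.supported_inter, ← Finsupp.supported_empty]
    congr 1
    ext f
    exact ⟨fun h => (h.1.1.not_bad fun k => h.1.2 k (hL' k)) h.2, fun h => h.elim⟩
  rw [← sub_eq_zero, ← Submodule.mem_bot ℤ, ← h2]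
  rw [one_pow, one_smul] at h1
  have h3 : T.plainOp S φ x ∈ span {f | T.IsReal f} :=
    S.op_mem φ (A := {f | T.IsReal f}) (fun f hf l r h => IsReal.plain hf h) hx
  refine ⟨Submodule.sub_mem _ (chain_mem hA hL (mem_rightStates h3))
    (S.op_mem φ (A := T.rightStates {k | k ∈ L}) ?_ (chain_mem hA hL (mem_rightStates hx))), h1⟩
  rintro f ⟨hf, hf'⟩ l r h
  refine ⟨hf.plain h, fun k hk => ?_⟩
  have := C.plain_ne_right hc h (hf' k hk)
  rw [rows_trans_swap]
  exact (exch_ne _ this.1 this.2).trans (hf' k hk)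

end Stabilization
end GridCover

namespace GridCover

open Sheets

namespace Sheets

variable {N m : ℕ} {Z : Sheets N m} {ρ : Curve N m → Fin N} {l r : Curve N m} {c c' p q d : Fin N}
  {k : ZMod m}

/-- A rectangle with sides off `c` in which the points on the lifts of `c` are disregarded. -/
structure Reduced (Z : Sheets N m) (c : Fin N) (ρ : Curve N m → Fin N) (l r : Curve N m) :
    Prop where
  left : l.1 ≠ c
  right : r.1 ≠ c
  col : l.1 ≠ r.1
  row : ρ l ≠ ρ r
  base : Z.Joined (ρ l) l r
  free : ∀ x, CycIco l.1 r.1 x → ∀ i, CycIco (ρ l) (ρ r) i → ¬ Z.M x i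
  empty : ∀ b, b.1 ≠ c → CycIoo l.1 r.1 b.1 → Z.Joined (ρ l) l b →
    ρ b ≠ ρ l ∧ ρ b ≠ ρ r ∧ ¬ CycIoo (ρ l) (ρ r) (ρ b)

theorem Corner.reduced_iff_left (C : Z.Corner c c' p q) {a : Fin N} (ha : Z.M a p)
    (hac : ∀ x, x ≠ c → CycIco x c a) (hρ : ∀ b, ρ b = p ↔ b.1 = c) :
    Z.Plain c p q ρ l r ∧ l.1 ≠ c ∧ r.1 ≠ c ↔ Z.Reduced c ρ l r := by
  constructor
  · rintro ⟨⟨h, -, -⟩, h1, h2⟩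
    exact ⟨h1, h2, h.col, h.row, h.base, h.free, fun b _ => h.empty b⟩
  · intro h
    have h1 : ρ l ≠ p := fun h' => h.left ((hρ l).1 h')
    have h2 : ρ r ≠ p := fun h' => h.right ((hρ r).1 h')
    have h3 : CycIco l.1 r.1 c → ¬ CycIco (ρ l) (ρ r) p := by
      intro h3 h4
      refine h.free a ?_ p h4 ha
      have h5 := hac _ h.left
      have := h.left
      simp only [cycIco_iff, Fin.ext_iff, ne_eq] at *
      omega
    refine ⟨⟨⟨h.col, h.row, h.base, h.free, fun b hb jb => ?_⟩, h3, fun h4 h5 => ?_⟩, h.left,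
      h.right⟩
    · by_cases hbc : b.1 = c
      · have h4 := h3 (hbc ▸ hb.2)
        rw [(hρ b).2 hbc]
        exact ⟨h1.symm, h2.symm, fun h5 => h4 h5.2⟩
      · exact h.empty b hbc hb jb
    · have h6 := h3 h4
      have := C.row
      have := (ρ l).2
      have := (ρ r).2
      simp only [cycIco_iff, Fin.ext_iff, ne_eq] at *
      omega

theorem swap_cases (c c' x : Fin N) (h : x ≠ c') :
    (x = c ∧ Equiv.swap c c' x = c') ∨ (x ≠ c ∧ Equiv.swap c c' x = x) := by
  by_cases hx : x = c
  · subst hx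
    exact .inl ⟨rfl, Equiv.swap_apply_left _ _⟩
  · exact .inr ⟨hx, Equiv.swap_apply_of_ne_of_ne hx h⟩

/-- The exchange of the lifts of `c` and `c'`. -/
def reflect (c c' : Fin N) (b : Curve N m) : Curve N m := (Equiv.swap c c' b.1, b.2)

theorem reflect_cases (c c' : Fin N) {b : Curve N m} (h : b.1 ≠ c') :
    (∃ k, b = (c, k) ∧ reflect c c' b = (c', k)) ∨ (b.1 ≠ c ∧ reflect c c' b = b) := by
  rcases swap_cases c c' b.1 h with ⟨h1, h2⟩ | ⟨h1, h2⟩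
  · exact .inl ⟨b.2, Prod.ext h1 rfl, by rw [reflect, h2]⟩
  · exact .inr ⟨h1, by rw [reflect, h2]⟩

theorem reflect_reflect (c c' : Fin N) (b : Curve N m) : reflect c c' (reflect c c' b) = b := by
  simp [reflect]

theorem Corner.joined_reflect (C : Z.Corner c c' p q) (hj : ∀ i k, Z.Joined i (c, k) (c', k))
    {i : Fin N} (hl : l.1 ≠ c') (hr : r.1 ≠ c') (h : l.1 ≠ r.1) :
    Z.Joined i (reflect c c' l) (reflect c c' r) ↔ Z.Joined i l r := by
  rcases reflect_cases c c' hl with ⟨k, rfl, h1⟩ | ⟨h1, h2⟩ <;>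
    rcases reflect_cases c c' hr with ⟨k', rfl, h3⟩ | ⟨h3, h4⟩
  · exact absurd rfl h
  · rw [h1, h4]
    exact ⟨fun h5 => (hj i k).trans h5 (C.cycIoo_c' h3 hr),
      fun h5 => (hj i k).cancel_left h5 (C.cycIoo_c' h3 hr)⟩
  · rw [h2, h3]
    exact ⟨fun h5 => h5.cancel_right (hj i k') (C.cycIoo_c h1 hl),
      fun h5 => h5.trans (hj i k') (C.cycIoo_c h1 hl)⟩
  · rw [h2, h4]

theorem Corner.reduced_iff_right (C : Z.Corner c c' p q) (hj : ∀ i k, Z.Joined i (c, k) (c', k))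
    (hc : Z.M c' p) (hρ : ∀ b, ρ b = p ↔ b.1 = c') :
    Z.Plain c p q ρ l r ∧ l.1 ≠ c' ∧ r.1 ≠ c' ↔
      Z.Reduced c (fun b => ρ (reflect c c' b)) (reflect c c' l) (reflect c c' r) := by
  have hflip : ∀ b : Curve N m, (reflect c c' b).1 ≠ c ↔ b.1 ≠ c' := by
    intro b
    rw [reflect, ne_eq, ne_eq, not_iff_not]
    constructor
    · intro h
      rw [← Equiv.swap_apply_self c c' b.1]
      exact (congrArg _ h).trans (Equiv.swap_apply_left _ _)
    · intro h
      exact (congrArg _ h).trans (Equiv.swap_apply_right _ _)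
  have hcol : l.1 ≠ c' → r.1 ≠ c' → l.1 ≠ r.1 → ∀ x, x ≠ c →
      (CycIco (reflect c c' l).1 (reflect c c' r).1 x ↔ CycIco l.1 r.1 x) := by
    intro hl hr h x hx
    have := C.col
    have := l.1.2
    have := r.1.2
    rw [reflect, reflect]
    rcases swap_cases c c' _ hl with ⟨h1, h2⟩ | ⟨h1, h2⟩ <;>
      rcases swap_cases c c' _ hr with ⟨h3, h4⟩ | ⟨h3, h4⟩ <;>
      simp only [h2, h4] <;> simp only [cycIco_iff, Fin.ext_iff, ne_eq] at * <;> omega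
  have hcol' : l.1 ≠ c' → r.1 ≠ c' → l.1 ≠ r.1 → ∀ x, x ≠ c' →
      (CycIoo (reflect c c' l).1 (reflect c c' r).1 (Equiv.swap c c' x) ↔ CycIoo l.1 r.1 x) := by
    intro hl hr h x hx
    have := C.col
    have := l.1.2
    have := r.1.2
    have := x.2
    rw [reflect, reflect]
    rcases swap_cases c c' _ hl with ⟨h1, h2⟩ | ⟨h1, h2⟩ <;>
      rcases swap_cases c c' _ hr with ⟨h3, h4⟩ | ⟨h3, h4⟩ <;>
      rcases swap_cases c c' _ hx with ⟨h5, h6⟩ | ⟨h5, h6⟩ <;>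
      simp only [h2, h4, h6] <;> simp only [cycIoo_iff, Fin.ext_iff, ne_eq] at * <;> omega
  constructor
  · rintro ⟨⟨h, -, -⟩, hl, hr⟩
    refine ⟨(hflip l).2 hl, (hflip r).2 hr, fun h' => h.col ?_, ?_, ?_, ?_, ?_⟩
    · exact (Equiv.swap c c').injective h'
    · simp only [reflect_reflect]; exact h.row
    · simp only [reflect_reflect]
      exact (C.joined_reflect hj hl hr h.col).2 h.base
    · simp only [reflect_reflect]
      intro x hx i hi hM
      exact h.free x ((hcol hl hr h.col x (C.col_ne hM)).1 hx) i hi hM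
    · simp only [reflect_reflect]
      intro b hb h1 h2
      obtain ⟨b, rfl⟩ : ∃ b', b = reflect c c' b' := ⟨_, (reflect_reflect c c' b).symm⟩
      have hb' := (hflip b).1 hb
      have h3 := (hcol' hl hr h.col _ hb').1 h1
      rw [reflect_reflect]
      exact h.empty b h3 ((C.joined_reflect hj hl hb' (ne_of_cycIoo_left h3)).1 h2)
  · rintro ⟨hl, hr, h1, h2, h3, h4, h5⟩
    rw [hflip] at hl hr
    have h1' : l.1 ≠ r.1 := fun h' => h1 (by rw [reflect, reflect, h'])
    simp only [reflect_reflect] at h2 h3 h4 h5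
    have hfree : ∀ x, CycIco l.1 r.1 x → ∀ i, CycIco (ρ l) (ρ r) i → ¬ Z.M x i :=
      fun x hx i hi hM => h4 x ((hcol hl hr h1' x (C.col_ne hM)).2 hx) i hi hM
    have hpl : ρ l ≠ p := fun h' => hl ((hρ l).1 h')
    have hpr : ρ r ≠ p := fun h' => hr ((hρ r).1 h')
    have hp : CycIco l.1 r.1 c ∨ CycIco l.1 r.1 c' → ¬ CycIco (ρ l) (ρ r) p := by
      intro h6 h7
      refine hfree c' ?_ p h7 hc
      have := C.col
      have := l.1.2
      have := r.1.2
      simp only [cycIco_iff, Fin.ext_iff, ne_eq] at *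
      omega
    refine ⟨⟨⟨h1', h2, (C.joined_reflect hj hl hr h1').1 h3, hfree, fun b hb jb => ?_⟩,
      fun h6 => hp (.inl h6), fun h6 h7 => ?_⟩, hl, hr⟩
    · by_cases hbc : b.1 = c'
      · have h6 := hp (.inr (hbc ▸ hb.2))
        rw [(hρ b).2 hbc]
        exact ⟨hpl.symm, hpr.symm, fun h7 => h6 h7.2⟩
      · have h6 := h5 (reflect c c' b) ((hflip b).2 hbc) ((hcol' hl hr h1' _ hbc).2 hb)
          ((C.joined_reflect hj hl hbc (ne_of_cycIoo_left hb)).2 jb)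
        rwa [reflect_reflect] at h6
    · have h8 := hp (.inl h6)
      have := C.row
      have := (ρ l).2
      have := (ρ r).2
      simp only [cycIco_iff, Fin.ext_iff, ne_eq] at *
      omega

/-- The exchanges of the lifts of `c` and `c'` in the sheets of a list. -/
def flips (c c' : Fin N) : List (ZMod m) → Equiv.Perm (Curve N m)
  | [] => 1
  | k :: L => Equiv.swap (c, k) (c', k) * flips c c' L

theorem flips_apply_of_notMem {L : List (ZMod m)} {b : Curve N m} (h : b.2 ∉ L) :
    flips c c' L b = b := by
  induction L with
  | nil => rfl
  | cons a L ih =>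
    simp only [List.mem_cons, not_or] at h
    rw [flips, Equiv.Perm.mul_apply, ih h.2, Equiv.swap_apply_of_ne_of_ne]
    · exact fun h' => h.1 (congrArg Prod.snd h')
    · exact fun h' => h.1 (congrArg Prod.snd h')

theorem flips_apply_of_mem {L : List (ZMod m)} (hL : L.Nodup) {b : Curve N m} (h : b.2 ∈ L) :
    flips c c' L b = reflect c c' b := by
  induction L with
  | nil => simp at h
  | cons a L ih =>
    rw [List.nodup_cons] at hL
    rw [flips, Equiv.Perm.mul_apply]
    by_cases ha : b.2 ∈ L
    · have : a ≠ b.2 := fun h' => hL.1 (h' ▸ ha)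
      rw [ih hL.2 ha, Equiv.swap_apply_of_ne_of_ne]
      · exact fun h' => this (congrArg Prod.snd h').symm
      · exact fun h' => this (congrArg Prod.snd h').symm
    · obtain rfl : b.2 = a := by simpa [ha] using h
      rw [flips_apply_of_notMem ha]
      obtain ⟨x, k⟩ := b
      simp only [reflect]
      by_cases h1 : x = c
      · subst h1; simp
      by_cases h2 : x = c'
      · subst h2; simp
      rw [Equiv.swap_apply_of_ne_of_ne h1 h2, Equiv.swap_apply_of_ne_of_ne]
      · exact fun h' => h1 (congrArg Prod.fst h')
      · exact fun h' => h2 (congrArg Prod.fst h')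

end Sheets

namespace SignAssignment

variable {N m : ℕ} [NeZero m] (S : SignAssignment (m * N)) {φ : Framing N m} {Z : Sheets N m}
  {c c' p q d : Fin N} {k : ZMod m}

theorem op_chain_exchange (h : c ≠ c')
    (Q : (Curve N m → Fin N) → Curve N m → Curve N m → Prop)
    (hQ : ∀ ρ l r, Q ρ l r → l ≠ r) (L : List (ZMod m)) (x : States N m) :
    S.op φ Q (chain (fun k => S.exchange φ (c, k) (c', k)) L x) =
      (-1 : ℤ) ^ L.length • chain (fun k => S.exchange φ (c, k) (c', k)) L
        (S.op φ (fun ρ l r => Q (fun b => ρ ((flips c c' L)⁻¹ b)) (flips c c' L l) (flips c c' L r))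
          x) := by
  induction L generalizing Q with
  | nil => simp [chain, flips]
  | cons a L ih =>
    have hac : ((c, a) : Curve N m) ≠ (c', a) := fun h' => h (congrArg Prod.fst h')
    have h1 : ∀ y, S.op φ Q (S.exchange φ (c, a) (c', a) y) = -S.exchange φ (c, a) (c', a)
        (S.op φ (fun ρ l r => Q (exch ρ (c, a) (c', a)) (Equiv.swap (c, a) (c', a) l)
          (Equiv.swap (c, a) (c', a) r)) y) := by
      intro y
      refine span_eq (A := Set.univ) (S.op φ Q ∘ₗ S.exchange φ (c, a) (c', a))
        (-(S.exchange φ (c, a) (c', a) ∘ₗ S.op φ (fun ρ l r => Q (exch ρ (c, a) (c', a))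
          (Equiv.swap (c, a) (c', a) l) (Equiv.swap (c, a) (c', a) r)))) (fun f _ => ?_)
          (by simp [span])
      refine S.op_exchange_single hac (fun l r => ⟨fun h' => ⟨?_, h'⟩, fun h' => h'.2⟩)
        fun l r h' => hQ _ _ _ h'
      exact fun h'' => hQ _ _ _ h' (h'' ▸ rfl)
    rw [chain, LinearMap.comp_apply, h1, ih]
    · rw [map_smul, ← smul_neg, List.length_cons, pow_succ, mul_smul, neg_one_smul,
        LinearMap.comp_apply]
      rfl
    · exact fun ρ l r h' h'' => hQ _ _ _ h' (h'' ▸ rfl)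

end SignAssignment

namespace Stabilization

variable {n : ℕ} {T : Stabilization n} {m : ℕ} [NeZero m] (S : SignAssignment (m * (n + 1)))
  {φ : Framing (n + 1) m}

open SignAssignment

variable (φ) in
/-- The boundary operator of the cover of `G` on states. -/
noncomputable def reducedOp (T : Stabilization n) : States (n + 1) m →ₗ[ℤ] States (n + 1) m :=
  S.op φ ((T.sheets m).Reduced T.c₀)

variable (φ) in
/-- The exchange of the points on the two circles next to the new markings. -/
noncomputable def sideOp (T : Stabilization n) (k : ZMod m) :
    States (n + 1) m →ₗ[ℤ] States (n + 1) m :=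
  S.exchange φ (T.left k) (T.right k)

theorem reducedOp_chain_sideOp (hc : (T.sheets m).M (T.c₀ + 1) T.p) {L : List (ZMod m)}
    (hL : L.Nodup) (hL' : ∀ k, k ∈ L) {x : States (n + 1) m}
    (hx : x ∈ span {f : Curve (n + 1) m ≃ Curve (n + 1) m |
      ∀ b, rows f b = T.p ↔ b.1 = T.c₀ + 1}) :
    T.reducedOp S φ (chain (T.sideOp S φ) L x) = (-1 : ℤ) ^ L.length • chain (T.sideOp S φ) L
      (S.op φ (fun ρ l r => (T.sheets m).Plain T.c₀ T.p T.q.castSucc ρ l r ∧ l.1 ≠ T.c₀ + 1 ∧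
        r.1 ≠ T.c₀ + 1) x) := by
  have C := T.corner (m := m)
  have hj : ∀ (i : Fin (n + 1)) (k : ZMod m), (T.sheets m).Joined i (T.c₀, k) (T.c₀ + 1, k) :=
    T.joined_left_right
  have h1 := S.op_chain_exchange (φ := φ) C.ne ((T.sheets m).Reduced T.c₀)
    (fun ρ l r h => ne_of_col h.col) L x
  refine h1.trans ?_
  congr 2
  refine span_eq (S.op φ _) (S.op φ _) (fun f hf => S.op_congr fun l r => ?_) hx
  rw [C.reduced_iff_right hj hc hf]
  have h2 : ∀ b, flips T.c₀ (T.c₀ + 1) L b = reflect T.c₀ (T.c₀ + 1) b :=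
    fun b => flips_apply_of_mem hL (hL' _)
  have h3 : ∀ b, (flips T.c₀ (T.c₀ + 1) L)⁻¹ b = reflect T.c₀ (T.c₀ + 1) b := by
    intro b
    rw [Equiv.Perm.inv_eq_iff_eq, h2, reflect_reflect]
  simp only [h2, h3]

variable (φ) in
/-- The sectors in sheet `k`. -/
noncomputable def sectorOp (T : Stabilization n) (k : ZMod m) :
    States (n + 1) m →ₗ[ℤ] States (n + 1) m :=
  S.op φ ((T.sheets m).Sector T.c₀ T.p k)

variable (φ) in
/-- The punctured hexagons in sheet `k` where the row of the obtuse corner satisfies `R`. -/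
noncomputable def hexagonOp (T : Stabilization n) (R : Fin (n + 1) → Prop) (k : ZMod m) :
    States (n + 1) m →ₗ[ℤ] States (n + 1) m :=
  S.hexagon φ (T.sheets m) T.c₀ (T.c₀ + 1) T.p R k

variable (φ) in
/-- A punctured hexagon with obtuse corner off `p` or no hexagon, and then a sector. -/
noncomputable def stepOp (T : Stabilization n) (k : ZMod m) :
    States (n + 1) m →ₗ[ℤ] States (n + 1) m :=
  T.sectorOp S φ k ∘ₗ (LinearMap.id + T.hexagonOp S φ (· ≠ T.p) k)

theorem chain_stepOp_right {L : List (ZMod m)} (hL : L.Nodup) :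
    chain (T.stepOp S φ) L = chain (T.sideOp S φ) L ∘ₗ chain (T.retractOp S φ) L := by
  have C := T.corner (m := m)
  have hj : ∀ (i : Fin (n + 1)) (k : ZMod m), (T.sheets m).Joined i (T.c₀, k) (T.c₀ + 1, k) :=
    T.joined_left_right
  obtain ⟨i, hi⟩ := chain_comp (Y := T.sideOp S φ) (X := T.retractOp S φ) 1 (fun j k h => by
    rw [one_smul]
    unfold sideOp retractOp retract
    have h1 : S.exchange φ (T.left j) (T.right j) ∘ₗ proj (fun ρ => ρ (T.c₀ + 1, k) = T.p ∧
        ρ (T.c₀, k) ≠ T.p) = proj (fun ρ => ρ (T.c₀ + 1, k) = T.p ∧ ρ (T.c₀, k) ≠ T.p) ∘ₗ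
        S.exchange φ (T.left j) (T.right j) := by
      refine hom_ext fun f => ?_
      simp only [LinearMap.comp_apply]
      have e1 : exch (rows f) (T.left j) (T.right j) (T.c₀ + 1, k) = rows f (T.c₀ + 1, k) :=
        exch_ne _ C.mk_ne.symm (mk_ne_left h.symm)
      have e2 : exch (rows f) (T.left j) (T.right j) (T.c₀, k) = rows f (T.c₀, k) :=
        exch_ne _ (mk_ne_left h.symm) C.mk_ne
      by_cases hp : rows f (T.c₀ + 1, k) = T.p ∧ rows f (T.c₀, k) ≠ T.p
      · rw [proj_of hp, exchange_single, map_smul, proj_of]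
        rw [rows_trans_swap, e1, e2]
        exact hp
      · rw [proj_of_not hp, exchange_single, map_smul, proj_of_not, smul_zero, map_zero]
        rw [rows_trans_swap, e1, e2]
        exact hp
    rw [LinearMap.comp_add, LinearMap.add_comp, h1, LinearMap.comp_assoc]
    have h2 := S.op_puncture_exchange (φ := φ) C hj h
    have h3 := S.op_sector_exchange (φ := φ) C hj h
    have h4 : S.op φ ((T.sheets m).Puncture (T.c₀ + 1) T.p k) ∘ₗ
      S.exchange φ (T.left j) (T.right j) = -(S.exchange φ (T.left j) (T.right j) ∘ₗ
        S.op φ ((T.sheets m).Puncture (T.c₀ + 1) T.p k)) := h2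
    have h5 : S.op φ ((T.sheets m).Sector (T.c₀ + 1) T.p k) ∘ₗ
      S.exchange φ (T.left j) (T.right j) = -(S.exchange φ (T.left j) (T.right j) ∘ₗ
        S.op φ ((T.sheets m).Sector (T.c₀ + 1) T.p k)) := h3
    rw [h4, LinearMap.comp_neg, ← LinearMap.comp_assoc, ← LinearMap.comp_assoc, h5,
      LinearMap.neg_comp, neg_neg]) hL
  rw [hi, one_pow, one_smul]
  exact chain_congr fun k _ => S.op_sector_add_hexagon C hj

theorem chain_stepOp_plainOp_right (hc : (T.sheets m).M (T.c₀ + 1) T.p) {L : List (ZMod m)}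
    (hL : L.Nodup) (hL' : ∀ k, k ∈ L) {x : States (n + 1) m} (hx : x ∈ span {f | T.IsReal f}) :
    chain (T.stepOp S φ) L (T.plainOp S φ x) =
      (-1 : ℤ) ^ L.length • T.reducedOp S φ (chain (T.stepOp S φ) L x) := by
  have C := T.corner (m := m)
  have h1 : chain (T.retractOp S φ) L x ∈ span (T.rightStates {k | k ∈ L}) :=
    chain_mem (A := fun J => span (T.rightStates J)) (fun k J _ x hx => retract_rightStates S hx) hL
      (mem_rightStates hx)
  have h2 : ∀ f ∈ T.rightStates {k : ZMod m | k ∈ L}, ∀ b : Curve (n + 1) m,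
      rows f b = T.p ↔ b.1 = T.c₀ + 1 := by
    rintro f ⟨hf, hf'⟩
    exact hf.row_iff fun k => hf' k (hL' k)
  rw [chain_stepOp_right S hL, LinearMap.comp_apply, LinearMap.comp_apply,
    chain_retractOp_plainOp S hc hL hL' hx,
    reducedOp_chain_sideOp S hc hL hL' (Finsupp.supported_mono h2 h1), smul_smul, ← mul_pow]
  norm_num
  congr 1
  refine span_eq (S.op φ _) (S.op φ _) (fun f hf => S.op_congr fun l r => ?_) h1
  refine ⟨fun h => ⟨h, ?_, ?_⟩, fun h => h.1⟩
  · intro h3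
    exact (C.plain_ne_right hc h (k := l.2) ((h2 f hf _).2 rfl)).1 (Prod.ext h3.symm rfl)
  · intro h3
    exact (C.plain_ne_right hc h (k := r.2) ((h2 f hf _).2 rfl)).2 (Prod.ext h3.symm rfl)

end Stabilization
end GridCover

namespace GridCover

open Sheets

namespace SignAssignment

variable {N m : ℕ} [NeZero m] (S : SignAssignment (m * N)) {φ : Framing N m} {Z : Sheets N m}
  {c c' p q d : Fin N} {k : ZMod m}

theorem op_sector_exchange_eq_zero (C : Z.Corner c c' p q)
    (hj : ∀ i k, Z.Joined i (c, k) (c', k)) {x : States N m}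
    (hx : x ∈ span {g : Curve N m ≃ Curve N m | rows g (c, k) ≠ p ∧
      ¬ CycIoo (rows g (c', k)) (rows g (c, k)) p}) :
    S.op φ (Z.Sector c p k) (S.exchange φ (c, k) (c', k) x) = 0 := by
  refine span_eq (S.op φ (Z.Sector c p k) ∘ₗ S.exchange φ (c, k) (c', k)) 0 (fun g hg => ?_) hx
  simp only [LinearMap.comp_apply, LinearMap.zero_apply]
  rw [exchange_single, map_smul, S.op_sector_of_not_cycIoo C hj, smul_zero]
  · rw [rows_trans_swap, exch_left, exch_right]
    exact hg.2
  · rw [rows_trans_swap, exch_right]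
    exact hg.1

/-- If there is a forbidden square on the left of `c` above `p`, no sector follows a punctured
hexagon. -/
theorem op_sector_hexagon_eq_zero (C : Z.Corner c c' p q)
    (hj : ∀ i k, Z.Joined i (c, k) (c', k)) {a : Fin N} (ha : Z.M a p)
    (hac : ∀ x, x ≠ c → CycIco x c a) :
    S.op φ (Z.Sector c p k) ∘ₗ S.hexagon φ Z c c' p (· ≠ p) k = 0 := by
  refine hom_ext fun f => ?_
  simp only [LinearMap.comp_apply, hexagon, LinearMap.zero_apply]
  by_cases h : CycIoo (rows f (c, k)) (rows f (c', k)) p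
  swap
  · rw [S.op_dent_of_not h, map_zero, map_zero]
  rw [S.op_dent h, S.op_flap_exchange C hj h, map_neg, neg_eq_zero]
  refine S.op_sector_exchange_eq_zero C hj (S.op_mem φ (A := {f}) ?_
    (Finsupp.single_mem_supported ℤ _ rfl))
  rintro g rfl l r ⟨rfl, R, h2, h3⟩
  rw [Set.mem_ofPred_eq, rows_trans_swap, exch_right, exch_ne _ (ne_of_col (Ne.symm h2)) C.mk_ne]
  refine ⟨ne_of_cycIoo_left h, fun h4 => ?_⟩
  have h5 := (C.rect_right hj R h2).2
  refine R.free a ?_ p ?_ ha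
  · have := hac _ h2
    have := C.cycIoo_c h2 R.col
    simp only [cycIco_iff, cycIoo_iff] at *
    omega
  · simp only [cycIco_iff, cycIoo_iff] at *
    omega

/-- Disregarding the points on the lifts of `c`, rectangles may be counted before or after the
points on two lifts of `c` are exchanged. -/
theorem op_reduced_exchange {j : ZMod m} (h : j ≠ k) :
    S.op φ (Z.Reduced c) ∘ₗ S.exchange φ (c, j) (c, k) =
      -(S.exchange φ (c, j) (c, k) ∘ₗ S.op φ (Z.Reduced c)) := by
  refine S.op_anticomm_exchange (mk_ne_left h) fun ρ l r hR => ?_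
  have e : ∀ {b : Curve N m}, b.1 ≠ c → exch ρ (c, j) (c, k) b = ρ b :=
    fun hb => exch_ne _ (ne_of_col hb) (ne_of_col hb)
  refine ⟨⟨ne_of_col hR.col, ne_of_col hR.left.symm, ne_of_col hR.right.symm,
    ne_of_col hR.left.symm, ne_of_col hR.right.symm⟩, hR.left, hR.right, hR.col, ?_, ?_, ?_, ?_⟩
  · rw [e hR.left, e hR.right]; exact hR.row
  · rw [e hR.left]; exact hR.base
  · rw [e hR.left, e hR.right]; exact hR.free
  · intro b hb
    rw [e hR.left, e hR.right, e hb]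
    exact hR.empty b hb

end SignAssignment

namespace Sheets

variable {N m : ℕ} {Z : Sheets N m} {ρ : Curve N m → Fin N} {l r : Curve N m} {c c' p q d : Fin N}
  {k : ZMod m} {J : Set (ZMod m)}

theorem Corner.sector_bad_insert (C : Z.Corner c c' p q) (hM : Z.M d q) (hd : Bad c c' p d J ρ)
    (h : Z.Sector c p k ρ l r) : Bad c c' p d (insert k J) (exch ρ l r) := by
  obtain ⟨b, h1, h2, h3⟩ := hd
  obtain ⟨rfl, R, e⟩ := h
  have h4 : b ≠ (c, k) := by
    rintro rfl
    exact R.row (h2.trans e.symm)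
  refine ⟨b, ?_, ?_, h3⟩
  · rintro h5 (h6 | h6)
    · exact h4 (Prod.ext h5 h6)
    · exact h1 h5 h6
  · rw [exch_ne _ h4, h2]
    rintro rfl
    refine C.not_cycIco_col hM R e ?_
    have := C.col
    have := R.col
    have := b.1.2
    have := C.col_ne hM
    simp only [cycIco_iff, Fin.ext_iff, ne_eq] at *
    omega

theorem Cosector.cobad (hd : Cobad c c' p c' J ρ) (C : Z.Corner c c' p q)
    (h : Z.Cosector c' p k ρ l r) : Cobad c c' p c' (insert k J) (exch ρ l r) := by
  obtain ⟨b, h1, h2, h3⟩ := hd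
  obtain ⟨rfl, R, e⟩ := h
  have hb : b.1 = c' := by
    have := C.col
    have := b.1.2
    simp only [cycIco_iff, Fin.ext_iff] at *
    omega
  have h4 : b ≠ (c', k) := by
    rintro rfl
    exact R.row (e.trans h2.symm)
  refine ⟨b, ?_, ?_, h3⟩
  · rintro h5 (h6 | h6)
    · exact h4 (Prod.ext h5 h6)
    · exact h1 h5 h6
  · rw [exch_ne _ _ h4, h2]
    rintro rfl
    exact R.col hb

end Sheets

namespace Stabilization

variable {n : ℕ} {T : Stabilization n} {m : ℕ}

theorem SectorLabelled.row_iff {f : Curve (n + 1) m ≃ Curve (n + 1) m} {J : Set (ZMod m)}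
    (h : T.SectorLabelled J f) (hJ : ∀ k, k ∈ J) (b : Curve (n + 1) m) :
    rows f b = T.p ↔ b.1 = T.c₀ := by
  constructor
  · intro hb
    by_contra hbc
    obtain ⟨k, rfl⟩ := eq_of_label (T := T) (g := T.left) (s := T.c₀ + 1)
      (fun k => (h (T.left k)).1 rfl (hJ k))
      (by rw [(h b).2 fun h' => absurd h' hbc, ← hb]; rfl)
    exact hbc rfl
  · intro hb
    rw [rows, (h b).1 hb (hJ _)]
    rfl

theorem CosectorLabelled.row_iff {f : Curve (n + 1) m ≃ Curve (n + 1) m} {J : Set (ZMod m)}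
    (h : T.CosectorLabelled J f) (hJ : ∀ k, k ∈ J) (b : Curve (n + 1) m) :
    rows f b = T.p ↔ b.1 = T.c₀ + 1 := by
  constructor
  · intro hb
    by_contra hbc
    obtain ⟨k, rfl⟩ := eq_of_label (T := T) (g := T.right) (s := T.c₀)
      (fun k => (h (T.right k)).1 rfl (hJ k))
      (by rw [(h b).2 fun h' => absurd h' hbc, ← hb]; rfl)
    exact hbc rfl
  · intro hb
    rw [rows, (h b).1 hb (hJ _)]
    rfl

variable [NeZero m] (S : SignAssignment (m * (n + 1))) {φ : Framing (n + 1) m}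

open SignAssignment

omit [NeZero m] in
theorem mem_labelled {s : Fin (n + 1)} {e : ZMod m → Curve (n + 1) m} {x : States (n + 1) m}
    (hx : x ∈ span {f | T.IsReal f}) : x ∈ span {f | T.Labelled s e ∅ f} :=
  Finsupp.supported_mono (s := {f | T.IsReal f}) (t := {f | T.Labelled s e ∅ f})
    (fun _ hf => labelled_empty.2 hf) hx

variable (φ) in
/-- The boundary operator without the rectangles with a side on a lift of `s` in a sheet of `J`. -/
noncomputable def plainOffOp (T : Stabilization n) (s : Fin (n + 1)) (J : Set (ZMod m)) :
    States (n + 1) m →ₗ[ℤ] States (n + 1) m :=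
  S.op φ fun ρ l r => (T.sheets m).Plain T.c₀ T.p T.q.castSucc ρ l r ∧ Off s J l r

theorem plainOffOp_empty (s : Fin (n + 1)) : T.plainOffOp S φ s ∅ = T.plainOp S φ :=
  hom_ext fun _ => S.op_congr fun _ _ => ⟨fun h => h.1, fun h => ⟨h, off_empty⟩⟩

theorem plainOffOp_mem {s : Fin (n + 1)} {e : ZMod m → Curve (n + 1) m} {J : Set (ZMod m)}
    {x : States (n + 1) m} (hx : x ∈ span {f | T.Labelled s e J f}) :
    T.plainOffOp S φ s J x ∈ span {f | T.Labelled s e J f} :=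
  S.op_mem φ (A := {f | T.Labelled s e J f}) (fun _ hf _ _ h => Labelled.plain hf h.2 h.1) hx

theorem plainOp_mem {x : States (n + 1) m} (hx : x ∈ span {f | T.IsReal f}) :
    T.plainOp S φ x ∈ span {f | T.IsReal f} :=
  S.op_mem φ (A := {f | T.IsReal f}) (fun _ hf _ _ h => IsReal.plain hf h) hx

theorem sectorOp_plainOffOp {d : Fin (n + 1)} (hd : (T.sheets m).M d T.q.castSucc)
    {a : Fin (n + 1)} (ha : (T.sheets m).M a T.p) (hac : ∀ x, x ≠ T.c₀ → CycIco x T.c₀ a)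
    {J : Set (ZMod m)} {k : ZMod m} (hk : k ∉ J) {x : States (n + 1) m}
    (hx : x ∈ span {f | T.SectorLabelled J f}) :
    T.sectorOp S φ k (T.plainOffOp S φ T.c₀ J x) +
        T.plainOffOp S φ T.c₀ (insert k J) (T.sectorOp S φ k x) ∈
      span {f : Curve (n + 1) m ≃ Curve (n + 1) m |
        Bad T.c₀ (T.c₀ + 1) T.p d (insert k J) (rows f)} := by
  have C := T.corner (m := m)
  refine span_induction (T.sectorOp S φ k ∘ₗ T.plainOffOp S φ T.c₀ J +
    T.plainOffOp S φ T.c₀ (insert k J) ∘ₗ T.sectorOp S φ k) _ (fun f hf => ?_) hx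
  have hblock : ∀ b, b ≠ T.c₀ → (∀ x, x ≠ T.c₀ → CycIco x T.c₀ b) →
      (T.sheets m).M b T.p ∨ (T.sheets m).M b T.q.castSucc := by
    intro b hb hbc
    have h1 := hbc a (C.col_ne ha)
    have h2 := hac b hb
    left
    convert ha
    simp only [cycIco_iff, Fin.ext_iff, ne_eq] at *
    omega
  have hf' : T.SectorLabelled J f := hf
  have hs : (T.sheets m).Separated T.c₀ T.c₀ T.p J (rows f) := Labelled.separated hf'
  have key := S.op_sector_add (φ := φ) C hd hblock f J hk hs
  rw [LinearMap.add_apply, LinearMap.comp_apply, LinearMap.comp_apply]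
  exact key

theorem sectorOp_mem {J : Set (ZMod m)} {k : ZMod m} (hk : k ∉ J) {x : States (n + 1) m}
    (hx : x ∈ span {f | T.SectorLabelled J f}) :
    T.sectorOp S φ k x ∈ span {f | T.SectorLabelled (insert k J) f} :=
  S.op_mem φ (A := {f | T.SectorLabelled J f}) (fun _ hf _ _ h => SectorLabelled.sector hf hk h) hx

theorem stepOp_eq_sectorOp {a : Fin (n + 1)} (ha : (T.sheets m).M a T.p)
    (hac : ∀ x, x ≠ T.c₀ → CycIco x T.c₀ a) (k : ZMod m) : T.stepOp S φ k = T.sectorOp S φ k := by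
  have h := S.op_sector_hexagon_eq_zero (φ := φ) (k := k) T.corner T.joined_left_right ha hac
  rw [stepOp, LinearMap.comp_add, LinearMap.comp_id]
  exact (congrArg _ h).trans (add_zero _)

theorem chain_stepOp_plainOp_left {a : Fin (n + 1)} (ha : (T.sheets m).M a T.p)
    (hac : ∀ x, x ≠ T.c₀ → CycIco x T.c₀ a) {L : List (ZMod m)}
    (hL : L.Nodup) (hL' : ∀ k, k ∈ L) {x : States (n + 1) m} (hx : x ∈ span {f | T.IsReal f}) :
    chain (T.stepOp S φ) L (T.plainOp S φ x) =
      (-1 : ℤ) ^ L.length • T.reducedOp S φ (chain (T.stepOp S φ) L x) := by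
  have C := T.corner (m := m)
  obtain ⟨d, hd⟩ := C.rowM T.q.castSucc
  rw [chain_congr fun k _ => stepOp_eq_sectorOp S ha hac k]
  have hA : ∀ (k : ZMod m) (J : Set (ZMod m)), k ∉ J → ∀ x ∈ span {f | T.SectorLabelled J f},
      T.sectorOp S φ k x ∈ span {f | T.SectorLabelled (insert k J) f} :=
    fun k J hk x hx => sectorOp_mem S hk hx
  have h1 := chain_comm_mem (A := fun J => span {f | T.SectorLabelled J f})
    (B := fun J => span {f : Curve (n + 1) m ≃ Curve (n + 1) m |
      Bad T.c₀ (T.c₀ + 1) T.p d J (rows f)})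
    (d := T.plainOffOp S φ T.c₀) (-1) hA
    (fun k J _ x hx => S.op_mem φ (fun f hf l r h => C.sector_bad_insert hd hf h) hx)
    (fun k J hk x hx => by
      rw [neg_one_smul, sub_neg_eq_add]
      exact sectorOp_plainOffOp S hd ha hac hk hx) hL (mem_labelled hx)
  have h2 : span {f | T.SectorLabelled {k | k ∈ L} f} ⊓
      span {f : Curve (n + 1) m ≃ Curve (n + 1) m |
        Bad T.c₀ (T.c₀ + 1) T.p d {k | k ∈ L} (rows f)} = ⊥ := by
    rw [span, span, ← Finsupp.supported_inter, ← Finsupp.supported_empty]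
    congr 1
    ext f
    refine ⟨?_, fun h => h.elim⟩
    rintro ⟨hf, b, h3, h4, -⟩
    exact h3 ((SectorLabelled.row_iff hf hL' b).1 h4) (hL' _)
  have h3 := chain_mem (A := fun J => span {f | T.SectorLabelled J f}) hA hL (mem_labelled hx)
  have h4 : T.plainOffOp S φ T.c₀ {k | k ∈ L} (chain (T.sectorOp S φ) L x) =
      T.reducedOp S φ (chain (T.sectorOp S φ) L x) := by
    refine span_eq _ _ (fun f hf => S.op_congr fun l r => ?_) h3
    rw [← C.reduced_iff_left ha hac (SectorLabelled.row_iff hf hL')]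
    refine and_congr_right fun _ => ⟨fun h => ⟨fun h' => h.1 h' (hL' _), fun h' => h.2 h' (hL' _)⟩,
      fun h => ⟨fun h' => absurd h' h.1, fun h' => absurd h' h.2⟩⟩
  rw [plainOffOp_empty] at h1
  rw [← h4, ← sub_eq_zero, ← Submodule.mem_bot ℤ, ← h2]
  exact ⟨Submodule.sub_mem _ (chain_mem (A := fun J => span {f | T.SectorLabelled J f}) hA hL
    (mem_labelled (plainOp_mem S hx))) (Submodule.smul_mem _ _ (plainOffOp_mem S h3)), h1⟩

/-- The marking next to the new column is on its right or on its left. -/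
theorem adjacent_cases (T : Stabilization n) (m : ℕ) : (T.sheets m).M (T.c₀ + 1) T.p ∨
    ∃ a, (T.sheets m).M a T.p ∧ ∀ x, x ≠ T.c₀ → CycIco x T.c₀ a := by
  obtain ⟨a, h1, h2 | h2⟩ := T.adjacent
  · left
    have h3 : a = T.c₀ + 1 := by
      have := (T.corner (m := m)).col
      have := a.2
      rw [Fin.ext_iff]
      omega
    exact ⟨(T.corner (m := m)).ne.symm, .inl (h3 ▸ h1)⟩
  · right
    refine ⟨a, ⟨fun h => ?_, .inl h1⟩, fun x hx => ?_⟩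
    · rw [h] at h2
      omega
    · have := x.2
      simp only [cycIco_iff, Fin.ext_iff, ne_eq] at *
      omega

theorem chain_stepOp_plainOp {L : List (ZMod m)} (hL : L.Nodup) (hL' : ∀ k, k ∈ L)
    {x : States (n + 1) m} (hx : x ∈ span {f | T.IsReal f}) :
    chain (T.stepOp S φ) L (T.plainOp S φ x) =
      (-1 : ℤ) ^ L.length • T.reducedOp S φ (chain (T.stepOp S φ) L x) := by
  rcases T.adjacent_cases m with h | ⟨a, ha, hac⟩
  · exact chain_stepOp_plainOp_right S h hL hL' hx
  · exact chain_stepOp_plainOp_left S ha hac hL hL' hx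

end Stabilization
end GridCover

namespace GridCover

open Sheets

namespace SignAssignment

variable {N m : ℕ} [NeZero m] (S : SignAssignment (m * N)) {φ : Framing N m} {Z : Sheets N m}
  {c c' p q : Fin N} {k : ZMod m}

theorem op_flap_eq_zero {a : Fin N} (ha : Z.M a p) (hac : ∀ x, x ≠ c → CycIco x c a) :
    S.op φ (Z.Flap c c' p (· = p) k) = 0 := by
  refine hom_ext fun f => S.op_eq_zero ?_
  rintro l r ⟨rfl, R, -, -, e⟩
  exact R.free a (hac _ R.col) p (e ▸ cycIco_self R.row) ha

/-- A cosector is a hexagon with obtuse corner on `p`, up to the exchange of the points next to the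
column `c`. -/
theorem exchange_op_cosector (C : Z.Corner c c' p q) (hj : ∀ i k, Z.Joined i (c, k) (c', k)) :
    S.exchange φ (c, k) (c', k) ∘ₗ (-S.op φ (Z.Cosector c' p k)) =
      proj (fun ρ => ρ (c, k) = p ∧ ρ (c', k) ≠ p) + S.hexagon φ Z c c' p (· = p) k := by
  refine hom_ext fun f => ?_
  simp only [LinearMap.comp_apply, LinearMap.add_apply, LinearMap.neg_apply, hexagon, map_neg]
  by_cases hs : rows f (c, k) = p
  · have h0 : ¬ CycIoo (rows f (c, k)) (rows f (c', k)) p := fun h => ne_of_cycIoo_left h hs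
    rw [S.op_dent_of_not h0, map_zero, add_zero]
    by_cases hp : rows f (c', k) = p
    · rw [proj_of_not (by tauto), S.op_eq_zero, map_zero, neg_zero]
      rintro l r ⟨rfl, R, e⟩
      exact R.row (e.trans hp.symm)
    · rw [proj_of ⟨hs, hp⟩, S.op_unique (a := (c, k)) (b := (c', k)),
        S.exchange_exchange_self C.mk_ne, neg_neg]
      refine fun l r => ⟨?_, ?_⟩
      · rintro ⟨rfl, R, e⟩
        refine ⟨?_, rfl⟩
        by_contra h1
        have h2 : l.1 ≠ c := fun h2 => h1 (R.base.unique_left (hj _ k) h2)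
        exact ne_of_cycIoo_left (C.rect_right hj R h2).2 (hs.trans e.symm)
      · rintro ⟨rfl, rfl⟩
        exact ⟨rfl, C.rect_side (by rw [hs]; exact Ne.symm hp) (hj _ _), hs⟩
  rw [proj_of_not (by tauto), zero_add]
  have key : ∀ l r, Z.Cosector c' p k (rows f) l r → l.1 ≠ c := by
    rintro l r ⟨rfl, R, e⟩ h1
    rw [(R.base.unique_left (hj _ k) h1 : l = (c, k))] at e
    exact hs e
  by_cases h : CycIoo (rows f (c, k)) (rows f (c', k)) p
  · rw [S.op_dent h, S.op_flap_exchange C hj h]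
    congr 2
    refine S.op_congr fun l r => ⟨fun h' => ⟨h'.1, h'.2.1, key l r h', h'.2.2⟩,
      fun h' => ⟨h'.1, h'.2.1, h'.2.2.2⟩⟩
  · rw [S.op_dent_of_not h, map_zero, S.op_eq_zero, map_zero, neg_zero]
    rintro l r h'
    have h1 := key l r h'
    obtain ⟨rfl, R, e⟩ := h'
    exact h (e ▸ (C.rect_right hj R h1).2)

omit [NeZero m] in
theorem chain_proj {K : Type*} (G : K → (Curve N m → Fin N) → Prop) (L : List K) :
    chain (fun k => (proj (G k) : States N m →ₗ[ℤ] States N m)) L =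
      proj fun ρ => ∀ k ∈ L, G k ρ := by
  induction L with
  | nil =>
    refine hom_ext fun f => ?_
    rw [chain, LinearMap.id_apply, proj_of (by simp)]
  | cons a L ih =>
    refine hom_ext fun f => ?_
    rw [chain, LinearMap.comp_apply, ih]
    by_cases h1 : ∀ k ∈ L, G k (rows f)
    · rw [proj_of h1]
      by_cases h2 : G a (rows f)
      · rw [proj_of h2, proj_of]
        simpa using ⟨h2, h1⟩
      · rw [proj_of_not h2, proj_of_not]
        exact fun h => h2 (h a (by simp))
    · rw [proj_of_not h1, map_zero, proj_of_not]
      exact fun h => h1 fun k hk => h k (by simp [hk])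

end SignAssignment

theorem chain_eq_of_mem {K V : Type*} [AddCommGroup V] {Y X : K → V →ₗ[ℤ] V} {A : Submodule ℤ V}
    (hA : ∀ k, ∀ x ∈ A, X k x ∈ A) (h : ∀ k, ∀ x ∈ A, Y k x = X k x) (L : List K) {x : V}
    (hx : x ∈ A) : chain Y L x = chain X L x ∧ chain X L x ∈ A := by
  induction L with
  | nil => exact ⟨rfl, hx⟩
  | cons a L ih =>
    rw [chain, chain, LinearMap.comp_apply, LinearMap.comp_apply, ih.1]
    exact ⟨h a _ ih.2, hA a _ ih.2⟩

namespace Stabilization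

variable {n : ℕ} {T : Stabilization n} {m : ℕ}

open SignAssignment

theorem IsReal.dent {f : Curve (n + 1) m ≃ Curve (n + 1) m} (h : T.IsReal f) {k : ZMod m}
    {l r : Curve (n + 1) m} (hd : Dent T.c₀ (T.c₀ + 1) T.p k (rows f) l r) :
    T.IsReal ((Equiv.swap l r).trans f) := by
  obtain ⟨rfl, rfl, e⟩ := hd
  refine h.exchange (T.corner.rect_side (fun h' => ?_) (T.joined_left_right _ k))
    (fun h' => ne_of_cycIoo_left e h'.1) fun h' => ne_of_cycIoo_right e h'.1.symm
  rw [h'] at e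
  simp only [cycIoo_iff] at e
  omega

theorem IsReal.flap {f : Curve (n + 1) m ≃ Curve (n + 1) m} (h : T.IsReal f) {k : ZMod m}
    {R : Fin (n + 1) → Prop} {l r : Curve (n + 1) m}
    (hd : (T.sheets m).Flap T.c₀ (T.c₀ + 1) T.p R k (rows f) l r) :
    T.IsReal ((Equiv.swap l r).trans f) := by
  obtain ⟨rfl, R, e⟩ := hd
  exact h.exchange R (fun h' => not_cycIco_right h'.2) fun h' => not_cycIco_right h'.2

variable [NeZero m] (S : SignAssignment (m * (n + 1))) {φ : Framing (n + 1) m}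

variable (φ) in
/-- A punctured hexagon with obtuse corner on `p`, or the identity on states with the property
`G`. -/
noncomputable def fillOp (T : Stabilization n) (G : ZMod m → (Curve (n + 1) m → Fin (n + 1)) → Prop)
    (k : ZMod m) : States (n + 1) m →ₗ[ℤ] States (n + 1) m :=
  proj (G k) + T.hexagonOp S φ (· = T.p) k

theorem fillOp_mem {G : ZMod m → (Curve (n + 1) m → Fin (n + 1)) → Prop} {k : ZMod m}
    {A : Set (Curve (n + 1) m ≃ Curve (n + 1) m)} {B : Set (Curve (n + 1) m ≃ Curve (n + 1) m)}
    (h : ∀ f ∈ A, G k (rows f) → f ∈ B)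
    (h' : ∀ f ∈ A, ∀ l r l' r', Dent T.c₀ (T.c₀ + 1) T.p k (rows f) l r →
      (T.sheets m).Flap T.c₀ (T.c₀ + 1) T.p (· = T.p) k (rows ((Equiv.swap l r).trans f)) l' r' →
      (Equiv.swap l' r').trans ((Equiv.swap l r).trans f) ∈ B) {x : States (n + 1) m}
    (hx : x ∈ span A) : T.fillOp S φ G k x ∈ span B := by
  refine Submodule.add_mem _ (proj_mem _ h hx) ?_
  refine span_induction (T.hexagonOp S φ (· = T.p) k) _ (fun f hf => ?_) hx
  have h1 := S.op_mem φ (P := Dent T.c₀ (T.c₀ + 1) T.p k) (A := {f})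
    (B := {g | ∃ l r, Dent T.c₀ (T.c₀ + 1) T.p k (rows f) l r ∧ g = (Equiv.swap l r).trans f})
    (by rintro g rfl l r h1; exact ⟨l, r, h1, rfl⟩) (Finsupp.single_mem_supported ℤ 1 rfl)
  refine S.op_mem φ ?_ h1
  rintro g ⟨l, r, h1, rfl⟩ l' r' h2
  exact h' f hf l r l' r' h1 h2

omit [NeZero m] in
theorem flap_dent_left {ρ : Curve (n + 1) m → Fin (n + 1)} {j k : ZMod m}
    {l r l' r' : Curve (n + 1) m} (h1 : Dent T.c₀ (T.c₀ + 1) T.p k ρ l r)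
    (h2 : (T.sheets m).Flap T.c₀ (T.c₀ + 1) T.p (· = T.p) k (exch ρ l r) l' r') :
    exch (exch ρ l r) l' r' (T.left j) = if j = k then T.p else ρ (T.left j) := by
  have C := T.corner (m := m)
  obtain ⟨rfl, rfl, e1⟩ := h1
  obtain ⟨rfl, R, -, -, e2⟩ := h2
  split_ifs with h
  · subst h
    exact (exch_right _ _ _).trans e2
  · have h3 : T.left j ≠ l' := ne_of_col R.col.symm
    have h4 : T.left j ≠ (T.c₀, k) := mk_ne_left h
    rw [exch_ne _ h3 h4, exch_ne _ h4 C.mk_ne]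

omit [NeZero m] in
theorem flap_dent_right {ρ : Curve (n + 1) m → Fin (n + 1)} {j k : ZMod m}
    {l r l' r' : Curve (n + 1) m} (h1 : Dent T.c₀ (T.c₀ + 1) T.p k ρ l r)
    (h2 : (T.sheets m).Flap T.c₀ (T.c₀ + 1) T.p (· = T.p) k (exch ρ l r) l' r') :
    exch (exch ρ l r) l' r' (T.right j) = T.p ↔ ρ (T.right j) = T.p := by
  have C := T.corner (m := m)
  obtain ⟨rfl, rfl, e1⟩ := h1
  obtain ⟨rfl, R, -, -, e2⟩ := h2
  have h3 : T.right j ≠ l' := by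
    rintro rfl
    exact C.not_around R rfl rfl
  have h4 : T.right j ≠ (T.c₀, k) := C.mk_ne.symm
  rw [exch_ne _ h3 h4]
  by_cases h : j = k
  · subst h
    rw [show exch ρ (T.c₀, j) (T.c₀ + 1, j) (T.right j) = ρ (T.c₀, j) from exch_right _ _ _]
    exact ⟨fun h => absurd h (ne_of_cycIoo_left e1), fun h => absurd h.symm (ne_of_cycIoo_right e1)⟩
  · rw [exch_ne _ h4 (mk_ne_left h)]

/-- A real state with a point over `p` on a right circle cannot be filled. -/
theorem chain_fillOp_eq_zero {G : ZMod m → (Curve (n + 1) m → Fin (n + 1)) → Prop}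
    (hG : ∀ k ρ, G k ρ → ρ (T.left k) = T.p) {L : List (ZMod m)} (hL : L.Nodup) (hL' : ∀ k, k ∈ L)
    (j : ZMod m) {x : States (n + 1) m}
    (hx : x ∈ span {f : Curve (n + 1) m ≃ Curve (n + 1) m | T.IsReal f ∧ rows f (T.right j) = T.p}) :
    chain (T.fillOp S φ G) L x = 0 := by
  have C := T.corner (m := m)
  have h := chain_mem (Y := T.fillOp S φ G) (A := fun J => span {f : Curve (n + 1) m ≃
    Curve (n + 1) m | (T.IsReal f ∧ rows f (T.right j) = T.p) ∧ ∀ k ∈ J, rows f (T.left k) = T.p})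
    ?_ hL (x := x) (by
      refine Finsupp.supported_mono (fun f hf => ?_) hx
      exact ⟨hf, fun k hk => absurd hk (Set.notMem_empty _)⟩)
  · rw [← Submodule.mem_bot ℤ]
    convert h using 1
    rw [span, ← Finsupp.supported_empty]
    congr 1
    symm
    rw [Set.eq_empty_iff_forall_notMem]
    rintro f ⟨⟨hf, h1⟩, h2⟩
    obtain ⟨k, hk⟩ := eq_of_label (T := T) (f := f) (g := T.left) (s := T.c₀)
      (fun k => by rw [hf (T.left k), ← h2 k (hL' k)]; rfl) (b := T.right j)
      (by rw [hf (T.right j), ← h1]; rfl)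
    exact C.mk_ne.symm hk
  · intro k J hk x hx
    refine fillOp_mem S ?_ ?_ hx
    · rintro f ⟨hf, h2⟩ h3
      refine ⟨hf, ?_⟩
      rintro i (rfl | hi)
      exacts [hG _ _ h3, h2 i hi]
    · rintro f ⟨⟨hf, h1⟩, h2⟩ l r l' r' h3 h4
      refine ⟨⟨(hf.dent h3).flap h4, ?_⟩, ?_⟩
      · exact (flap_dent_right h3 h4).2 h1
      · intro i hi
        refine (flap_dent_left h3 h4).trans ?_
        split_ifs with h
        exacts [rfl, h2 i (hi.resolve_left h)]

variable (T) in
/-- The states with a point over `p` on the left circle of sheet `k`. -/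
def AtLeft (k : ZMod m) (ρ : Curve (n + 1) m → Fin (n + 1)) : Prop := ρ (T.left k) = T.p

theorem chain_fillOp_eq {L : List (ZMod m)} (hL : L.Nodup) (hL' : ∀ k, k ∈ L)
    {x : States (n + 1) m} (hx : x ∈ span {f | T.IsReal f}) :
    chain (T.fillOp S φ T.AtLeft) L x =
      chain (T.fillOp S φ fun k ρ => ρ (T.left k) = T.p ∧ ρ (T.right k) ≠ T.p) L x := by
  refine span_eq _ _ (fun f hf => ?_) hx
  by_cases h : ∃ j, rows f (T.right j) = T.p
  · obtain ⟨j, hj⟩ := h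
    have hf' := Finsupp.single_mem_supported ℤ (1 : ℤ) (s := {f : Curve (n + 1) m ≃ Curve (n + 1) m |
      T.IsReal f ∧ rows f (T.right j) = T.p}) (a := f) ⟨hf, hj⟩
    rw [chain_fillOp_eq_zero S (G := T.AtLeft) (fun k ρ h => h) hL hL' j hf',
      chain_fillOp_eq_zero S (fun k ρ h => h.1) hL hL' j hf']
  · push Not at h
    refine (chain_eq_of_mem (A := span {f : Curve (n + 1) m ≃ Curve (n + 1) m |
      ∀ j, rows f (T.right j) ≠ T.p}) (fun k x hx => ?_) (fun k x hx => ?_) L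
      (Finsupp.single_mem_supported ℤ (1 : ℤ) h)).1
    · refine fillOp_mem S (fun f hf _ => hf) ?_ hx
      intro f hf l r l' r' h3 h4 j h5
      exact hf j ((flap_dent_right h3 h4).1 h5)
    · refine span_eq _ _ (fun f hf => ?_) hx
      rw [fillOp, fillOp, LinearMap.add_apply, LinearMap.add_apply]
      congr 1
      by_cases h1 : rows f (T.left k) = T.p
      · rw [proj_of (G := T.AtLeft k) h1, proj_of ⟨h1, hf k⟩]
      · rw [proj_of_not (G := T.AtLeft k) h1, proj_of_not (fun h => h1 h.1)]

variable (φ) in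
/-- The cosectors in sheet `k`, counted negatively. -/
noncomputable def cosectorOp (T : Stabilization n) (k : ZMod m) :
    States (n + 1) m →ₗ[ℤ] States (n + 1) m :=
  -S.op φ ((T.sheets m).Cosector (T.c₀ + 1) T.p k)

theorem chain_fillOp_right {L : List (ZMod m)} (hL : L.Nodup) :
    ∃ i : ℕ, chain (T.fillOp S φ fun k ρ => ρ (T.left k) = T.p ∧ ρ (T.right k) ≠ T.p) L =
      (-1 : ℤ) ^ i • (chain (T.sideOp S φ) L ∘ₗ chain (T.cosectorOp S φ) L) := by
  have C := T.corner (m := m)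
  have hj : ∀ (i : Fin (n + 1)) (k : ZMod m), (T.sheets m).Joined i (T.c₀, k) (T.c₀ + 1, k) :=
    T.joined_left_right
  obtain ⟨i, hi⟩ := chain_comp (Y := T.sideOp S φ) (X := T.cosectorOp S φ) (-1) (fun j k h => by
    have h1 := S.op_cosector_exchange (φ := φ) C hj h
    unfold sideOp cosectorOp
    rw [LinearMap.comp_neg, LinearMap.neg_comp, neg_one_smul, neg_neg]
    have h2 : S.op φ ((T.sheets m).Cosector (T.c₀ + 1) T.p k) ∘ₗ
      S.exchange φ (T.left j) (T.right j) = -(S.exchange φ (T.left j) (T.right j) ∘ₗ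
        S.op φ ((T.sheets m).Cosector (T.c₀ + 1) T.p k)) := h1
    rw [h2]) hL
  refine ⟨i, ?_⟩
  rw [hi, smul_smul, ← mul_pow]
  norm_num
  exact chain_congr fun k _ => (S.exchange_op_cosector C hj).symm

theorem cosectorOp_mem {J : Set (ZMod m)} {k : ZMod m} (hk : k ∉ J) {x : States (n + 1) m}
    (hx : x ∈ span {f | T.CosectorLabelled J f}) :
    T.cosectorOp S φ k x ∈ span {f | T.CosectorLabelled (insert k J) f} :=
  Submodule.neg_mem _ (S.op_mem φ (A := {f | T.CosectorLabelled J f})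
    (fun _ hf _ _ h => CosectorLabelled.cosector hf hk h) hx)

theorem chain_fillOp_plainOp_right (hc : (T.sheets m).M (T.c₀ + 1) T.p) {L : List (ZMod m)}
    (hL : L.Nodup) (hL' : ∀ k, k ∈ L) {x : States (n + 1) m} (hx : x ∈ span {f | T.IsReal f}) :
    chain (T.fillOp S φ T.AtLeft) L (T.plainOp S φ x) =
      T.reducedOp S φ (chain (T.fillOp S φ T.AtLeft) L x) := by
  have C := T.corner (m := m)
  rw [chain_fillOp_eq S hL hL' (plainOp_mem S hx), chain_fillOp_eq S hL hL' hx]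
  obtain ⟨i, hi⟩ := chain_fillOp_right S (φ := φ) (T := T) hL
  rw [hi, LinearMap.smul_apply, LinearMap.smul_apply, map_smul]
  congr 1
  rw [LinearMap.comp_apply, LinearMap.comp_apply]
  have hA : ∀ (k : ZMod m) (J : Set (ZMod m)), k ∉ J → ∀ x ∈ span {f | T.CosectorLabelled J f},
      T.cosectorOp S φ k x ∈ span {f | T.CosectorLabelled (insert k J) f} :=
    fun k J hk x hx => cosectorOp_mem S hk hx
  have h1 := chain_comm_mem (A := fun J => span {f | T.CosectorLabelled J f})
    (B := fun J => span {f : Curve (n + 1) m ≃ Curve (n + 1) m |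
      Cobad T.c₀ (T.c₀ + 1) T.p (T.c₀ + 1) J (rows f)})
    (d := T.plainOffOp S φ (T.c₀ + 1)) (-1) hA
    (fun k J _ x hx => Submodule.neg_mem _ (S.op_mem φ (fun f hf l r h => Cosector.cobad hf C h) hx))
    (fun k J hk x hx => by
      rw [neg_one_smul, sub_neg_eq_add]
      refine span_induction (T.cosectorOp S φ k ∘ₗ T.plainOffOp S φ (T.c₀ + 1) J +
        T.plainOffOp S φ (T.c₀ + 1) (insert k J) ∘ₗ T.cosectorOp S φ k) _ (fun f hf => ?_) hx
      have hf' : T.CosectorLabelled J f := hf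
      have hs : (T.sheets m).Separated (T.c₀ + 1) T.c₀ T.p J (rows f) := Labelled.separated hf'
      have key := S.op_cosector_add (φ := φ) C hc (.inl hc) f J hk hs
      rw [LinearMap.add_apply, LinearMap.comp_apply, LinearMap.comp_apply, cosectorOp,
        LinearMap.neg_apply, LinearMap.neg_apply, map_neg, ← neg_add]
      exact Submodule.neg_mem _ key) hL (mem_labelled hx)
  have h2 : {f : Curve (n + 1) m ≃ Curve (n + 1) m |
      Cobad T.c₀ (T.c₀ + 1) T.p (T.c₀ + 1) {k | k ∈ L} (rows f)} = ∅ := by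
    rw [Set.eq_empty_iff_forall_notMem]
    rintro f ⟨b, h3, h4, h5⟩
    refine h3 ?_ (hL' _)
    have := C.col
    have := b.1.2
    simp only [cycIco_iff, Fin.ext_iff, ne_eq] at *
    omega
  have h3 := chain_mem (A := fun J => span {f | T.CosectorLabelled J f}) hA hL (mem_labelled hx)
  rw [h2, span, Finsupp.supported_empty, Submodule.mem_bot, sub_eq_zero, plainOffOp_empty] at h1
  rw [h1, reducedOp_chain_sideOp S hc hL hL'
    (Finsupp.supported_mono (fun f hf => CosectorLabelled.row_iff hf hL') h3), map_smul]
  congr 2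
  refine span_eq (T.plainOffOp S φ (T.c₀ + 1) {k | k ∈ L}) (S.op φ _)
    (fun f _ => S.op_congr fun l r => ?_) h3
  exact and_congr_right fun _ => ⟨fun h => ⟨fun h' => h.1 h' (hL' _), fun h' => h.2 h' (hL' _)⟩,
      fun h => ⟨fun h' => absurd h' h.1, fun h' => absurd h' h.2⟩⟩

theorem chain_fillOp_plainOp_left {a : Fin (n + 1)} (ha : (T.sheets m).M a T.p)
    (hac : ∀ x, x ≠ T.c₀ → CycIco x T.c₀ a) {L : List (ZMod m)}
    (hL' : ∀ k, k ∈ L) {x : States (n + 1) m} (hx : x ∈ span {f | T.IsReal f}) :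
    chain (T.fillOp S φ T.AtLeft) L (T.plainOp S φ x) =
      T.reducedOp S φ (chain (T.fillOp S φ T.AtLeft) L x) := by
  have C := T.corner (m := m)
  have h1 : chain (T.fillOp S φ T.AtLeft) L = proj fun ρ => ∀ k ∈ L, T.AtLeft k ρ := by
    rw [← chain_proj]
    refine chain_congr fun k _ => ?_
    rw [fillOp, hexagonOp, hexagon, S.op_flap_eq_zero ha hac, LinearMap.zero_comp, add_zero]
  rw [h1]
  refine span_eq (proj (fun ρ => ∀ k ∈ L, T.AtLeft k ρ) ∘ₗ T.plainOp S φ)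
    (T.reducedOp S φ ∘ₗ proj fun ρ => ∀ k ∈ L, T.AtLeft k ρ) (fun f hf => ?_) hx
  rw [LinearMap.comp_apply, LinearMap.comp_apply, plainOp, S.proj_op]
  by_cases h : ∀ k ∈ L, T.AtLeft k (rows f)
  · rw [proj_of h]
    have hρ : ∀ b, rows f b = T.p ↔ b.1 = T.c₀ := by
      intro b
      constructor
      · intro hb
        obtain ⟨k, rfl⟩ := eq_of_label (T := T) (f := f) (g := T.left) (s := T.c₀)
          (fun k => by
            have h2 : rows f (T.left k) = T.p := h k (hL' k)
            rw [hf (T.left k), ← h2]; rfl) (b := b) (by rw [hf b, ← hb]; rfl)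
        rfl
      · intro hb
        rw [(Prod.ext hb rfl : b = T.left b.2)]
        exact h b.2 (hL' _)
    refine S.op_congr fun l r => ?_
    rw [← C.reduced_iff_left ha hac hρ]
    refine and_congr_right fun hP => ⟨fun h2 => ?_, fun h2 k hk => ?_⟩
    · constructor <;> intro h3
      · have h4 := h2 l.2 (hL' _)
        rw [AtLeft, (Prod.ext h3.symm rfl : T.left l.2 = l), exch_left, hρ] at h4
        exact hP.1.col (h3.trans h4.symm)
      · have h4 := h2 r.2 (hL' _)
        rw [AtLeft, (Prod.ext h3.symm rfl : T.left r.2 = r), exch_right, hρ] at h4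
        exact hP.1.col (h4.trans h3.symm)
    · exact (exch_ne _ (ne_of_col h2.1.symm) (ne_of_col h2.2.symm)).trans (h k hk)
  · rw [proj_of_not h, map_zero]
    refine S.op_eq_zero ?_
    rintro l r ⟨hP, h2⟩
    push Not at h
    obtain ⟨k, hk, h3⟩ := h
    have h4 := h2 k hk
    rw [AtLeft] at h3 h4
    by_cases hl : T.left k = l
    · subst hl
      rw [exch_left] at h4
      exact hP.2.2 (cycIco_self hP.1.col) (h4 ▸ C.cycIco_q (h4 ▸ hP.1.row))
    by_cases hr : T.left k = r
    · subst hr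
      rw [exch_right] at h4
      exact hP.1.free a (hac _ hP.1.col) T.p (h4 ▸ cycIco_self hP.1.row) ha
    · rw [exch_ne _ hl hr] at h4
      exact h3 h4

/-- Filling the left circles commutes with the boundary operators. -/
theorem chain_fillOp_plainOp {L : List (ZMod m)} (hL : L.Nodup) (hL' : ∀ k, k ∈ L)
    {x : States (n + 1) m} (hx : x ∈ span {f | T.IsReal f}) :
    chain (T.fillOp S φ T.AtLeft) L (T.plainOp S φ x) =
      T.reducedOp S φ (chain (T.fillOp S φ T.AtLeft) L x) := by
  rcases T.adjacent_cases m with h | ⟨a, ha, hac⟩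
  · exact chain_fillOp_plainOp_right S h hL hL' hx
  · exact chain_fillOp_plainOp_left S ha hac hL' hx

end Stabilization
end GridCover

namespace GridCover

open Sheets

section Chain

variable {K V : Type*} [AddCommGroup V]

theorem chain_range_succ (Y : ℕ → V →ₗ[ℤ] V) (i : ℕ) :
    chain Y (List.range (i + 1)).reverse = Y i ∘ₗ chain Y (List.range i).reverse := by
  rw [List.range_succ, List.reverse_append]
  rfl

theorem chain_map {K' : Type*} (Y : K → V →ₗ[ℤ] V) (g : K' → K) (L : List K') :
    chain Y (L.map g) = chain (fun k => Y (g k)) L := by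
  induction L with
  | nil => rfl
  | cons a L ih => rw [List.map_cons, chain, chain, ih]

end Chain

namespace SignAssignment

variable {N m : ℕ} (S : SignAssignment (m * N)) {φ : Framing N m}

variable (φ) in
/-- The exchanges along the curves `l 0, l 1, …, l i`. -/
noncomputable def link (l : ℕ → Curve N m) (i : ℕ) : States N m →ₗ[ℤ] States N m :=
  chain (fun j => S.exchange φ (l j) (l (j + 1))) (List.range i).reverse

theorem link_succ (l : ℕ → Curve N m) (i : ℕ) :
    S.link φ l (i + 1) = S.exchange φ (l i) (l (i + 1)) ∘ₗ S.link φ l i := chain_range_succ _ _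

variable (φ) in
/-- The exchanges of the points on `l j` and `e j` for `j = 1, …, i`. -/
noncomputable def fan (l e : ℕ → Curve N m) (i : ℕ) : States N m →ₗ[ℤ] States N m :=
  chain (fun j => S.exchange φ (l (j + 1)) (e (j + 1))) (List.range i).reverse

theorem fan_succ (l e : ℕ → Curve N m) (i : ℕ) :
    S.fan φ l e (i + 1) = S.exchange φ (l (i + 1)) (e (i + 1)) ∘ₗ S.fan φ l e i :=
  chain_range_succ _ _

variable (φ) in
/-- The exchanges along the curves `l 0, e 1, l 1, …, e i, l i`. -/
noncomputable def zigzag (l e : ℕ → Curve N m) (i : ℕ) : States N m →ₗ[ℤ] States N m :=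
  chain (fun j => S.exchange φ (l (j + 1)) (e (j + 1)) ∘ₗ S.exchange φ (l j) (e (j + 1)))
    (List.range i).reverse

theorem zigzag_succ (l e : ℕ → Curve N m) (i : ℕ) :
    S.zigzag φ l e (i + 1) = (S.exchange φ (l (i + 1)) (e (i + 1)) ∘ₗ
      S.exchange φ (l i) (e (i + 1))) ∘ₗ S.zigzag φ l e i := chain_range_succ _ _

theorem exchange_link {l : ℕ → Curve N m} {i : ℕ} {x : Curve N m}
    (hl : ∀ j k, j ≤ i → k ≤ i → l j = l k → j = k) (hx : ∀ j ≤ i, l j ≠ x) :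
    S.exchange φ (l i) x ∘ₗ S.link φ l i = (-1 : ℤ) ^ i • (S.link φ l i ∘ₗ S.exchange φ (l 0) x) := by
  induction i with
  | zero => simp [link, chain]
  | succ i ih =>
    have h1 : l i ≠ l (i + 1) := fun h => by
      have := hl i (i + 1) (by omega) le_rfl h
      omega
    rw [link_succ, ← LinearMap.comp_assoc, S.exchange_exchange h1 (hx _ le_rfl),
      Equiv.swap_apply_right, Equiv.swap_apply_of_ne_of_ne (hx i (by omega)).symm (hx _ le_rfl).symm,
      LinearMap.neg_comp, LinearMap.comp_assoc, ih (fun j k hj hk => hl j k (by omega) (by omega))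
      fun j hj => hx j (by omega), LinearMap.comp_smul, LinearMap.comp_assoc, pow_succ, mul_neg_one,
      neg_smul]

theorem exchange_link_of_ne {l : ℕ → Curve N m} {i : ℕ} {x y : Curve N m} (hxy : y ≠ x)
    (hl : ∀ j k, j ≤ i → k ≤ i → l j = l k → j = k) (hx : ∀ j ≤ i, l j ≠ x)
    (hy : ∀ j ≤ i, l j ≠ y) :
    S.exchange φ y x ∘ₗ S.link φ l i = (-1 : ℤ) ^ i • (S.link φ l i ∘ₗ S.exchange φ y x) := by
  induction i with
  | zero => simp [link, chain]
  | succ i ih =>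
    have h1 : l i ≠ l (i + 1) := fun h => by
      have := hl i (i + 1) (by omega) le_rfl h
      omega
    rw [link_succ, ← LinearMap.comp_assoc, S.exchange_disjoint hxy h1 (hy i (by omega)).symm
      (hy _ le_rfl).symm (hx i (by omega)).symm (hx _ le_rfl).symm,
      LinearMap.neg_comp, LinearMap.comp_assoc, ih (fun j k hj hk => hl j k (by omega) (by omega))
      (fun j hj => hx j (by omega)) fun j hj => hy j (by omega), LinearMap.comp_smul,
      LinearMap.comp_assoc, pow_succ, mul_neg_one, neg_smul]

/-- The sign does not depend on the curves. -/
theorem zigzag_eq (i : ℕ) : ∃ s : ℕ, ∀ l e : ℕ → Curve N m,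
    (∀ j k, j ≤ i → k ≤ i → l j = l k → j = k) → (∀ j k, j ≤ i → k ≤ i → l j ≠ e k) →
    S.zigzag φ l e i = (-1 : ℤ) ^ s • (S.link φ l i ∘ₗ S.fan φ l e i) := by
  induction i with
  | zero => exact ⟨0, fun l e _ _ => by simp [zigzag, link, fan, chain]⟩
  | succ i ih =>
    obtain ⟨s, hs⟩ := ih
    refine ⟨s + i + 1, fun l e hl he => ?_⟩
    have h1 : l (i + 1) ≠ e (i + 1) := he _ _ le_rfl le_rfl
    have h2 : l i ≠ l (i + 1) := fun h => by
      have := hl i (i + 1) (by omega) le_rfl h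
      omega
    have h3 := S.exchange_exchange (φ := φ) h1 h2
    rw [Equiv.swap_apply_left, Equiv.swap_apply_of_ne_of_ne h2 (he i (i + 1) (by omega) le_rfl)]
      at h3
    have h4 := S.exchange_link_of_ne (φ := φ) (l := l) (i := i) h1
      (fun j k hj hk => hl j k (by omega) (by omega)) (fun j hj => he j (i + 1) (by omega) le_rfl)
      fun j hj h => by
        have := hl j (i + 1) (by omega) le_rfl h
        omega
    rw [zigzag_succ, hs l e (fun j k hj hk => hl j k (by omega) (by omega))
      (fun j k hj hk => he j k (by omega) (by omega)), ← neg_eq_iff_eq_neg.2 h3, link_succ, fan_succ,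
      LinearMap.comp_smul, LinearMap.neg_comp, LinearMap.comp_assoc,
      ← LinearMap.comp_assoc (S.fan φ l e i) (S.link φ l i), h4, LinearMap.smul_comp,
      LinearMap.comp_smul, smul_neg, smul_smul, ← neg_smul, ← pow_add,
      ← mul_neg_one, ← pow_succ, LinearMap.comp_assoc, LinearMap.comp_assoc]

/-- The exchanges along the boundary of a polygon, up to a sign which does not depend on the
curves. -/
theorem exchange_zigzag (i : ℕ) : ∃ s : ℕ, ∀ (l e : ℕ → Curve N m) (x : Curve N m),
    (∀ j k, j ≤ i → k ≤ i → l j = l k → j = k) → (∀ j k, j ≤ i → k ≤ i → l j ≠ e k) →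
    (∀ j ≤ i, l j ≠ x) → S.exchange φ (l i) x ∘ₗ S.zigzag φ l e i =
      (-1 : ℤ) ^ s • (S.link φ l i ∘ₗ S.exchange φ (l 0) x ∘ₗ S.fan φ l e i) := by
  obtain ⟨s, hs⟩ := S.zigzag_eq (φ := φ) i
  refine ⟨s + i, fun l e x hl he hx => ?_⟩
  rw [hs l e hl he, LinearMap.comp_smul, ← LinearMap.comp_assoc, S.exchange_link hl hx,
    LinearMap.smul_comp, smul_smul, ← pow_add, LinearMap.comp_assoc]

end SignAssignment

namespace Sheets

variable {N m : ℕ} {Z : Sheets N m} {ρ : Curve N m → Fin N} {l r l' r' : Curve N m}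
  {c p : Fin N} {j k : ZMod m}

theorem Sector.unique (h : Z.Sector c p k ρ l r) (h' : Z.Sector c p k ρ l' r') :
    l = l' ∧ r = r' := by
  obtain ⟨rfl, R, e⟩ := h
  obtain ⟨rfl, R', e'⟩ := h'
  refine ⟨rfl, ?_⟩
  by_cases h1 : r.1 = r'.1
  · exact R.base.unique R'.base h1
  · have h2 := R.col
    have h3 := R'.col
    have h4 : CycIoo c r.1 r'.1 ∨ CycIoo c r'.1 r.1 := by
      simp only [cycIoo_iff, Fin.ext_iff, ne_eq] at *
      omega
    rcases h4 with h4 | h4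
    · exact absurd (e'.trans e.symm) (R.empty r' h4 R'.base).2.1
    · exact absurd (e.trans e'.symm) (R'.empty r h4 R.base).2.1

theorem Sector.ne_of_ne (hjk : j ≠ k) (h : Z.Sector c p j ρ l r) (h' : Z.Sector c p k ρ l' r') :
    r ≠ r' := by
  obtain ⟨rfl, R, e⟩ := h
  obtain ⟨rfl, R', e'⟩ := h'
  rintro rfl
  have h1 := R.base.flat R.free
  have h2 := R'.base.flat R'.free
  rw [e] at h1 h2
  exact mk_ne_left hjk (h1.unique_left h2 rfl)

/-- Sectors in different sheets are independent of each other. -/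
theorem Sector.exchange (hjk : j ≠ k) (h : Z.Sector c p j ρ l r) (h' : Z.Sector c p k ρ l' r') :
    Z.Sector c p k (exch ρ l r) l' r' := by
  have hr := h.ne_of_ne hjk h'
  obtain ⟨rfl, R, e⟩ := h
  obtain ⟨rfl, R', e'⟩ := h'
  have h3 : ((c, k) : Curve N m) ≠ (c, j) := mk_ne_left hjk.symm
  have h4 : ((c, k) : Curve N m) ≠ r := ne_of_col R.col
  have h5 : r' ≠ (c, j) := ne_of_col R'.col.symm
  have e1 : exch ρ (c, j) r (c, k) = ρ (c, k) := exch_ne _ h3 h4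
  have e2 : exch ρ (c, j) r r' = ρ r' := exch_ne _ h5 hr.symm
  refine ⟨rfl, ⟨R'.col, ?_, ?_, ?_, fun b hb jb => ?_⟩, e2.trans e'⟩
  · rw [e1, e2]; exact R'.row
  · rw [e1]; exact R'.base
  · rw [e1, e2]; exact R'.free
  rw [e1] at jb
  rw [e1, e2]
  by_cases hbr : b = r
  · subst hbr
    rw [exch_right]
    have key : ¬ Z.Joined (ρ (c, j)) (c, k) b :=
      fun h7 => mk_ne_left hjk (R.base.unique_left h7 rfl)
    have h6 : ∀ x, CycIco c b.1 x → CycIco c r'.1 x := by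
      intro x hx
      simp only [cycIoo_iff, cycIco_iff, Fin.ext_iff, ne_eq] at *
      omega
    refine ⟨fun h7 => key (h7 ▸ jb), fun h7 => R.row (h7.trans (e'.trans e.symm)), fun h7 => key ?_⟩
    refine jb.flat fun x hx i hi => R'.free x (h6 x hx) i ?_
    simp only [cycIoo_iff, cycIco_iff, Fin.ext_iff, ne_eq] at *
    omega
  · rw [exch_ne _ (ne_of_col (ne_of_cycIoo_left hb).symm : b ≠ (c, j)) hbr]
    exact R'.empty b hb jb

end Sheets

namespace Stabilization

variable {n : ℕ} {T : Stabilization n} {m : ℕ} [NeZero m] (S : SignAssignment (m * (n + 1)))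
  {φ : Framing (n + 1) m}

open SignAssignment

theorem sectorOp_of {k : ZMod m} {f : Curve (n + 1) m ≃ Curve (n + 1) m} {r : Curve (n + 1) m}
    (h : (T.sheets m).Sector T.c₀ T.p k (rows f) (T.left k) r) :
    T.sectorOp S φ k (Finsupp.single f 1) = S.exchange φ (T.left k) r (Finsupp.single f 1) :=
  S.op_unique fun _ _ => ⟨fun h' => h'.unique h, by rintro ⟨rfl, rfl⟩; exact h⟩

theorem chain_sectorOp {L : List (ZMod m)} (hL : L.Nodup) {f : Curve (n + 1) m ≃ Curve (n + 1) m}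
    {e : ZMod m → Curve (n + 1) m}
    (h : ∀ k ∈ L, (T.sheets m).Sector T.c₀ T.p k (rows f) (T.left k) (e k)) :
    ∃ (s : ℤ) (g : Curve (n + 1) m ≃ Curve (n + 1) m),
      chain (T.sectorOp S φ) L (Finsupp.single f 1) = s • Finsupp.single g 1 ∧
      chain (fun k => S.exchange φ (T.left k) (e k)) L (Finsupp.single f 1) =
        s • Finsupp.single g 1 ∧ ∀ k ∉ L, ∀ l r,
        (T.sheets m).Sector T.c₀ T.p k (rows g) l r ↔ (T.sheets m).Sector T.c₀ T.p k (rows f) l r := by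
  induction L with
  | nil => exact ⟨1, f, by simp [chain], by simp [chain], fun k _ l r => Iff.rfl⟩
  | cons a L ih =>
    rw [List.nodup_cons] at hL
    obtain ⟨s, g, h1, h2, h3⟩ := ih hL.2 fun k hk => h k (List.mem_cons_of_mem _ hk)
    have h4 := (h3 a hL.1 _ _).2 (h a List.mem_cons_self)
    refine ⟨s * S.rectSign φ g (g (T.left a)) (g (e a)), (Equiv.swap (T.left a) (e a)).trans g,
      ?_, ?_, fun k hk l r => ?_⟩
    · rw [chain, LinearMap.comp_apply, h1, map_smul, sectorOp_of S h4, exchange_single, smul_smul]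
    · rw [chain, LinearMap.comp_apply, h2, map_smul, exchange_single, smul_smul]
    · simp only [List.mem_cons, not_or] at hk
      rw [← h3 k hk.2, rows_trans_swap]
      have hak : a ≠ k := fun h => hk.1 h.symm
      exact ⟨fun h5 => (sector_sector hak h4 h5).2.1,
        fun h5 => h4.exchange hak h5⟩

theorem chain_sectorOp_eq_zero {L : List (ZMod m)} (hL : L.Nodup)
    {f : Curve (n + 1) m ≃ Curve (n + 1) m} {k : ZMod m} (hk : k ∈ L)
    (h : ∀ r, ¬ (T.sheets m).Sector T.c₀ T.p k (rows f) (T.left k) r) :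
    chain (T.sectorOp S φ) L (Finsupp.single f 1) = 0 := by
  induction L generalizing k with
  | nil => simp at hk
  | cons a L ih =>
    rw [List.nodup_cons] at hL
    rw [chain, LinearMap.comp_apply]
    by_cases h1 : ∃ j ∈ L, ∀ r, ¬ (T.sheets m).Sector T.c₀ T.p j (rows f) (T.left j) r
    · obtain ⟨j, hj, h2⟩ := h1
      rw [ih hL.2 hj h2, map_zero]
    · push Not at h1
      have hka : k = a := by
        by_contra hka
        obtain ⟨r, hr⟩ := h1 k ((List.mem_cons.1 hk).resolve_left hka)
        exact h r hr
      subst hka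
      have : Nonempty (Curve (n + 1) m) := ⟨T.left 0⟩
      choose! e he using h1
      obtain ⟨s, g, h2, -, h3⟩ := chain_sectorOp S (φ := φ) hL.2 he
      rw [h2, map_smul, sectorOp, S.op_eq_zero, smul_zero]
      intro l r h4
      have h5 := (h3 k hL.1 _ _).1 h4
      rw [h5.1] at h5
      exact h r h5

end Stabilization
end GridCover

namespace GridCover

open Sheets

namespace SignAssignment

variable {N m : ℕ} (S : SignAssignment (m * N)) (φ : Framing N m)

theorem pathSign_append {M : ℕ} (S : SignAssignment M) (x : FormalGenerator M)
    (A B : List (FlowShape M)) : S.pathSign x (A ++ B) =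
      S.pathSign x A * S.pathSign (A.foldl (fun x a => a.terminal x) x) B := by
  induction A generalizing x with
  | nil => simp [pathSign]
  | cons a A ih => rw [List.cons_append, pathSign, pathSign, ih, List.foldl_cons, mul_assoc]

/-- The operator `F` sends the state `f` to `g`, with the sign of a path of formal flows. -/
structure Follows (f : Curve N m ≃ Curve N m) (A : List (FlowShape (m * N)))
    (F : States N m →ₗ[ℤ] States N m) (g : Curve N m ≃ Curve N m) : Prop where
  sign : F (Finsupp.single f 1) = (S.pathSign (φ.formalState f) A : ℤ) • Finsupp.single g 1
  last : A.foldl (fun x a => a.terminal x) (φ.formalState f) = φ.formalState g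

variable {S φ}

theorem Follows.trans {f g h : Curve N m ≃ Curve N m} {A B : List (FlowShape (m * N))}
    {F G : States N m →ₗ[ℤ] States N m} (h1 : S.Follows φ f A F g) (h2 : S.Follows φ g B G h) :
    S.Follows φ f (A ++ B) (G ∘ₗ F) h where
  sign := by
    rw [LinearMap.comp_apply, h1.sign, map_smul, h2.sign, smul_smul, pathSign_append, h1.last,
      Units.val_mul]
  last := by rw [List.foldl_append, h1.last, h2.last]

variable (S φ)

theorem follows_exchange (f : Curve N m ≃ Curve N m) {l r : Curve N m} (h : l ≠ r) :
    S.Follows φ f (φ.edgePair (f l) (f r) (φ.αSign (f l)) (-φ.αSign (f r))) (S.exchange φ l r)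
      ((Equiv.swap l r).trans f) where
  sign := S.exchange_single l r f
  last := by
    have hf : f l ≠ f r := fun h' => h (f.injective h')
    have h1 := φ.rectangle_eq hf
    rw [Framing.rectangle] at h1
    rw [h1, trans_swap]
    exact φ.shape_terminal f hf

theorem follows_exchange_rotate (f : Curve N m ≃ Curve N m) {l r : Curve N m} (h : l ≠ r) :
    S.Follows φ f (φ.edgePair (f r) (f l) (-φ.αSign (f r)) (φ.αSign (f l))) (S.exchange φ l r)
      ((Equiv.swap l r).trans f) := by
  have hf : f l ≠ f r := fun h' => h (f.injective h')
  have ho : φ.αOrder (f r) ≠ φ.αOrder (f l) := fun h' => hf (φ.αOrder.injective h').symm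
  have h1 : φ.edgePair (f r) (f l) (-φ.αSign (f r)) (φ.αSign (f l)) =
      [.rectangle (φ.αOrder (f r)) (φ.αOrder (f l)) ho (-φ.αSign (f r)) (φ.αSign (f l))] := by
    rw [Framing.edgePair, dif_pos hf.symm]
  constructor
  · rw [h1, exchange_single, rectSign_eq S f hf, Framing.shape, S.rotate]
    simp [pathSign]
  · rw [h1, trans_swap, ← φ.shape_terminal f hf]
    simp only [List.foldl_cons, List.foldl_nil, Framing.shape, FlowShape.terminal,
      FormalGenerator.betaSign]
    rw [Equiv.swap_comm, Function.update_comm ho.symm]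

theorem follows_zigzag {l e : ℕ → Curve N m} {i : ℕ} (f : Curve N m ≃ Curve N m)
    (F : ℕ → List (FlowShape (m * N))) (hl : ∀ j k, j ≤ i → k ≤ i → l j = l k → j = k)
    (he : ∀ j k, j < i → k < i → e (j + 1) = e (k + 1) → j = k) (hle : ∀ j k, l j ≠ e k)
    (hF : ∀ j < i, F (2 * j) = φ.edgePair (f (l 0)) (f (e (j + 1))) (φ.αSign (f (l 0)))
      (-φ.αSign (f (e (j + 1)))) ∧ F (2 * j + 1) = φ.edgePair (f (l 0)) (f (l (j + 1)))
        (-φ.αSign (f (l 0))) (φ.αSign (f (l (j + 1))))) :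
    ∃ g, S.Follows φ f ((List.range (2 * i)).flatMap F) (S.zigzag φ l e i) g ∧ g (l i) = f (l 0) ∧
      (∀ j < i, g (l j) = f (e (j + 1)) ∧ g (e (j + 1)) = f (l (j + 1))) ∧
      ∀ b, (∀ j ≤ i, b ≠ l j) → (∀ j < i, b ≠ e (j + 1)) → g b = f b := by
  induction i with
  | zero =>
    refine ⟨f, ⟨by simp [zigzag, chain, pathSign], by simp⟩, rfl, by simp, by simp⟩
  | succ i ih =>
    obtain ⟨g, h1, h2, h3, h4⟩ := ih (fun j k hj hk => hl j k (by omega) (by omega))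
      (fun j k hj hk => he j k (by omega) (by omega)) fun j hj => hF j (by omega)
    have hl' : ∀ j, j ≤ i → l (i + 1) ≠ l j := fun j hj h => by
      have := hl (i + 1) j le_rfl (by omega) h
      omega
    have he' : ∀ j, j < i → e (i + 1) ≠ e (j + 1) := fun j hj h => by
      have := he i j (by omega) (by omega) h
      omega
    have h5 := S.follows_exchange φ g (hle i (i + 1))
    set g' := (Equiv.swap (l i) (e (i + 1))).trans g with hg'
    have h6 := S.follows_exchange_rotate φ g' (hle (i + 1) (i + 1))
    set g'' := (Equiv.swap (l (i + 1)) (e (i + 1))).trans g' with hg''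
    have k1 : g (e (i + 1)) = f (e (i + 1)) := h4 _ (fun j _ => (hle _ _).symm) he'
    have k2 : g (l (i + 1)) = f (l (i + 1)) := h4 _ hl' fun j _ => hle _ _
    have k3 : g' (e (i + 1)) = f (l 0) := by simp [hg', h2]
    have k4 : g' (l (i + 1)) = f (l (i + 1)) := by
      rw [hg', Equiv.trans_apply, Equiv.swap_apply_of_ne_of_ne (hl' i le_rfl) (hle _ _), k2]
    rw [h2, k1] at h5
    rw [k3, k4] at h6
    refine ⟨g'', ?_, ?_, fun j hj => ?_, fun b hb hb' => ?_⟩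
    · rw [zigzag_succ, show 2 * (i + 1) = 2 * i + 1 + 1 by ring, List.range_succ, List.range_succ,
        List.append_assoc, List.flatMap_append]
      refine h1.trans ?_
      simp only [List.flatMap_append, List.flatMap_cons, List.flatMap_nil, List.append_nil]
      rw [(hF i (by omega)).1, (hF i (by omega)).2]
      exact h5.trans h6
    · simp [hg'', k3]
    · rcases Nat.lt_succ_iff_lt_or_eq.1 hj with hj | rfl
      · have n1 : l j ≠ l (i + 1) := (hl' j hj.le).symm
        have n2 : l j ≠ l i := fun h => by
          have := hl j i (by omega) (by omega) h
          omega
        rw [hg'', hg', Equiv.trans_apply, Equiv.trans_apply, Equiv.trans_apply, Equiv.trans_apply,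
          Equiv.swap_apply_of_ne_of_ne n1 (hle _ _), Equiv.swap_apply_of_ne_of_ne n2 (hle _ _),
          Equiv.swap_apply_of_ne_of_ne (hle _ _).symm (he' j hj).symm,
          Equiv.swap_apply_of_ne_of_ne (hle _ _).symm (he' j hj).symm]
        exact h3 j hj
      · constructor
        · rw [hg'', hg', Equiv.trans_apply, Equiv.trans_apply,
            Equiv.swap_apply_of_ne_of_ne (hl' j le_rfl).symm (hle _ _), Equiv.swap_apply_left, k1]
        · rw [hg'', Equiv.trans_apply, Equiv.swap_apply_right, k4]
    · rw [hg'', hg', Equiv.trans_apply, Equiv.trans_apply,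
        Equiv.swap_apply_of_ne_of_ne (hb _ le_rfl) (hb' i (by omega)),
        Equiv.swap_apply_of_ne_of_ne (hb i (by omega)) (hb' i (by omega))]
      exact h4 b (fun j hj => hb j (by omega)) fun j hj => hb' j (by omega)

end SignAssignment
end GridCover

namespace GridCover

open Sheets

namespace Stabilization

variable {n : ℕ} {T : Stabilization n} {m : ℕ}

open SignAssignment

theorem isReal_equiv (x : Generator T.H m) : T.IsReal x.equiv := fun _ => rfl

theorem rows_equiv (x : Generator T.H m) : rows x.equiv = x.row := rfl

theorem equiv_injective : Function.Injective (Generator.equiv : Generator T.H m → _) :=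
  fun _ _ h => Generator.ext (congrArg rows h)

theorem IsReal.exists_equiv {f : Curve (n + 1) m ≃ Curve (n + 1) m} (hf : T.IsReal f) :
    ∃ x : Generator T.H m, x.equiv = f := by
  have h : (fun b => T.H.alphaThrough (rows f b) b) = f := funext fun b => (hf b).symm
  exact ⟨⟨rows f, h ▸ f.bijective⟩, Equiv.ext fun b => (hf b).symm⟩

theorem rectangle_iff_plain {x y : Generator T.H m} {l r : Curve (n + 1) m} :
    x.IsRectangle y l r ↔ (T.sheets m).Plain T.c₀ T.p T.q.castSucc x.row l r ∧
      y.equiv = (Equiv.swap l r).trans x.equiv := by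
  have C := T.corner (m := m)
  have inj : ∀ {a b : Curve (n + 1) m}, x.alpha a = x.alpha b → a = b := fun h => x.bijective.1 h
  constructor
  · intro h
    have hrow : x.row l ≠ x.row r := by
      intro h'
      refine ne_of_col h.columns_ne (inj ?_)
      rw [← h.bottom, h', Generator.alpha]
    have hp : CycIco l.1 r.1 T.c₀ → ¬ CycIco (x.row l) (x.row r) T.p := by
      intro h1 h2
      refine h.no_O _ h1 ?_
      rw [T.O_new]
      exact h2
    have hq : CycIco l.1 r.1 T.c₀ → ¬ CycIco (x.row l) (x.row r) T.q.castSucc := by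
      intro h1 h2
      refine h.no_X _ h1 ?_
      rw [T.X_new]
      exact h2
    have hl : ∀ b, CycIco l.1 b.1 T.c₀ → CycIco l.1 r.1 b.1 ∨ b = r → x.row l ≠ T.p := by
      intro b hb hbr h1
      refine hp ?_ (h1 ▸ cycIco_self hrow)
      rcases hbr with hbr | rfl
      · simp only [cycIco_iff] at *
        omega
      · exact hb
    have free : ∀ c, CycIco l.1 r.1 c → ∀ i, CycIco (x.row l) (x.row r) i →
        ¬ (T.sheets m).M c i := by
      rintro c hc i hi ⟨h1, rfl | rfl⟩
      exacts [h.no_X c hc hi, h.no_O c hc hi]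
    have base : (T.sheets m).Joined (x.row l) l r :=
      (T.alphaThrough_eq_iff_joined fun h' => hl r h'.2 (.inr rfl) h'.1).1 h.bottom.symm
    refine ⟨⟨⟨h.columns_ne, hrow, base, free, fun b hb jb => ?_⟩, hp, hq⟩, ?_⟩
    · have e1 : T.H.alphaThrough (x.row l) l = T.H.alphaThrough (x.row l) b :=
        (T.alphaThrough_eq_iff_joined fun h' => hl b h'.2 (.inl hb.2) h'.1).2 jb
      refine ⟨fun h1 => ?_, fun h1 => ?_, h.empty b hb e1.symm⟩
      · refine ne_of_col (ne_of_cycIoo_left hb) (inj (e1.trans ?_))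
        rw [Generator.alpha, h1]
      · have h2 : ∀ c, CycIco l.1 b.1 c → CycIco l.1 r.1 c := by
          intro c hc
          simp only [cycIoo_iff, cycIco_iff] at *
          omega
        have e2 : T.H.alphaThrough (x.row r) l = T.H.alphaThrough (x.row r) b := by
          refine (T.alphaThrough_eq_iff_joined ?_).2
            (jb.flat fun c hc => free c (h2 c hc))
          rintro ⟨h3, h4⟩
          refine hq (h2 _ h4) ?_
          rw [h3]
          exact C.cycIco_q (h3 ▸ hrow)
        refine ne_of_cycIoo_right hb (congrArg Prod.fst (inj ?_))
        rw [← h.top, e2, ← h1, Generator.alpha]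
    · ext b : 1
      change T.H.alphaThrough (y.row b) b = x.alpha (Equiv.swap l r b)
      by_cases hbl : b = l
      · subst hbl
        rw [h.exchange.left, Equiv.swap_apply_left, h.top]
      by_cases hbr : b = r
      · subst hbr
        rw [h.exchange.right, Equiv.swap_apply_right, h.bottom]
      rw [h.exchange.rest b hbl hbr, Equiv.swap_apply_of_ne_of_ne hbl hbr, Generator.alpha]
  · rintro ⟨⟨R, hp, hq⟩, hy⟩
    have hrow : y.row = exch x.row l r := by
      rw [← rows_equiv, hy, rows_trans_swap, rows_equiv]
    have e1 : ∀ b, CycIco l.1 b.1 T.c₀ → CycIco l.1 r.1 b.1 ∨ b = r → x.row l ≠ T.p := by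
      intro b hb hbr h1
      refine hp ?_ (h1 ▸ cycIco_self R.row)
      rcases hbr with hbr | rfl
      · simp only [cycIco_iff] at *
        omega
      · exact hb
    refine ⟨R.col, ?_, ?_, fun c hc h1 => ?_, fun c hc h1 => ?_, fun b hb jb => ?_, ?_, ?_, ?_⟩
    · exact ((T.alphaThrough_eq_iff_joined fun h' => e1 r h'.2 (.inr rfl) h'.1).2 R.base).symm
    · refine (T.alphaThrough_eq_iff_joined ?_).2 (R.base.flat R.free)
      rintro ⟨h3, h4⟩
      exact hq h4 (h3 ▸ C.cycIco_q (h3 ▸ R.row))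
    · by_cases h2 : c = T.c₀
      · subst h2
        rw [T.X_new] at h1
        exact hq hc h1
      · exact R.free c hc _ h1 ⟨h2, .inl rfl⟩
    · by_cases h2 : c = T.c₀
      · subst h2
        rw [T.O_new] at h1
        exact hp hc h1
      · exact R.free c hc _ h1 ⟨h2, .inr rfl⟩
    · exact (R.empty b hb ((T.alphaThrough_eq_iff_joined fun h' => e1 b h'.2 (.inl hb.2) h'.1).1
        jb.symm)).2.2
    · rw [hrow, exch_left]
    · rw [hrow, exch_right]
    · intro b hbl hbr
      rw [hrow, exch_ne _ hbl hbr]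

variable [NeZero m] (S : SignAssignment (m * (n + 1))) (φ : Framing (n + 1) m)

theorem extend_row_left (y : Generator T.G m) (k : ZMod m) : (T.extend y).row (T.left k) = T.p := by
  simp [extend, left]

theorem extend_row_betaCurve (y : Generator T.G m) (b : Curve n m) :
    (T.extend y).row (T.betaCurve b) = T.p.succAbove (y.row b) := by
  simp [extend, betaCurve]

theorem extend_injective : Function.Injective (T.extend (m := m)) := by
  intro y y' h
  ext b : 2
  have := congrArg (fun x => Generator.row x (T.betaCurve b)) h
  simp only [extend_row_betaCurve] at this
  exact Fin.succAbove_right_injective this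

omit [NeZero m] in
theorem alphaCurve_injective : Function.Injective (T.alphaCurve (m := m)) := by
  intro a b h
  exact Prod.ext (Fin.succAbove_right_injective (congrArg Prod.fst h)) (congrArg Prod.snd h :)

omit [NeZero m] in
theorem betaCurve_injective : Function.Injective (T.betaCurve (m := m)) := by
  intro a b h
  exact Prod.ext (Fin.succAbove_right_injective (congrArg Prod.fst h)) (congrArg Prod.snd h :)

omit [NeZero m] in
theorem exists_betaCurve {b : Curve (n + 1) m} (h : b.1 ≠ T.c₀) : ∃ b', T.betaCurve b' = b := by
  obtain ⟨j, hj⟩ := Fin.exists_succAbove_eq h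
  exact ⟨(j, b.2), Prod.ext hj rfl⟩

theorem exists_extend {x : Generator T.H m} (h : ∀ k, x.row (T.left k) = T.p) :
    ∃ y : Generator T.G m, T.extend y = x := by
  have h1 : ∀ b : Curve n m, x.row (T.betaCurve b) ≠ T.p := by
    intro b hb
    obtain ⟨k, hk⟩ := eq_of_label (T := T) (f := x.equiv) (g := T.left) (s := T.c₀)
      (fun k => by
        change T.H.alphaThrough _ _ = _
        rw [h k]; rfl) (b := T.betaCurve b) (by
        change T.H.alphaThrough _ _ = _
        rw [hb])
    exact Fin.succAbove_ne _ _ (congrArg Prod.fst hk)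
  choose row hrow using fun b => Fin.exists_succAbove_eq (h1 b)
  have hinj : Function.Injective fun b => T.G.alphaThrough (row b) b := by
    intro b b' hb
    refine betaCurve_injective (T := T) (x.bijective.1 ?_)
    simp only
    rw [← hrow, ← hrow, T.alphaThrough_old, T.alphaThrough_old]
    exact congrArg _ hb
  refine ⟨⟨row, Finite.injective_iff_bijective.1 hinj⟩, Generator.ext (funext fun b => ?_)⟩
  by_cases hb : b.1 = T.c₀
  · rw [(Prod.ext hb rfl : b = T.left b.2), extend_row_left, h]
  · obtain ⟨b, rfl⟩ := exists_betaCurve hb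
    rw [extend_row_betaCurve, hrow]

variable (T) in
/-- The state of a generator of the cover of `H`. -/
noncomputable def toStates : Chains T.H m →ₗ[ℤ] States (n + 1) m :=
  Finsupp.lmapDomain ℤ ℤ Generator.equiv

variable (T) in
/-- The state of a generator of the cover of `G`. -/
noncomputable def extendStates : Chains T.G m →ₗ[ℤ] States (n + 1) m :=
  Finsupp.lmapDomain ℤ ℤ fun y => (T.extend y).equiv

omit [NeZero m] in
theorem toStates_single (x : Generator T.H m) (a : ℤ) :
    T.toStates (Finsupp.single x a) = a • Finsupp.single x.equiv 1 := by
  rw [toStates, Finsupp.lmapDomain_apply, Finsupp.mapDomain_single, Finsupp.smul_single, smul_eq_mul,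
    mul_one]

theorem extendStates_single (y : Generator T.G m) (a : ℤ) :
    T.extendStates (Finsupp.single y a) = a • Finsupp.single (T.extend y).equiv 1 := by
  rw [extendStates, Finsupp.lmapDomain_apply, Finsupp.mapDomain_single, Finsupp.smul_single,
    smul_eq_mul, mul_one]

theorem extendStates_injective : Function.Injective (T.extendStates (m := m)) :=
  Finsupp.mapDomain_injective fun _ _ h => extend_injective (equiv_injective h)

omit [NeZero m] in
theorem toStates_mem (x : Chains T.H m) : T.toStates x ∈ span {f | T.IsReal f} := by
  induction x using Finsupp.induction_linear with
  | zero => simp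
  | add x y hx hy => rw [map_add]; exact Submodule.add_mem _ hx hy
  | single x a =>
    rw [toStates_single]
    exact Submodule.smul_mem _ _ (Finsupp.single_mem_supported ℤ _ (isReal_equiv x))

open Classical in
theorem op_sum {P : (Curve (n + 1) m → Fin (n + 1)) → Curve (n + 1) m → Curve (n + 1) m → Prop}
    {f : Curve (n + 1) m ≃ Curve (n + 1) m}
    (h : ∀ l r, P (rows f) l r → T.IsReal ((Equiv.swap l r).trans f)) :
    S.op φ P (Finsupp.single f 1) = ∑ y : Generator T.H m, ∑ l, ∑ r,
      if P (rows f) l r ∧ y.equiv = (Equiv.swap l r).trans f then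
        (S.rectSign φ f (f l) (f r) : ℤ) • Finsupp.single y.equiv 1 else 0 := by
  symm
  rw [op_single, Finset.sum_comm]
  refine Finset.sum_congr rfl fun l _ => ?_
  rw [Finset.sum_comm]
  refine Finset.sum_congr rfl fun r _ => ?_
  by_cases h1 : P (rows f) l r
  · obtain ⟨y, hy⟩ := (h l r h1).exists_equiv
    rw [if_pos h1, Finset.sum_eq_single y, if_pos ⟨h1, hy⟩, exchange_single, hy]
    · intro z _ hz
      rw [if_neg]
      rintro ⟨-, h2⟩
      exact hz (equiv_injective (h2.trans hy.symm))
    · simp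
  · rw [if_neg h1]
    exact Finset.sum_eq_zero fun z _ => if_neg fun h2 => h1 h2.1

theorem toStates_boundaryH (x : Chains T.H m) :
    T.toStates (T.boundaryH S φ x) = T.plainOp S φ (T.toStates x) := by
  classical
  induction x using Finsupp.induction_linear with
  | zero => simp
  | add x y hx hy => rw [map_add, map_add, hx, hy, map_add, map_add]
  | single x a =>
    rw [← mul_one a, ← smul_eq_mul, ← Finsupp.smul_single, map_smul, map_smul, map_smul, map_smul]
    congr 1
    rw [toStates_single, one_smul, plainOp, op_sum S φ fun l r h => (isReal_equiv x).plain h,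
      boundaryH, boundary, Finsupp.linearCombination_single, one_smul, map_sum]
    refine Finset.sum_congr rfl fun y _ => ?_
    rw [map_sum, Generator.rectangles, Finset.sum_filter, Fintype.sum_prod_type]
    refine Finset.sum_congr rfl fun l _ => Finset.sum_congr rfl fun r _ => ?_
    simp only [rectangle_iff_plain, rows_equiv, toStates_single]
    rfl

end Stabilization
end GridCover

namespace GridCover

open Sheets

namespace Stabilization

variable {n : ℕ} {T : Stabilization n} {m : ℕ}

open SignAssignment

theorem cycIco_succAbove (c : Fin (n + 1)) {a b t : Fin n} :
    CycIco (c.succAbove a) (c.succAbove b) (c.succAbove t) ↔ CycIco a b t := by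
  have h : ∀ x y : Fin n, ((c.succAbove x : Fin (n + 1)) : ℕ) < c.succAbove y ↔ (x : ℕ) < y :=
    fun x y => Fin.succAbove_lt_succAbove_iff
  have h1 := h t a
  have h2 := h t b
  have h3 := h a b
  have h4 := h b a
  simp only [cycIco_iff]
  omega

theorem cycIoo_succAbove (c : Fin (n + 1)) {a b t : Fin n} :
    CycIoo (c.succAbove a) (c.succAbove b) (c.succAbove t) ↔ CycIoo a b t :=
  and_congr (not_congr Fin.succAbove_right_inj) (cycIco_succAbove c)

theorem cycIco_predAbove {a b : Fin n} {t : Fin (n + 1)} :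
    CycIco (T.p.succAbove a) (T.p.succAbove b) t ↔ CycIco a b (T.q.predAbove t) := by
  have h : ∀ x y : Fin n, ((T.p.succAbove x : Fin (n + 1)) : ℕ) < T.p.succAbove y ↔ (x : ℕ) < y :=
    fun x y => Fin.succAbove_lt_succAbove_iff
  have h1 := T.lt_succAbove_iff t a
  have h2 := T.lt_succAbove_iff t b
  have h3 := h a b
  have h4 := h b a
  simp only [cycIco_iff, Fin.lt_def] at *
  omega

variable [NeZero m] (S : SignAssignment (m * (n + 1))) (φ : Framing (n + 1) m)

omit [NeZero m] in
theorem joined_betaCurve {i : Fin n} {l r : Curve n m} :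
    (T.sheets m).Joined (T.p.succAbove i) (T.betaCurve l) (T.betaCurve r) ↔
      T.G.alphaThrough i l = T.G.alphaThrough i r := by
  rw [← T.alphaThrough_eq_iff_joined fun h => Fin.succAbove_ne _ _ h.1, T.alphaThrough_old,
    T.alphaThrough_old, alphaCurve_injective.eq_iff]

theorem extend_equiv_betaCurve (y : Generator T.G m) (b : Curve n m) :
    (T.extend y).equiv (T.betaCurve b) = T.alphaCurve (y.alpha b) := by
  change T.H.alphaThrough _ _ = _
  rw [extend_row_betaCurve, T.alphaThrough_old]
  rfl

theorem rectangle_iff_reduced {y y' : Generator T.G m} {l r : Curve n m} :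
    y.IsRectangle y' l r ↔
      (T.sheets m).Reduced T.c₀ (T.extend y).row (T.betaCurve l) (T.betaCurve r) ∧
        (T.extend y').equiv =
          (Equiv.swap (T.betaCurve l) (T.betaCurve r)).trans (T.extend y).equiv := by
  have inj : ∀ {a b : Curve n m}, y.alpha a = y.alpha b → a = b := fun h => y.bijective.1 h
  have hfree : (∀ x, CycIco (T.betaCurve l).1 (T.betaCurve r).1 x → ∀ i,
      CycIco ((T.extend y).row (T.betaCurve l)) ((T.extend y).row (T.betaCurve r)) i →
        ¬ (T.sheets m).M x i) ↔
      (∀ c, CycIco l.1 r.1 c → ¬ CycIco (y.row l) (y.row r) (T.G.X c)) ∧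
        ∀ c, CycIco l.1 r.1 c → ¬ CycIco (y.row l) (y.row r) (T.G.O c) := by
    simp only [extend_row_betaCurve, cycIco_predAbove]
    constructor
    · intro h
      constructor <;> intro c hc h'
      · rw [← T.X_old] at h'
        exact h _ ((cycIco_succAbove T.c₀).2 hc) _ h' ⟨Fin.succAbove_ne _ _, .inl rfl⟩
      · rw [← T.O_old] at h'
        exact h _ ((cycIco_succAbove T.c₀).2 hc) _ h' ⟨Fin.succAbove_ne _ _, .inr rfl⟩
    · rintro ⟨hX, hO⟩ x hx i hi ⟨hc, h⟩
      obtain ⟨c, rfl⟩ := Fin.exists_succAbove_eq hc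
      have hx' := (cycIco_succAbove T.c₀).1 hx
      rcases h with rfl | rfl
      · rw [T.X_old] at hi
        exact hX c hx' hi
      · rw [T.O_old] at hi
        exact hO c hx' hi
  have hcol : (T.betaCurve l).1 ≠ (T.betaCurve r).1 ↔ l.1 ≠ r.1 :=
    not_congr Fin.succAbove_right_inj
  have hequiv : (T.extend y').equiv =
      (Equiv.swap (T.betaCurve l) (T.betaCurve r)).trans (T.extend y).equiv ↔
      ∀ b, y'.alpha b = y.alpha (Equiv.swap l r b) := by
    have hs : ∀ b, Equiv.swap (T.betaCurve l) (T.betaCurve r) (T.betaCurve b) =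
        T.betaCurve (Equiv.swap l r b) := fun b => betaCurve_injective.swap_apply l r b
    constructor
    · intro h b
      have := congrArg (fun f : _ ≃ _ => f (T.betaCurve b)) h
      simp only [Equiv.trans_apply] at this
      rw [hs, extend_equiv_betaCurve, extend_equiv_betaCurve] at this
      exact alphaCurve_injective this
    · intro h
      ext b : 1
      by_cases hb : b.1 = T.c₀
      · have hbl : ∀ a : Curve n m, b ≠ T.betaCurve a :=
          fun a => ne_of_col (hb ▸ (Fin.succAbove_ne _ _).symm)
        rw [Equiv.trans_apply, Equiv.swap_apply_of_ne_of_ne (hbl _) (hbl _)]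
        change T.H.alphaThrough _ _ = T.H.alphaThrough _ _
        rw [(Prod.ext hb rfl : b = T.left b.2), extend_row_left, extend_row_left]
      · obtain ⟨b, rfl⟩ := exists_betaCurve hb
        rw [Equiv.trans_apply, hs, extend_equiv_betaCurve, extend_equiv_betaCurve, h]
  constructor
  · intro h
    have hrow : y.row l ≠ y.row r := by
      intro h'
      refine ne_of_col h.columns_ne (inj ?_)
      rw [← h.bottom, h', Generator.alpha]
    have free := hfree.2 ⟨h.no_X, h.no_O⟩
    refine ⟨⟨Fin.succAbove_ne _ _, Fin.succAbove_ne _ _, hcol.2 h.columns_ne, ?_, ?_, free, ?_⟩,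
      hequiv.2 fun b => ?_⟩
    · rw [extend_row_betaCurve, extend_row_betaCurve]
      exact fun h' => hrow (Fin.succAbove_right_injective h')
    · rw [extend_row_betaCurve, joined_betaCurve, h.bottom]
      rfl
    · intro b hb hb' jb
      obtain ⟨b, rfl⟩ := exists_betaCurve hb
      have hb1 : CycIoo l.1 r.1 b.1 := (cycIoo_succAbove T.c₀).1 hb'
      have jr : (T.sheets m).Joined ((T.extend y).row (T.betaCurve r)) (T.betaCurve l)
          (T.betaCurve b) := jb.flat fun c hc => free c (by
        simp only [cycIoo_iff, cycIco_iff] at *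
        omega)
      rw [extend_row_betaCurve, joined_betaCurve] at jb jr
      simp only [extend_row_betaCurve, cycIoo_succAbove, ne_eq, Fin.succAbove_right_inj]
      refine ⟨fun h1 => ne_of_col (ne_of_cycIoo_left hb1) (inj (jb.trans ?_)), fun h1 => ?_,
        h.empty b hb1 jb.symm⟩
      · rw [Generator.alpha, h1]
      · refine ne_of_cycIoo_right hb1 (congrArg Prod.fst (inj ?_))
        rw [← h.top, jr, ← h1, Generator.alpha]
    · rw [Generator.alpha]
      by_cases hbl : b = l
      · subst hbl
        rw [h.exchange.left, Equiv.swap_apply_left, h.top]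
      by_cases hbr : b = r
      · subst hbr
        rw [h.exchange.right, Equiv.swap_apply_right, h.bottom]
      rw [h.exchange.rest b hbl hbr, Equiv.swap_apply_of_ne_of_ne hbl hbr, Generator.alpha]
  · rintro ⟨h, hy⟩
    rw [hequiv] at hy
    have hy' : ∀ b, y'.row b = y.row (Equiv.swap l r b) := fun b => congrArg Prod.fst (hy b)
    have h1 := hfree.1 h.free
    have base := h.base
    have top := h.base.flat h.free
    rw [extend_row_betaCurve, joined_betaCurve] at base top
    refine ⟨hcol.1 h.col, base.symm, top, h1.1, h1.2, fun b hb jb => ?_, ?_, ?_, ?_⟩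
    · have := (h.empty (T.betaCurve b) (Fin.succAbove_ne _ _) ((cycIoo_succAbove T.c₀).2 hb)
        (by rw [extend_row_betaCurve, joined_betaCurve]; exact jb.symm)).2.2
      rwa [extend_row_betaCurve, extend_row_betaCurve, extend_row_betaCurve, cycIoo_succAbove] at this
    · rw [hy', Equiv.swap_apply_left]
    · rw [hy', Equiv.swap_apply_right]
    · intro b hbl hbr
      rw [hy', Equiv.swap_apply_of_ne_of_ne hbl hbr]

theorem exists_extend_of_reduced {y : Generator T.G m} {l r : Curve (n + 1) m}
    (h : (T.sheets m).Reduced T.c₀ (T.extend y).row l r) :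
    ∃ y' : Generator T.G m, (T.extend y').equiv = (Equiv.swap l r).trans (T.extend y).equiv := by
  have hp : ∀ b : Curve (n + 1) m, b.1 ≠ T.c₀ → (T.extend y).row b ≠ T.p := by
    intro b hb
    obtain ⟨b, rfl⟩ := exists_betaCurve hb
    rw [extend_row_betaCurve]
    exact Fin.succAbove_ne _ _
  have h1 : T.IsReal ((Equiv.swap l r).trans (T.extend y).equiv) :=
    labelled_empty.1 ((labelled_empty (s := T.c₀) (e := T.left).2 (isReal_equiv _)).exchange
      off_empty ((T.alphaThrough_eq_iff_joined fun h' => hp _ h.left h'.1).2 h.base)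
      ((T.alphaThrough_eq_iff_joined fun h' => hp _ h.right h'.1).2 (h.base.flat h.free)))
  obtain ⟨x, hx⟩ := h1.exists_equiv
  obtain ⟨y', rfl⟩ := exists_extend (x := x) fun k => by
    rw [← rows_equiv, hx, rows_trans_swap]
    exact (exch_ne _ (ne_of_col h.left.symm) (ne_of_col h.right.symm)).trans (extend_row_left y k)
  exact ⟨y', hx⟩

theorem sum_betaCurve {V : Type*} [AddCommMonoid V] {F : Curve (n + 1) m → V}
    (h : ∀ b, b.1 = T.c₀ → F b = 0) : ∑ b, F b = ∑ b : Curve n m, F (T.betaCurve b) := by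
  symm
  refine Finset.sum_of_injOn T.betaCurve betaCurve_injective.injOn (by simp) (fun b _ hb => h b ?_)
    fun _ _ => rfl
  by_contra hb'
  obtain ⟨b, rfl⟩ := exists_betaCurve hb'
  exact hb ⟨b, by simp, rfl⟩

theorem extendStates_boundaryG (x : Chains T.G m) :
    T.extendStates (T.boundaryG S φ x) = T.reducedOp S φ (T.extendStates x) := by
  classical
  induction x using Finsupp.induction_linear with
  | zero => simp
  | add x y hx hy => rw [map_add, map_add, hx, hy, map_add, map_add]
  | single x a =>
    rw [← mul_one a, ← smul_eq_mul, ← Finsupp.smul_single, map_smul, map_smul, map_smul, map_smul]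
    congr 1
    rw [extendStates_single, one_smul, reducedOp, op_single, sum_betaCurve (T := T), boundaryG,
      boundary, Finsupp.linearCombination_single, one_smul, map_sum]
    swap
    · exact fun b hb => Finset.sum_eq_zero fun r _ => if_neg fun h => h.left hb
    simp only [map_sum, Generator.rectangles, Finset.sum_filter, Fintype.sum_prod_type (α₁ := Curve n m)]
    rw [Finset.sum_comm]
    refine Finset.sum_congr rfl fun l _ => ?_
    rw [Finset.sum_comm, sum_betaCurve (T := T)]
    swap
    · exact fun b hb => if_neg fun h => h.right hb
    refine Finset.sum_congr rfl fun r _ => ?_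
    simp only [rectangle_iff_reduced]
    by_cases h : (T.sheets m).Reduced T.c₀ (T.extend x).row (T.betaCurve l) (T.betaCurve r)
    · obtain ⟨y, hy⟩ := exists_extend_of_reduced h
      rw [if_pos (by exact h), Finset.sum_eq_single y, if_pos ⟨h, hy⟩, extendStates_single,
        exchange_single, hy, extend_equiv_betaCurve, extend_equiv_betaCurve]
      · rfl
      · intro z _ hz
        rw [if_neg, map_zero]
        rintro ⟨-, h2⟩
        exact hz (extend_injective (equiv_injective (h2.trans hy.symm)))
      · simp
    · rw [if_neg (by exact h)]
      exact Finset.sum_eq_zero fun z _ => by rw [if_neg fun h2 => h h2.1, map_zero]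

end Stabilization
end GridCover

namespace GridCover

open Sheets

namespace Stabilization

variable {n : ℕ} {T : Stabilization n} {m : ℕ}

open SignAssignment

variable (T) in
/-- The state `g` is obtained from `f` by a polygon with corners on the curves `e k`. -/
structure Turns (f : Curve (n + 1) m ≃ Curve (n + 1) m) (e : ZMod m → Curve (n + 1) m)
    (g : Curve (n + 1) m ≃ Curve (n + 1) m) : Prop where
  left : ∀ k, g (T.left (k + 1)) = f (e k)
  right : ∀ k, g (e k) = f (T.left k)
  rest : ∀ b, (∀ k, b ≠ T.left k) → (∀ k, b ≠ e k) → g b = f b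

theorem polygon_iff {x y : Generator T.H m} {e : ZMod m → Curve (n + 1) m} :
    T.IsPolygon x y e ↔ (∀ k, (T.sheets m).Sector T.c₀ T.p k x.row (T.left k) (e k)) ∧
      T.Turns x.equiv e y.equiv := by
  have C := T.corner (m := m)
  have inj : ∀ {a b : Curve (n + 1) m}, x.alpha a = x.alpha b → a = b := fun h => x.bijective.1 h
  constructor
  · intro h
    have hp : ∀ k, x.row (e k) = T.p := fun k => congrArg Prod.fst (h.top k)
    have free : ∀ k c, CycIco T.c₀ (e k).1 c → ∀ i, CycIco (x.row (T.left k)) (x.row (e k)) i →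
        ¬ (T.sheets m).M c i := by
      rintro k c hc i hi ⟨hcc, rfl | rfl⟩
      · rw [hp] at hi
        exact hcc ((h.only_X k c hc).1 hi)
      · rw [hp] at hi
        exact h.no_O k c hc hi
    have base : ∀ k, (T.sheets m).Joined (x.row (T.left k)) (T.left k) (e k) := fun k =>
      (T.alphaThrough_eq_iff_joined fun h' => h.row_ne k h'.1).1 (h.bottom k).symm
    refine ⟨fun k => ⟨rfl, ⟨(h.column_ne k).symm, ?_, base k, free k, fun b hb jb => ?_⟩, hp k⟩,
      fun k => ?_, fun k => ?_, fun b hb hb' => ?_⟩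
    · rw [hp]; exact h.row_ne k
    · have e1 : T.H.alphaThrough (x.row (T.left k)) (T.left k) =
          T.H.alphaThrough (x.row (T.left k)) b :=
        (T.alphaThrough_eq_iff_joined fun h' => h.row_ne k h'.1).2 jb
      refine ⟨fun h1 => ?_, fun h1 => ?_, hp k ▸ h.empty k b hb e1.symm⟩
      · refine ne_of_col (ne_of_cycIoo_left hb) (inj (e1.trans ?_))
        rw [Generator.alpha, h1]
      · rw [hp] at h1
        have j1 := (base k).flat (free k)
        have j2 := jb.flat fun c hc => free k c (by
          change CycIoo T.c₀ (e k).1 b.1 at hb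
          change CycIco T.c₀ b.1 c at hc
          simp only [cycIoo_iff, cycIco_iff] at *
          omega)
        rw [hp] at j1 j2
        have j3 := j2.cancel_left j1 hb
        have h2 : T.H.alphaThrough T.p b = T.H.alphaThrough T.p (e k) := by
          refine (T.alphaThrough_eq_iff_joined fun h' => ?_).2 j3
          have h3 := h'.2
          change CycIoo T.c₀ (e k).1 b.1 at hb
          simp only [cycIoo_iff, cycIco_iff] at *
          omega
        refine ne_of_cycIoo_right hb (congrArg Prod.fst (inj ?_))
        rw [Generator.alpha, Generator.alpha, h1, hp, h2]
    · change T.H.alphaThrough _ _ = _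
      rw [h.target_left]
      exact (h.top k).symm
    · change T.H.alphaThrough _ _ = _
      rw [h.target_right]
      exact h.bottom k
    · change T.H.alphaThrough _ _ = T.H.alphaThrough _ _
      rw [h.rest b hb hb']
  · rintro ⟨h, ht⟩
    have hp : ∀ k, x.row (e k) = T.p := fun k => (h k).2.2
    have hne : ∀ k, x.row (T.left k) ≠ T.p := fun k h' => (h k).2.1.row (h'.trans (hp k).symm)
    refine ⟨hne, fun k => (h k).2.1.col.symm, fun k => ?_, fun k => ?_, fun k c hc hi => ?_,
      fun k c hc => ⟨fun hi => ?_, ?_⟩, fun k b hb jb => ?_, fun k => ?_, fun k => ?_,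
      fun b hb hb' => ?_⟩
    · exact ((T.alphaThrough_eq_iff_joined fun h' => hne k h'.1).2 (h k).2.1.base).symm
    · rw [Generator.alpha, hp, alphaThrough_of_sector (h k), alphaThrough_p_right]
    · by_cases hcc : c = T.c₀
      · rw [hcc, T.O_new] at hi
        exact not_cycIco_right hi
      · exact (h k).2.1.free c hc _ ((hp k).symm ▸ hi) ⟨hcc, .inr rfl⟩
    · by_contra hcc
      exact (h k).2.1.free c hc _ ((hp k).symm ▸ hi) ⟨hcc, .inl rfl⟩
    · rintro rfl
      rw [T.X_new]
      exact C.cycIco_q (hne k)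
    · have := (h k).2.1.empty b hb
        ((T.alphaThrough_eq_iff_joined fun h' => hne k h'.1).1 jb.symm)
      exact hp k ▸ this.2.2
    · have := congrArg Prod.fst (ht.left (k - 1))
      rw [sub_add_cancel] at this
      exact this.trans (hp _)
    · exact congrArg Prod.fst (ht.right k)
    · exact congrArg Prod.fst (ht.rest b hb hb')

variable [NeZero m] (S : SignAssignment (m * (n + 1))) (φ : Framing (n + 1) m)

theorem exists_extend_of_turns {x : Generator T.H m} {e : ZMod m → Curve (n + 1) m}
    {g : Curve (n + 1) m ≃ Curve (n + 1) m}
    (h : ∀ k, (T.sheets m).Sector T.c₀ T.p k x.row (T.left k) (e k)) (ht : T.Turns x.equiv e g) :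
    ∃ y : Generator T.G m, (T.extend y).equiv = g := by
  have hp : ∀ k, x.row (e k) = T.p := fun k => (h k).2.2
  have hne : ∀ k, x.row (T.left k) ≠ T.p := fun k h' => (h k).2.1.row (h'.trans (hp k).symm)
  have h1 : ∀ k, g (T.left k) = T.H.alphaThrough T.p (T.left k) := by
    intro k
    have := ht.left (k - 1)
    rw [sub_add_cancel] at this
    rw [this]
    change T.H.alphaThrough _ _ = _
    rw [hp, alphaThrough_of_sector (h _), alphaThrough_p_right, sub_add_cancel]
  have hg : T.IsReal g := by
    intro b
    by_cases hb : ∃ k, b = T.left k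
    · obtain ⟨k, rfl⟩ := hb
      rw [h1]
      rfl
    by_cases hb' : ∃ k, b = e k
    · obtain ⟨k, rfl⟩ := hb'
      rw [ht.right]
      exact (T.alphaThrough_eq_iff_joined fun h' => hne k h'.1).2 (h k).2.1.base
    push Not at hb hb'
    rw [ht.rest b hb hb']
    rfl
  obtain ⟨z, rfl⟩ := hg.exists_equiv
  obtain ⟨y, rfl⟩ := exists_extend (x := z) fun k => congrArg Prod.fst (h1 k)
  exact ⟨y, rfl⟩

omit [NeZero m] in
theorem polygonEdge_even {x y : Generator T.H m} {e : ZMod m → Curve (n + 1) m}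
    (ht : T.Turns x.equiv e y.equiv) (i : ℕ) :
    T.polygonEdge x y (2 * i) = x.equiv (T.left (-(i : ZMod m))) ∧
      T.polygonEdge x y (2 * i + 1) = x.equiv (e (-((i + 1 : ℕ) : ZMod m))) := by
  have step : ∀ i, T.polygonEdge x y (i + 1) = y.equiv (x.equiv.symm (T.polygonEdge x y i)) :=
    fun i => Function.iterate_succ_apply' _ _ _
  have odd : ∀ i : ℕ, T.polygonEdge x y (2 * i) = x.equiv (T.left (-(i : ZMod m))) →
      T.polygonEdge x y (2 * i + 1) = x.equiv (e (-((i + 1 : ℕ) : ZMod m))) := by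
    intro i h
    rw [step, h, Equiv.symm_apply_apply, ← ht.left]
    congr 2
    push_cast
    ring
  induction i with
  | zero =>
    have h0 : T.polygonEdge x y (2 * 0) = x.equiv (T.left (-((0 : ℕ) : ZMod m))) := by
      simp [polygonEdge]
      rfl
    exact ⟨h0, odd 0 h0⟩
  | succ i ih =>
    have h1 : T.polygonEdge x y (2 * (i + 1)) = x.equiv (T.left (-((i + 1 : ℕ) : ZMod m))) := by
      rw [show 2 * (i + 1) = 2 * i + 1 + 1 by ring, step, ih.2, Equiv.symm_apply_apply, ht.right]
    exact ⟨h1, odd _ h1⟩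

/-- The sheets in the order in which the exchanges along a polygon meet them. -/
def ringList (m : ℕ) : List (ZMod m) :=
  0 :: (List.range (m - 1)).reverse.map fun j => -((j + 1 : ℕ) : ZMod m)

omit [NeZero m] in
theorem natCast_inj_of_lt {i j : ℕ} (hi : i < m) (hj : j < m) (h : (i : ZMod m) = j) : i = j := by
  have := congrArg ZMod.val h
  rwa [ZMod.val_natCast_of_lt hi, ZMod.val_natCast_of_lt hj] at this

theorem exists_eq_neg_natCast (k : ZMod m) : ∃ j < m, k = -(j : ZMod m) :=
  ⟨(-k).val, ZMod.val_lt _, by rw [ZMod.natCast_zmod_val, neg_neg]⟩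

theorem ringList_nodup : (ringList m).Nodup := by
  have hm := NeZero.pos m
  rw [ringList, List.nodup_cons]
  constructor
  · simp only [List.mem_map, List.mem_reverse, List.mem_range, not_exists, not_and]
    intro j hj h
    have := natCast_inj_of_lt (m := m) (i := j + 1) (j := 0) (by omega) hm
      (by rw [neg_eq_zero] at h; rw [h]; simp)
    omega
  · refine (List.nodup_reverse.2 List.nodup_range).map_on fun i hi j hj h => ?_
    simp only [List.mem_reverse, List.mem_range] at hi hj
    have := natCast_inj_of_lt (m := m) (by omega) (by omega) (neg_injective h)
    omega

theorem mem_ringList (k : ZMod m) : k ∈ ringList m := by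
  obtain ⟨j, hj, rfl⟩ := exists_eq_neg_natCast k
  rw [ringList, List.mem_cons, List.mem_map]
  rcases Nat.eq_zero_or_pos j with rfl | h
  · left; simp
  · right
    exact ⟨j - 1, by simp; omega, by rw [Nat.sub_add_cancel h]⟩

variable (T) in
/-- The polygons. -/
noncomputable def polygonOp : States (n + 1) m →ₗ[ℤ] States (n + 1) m :=
  S.link φ (fun j => T.left (-(j : ZMod m))) (m - 1) ∘ₗ chain (T.sectorOp S φ) (ringList m)

end Stabilization
end GridCover

namespace GridCover

open Sheets

namespace Stabilization

variable {n : ℕ} {T : Stabilization n} {m : ℕ}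

open SignAssignment

theorem Turns.unique {f g g' : Curve (n + 1) m ≃ Curve (n + 1) m} {e : ZMod m → Curve (n + 1) m}
    (h : T.Turns f e g) (h' : T.Turns f e g') : g = g' := by
  ext1 b
  by_cases hb : ∃ k, b = T.left k
  · obtain ⟨k, rfl⟩ := hb
    rw [← sub_add_cancel k 1, h.left, h'.left]
  by_cases hb' : ∃ k, b = e k
  · obtain ⟨k, rfl⟩ := hb'
    rw [h.right, h'.right]
  push Not at hb hb'
  rw [h.rest b hb hb', h'.rest b hb hb']

variable [NeZero m] (S : SignAssignment (m * (n + 1))) (φ : Framing (n + 1) m)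

theorem follows_turns {f : Curve (n + 1) m ≃ Curve (n + 1) m} {e : ZMod m → Curve (n + 1) m}
    (he : Function.Injective e) (hle : ∀ j k, T.left j ≠ e k)
    (F : ℕ → List (FlowShape (m * (n + 1))))
    (hF : ∀ j < m, F (2 * j) = φ.edgePair (f (T.left 0)) (f (e (-((j + 1 : ℕ) : ZMod m))))
        (φ.αSign (f (T.left 0))) (-φ.αSign (f (e (-((j + 1 : ℕ) : ZMod m))))) ∧
      F (2 * j + 1) = φ.edgePair (f (T.left 0)) (f (T.left (-((j + 1 : ℕ) : ZMod m))))
        (-φ.αSign (f (T.left 0))) (φ.αSign (f (T.left (-((j + 1 : ℕ) : ZMod m)))))) :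
    ∃ g, S.Follows φ f ((List.range (2 * m - 1)).flatMap F)
      (S.exchange φ (T.left (-((m - 1 : ℕ) : ZMod m))) (e 0) ∘ₗ
        S.zigzag φ (fun j => T.left (-(j : ZMod m))) (fun j => e (-(j : ZMod m))) (m - 1)) g ∧
      T.Turns f e g := by
  have hm := NeZero.pos m
  have hcast : -((m - 1 + 1 : ℕ) : ZMod m) = 0 := by
    rw [Nat.sub_add_cancel hm, ZMod.natCast_self, neg_zero]
  have l_inj : ∀ {j k : ℕ}, j < m → k < m → T.left (-(j : ZMod m)) = T.left (-(k : ZMod m)) →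
      j = k := fun hj hk h => natCast_inj_of_lt hj hk (neg_injective (congrArg Prod.snd h))
  have e_inj : ∀ {j k : ℕ}, j < m → k < m → e (-(j : ZMod m)) = e (-(k : ZMod m)) → j = k :=
    fun hj hk h => natCast_inj_of_lt hj hk (neg_injective (he h))
  obtain ⟨g, h1, h2, h3, h4⟩ := S.follows_zigzag φ (l := fun j => T.left (-(j : ZMod m)))
    (e := fun j => e (-(j : ZMod m))) (i := m - 1) f F
    (fun j k hj hk => l_inj (by omega) (by omega))
    (fun j k hj hk h => by
      have := e_inj (j := j + 1) (k := k + 1) (by omega) (by omega) h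
      omega) (fun j k => hle _ _) fun j hj => by
      simpa using hF j (by omega)
  have e0 : ∀ j < m - 1, e 0 ≠ e (-((j + 1 : ℕ) : ZMod m)) := fun j hj h => by
    have := e_inj (j := 0) (k := j + 1) hm (by omega) (by simpa using h)
    omega
  simp only [Nat.cast_zero, neg_zero] at h2
  have h5 : g (e 0) = f (e 0) := h4 _ (fun j _ => (hle _ _).symm) e0
  have h6 := S.follows_exchange φ g (hle (-((m - 1 : ℕ) : ZMod m)) 0)
  refine ⟨(Equiv.swap (T.left (-((m - 1 : ℕ) : ZMod m))) (e 0)).trans g, ?_, fun k => ?_,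
    fun k => ?_, fun b hb hb' => ?_⟩
  · rw [show 2 * m - 1 = 2 * (m - 1) + 1 by omega, List.range_succ, List.flatMap_append]
    refine h1.trans ?_
    simp only [List.flatMap_cons, List.flatMap_nil, List.append_nil]
    rw [(hF (m - 1) (by omega)).1, hcast]
    rwa [h2, h5] at h6
  · obtain ⟨j, hj, hk⟩ := exists_eq_neg_natCast (k + 1)
    have hk' : k = -((j + 1 : ℕ) : ZMod m) := by
      rw [eq_sub_of_add_eq hk]
      push_cast
      ring
    rw [hk]
    rcases (show j = m - 1 ∨ j < m - 1 by omega) with rfl | hj'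
    · rw [hcast] at hk'
      rw [Equiv.trans_apply, Equiv.swap_apply_left, h5, hk']
    · rw [Equiv.trans_apply, Equiv.swap_apply_of_ne_of_ne _ (hle _ _), hk']
      · exact (h3 j hj').1
      · intro h
        have := l_inj (by omega) (by omega) h
        omega
  · obtain ⟨j, hj, rfl⟩ := exists_eq_neg_natCast k
    rcases (show j = 0 ∨ ∃ i, j = i + 1 by cases j <;> simp) with rfl | ⟨i, rfl⟩
    · simp [h2]
    · rw [Equiv.trans_apply, Equiv.swap_apply_of_ne_of_ne (hle _ _).symm (e0 i (by omega)).symm]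
      exact (h3 i (by omega)).2
  · rw [Equiv.trans_apply, Equiv.swap_apply_of_ne_of_ne (hb _) (hb' _)]
    exact h4 b (fun j _ => hb _) fun j _ => hb' _

/-- The operator of the polygons, up to a sign which does not depend on the generator. -/
theorem exists_polygonOp_eq : ∃ s : ℕ, ∀ (x : Generator T.H m)
    (e : ZMod m → Curve (n + 1) m), (∀ k, (T.sheets m).Sector T.c₀ T.p k x.row (T.left k) (e k)) →
      ∃ y : Generator T.G m, T.Turns x.equiv e (T.extend y).equiv ∧
        T.polygonOp S φ (Finsupp.single x.equiv 1) = (-1 : ℤ) ^ s •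
          (T.polygonSign S φ x (T.extend y) : ℤ) • Finsupp.single (T.extend y).equiv 1 := by
  have hm := NeZero.pos m
  obtain ⟨s, hs⟩ := S.exchange_zigzag (φ := φ) (m - 1)
  refine ⟨s + (m - 1), fun x e h => ?_⟩
  have hp : ∀ k, x.row (e k) = T.p := fun k => (h k).2.2
  have hne : ∀ k, x.row (T.left k) ≠ T.p := fun k h' => (h k).2.1.row (h'.trans (hp k).symm)
  have he : Function.Injective e := fun j k hjk => by
    by_contra hne
    exact (h j).ne_of_ne hne (h k) hjk
  have hle : ∀ j k, T.left j ≠ e k := fun j k => ne_of_col (h k).2.1.col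
  have l_inj : ∀ {j k : ℕ}, j < m → k < m → T.left (-(j : ZMod m)) = T.left (-(k : ZMod m)) →
      j = k := fun hj hk h => natCast_inj_of_lt hj hk (neg_injective (congrArg Prod.snd h))
  obtain ⟨g, h1, h2⟩ := follows_turns S φ (f := x.equiv) he hle
    (fun i => if i % 2 = 0 then
        φ.edgePair (x.equiv (T.left 0)) (x.equiv (e (-((i / 2 + 1 : ℕ) : ZMod m))))
          (φ.αSign (x.equiv (T.left 0))) (-φ.αSign (x.equiv (e (-((i / 2 + 1 : ℕ) : ZMod m)))))
      else φ.edgePair (x.equiv (T.left 0)) (x.equiv (T.left (-((i / 2 + 1 : ℕ) : ZMod m))))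
        (-φ.αSign (x.equiv (T.left 0))) (φ.αSign (x.equiv (T.left (-((i / 2 + 1 : ℕ) : ZMod m))))))
    fun j _ => by
      have e1 : 2 * j % 2 = 0 := by omega
      have e2 : (2 * j + 1) % 2 ≠ 0 := by omega
      have e3 : (2 * j + 1) / 2 = j := by omega
      have e4 : 2 * j / 2 = j := by omega
      simp only [if_pos e1, if_neg e2, e3, e4, and_self]
  obtain ⟨y, rfl⟩ := exists_extend_of_turns h h2
  refine ⟨y, h2, ?_⟩
  obtain ⟨t, g', h3, h4, -⟩ := chain_sectorOp S (φ := φ) (L := ringList m) ringList_nodup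
    (f := x.equiv) (e := e) fun k _ => h k
  have h5 : chain (T.sectorOp S φ) (ringList m) (Finsupp.single x.equiv 1) =
      (S.exchange φ (T.left (-((0 : ℕ) : ZMod m))) (e 0) ∘ₗ S.fan φ
        (fun j => T.left (-(j : ZMod m))) (fun j => e (-(j : ZMod m))) (m - 1))
        (Finsupp.single x.equiv 1) := by
    rw [h3, ← h4, ringList, chain, chain_map, Nat.cast_zero, neg_zero]
    rfl
  have h6 := hs (fun j => T.left (-(j : ZMod m))) (fun j => e (-(j : ZMod m))) (e 0)
    (fun j k hj hk => l_inj (by omega) (by omega)) (fun j k _ _ => hle _ _) fun j _ => hle _ _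
  have h7 := h1.sign
  rw [h6, LinearMap.smul_apply, LinearMap.comp_apply, ← h5] at h7
  have h8 : (T.polygonSign S φ x (T.extend y) : ℤ) = (-1) ^ (m - 1) *
      (S.pathSign (φ.formalState x.equiv) ((List.range (2 * m - 1)).flatMap fun i =>
        if i % 2 = 0 then
          φ.edgePair (x.equiv (T.left 0)) (x.equiv (e (-((i / 2 + 1 : ℕ) : ZMod m))))
            (φ.αSign (x.equiv (T.left 0))) (-φ.αSign (x.equiv (e (-((i / 2 + 1 : ℕ) : ZMod m)))))
        else φ.edgePair (x.equiv (T.left 0)) (x.equiv (T.left (-((i / 2 + 1 : ℕ) : ZMod m))))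
          (-φ.αSign (x.equiv (T.left 0)))
          (φ.αSign (x.equiv (T.left (-((i / 2 + 1 : ℕ) : ZMod m)))))) : ℤ) := by
    have sgn_left : ∀ k, T.polygonEdgeSign φ (x.equiv (T.left k)) = φ.αSign (x.equiv (T.left k)) :=
      fun k => if_neg (hne k)
    have sgn_e : ∀ k, T.polygonEdgeSign φ (x.equiv (e k)) = -φ.αSign (x.equiv (e k)) :=
      fun k => if_pos (hp k)
    have edge := polygonEdge_even h2
    have edge0 : T.polygonEdge x (T.extend y) 0 = x.equiv (T.left 0) := by simpa using (edge 0).1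
    rw [polygonSign, Units.val_mul, Units.val_pow_eq_pow_val, Units.val_neg, Units.val_one]
    refine congrArg (fun A => (-1) ^ (m - 1) * (S.pathSign (φ.formal x) A : ℤ))
      (List.flatMap_congr fun i _ => ?_)
    rw [edge0, sgn_left]
    rcases Nat.even_or_odd' i with ⟨j, rfl | rfl⟩
    · have e1 : 2 * j % 2 = 0 := by omega
      have e4 : 2 * j / 2 = j := by omega
      rw [if_pos e1, e4, (edge j).2, sgn_e, pow_mul, neg_one_sq, one_pow, one_mul]
    · have e2 : ¬ (2 * j + 1) % 2 = 0 := by omega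
      have e3 : (2 * j + 1) / 2 = j := by omega
      have e5 : 2 * j + 1 + 1 = 2 * (j + 1) := by ring
      rw [if_neg e2, e3, e5, (edge (j + 1)).1, sgn_left, pow_succ, pow_mul, neg_one_sq, one_pow,
        one_mul, neg_one_mul]
  rw [h8, mul_smul, ← h7, polygonOp, LinearMap.comp_apply, smul_smul, smul_smul, ← pow_add,
    ← pow_add, (show Even (s + (m - 1) + (m - 1) + s) from ⟨s + (m - 1), by ring⟩).neg_one_pow,
    one_smul]

open Classical in
theorem exists_polygonOp : ∃ s : ℕ, ∀ x : Generator T.H m,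
    T.polygonOp S φ (Finsupp.single x.equiv 1) = (-1 : ℤ) ^ s • ∑ y : Generator T.G m,
      if ∃ e, T.IsPolygon x (T.extend y) e then
        (T.polygonSign S φ x (T.extend y) : ℤ) • Finsupp.single (T.extend y).equiv 1 else 0 := by
  obtain ⟨s, hs⟩ := exists_polygonOp_eq (T := T) S φ
  refine ⟨s, fun x => ?_⟩
  by_cases h : ∀ k, ∃ r, (T.sheets m).Sector T.c₀ T.p k x.row (T.left k) r
  · choose e h using h
    obtain ⟨y, ht, hy⟩ := hs x e h
    rw [hy, Finset.sum_eq_single_of_mem y (Finset.mem_univ y), if_pos ⟨e, polygon_iff.2 ⟨h, ht⟩⟩]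
    intro y' _ hyy
    refine if_neg ?_
    rintro ⟨e', h'⟩
    obtain ⟨h3, h4⟩ := polygon_iff.1 h'
    obtain rfl : e' = e := funext fun k => ((h3 k).unique (h k)).2
    exact hyy (extend_injective (equiv_injective (h4.unique ht)))
  · push Not at h
    obtain ⟨k, hk⟩ := h
    rw [polygonOp, LinearMap.comp_apply,
      chain_sectorOp_eq_zero S ringList_nodup (mem_ringList k) hk, map_zero,
      Finset.sum_eq_zero, smul_zero]
    intro y _
    refine if_neg ?_
    rintro ⟨e, he⟩
    exact hk _ ((polygon_iff.1 he).1 k)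

end Stabilization
end GridCover

namespace GridCover

open Sheets

theorem chain_ofFn_reverse {K Y V : Type*} [Fintype Y] [DecidableEq Y] [AddCommGroup V]
    {A : K → V →ₗ[ℤ] V} {ι : Y → V} {w : K → Y → Y → ℤ}
    (h : ∀ k x, A k (ι x) = ∑ y, w k x y • ι y) (m : ℕ) (e : Fin m → K) (x : Y) :
    chain A (List.ofFn e).reverse (ι x) = ∑ z : Fin (m + 1) → Y, if z 0 = x then
      (∏ i, w (e i) (z i.castSucc) (z i.succ)) • ι (z (Fin.last m)) else 0 := by
  induction m with
  | zero =>
    rw [Finset.sum_eq_single_of_mem (fun _ => x) (Finset.mem_univ _)]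
    · simp [chain]
    · exact fun z _ hz => if_neg fun h0 => hz (funext fun i => by rw [Fin.fin_one_eq_zero i, h0])
  | succ m ih =>
    rw [List.ofFn_succ', List.concat_eq_append, List.reverse_append, List.reverse_singleton,
      List.singleton_append, chain, LinearMap.comp_apply, ih, map_sum,
      ← (Fin.snocEquiv fun _ : Fin (m + 2) => Y).sum_comp, Fintype.sum_prod_type, Finset.sum_comm]
    refine Finset.sum_congr rfl fun z _ => ?_
    simp only [Fin.snocEquiv_apply, ← Fin.castSucc_zero, Fin.snoc_castSucc, Fin.prod_univ_castSucc,
      Fin.succ_last, Fin.snoc_last, Fin.succ_castSucc]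
    split_ifs with h0
    · rw [map_smul, h, Finset.smul_sum]
      exact Finset.sum_congr rfl fun y _ => by rw [smul_smul]
    · simp

theorem eq_of_succ_eq {m : ℕ} {β : Type*} (g : Fin (m + 1) → β) (i : Fin m)
    (h : ∀ j, j ≠ i → g j.succ = g j.castSucc) :
    g i.castSucc = g 0 ∧ g (Fin.last m) = g i.succ := by
  constructor
  · have : ∀ b : Fin (m + 1), b ≤ i.castSucc → g b = g 0 := by
      intro b
      induction b using Fin.induction with
      | zero => exact fun _ => rfl
      | succ b ih =>
        intro hb
        have hb' : (b : ℕ) + 1 ≤ i := hb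
        rw [h b (Fin.ne_of_val_ne (by omega)), ih (Fin.le_def.2 (by simp; omega))]
    exact this _ le_rfl
  · have : ∀ b : Fin (m + 1), i.succ ≤ b → g b = g i.succ := by
      intro b
      induction b using Fin.induction with
      | zero => exact fun hb => absurd hb (by simp)
      | succ b ih =>
        intro hb
        have hb' : (i : ℕ) + 1 ≤ (b : ℕ) + 1 := hb
        by_cases hbi : b = i
        · rw [hbi]
        · have : (b : ℕ) ≠ i := fun h => hbi (Fin.ext h)
          rw [h b hbi, ih (Fin.le_def.2 (by simp; omega))]
    exact this _ (Fin.le_last _)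

namespace Stabilization

variable {n : ℕ} {T : Stabilization n} {m : ℕ}

open SignAssignment

theorem puncturedRectangle_iff {x z : Generator T.H m} {k : ZMod m} :
    T.IsPuncturedRectangle x z k ↔ CycIoo (x.row (T.left k)) (x.row (T.right k)) T.p ∧
      z.equiv = (Equiv.swap (T.left k) (T.right k)).trans x.equiv := by
  have hlr : T.right k ≠ T.left k := (T.corner (m := m)).mk_ne.symm
  constructor
  · intro h
    refine ⟨h.puncture, Equiv.ext fun b => ?_⟩
    change T.H.alphaThrough (z.row b) b = x.alpha (Equiv.swap _ _ b)
    by_cases hbl : b = T.left k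
    · rw [hbl, h.exchange.left, Equiv.swap_apply_left, h.top]
    by_cases hbr : b = T.right k
    · rw [hbr, h.exchange.right, Equiv.swap_apply_right, h.bottom]
    rw [h.exchange.rest b hbl hbr, Equiv.swap_apply_of_ne_of_ne hbl hbr, Generator.alpha]
  · rintro ⟨h, hz⟩
    have key : ∀ b, z.alpha b = x.alpha (Equiv.swap (T.left k) (T.right k) b) :=
      fun b => congrArg (fun f => f b) hz
    have hl := key (T.left k)
    have hr := key (T.right k)
    rw [Equiv.swap_apply_left] at hl
    rw [Equiv.swap_apply_right] at hr
    have el : z.row (T.left k) = x.row (T.right k) := congrArg Prod.fst hl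
    have er : z.row (T.right k) = x.row (T.left k) := congrArg Prod.fst hr
    refine ⟨?_, ?_, h, el, er, fun b hbl hbr => ?_⟩
    · rw [← hr, Generator.alpha, er]
    · rw [← hl, Generator.alpha, el]
    · have hb := key b
      rw [Equiv.swap_apply_of_ne_of_ne hbl hbr] at hb
      exact congrArg Prod.fst hb

theorem puncturedHexagon_iff {x y : Generator T.H m} {k : ZMod m} {R : Fin (n + 1) → Prop} :
    T.IsPuncturedHexagon x y k ∧ R (y.row (T.left k)) ↔
      CycIoo (x.row (T.left k)) (x.row (T.right k)) T.p ∧ ∃ l,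
        (T.sheets m).Flap T.c₀ (T.c₀ + 1) T.p R k (exch x.row (T.left k) (T.right k)) l (T.left k) ∧
        y.equiv = (Equiv.swap l (T.left k)).trans
          ((Equiv.swap (T.left k) (T.right k)).trans x.equiv) := by
  have C := T.corner (m := m)
  have rows_z : ∀ {z : Generator T.H m},
      z.equiv = (Equiv.swap (T.left k) (T.right k)).trans x.equiv →
        z.row = exch x.row (T.left k) (T.right k) := by
    intro z hz
    rw [← rows_equiv, hz, rows_trans_swap, rows_equiv]
  have row_y : ∀ {l : Curve (n + 1) m}, y.equiv = (Equiv.swap l (T.left k)).trans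
      ((Equiv.swap (T.left k) (T.right k)).trans x.equiv) →
        y.row (T.left k) = exch x.row (T.left k) (T.right k) l := by
    intro l hy
    rw [← rows_equiv, hy, rows_trans_swap, rows_trans_swap, exch_right, rows_equiv]
  constructor
  · rintro ⟨⟨z, l, h1, h2, hl, hr, -, h3⟩, hR⟩
    obtain ⟨hp, hz⟩ := puncturedRectangle_iff.1 h1
    obtain ⟨h4, hy⟩ := rectangle_iff_plain.1 h2
    rw [hz] at hy
    rw [rows_z hz] at h4
    rw [row_y hy] at h3 hR
    refine ⟨hp, l, ⟨rfl, h4.1, ?_, ?_, hR⟩, hy⟩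
    · change CycIoo (exch x.row (T.left k) (T.right k) (T.right k)) _ _
      rwa [exch_left, exch_right]
    · change CycIoo (exch x.row (T.left k) (T.right k) (T.right k)) _ _
      rwa [exch_left, exch_right]
  · rintro ⟨hp, l, ⟨-, h1, h2, h3, hR⟩, hy⟩
    change CycIoo (exch x.row (T.left k) (T.right k) (T.right k)) _ _ at h2
    rw [exch_left, exch_right] at h2
    obtain ⟨z, hz⟩ : ∃ z : Generator T.H m, z.equiv =
        (Equiv.swap (T.left k) (T.right k)).trans x.equiv :=
      ((isReal_equiv x).dent (k := k) ⟨rfl, rfl, hp⟩).exists_equiv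
    refine ⟨⟨z, l, puncturedRectangle_iff.2 ⟨hp, hz⟩, rectangle_iff_plain.2 ⟨?_, ?_⟩, ne_of_col h1.col,
      fun h => C.not_around (h ▸ h1) rfl rfl, ?_, (row_y hy).symm ▸ h2⟩, (row_y hy).symm ▸ hR⟩
    · rw [rows_z hz]
      exact ⟨h1, fun h => absurd h not_cycIco_right, fun h => absurd h not_cycIco_right⟩
    · rw [hy, hz]
    · exact (congrArg (fun f => f (T.left k)) hz).trans
        (congrArg x.equiv (Equiv.swap_apply_left _ _))

theorem IsPuncturedHexagon.ne {x y : Generator T.H m} {k : ZMod m} (h : T.IsPuncturedHexagon x y k) :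
    y ≠ x := by
  obtain ⟨z, l, -, -, -, -, -, h⟩ := h
  rintro rfl
  exact ne_of_cycIoo_left h rfl

theorem IsPuncturedHexagon.row_left_ne {x y : Generator T.H m} {k : ZMod m}
    (h : T.IsPuncturedHexagon x y k) : x.row (T.left k) ≠ T.p := by
  obtain ⟨z, l, h, -⟩ := h
  exact fun h' => ne_of_cycIoo_left h.puncture h'

theorem IsPuncturedHexagon.row_left {x y : Generator T.H m} {j k : ZMod m} (hjk : k ≠ j)
    (h : T.IsPuncturedHexagon x y j) : y.row (T.left k) = x.row (T.left k) := by
  obtain ⟨z, l, h1, h2, -⟩ := h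
  have e1 : T.left k ≠ T.left j := mk_ne_left hjk
  have e2 : T.left k ≠ l := fun h => h2.columns_ne (congrArg Prod.fst h).symm
  rw [h2.exchange.rest _ e2 e1, h1.exchange.rest _ e1 (T.corner (m := m)).mk_ne]

variable [NeZero m] (S : SignAssignment (m * (n + 1))) (φ : Framing (n + 1) m)

open Classical in
theorem hexagonOp_single (x : Generator T.H m) (R : Fin (n + 1) → Prop) (k : ZMod m) :
    T.hexagonOp S φ R k (Finsupp.single x.equiv 1) = ∑ y : Generator T.H m,
      (if T.IsPuncturedHexagon x y k ∧ R (y.row (T.left k)) then (T.hexagonSign S φ x y k : ℤ) else 0) •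
        Finsupp.single y.equiv 1 := by
  have C := T.corner (m := m)
  rw [hexagonOp, hexagon, LinearMap.comp_apply]
  by_cases hp : CycIoo (x.row (T.left k)) (x.row (T.right k)) T.p
  · have hp' : CycIoo (rows x.equiv (T.c₀, k)) (rows x.equiv (T.c₀ + 1, k)) T.p := hp
    rw [S.op_dent hp', exchange_single, map_smul, op_sum S φ fun l r h =>
      ((isReal_equiv x).dent (k := k) ⟨rfl, rfl, hp⟩).flap h, Finset.smul_sum]
    refine Finset.sum_congr rfl fun y _ => ?_
    by_cases hy : T.IsPuncturedHexagon x y k ∧ R (y.row (T.left k))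
    · rw [if_pos hy]
      obtain ⟨-, l, h1, h2⟩ := puncturedHexagon_iff.1 hy
      rw [Finset.sum_eq_single_of_mem l (Finset.mem_univ _),
        Finset.sum_eq_single_of_mem (T.left k) (Finset.mem_univ _), if_pos ⟨h1, h2⟩, smul_smul]
      · congr 1
        have h3 := (S.follows_exchange φ x.equiv (l := T.left k) (r := T.right k) C.mk_ne).last
        have h4 : y.alpha (T.left k) =
            ((Equiv.swap (T.left k) (T.right k)).trans x.equiv) l :=
          (congrArg (fun f => f (T.left k)) h2).trans
            (congrArg ((Equiv.swap (T.left k) (T.right k)).trans x.equiv)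
              (Equiv.swap_apply_right _ _))
        have h5 : x.alpha (T.right k) =
            ((Equiv.swap (T.left k) (T.right k)).trans x.equiv) (T.left k) :=
          (congrArg x.equiv (Equiv.swap_apply_left _ _)).symm
        rw [hexagonSign, pathSign_append, Units.val_mul]
        refine congrArg₂ (fun a b : ℤ => a * b) rfl (congrArg Units.val ?_)
        refine Eq.trans ?_ (congrArg (fun z => S.pathSign z _) h3.symm)
        rw [h4, h5]
        rfl
      · rintro r - hr
        exact if_neg fun h => hr h.1.1
      · rintro l' - hl
        refine Finset.sum_eq_zero fun r _ => if_neg ?_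
        rintro ⟨h, h'⟩
        obtain rfl : r = T.left k := h.1
        refine hl ?_
        have h3 := congrArg (fun f => f (T.left k)) (h2.symm.trans h')
        simp only [Equiv.trans_apply, Equiv.swap_apply_right] at h3
        exact ((Equiv.swap (T.left k) (T.right k)).injective (x.equiv.injective h3)).symm
    · rw [if_neg hy, zero_smul, Finset.sum_eq_zero, smul_zero]
      intro l _
      refine Finset.sum_eq_zero fun r _ => if_neg ?_
      rintro ⟨h, h'⟩
      obtain rfl : r = T.left k := h.1
      exact hy (puncturedHexagon_iff.2 ⟨hp, l, h, h'⟩)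
  · have hp' : ¬ CycIoo (rows x.equiv (T.c₀, k)) (rows x.equiv (T.c₀ + 1, k)) T.p := hp
    rw [S.op_dent_of_not hp', map_zero, Finset.sum_eq_zero]
    intro y _
    rw [if_neg fun h => hp (puncturedHexagon_iff.1 h).1, zero_smul]

end Stabilization
end GridCover

namespace GridCover

open Sheets

namespace Stabilization

variable {n : ℕ} {T : Stabilization n} {m : ℕ}

open SignAssignment

/-- A step of a pseudo-domain in sheet `k`. -/
def Step (T : Stabilization n) (G : ZMod m → (Curve (n + 1) m → Fin (n + 1)) → Prop)
    (R : Fin (n + 1) → Prop) (k : ZMod m) (x y : Generator T.H m) : Prop :=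
  (y = x ∧ G k x.row) ∨ (T.IsPuncturedHexagon x y k ∧ R (y.row (T.left k)))

theorem Step.row_left {G : ZMod m → (Curve (n + 1) m → Fin (n + 1)) → Prop}
    {R : Fin (n + 1) → Prop} {j k : ZMod m} {x y : Generator T.H m} (hjk : k ≠ j)
    (h : T.Step G R j x y) : y.row (T.left k) = x.row (T.left k) := by
  rcases h with ⟨rfl, -⟩ | ⟨h, -⟩
  · rfl
  · exact h.row_left hjk

theorem row_left_of_steps {G : ZMod m → (Curve (n + 1) m → Fin (n + 1)) → Prop}
    {R : Fin (n + 1) → Prop} (e : Fin m ≃ ZMod m) {z : Fin (m + 1) → Generator T.H m}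
    (h : ∀ i, T.Step G R (e i) (z i.castSucc) (z i.succ)) (i : Fin m) :
    (z i.castSucc).row (T.left (e i)) = (z 0).row (T.left (e i)) ∧
      (z (Fin.last m)).row (T.left (e i)) = (z i.succ).row (T.left (e i)) :=
  eq_of_succ_eq (fun j => (z j).row (T.left (e i))) i fun j hj =>
    (h j).row_left fun h' => hj (e.injective h').symm

theorem typeL_iff (e : Fin m ≃ ZMod m) {x y : Generator T.H m} {z : Fin (m + 1) → Generator T.H m}
    (hy : ∀ k, y.row (T.left k) = T.p) : T.IsTypeL e x y z ↔ (z 0 = x ∧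
      ∀ i, T.Step T.AtLeft (· = T.p) (e i) (z i.castSucc) (z i.succ)) ∧ z (Fin.last m) = y := by
  constructor
  · intro h
    have h1 : ∀ i, T.Step (fun _ _ => True) (· = T.p) (e i) (z i.castSucc) (z i.succ) := by
      intro i
      by_cases hi : x.row (T.left (e i)) = T.p
      · exact .inl ⟨h.trivial i hi, trivial⟩
      · exact .inr (h.hexagon i hi)
    refine ⟨⟨h.first, fun i => ?_⟩, h.last⟩
    by_cases hi : x.row (T.left (e i)) = T.p
    · refine .inl ⟨h.trivial i hi, ?_⟩
      change (z i.castSucc).row (T.left (e i)) = T.p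
      rw [(row_left_of_steps e h1 i).1, h.first, hi]
    · exact .inr (h.hexagon i hi)
  · rintro ⟨⟨h0, h⟩, hl⟩
    refine ⟨h0, hl, fun i hi => ?_, fun i hi => ?_, hy⟩
    · rcases h i with ⟨h1, -⟩ | ⟨h1, -⟩
      · exact h1
      · refine absurd ?_ h1.row_left_ne
        rw [(row_left_of_steps e h i).1, h0, hi]
    · rcases h i with ⟨-, h1⟩ | h1
      · refine absurd ?_ hi
        rw [← h0, ← (row_left_of_steps e h i).1]
        exact h1
      · exact h1

theorem row_last_of_steps (e : Fin m ≃ ZMod m) {z : Fin (m + 1) → Generator T.H m}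
    (h : ∀ i, T.Step T.AtLeft (· = T.p) (e i) (z i.castSucc) (z i.succ)) (k : ZMod m) :
    (z (Fin.last m)).row (T.left k) = T.p := by
  obtain ⟨i, rfl⟩ := e.surjective k
  rw [(row_left_of_steps e h i).2]
  rcases h i with ⟨h1, h2⟩ | ⟨-, h1⟩
  · rw [h1]
    exact h2
  · exact h1

theorem typeR_iff (e : Fin m ≃ ZMod m) {x y : Generator T.H m} {z : Fin (m + 1) → Generator T.H m} :
    T.IsTypeR e x y z ↔ (z 0 = x ∧
      ∀ i, T.Step (fun _ _ => True) (· ≠ T.p) (e i) (z i.castSucc) (z i.succ)) ∧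
        ∃ c, T.IsPolygon (z (Fin.last m)) y c := by
  constructor
  · exact fun h => ⟨⟨h.first, fun i => (h.step i).imp (fun h => ⟨h, trivial⟩) id⟩, h.polygon⟩
  · exact fun h => ⟨h.1.1, fun i => (h.1.2 i).imp And.left id, h.2⟩

variable [NeZero m] (S : SignAssignment (m * (n + 1))) (φ : Framing (n + 1) m)

open Classical in
theorem chain_step_single (G : ZMod m → (Curve (n + 1) m → Fin (n + 1)) → Prop)
    (R : Fin (n + 1) → Prop) (e : Fin m ≃ ZMod m) (x : Generator T.H m) :
    chain (fun k => proj (G k) + T.hexagonOp S φ R k) (List.ofFn e).reverse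
        (Finsupp.single x.equiv 1) = ∑ z : Fin (m + 1) → Generator T.H m,
      if z 0 = x ∧ ∀ i, T.Step G R (e i) (z i.castSucc) (z i.succ) then
        (T.hexagonsSign S φ e z : ℤ) • Finsupp.single (z (Fin.last m)).equiv 1 else 0 := by
  have h : ∀ k (x : Generator T.H m), (proj (G k) + T.hexagonOp S φ R k) (Finsupp.single x.equiv 1) =
      ∑ y : Generator T.H m, (if T.Step G R k x y then
        (((if y = x then 1 else T.hexagonSign S φ x y k) : ℤˣ) : ℤ) else 0) •
          Finsupp.single y.equiv (1 : ℤ) := by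
    intro k x
    have h1 : (proj (G k) (Finsupp.single x.equiv 1) : States (n + 1) m) =
        ∑ y : Generator T.H m, (if y = x ∧ G k x.row then (1 : ℤ) else 0) •
          Finsupp.single y.equiv (1 : ℤ) := by
      rw [Finset.sum_eq_single_of_mem x (Finset.mem_univ _)]
      · by_cases hG : G k x.row
        · rw [if_pos ⟨rfl, hG⟩, one_smul]
          exact proj_of hG
        · rw [if_neg fun h => hG h.2, zero_smul]
          exact proj_of_not hG
      · intro y _ hy
        rw [if_neg fun h => hy h.1, zero_smul]
    rw [LinearMap.add_apply, h1, hexagonOp_single, ← Finset.sum_add_distrib]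
    refine Finset.sum_congr rfl fun y _ => ?_
    rw [← add_smul]
    congr 1
    by_cases hy : y = x
    · subst hy
      have h2 : ¬ T.IsPuncturedHexagon y y k := fun h => h.ne rfl
      simp [Step, h2]
    · simp [Step, hy]
  rw [chain_ofFn_reverse (ι := fun x : Generator T.H m => Finsupp.single x.equiv 1) h]
  refine Finset.sum_congr rfl fun z _ => ?_
  rw [Finset.prod_ite_zero, ite_and]
  simp only [Finset.mem_univ, true_implies, hexagonsSign, Units.coe_prod, ite_smul, zero_smul]

theorem extendStates_typeL (e : Fin m ≃ ZMod m) (x : Chains T.H m) :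
    T.extendStates (T.stabilizationMap S φ e x).2 =
      chain (T.fillOp S φ T.AtLeft) (List.ofFn e).reverse (T.toStates x) := by
  classical
  induction x using Finsupp.induction_linear with
  | zero => simp
  | add x y hx hy => rw [map_add, Prod.snd_add, map_add, hx, hy, map_add, map_add]
  | single x a =>
    rw [← mul_one a, ← smul_eq_mul, ← Finsupp.smul_single, map_smul, map_smul, map_smul,
      Prod.smul_snd, map_smul]
    congr 1
    rw [toStates_single, one_smul]
    refine Eq.trans ?_ (chain_step_single S φ T.AtLeft (· = T.p) e x).symm
    rw [stabilizationMap, Finsupp.linearCombination_single, one_smul]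
    simp only [map_sum, typeL, Finset.sum_filter, apply_ite T.extendStates, map_zero,
      extendStates_single]
    rw [Finset.sum_comm]
    refine Finset.sum_congr rfl fun z _ => ?_
    by_cases hz : z 0 = x ∧ ∀ i, T.Step T.AtLeft (· = T.p) (e i) (z i.castSucc) (z i.succ)
    · obtain ⟨y, hy⟩ := exists_extend (row_last_of_steps e hz.2)
      rw [if_pos hz, Finset.sum_eq_single_of_mem y (Finset.mem_univ _),
        if_pos ((typeL_iff e (extend_row_left y)).2 ⟨hz, hy.symm⟩), hy]
      intro y' _ hyy
      refine if_neg fun h => hyy (extend_injective ?_)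
      rw [hy, ← ((typeL_iff e (extend_row_left y')).1 h).2]
    · rw [if_neg hz]
      exact Finset.sum_eq_zero fun y _ =>
        if_neg fun h => hz ((typeL_iff e (extend_row_left y)).1 h).1

theorem extendStates_typeR (e : Fin m ≃ ZMod m) : ∃ s : ℕ, ∀ x : Chains T.H m,
    T.extendStates (T.stabilizationMap S φ e x).1 = (-1 : ℤ) ^ s • T.polygonOp S φ
      (chain (fun k => LinearMap.id + T.hexagonOp S φ (· ≠ T.p) k) (List.ofFn e).reverse
        (T.toStates x)) := by
  classical
  obtain ⟨s, hs⟩ := exists_polygonOp (T := T) S φ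
  refine ⟨s, fun x => ?_⟩
  induction x using Finsupp.induction_linear with
  | zero => simp
  | add x y hx hy =>
    rw [map_add, Prod.fst_add, map_add, hx, hy, map_add, map_add, map_add, smul_add]
  | single x a =>
    rw [← mul_one a, ← smul_eq_mul, ← Finsupp.smul_single, map_smul, map_smul, map_smul, map_smul,
      Prod.smul_fst, map_smul, smul_comm]
    congr 1
    rw [toStates_single, one_smul]
    have h1 : (proj (fun _ : Curve (n + 1) m → Fin (n + 1) => True) :
        States (n + 1) m →ₗ[ℤ] States (n + 1) m) = LinearMap.id :=
      hom_ext fun f => proj_of trivial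
    have h2 := chain_step_single S φ (T := T) (fun _ _ => True) (· ≠ T.p) e x
    rw [h1] at h2
    rw [h2, map_sum, Finset.smul_sum, stabilizationMap, Finsupp.linearCombination_single, one_smul]
    simp only [map_sum, typeR, Finset.sum_filter, apply_ite T.extendStates, map_zero,
      extendStates_single]
    rw [Finset.sum_comm]
    refine Finset.sum_congr rfl fun z _ => ?_
    by_cases hz : z 0 = x ∧
        ∀ i, T.Step (fun _ _ => True) (· ≠ T.p) (e i) (z i.castSucc) (z i.succ)
    · rw [if_pos hz, map_smul, hs, smul_smul, smul_smul, mul_comm, ← mul_assoc, ← pow_add,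
        (Even.add_self s).neg_one_pow, one_mul, Finset.smul_sum]
      refine Finset.sum_congr rfl fun y _ => ?_
      rw [smul_ite, smul_zero, smul_smul, Units.val_mul]
      refine if_congr ?_ rfl rfl
      rw [typeR_iff, and_iff_right hz]
    · rw [if_neg hz, map_zero, smul_zero]
      exact Finset.sum_eq_zero fun y _ => if_neg fun h => hz ((typeR_iff e).1 h).1

theorem link_reducedOp : ∀ i < m,
    S.link φ (fun j => T.left (-(j : ZMod m))) i ∘ₗ T.reducedOp S φ =
      (-1 : ℤ) ^ i • (T.reducedOp S φ ∘ₗ S.link φ (fun j => T.left (-(j : ZMod m))) i) := by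
  intro i hi
  induction i with
  | zero => simp [link, chain]
  | succ i ih =>
    have hne : -(i : ZMod m) ≠ -((i + 1 : ℕ) : ZMod m) := fun h => by
      have := natCast_inj_of_lt (m := m) (by omega) hi (neg_injective h)
      omega
    have h1 : T.reducedOp S φ ∘ₗ S.exchange φ (T.left (-(i : ZMod m))) (T.left (-((i + 1 : ℕ) : ZMod m)))
        = -(S.exchange φ (T.left (-(i : ZMod m))) (T.left (-((i + 1 : ℕ) : ZMod m))) ∘ₗ
          T.reducedOp S φ) := S.op_reduced_exchange hne
    rw [link_succ, LinearMap.comp_assoc, ih (by omega), LinearMap.comp_smul, ← LinearMap.comp_assoc,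
      ← neg_eq_iff_eq_neg.2 h1, LinearMap.neg_comp, LinearMap.comp_assoc, smul_neg, pow_succ,
      mul_neg_one, neg_smul]

theorem polygonOp_chain {L : List (ZMod m)} (hL : L.Nodup) (hL' : ∀ k, k ∈ L) : ∃ s : ℕ,
    T.polygonOp S φ ∘ₗ chain (fun k => LinearMap.id + T.hexagonOp S φ (· ≠ T.p) k) L =
      (-1 : ℤ) ^ s • (S.link φ (fun j => T.left (-(j : ZMod m))) (m - 1) ∘ₗ
        chain (T.stepOp S φ) L) := by
  have C := T.corner (m := m)
  obtain ⟨i, hi⟩ := chain_perm (Y := T.sectorOp S φ)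
    (fun j k h => S.op_sector_op_sector h.symm) (L' := L)
    ((List.perm_ext_iff_of_nodup ringList_nodup hL).2 fun k => by simp [mem_ringList, hL'])
    ringList_nodup
  obtain ⟨j, hj⟩ := chain_comp (Y := T.sectorOp S φ)
    (X := fun k => LinearMap.id + T.hexagonOp S φ (· ≠ T.p) k) 1 (fun j k h => by
      rw [one_smul, LinearMap.comp_add, LinearMap.add_comp, LinearMap.comp_id, LinearMap.id_comp]
      congr 1
      exact S.op_sector_hexagon C T.joined_left_right h) hL
  rw [one_pow, one_smul] at hj
  refine ⟨i, ?_⟩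
  rw [polygonOp, hi, LinearMap.comp_smul, LinearMap.smul_comp, LinearMap.comp_assoc, hj]
  rfl

theorem stabilizationMap_boundaryH (e : Fin m ≃ ZMod m) :
    T.stabilizationMap S φ e ∘ₗ T.boundaryH S φ =
      T.boundarySum S φ ∘ₗ T.stabilizationMap S φ e := by
  have hm := NeZero.pos m
  have hL : (List.ofFn e).reverse.Nodup := List.nodup_reverse.2 (List.nodup_ofFn.2 e.injective)
  have hL' : ∀ k, k ∈ (List.ofFn e).reverse := fun k => by
    rw [List.mem_reverse, List.mem_ofFn]
    exact e.surjective k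
  refine LinearMap.ext fun x => ?_
  rw [LinearMap.comp_apply, LinearMap.comp_apply, boundarySum, LinearMap.prodMap_apply]
  refine Prod.ext (extendStates_injective ?_) (extendStates_injective ?_)
  · obtain ⟨s, hs⟩ := extendStates_typeR (T := T) S φ e
    obtain ⟨t, ht⟩ := polygonOp_chain (T := T) S φ hL hL'
    have h1 : ∀ v, T.extendStates (T.stabilizationMap S φ e v).1 = (-1 : ℤ) ^ (s + t) •
        S.link φ (fun j => T.left (-(j : ZMod m))) (m - 1)
          (chain (T.stepOp S φ) (List.ofFn e).reverse (T.toStates v)) := by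
      intro v
      rw [hs, ← LinearMap.comp_apply (T.polygonOp S φ), ht, LinearMap.smul_apply, smul_smul,
        ← pow_add, LinearMap.comp_apply]
    have h2 := LinearMap.congr_fun (link_reducedOp S φ (T := T) (m - 1) (by omega))
      (chain (T.stepOp S φ) (List.ofFn e).reverse (T.toStates x))
    rw [LinearMap.comp_apply, LinearMap.smul_apply, LinearMap.comp_apply] at h2
    simp only
    rw [h1, toStates_boundaryH, chain_stepOp_plainOp S hL hL' (toStates_mem x), map_smul, h2,
      LinearMap.neg_apply, map_neg, extendStates_boundaryG, h1, map_smul, ← smul_neg, smul_smul]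
    rw [List.length_reverse, List.length_ofFn, ← pow_add, smul_smul, ← pow_add,
      show s + t + m + (m - 1) = s + t + 2 * (m - 1) + 1 by omega, pow_succ, pow_add, pow_mul,
      neg_one_sq, one_pow, mul_one, mul_neg_one, neg_smul, smul_neg]
  · simp only
    rw [extendStates_typeL, toStates_boundaryH, chain_fillOp_plainOp S hL hL' (toStates_mem x),
      extendStates_boundaryG, extendStates_typeL]

end Stabilization
end GridCover

namespace GridCover

theorem pairCount_comm (A B : ℚ × ℚ →₀ ℚ) : pairCount A B = pairCount B A := by
  unfold pairCount
  rw [Finsupp.sum_comm]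
  refine Finsupp.sum_congr fun b _ => Finsupp.sum_congr fun a _ => ?_
  rw [mul_comm (A a), ← neg_sub b.1 a.1, ← neg_sub b.2 a.2, neg_mul_neg]

theorem pairCount_sum {ι : Type*} (s : Finset ι) (f : ι → ℚ × ℚ →₀ ℚ) (B : ℚ × ℚ →₀ ℚ) :
    pairCount (∑ i ∈ s, f i) B = ∑ i ∈ s, pairCount (f i) B := by
  induction s using Finset.cons_induction with
  | empty => simp [pairCount]
  | cons a s ha ih => rw [Finset.sum_cons, Finset.sum_cons, pairCount_add, ih]

theorem pairCount_sub (A A' B : ℚ × ℚ →₀ ℚ) :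
    pairCount (A - A') B = pairCount A B - pairCount A' B := by
  have := pairCount_add (A - A') A' B
  rw [sub_add_cancel] at this
  linarith

theorem pairCount_single (a b : ℚ × ℚ) (s t : ℚ) :
    pairCount (Finsupp.single a s) (Finsupp.single b t) =
      s * t * if 0 < (b.1 - a.1) * (b.2 - a.2) then 1 else 0 := by
  unfold pairCount
  rw [Finsupp.sum_single_index, Finsupp.sum_single_index] <;> simp

theorem latticePoint_lt_centre_iff {n : ℕ} (j i c r : Fin n) :
    0 < ((centre c r).1 - (latticePoint j i).1) * ((centre c r).2 - (latticePoint j i).2) ↔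
      (c < j ↔ r < i) := by
  have key : ∀ a b : Fin n, (a < b → ((a : ℕ) : ℚ) + 1 / 2 - (b : ℕ) < 0) ∧
      (¬ a < b → 0 < ((a : ℕ) : ℚ) + 1 / 2 - (b : ℕ)) := by
    intro a b
    rw [Fin.lt_def, not_lt]
    constructor
    · intro h
      have : ((a : ℕ) : ℚ) + 1 ≤ (b : ℕ) := by exact_mod_cast h
      linarith
    · intro h
      have : ((b : ℕ) : ℚ) ≤ (a : ℕ) := by exact_mod_cast h
      linarith
  simp only [centre, latticePoint]
  by_cases h1 : c < j <;> by_cases h2 : r < i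
  · simp only [h1, h2, iff_true]
    exact mul_pos_of_neg_of_neg ((key _ _).1 h1) ((key _ _).1 h2)
  · simp only [h1, h2, iff_false, not_true]
    exact (mul_neg_of_neg_of_pos ((key _ _).1 h1) ((key _ _).2 h2)).not_gt
  · simp only [h1, h2, false_iff, not_true, iff_false]
    exact (mul_neg_of_pos_of_neg ((key _ _).2 h1) ((key _ _).1 h2)).not_gt
  · simp only [h1, h2, iff_true]
    exact mul_pos ((key _ _).2 h1) ((key _ _).2 h2)

theorem centre_lt_centre_iff {n : ℕ} (c r c' r' : Fin n) :
    0 < ((centre c' r').1 - (centre c r).1) * ((centre c' r').2 - (centre c r).2) ↔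
      (c < c' ∧ r < r') ∨ (c' < c ∧ r' < r) := by
  simp only [centre, add_sub_add_right_eq_sub, mul_pos_iff, sub_pos, sub_neg, Nat.cast_lt, Fin.lt_def]

namespace Grid

variable {n : ℕ} (G : Grid n)

theorem crossing_eq_sub (j i c : Fin n) :
    (if c < j ↔ G.X c < i then (1 : ℤ) else 0) - (if c < j ↔ G.O c < i then 1 else 0) =
      G.crossing c i - 2 * if c < j then G.crossing c i else 0 := by
  unfold crossing
  by_cases h1 : c < j <;> by_cases h2 : G.X c < i <;> by_cases h3 : G.O c < i <;>
    simp [h1, h2, h3, not_le.2, not_lt.1]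

theorem pairCount_latticePoint (j i : Fin n) (w : ℚ) :
    pairCount (Finsupp.single (latticePoint j i) w) (G.sumX - G.sumO) =
      w * ((-2 * G.sheetShift i j : ℤ) : ℚ) := by
  rw [pairCount_comm, pairCount_sub, sumX, sumO, pairCount_sum, pairCount_sum,
    ← Finset.sum_sub_distrib]
  have h : ∀ c, pairCount (Finsupp.single (centre c (G.X c)) 1) (Finsupp.single (latticePoint j i) w) -
      pairCount (Finsupp.single (centre c (G.O c)) 1) (Finsupp.single (latticePoint j i) w) =
        w * ((G.crossing c i - 2 * if c < j then G.crossing c i else 0 : ℤ) : ℚ) := by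
    intro c
    rw [pairCount_comm, pairCount_comm (Finsupp.single (centre c (G.O c)) 1), pairCount_single,
      pairCount_single, ← crossing_eq_sub]
    simp only [latticePoint_lt_centre_iff]
    push_cast
    ring
  rw [Finset.sum_congr rfl fun c _ => h c, ← Finset.mul_sum, ← Int.cast_sum, Finset.sum_sub_distrib,
    G.sum_crossing, ← Finset.mul_sum, sheetShift, zero_sub, neg_mul]

/-- The part of the Alexander grading which does not depend on the generator. -/
noncomputable def alexanderConst : ℚ :=
  -(1 / 4) * pairCount (G.sumX + G.sumO) (G.sumX - G.sumO) - ((n : ℚ) - 1) / 2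

/-- The number of ordered pairs of columns in which the markings `f` are in increasing
position. -/
def orderCount (f : Fin n → Fin n) : ℤ :=
  ∑ c, ∑ c', if (c < c' ∧ f c < f c') ∨ (c' < c ∧ f c' < f c) then 1 else 0

theorem alexanderConst_eq : G.alexanderConst =
    -(1 / 4) * ((orderCount G.X - orderCount G.O : ℤ) : ℚ) - ((n : ℚ) - 1) / 2 := by
  have h : ∀ f : Fin n → Fin n, pairCount (∑ c, Finsupp.single (centre c (f c)) 1)
      (∑ c, Finsupp.single (centre c (f c)) 1) = (orderCount f : ℚ) := by
    intro f
    rw [pairCount_sum, orderCount, Int.cast_sum]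
    refine Finset.sum_congr rfl fun c _ => ?_
    rw [pairCount_comm, pairCount_sum, Int.cast_sum]
    refine Finset.sum_congr rfl fun c' _ => ?_
    rw [pairCount_comm, pairCount_single]
    simp only [centre_lt_centre_iff]
    push_cast
    ring
  rw [alexanderConst, pairCount_comm, pairCount_sub, pairCount_comm, pairCount_comm G.sumO,
    pairCount_add, pairCount_add, pairCount_comm G.sumO, sumX, sumO, h, h]
  push_cast
  ring

open Classical in
theorem crossing_sub_crossing {c i i' : Fin n} : G.crossing c i - G.crossing c i' =
    (if CycIco i i' (G.X c) then 1 else 0) - (if CycIco i i' (G.O c) then 1 else 0) := by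
  unfold crossing
  simp only [cycIco_iff, Fin.lt_def, Fin.le_def]
  split_ifs <;> omega

open Classical in
/-- The markings in the rectangle with left side `a`, right side `b`, lower side `i` and upper side
`i'`. -/
theorem sheetShift_rectangle (a b i i' : Fin n) :
    (G.sheetShift i b - G.sheetShift i a) - (G.sheetShift i' b - G.sheetShift i' a) =
      ∑ c, if CycIco a b c then ((if CycIco i i' (G.X c) then 1 else 0) -
        (if CycIco i i' (G.O c) then 1 else 0) : ℤ) else 0 := by
  rw [sheetShift_sub, sheetShift_sub, ← Finset.sum_sub_distrib]
  refine Finset.sum_congr rfl fun c _ => ?_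
  rw [← crossing_sub_crossing]
  split_ifs <;> simp

end Grid

namespace Generator

variable {n m : ℕ} [NeZero m] {G : Grid n}

theorem alexander_eq (x : Generator G m) : x.alexander =
    G.alexanderConst - 1 / (m : ℚ) * ((∑ b : Curve n m, G.sheetShift (x.row b) b.1 : ℤ) : ℚ) := by
  rw [alexander, Grid.alexanderValue, pairCount_sub, pairCount_smul, pairCount_sum,
    Finset.sum_congr rfl fun b _ => G.pairCount_latticePoint b.1 (x.row b) (1 / (m : ℚ)),
    ← Finset.mul_sum, ← Int.cast_sum, ← Finset.mul_sum, Grid.alexanderConst]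
  push_cast
  ring

theorem IsExchange.alexander {x y : Generator G m} {l r : Curve n m} (h : x.IsExchange y l r)
    (hlr : l ≠ r) (h0 : G.sheetShift (x.row l) r.1 - G.sheetShift (x.row l) l.1 -
      (G.sheetShift (x.row r) r.1 - G.sheetShift (x.row r) l.1) = 0) : y.alexander = x.alexander := by
  rw [alexander_eq, alexander_eq]
  congr 3
  rw [← sub_eq_zero, ← Finset.sum_sub_distrib, ← Finset.sum_subset (Finset.subset_univ {l, r}),
    Finset.sum_pair hlr, h.left, h.right]
  · linarith
  · intro b _ hb
    simp only [Finset.mem_insert, Finset.mem_singleton, not_or] at hb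
    rw [h.rest b hb.1 hb.2, sub_self]

theorem IsRectangle.alexander {x y : Generator G m} {l r : Curve n m} (h : x.IsRectangle y l r) :
    y.alexander = x.alexander := by
  refine h.exchange.alexander (fun h' => h.columns_ne (congrArg _ h')) ?_
  rw [Grid.sheetShift_rectangle]
  refine Finset.sum_eq_zero fun c _ => ?_
  split_ifs with h1 h2 h3 h3
  · rfl
  · exact absurd h2 (h.no_X c h1)
  · exact absurd h3 (h.no_O c h1)
  · rfl
  · rfl

end Generator

namespace Stabilization

variable {n : ℕ} {T : Stabilization n} {m : ℕ} [NeZero m]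

theorem IsPuncturedHexagon.alexander {x y : Generator T.H m} {k : ZMod m}
    (h : T.IsPuncturedHexagon x y k) : y.alexander = x.alexander := by
  have C := T.corner (m := m)
  obtain ⟨z, l, h1, h2, -⟩ := h
  refine h2.alexander.trans (h1.exchange.alexander C.mk_ne ?_)
  rw [Grid.sheetShift_rectangle]
  refine Finset.sum_eq_zero fun c _ => ?_
  by_cases h3 : CycIco (T.left k).1 (T.right k).1 c
  · have h4 := h1.puncture
    obtain rfl := C.eq_of_cycIco h3
    rw [if_pos h3, T.X_new, T.O_new, if_pos, if_pos, sub_self] <;>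
      simp only [cycIco_iff, cycIoo_iff, p, Fin.val_succ, Fin.val_castSucc] at * <;> omega
  · exact if_neg h3

theorem IsPolygon.alexander {x y : Generator T.H m} {e : ZMod m → Curve (n + 1) m}
    (h : T.IsPolygon x y e) : y.alexander = x.alexander - 1 := by
  have hm : (m : ℚ) ≠ 0 := Nat.cast_ne_zero.mpr (NeZero.ne m)
  have hS := (polygon_iff.1 h).1
  have hp : ∀ k, x.row (e k) = T.p := fun k => (hS k).2.2
  have he : Function.Injective e := fun j k hjk => by
    by_contra hne
    exact (hS j).ne_of_ne hne (hS k) hjk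
  have hl : Function.Injective (T.left (m := m)) := fun j k hjk => congrArg Prod.snd hjk
  have hd : Disjoint (Finset.univ.image (T.left (m := m))) (Finset.univ.image e) := by
    rw [Finset.disjoint_left]
    simp only [Finset.mem_image, Finset.mem_univ, true_and]
    rintro b ⟨j, rfl⟩ ⟨k, hk⟩
    exact h.column_ne k (congrArg Prod.fst hk)
  have key : (∑ b : Curve (n + 1) m, T.H.sheetShift (y.row b) b.1) -
      ∑ b : Curve (n + 1) m, T.H.sheetShift (x.row b) b.1 = m := by
    rw [← Finset.sum_sub_distrib, ← Finset.sum_subset (Finset.subset_univ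
      (Finset.univ.image (T.left (m := m)) ∪ Finset.univ.image e)), Finset.sum_union hd,
      Finset.sum_image fun _ _ _ _ h => hl h, Finset.sum_image fun _ _ _ _ h => he h,
      ← Finset.sum_add_distrib]
    · rw [Finset.sum_congr rfl fun k _ => (?_ : _ = (1 : ℤ))]
      · simp
      · have h1 := T.H.sheetShift_rectangle T.c₀ (e k).1 (x.row (T.left k)) T.p
        rw [h.target_left, h.target_right, hp]
        change T.H.sheetShift T.p T.c₀ - T.H.sheetShift (x.row (T.left k)) T.c₀ + _ = 1
        rw [Finset.sum_eq_single_of_mem T.c₀ (Finset.mem_univ _), if_pos, if_pos, if_neg] at h1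
        · linarith
        · exact h.no_O k _ (Sheets.cycIco_self (h.column_ne k).symm)
        · exact (h.only_X k _ (Sheets.cycIco_self (h.column_ne k).symm)).2 rfl
        · exact Sheets.cycIco_self (h.column_ne k).symm
        · intro c _ hc
          split_ifs with h2 h3 h4 h4
          · rfl
          · exact absurd ((h.only_X k c h2).1 h3) hc
          · exact absurd h4 (h.no_O k c h2)
          · rfl
          · rfl
    · intro b _ hb
      simp only [Finset.mem_union, Finset.mem_image, Finset.mem_univ, true_and, not_or,
        not_exists] at hb
      rw [h.rest b (fun k h' => hb.1 k h'.symm) (fun k h' => hb.2 k h'.symm), sub_self]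
  rw [Generator.alexander_eq, Generator.alexander_eq, eq_add_of_sub_eq key]
  push_cast
  field_simp
  ring

theorem orderCount_eq {f : Fin (n + 1) → Fin (n + 1)} {g : Equiv.Perm (Fin n)} {c₀ : Fin (n + 1)}
    {q : Fin n} (h : ∀ c, q.predAbove (f (c₀.succAbove c)) = g c) :
    Grid.orderCount f = Grid.orderCount g + 2 * ∑ c : Fin n,
      if (c₀ < c₀.succAbove c ∧ f c₀ < f (c₀.succAbove c)) ∨
        (c₀.succAbove c < c₀ ∧ f (c₀.succAbove c) < f c₀) then 1 else 0 := by
  have key : ∀ c c', c₀.succAbove c < c₀.succAbove c' ∧ f (c₀.succAbove c) < f (c₀.succAbove c') ↔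
      c < c' ∧ g c < g c' := by
    intro c c'
    rw [Fin.succAbove_lt_succAbove_iff]
    refine and_congr_right fun hc => ⟨fun h1 => ?_, fun h1 => ?_⟩
    · have h2 := Fin.predAbove_right_monotone q h1.le
      rw [h, h] at h2
      exact lt_of_le_of_ne h2 fun h3 => hc.ne (g.injective h3)
    · by_contra h2
      have h3 := Fin.predAbove_right_monotone q (not_lt.1 h2)
      rw [h, h] at h3
      exact absurd h1 (not_lt.2 h3)
  unfold Grid.orderCount
  rw [Fin.sum_univ_succAbove _ c₀, Fin.sum_univ_succAbove _ c₀]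
  simp only [lt_self_iff_false, false_and, or_false, if_false, zero_add]
  rw [Finset.sum_congr rfl fun c _ => Fin.sum_univ_succAbove _ c₀, Finset.sum_add_distrib]
  simp only [key]
  rw [← add_assoc, add_comm, two_mul]
  congr 2
  exact Finset.sum_congr rfl fun c _ => if_congr (by tauto) rfl rfl

theorem alexanderConst_H :
    T.H.alexanderConst = T.G.alexanderConst + T.H.sheetShift T.p T.c₀ - 1 := by
  have h1 : ∀ c : Fin n, (if (T.c₀ < T.c₀.succAbove c ∧ T.H.X T.c₀ < T.H.X (T.c₀.succAbove c)) ∨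
        (T.c₀.succAbove c < T.c₀ ∧ T.H.X (T.c₀.succAbove c) < T.H.X T.c₀) then (1 : ℤ) else 0) -
      (if (T.c₀ < T.c₀.succAbove c ∧ T.H.O T.c₀ < T.H.O (T.c₀.succAbove c)) ∨
        (T.c₀.succAbove c < T.c₀ ∧ T.H.O (T.c₀.succAbove c) < T.H.O T.c₀) then 1 else 0) =
      (if T.c₀.succAbove c < T.c₀ ↔ T.H.X (T.c₀.succAbove c) < T.p then 1 else 0) -
        (if T.c₀.succAbove c < T.c₀ ↔ T.H.O (T.c₀.succAbove c) < T.p then 1 else 0) := by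
    intro c
    have e1 : T.H.X (T.c₀.succAbove c) ≠ T.H.X T.c₀ :=
      fun h => Fin.succAbove_ne _ _ (T.H.X.injective h)
    have e2 : T.H.O (T.c₀.succAbove c) ≠ T.H.O T.c₀ :=
      fun h => Fin.succAbove_ne _ _ (T.H.O.injective h)
    have e3 := Fin.succAbove_ne T.c₀ c
    rw [T.X_new] at e1 ⊢
    rw [T.O_new] at e2 ⊢
    simp only [p, ne_eq, Fin.ext_iff, Fin.lt_def, Fin.val_castSucc, Fin.val_succ] at *
    congr 1
    · exact if_congr (by omega) rfl rfl
    · exact if_congr (by omega) rfl rfl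
  have h2 := Fin.sum_univ_succAbove (fun c => T.H.crossing c T.p -
    2 * if c < T.c₀ then T.H.crossing c T.p else 0) T.c₀
  simp only [← T.H.crossing_eq_sub T.c₀ T.p (T.c₀.succAbove _), ← h1] at h2
  rw [Finset.sum_sub_distrib, Finset.sum_sub_distrib, T.H.sum_crossing, ← Finset.mul_sum,
    T.crossing_c₀, if_pos rfl, if_neg (lt_irrefl _)] at h2
  rw [Grid.alexanderConst_eq, Grid.alexanderConst_eq, orderCount_eq T.X_old, orderCount_eq T.O_old,
    Grid.sheetShift]
  have h3 := congrArg (Int.cast : ℤ → ℚ) h2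
  push_cast at h3 ⊢
  linarith

theorem alexander_extend (y : Generator T.G m) : (T.extend y).alexander = y.alexander - 1 := by
  have hm : (m : ℚ) ≠ 0 := Nat.cast_ne_zero.mpr (NeZero.ne m)
  have h : ∑ b : Curve (n + 1) m, T.H.sheetShift ((T.extend y).row b) b.1 =
      m * T.H.sheetShift T.p T.c₀ + ∑ b : Curve n m, T.G.sheetShift (y.row b) b.1 := by
    rw [Fintype.sum_prod_type, Fin.sum_univ_succAbove _ T.c₀, Fintype.sum_prod_type]
    congr 1
    · refine (Finset.sum_congr rfl fun k _ =>
        congrArg (T.H.sheetShift · T.c₀) (extend_row_left y k)).trans ?_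
      simp
    · refine Finset.sum_congr rfl fun j _ => Finset.sum_congr rfl fun k _ => ?_
      rw [← T.sheetShift_old]
      exact congrArg (T.H.sheetShift · _) (extend_row_betaCurve y (j, k))
  rw [Generator.alexander_eq, Generator.alexander_eq, alexanderConst_H, h]
  push_cast
  field_simp
  ring

theorem alexander_of_steps {G : ZMod m → (Curve (n + 1) m → Fin (n + 1)) → Prop}
    {R : Fin (n + 1) → Prop} (e : Fin m ≃ ZMod m) {z : Fin (m + 1) → Generator T.H m}
    (h : ∀ i, T.Step G R (e i) (z i.castSucc) (z i.succ)) :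
    (z (Fin.last m)).alexander = (z 0).alexander := by
  have : ∀ b, (z b).alexander = (z 0).alexander := by
    intro b
    induction b using Fin.induction with
    | zero => rfl
    | succ b ih =>
      rw [← ih]
      rcases h b with ⟨h1, -⟩ | ⟨h1, -⟩
      · rw [h1]
      · exact h1.alexander
  exact this _

theorem map_gradedH_le (S : SignAssignment (m * (n + 1))) (φ : Framing (n + 1) m)
    (e : Fin m ≃ ZMod m) (d : ℚ) :
    (T.gradedH m d).map (T.stabilizationMap S φ e) ≤ T.gradedSum m d := by
  classical
  rw [Submodule.map_le_iff_le_comap, gradedH, Finsupp.supported_eq_span_single, Submodule.span_le]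
  rintro _ ⟨x, rfl, rfl⟩
  change T.stabilizationMap S φ e (Finsupp.single x 1) ∈ T.gradedSum m x.alexander
  rw [stabilizationMap, Finsupp.linearCombination_single, one_smul]
  refine Submodule.mem_prod.2 ⟨Submodule.sum_mem _ fun y _ => Submodule.sum_mem _ fun z hz =>
    Finsupp.single_mem_supported ℤ _ ?_, Submodule.sum_mem _ fun y _ => Submodule.sum_mem _
    fun z hz => Finsupp.single_mem_supported ℤ _ ?_⟩
  · obtain ⟨⟨h0, h1⟩, c, h2⟩ := (typeR_iff e).1 (Finset.mem_filter.1 hz).2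
    have h3 := h2.alexander
    rw [alexander_of_steps e h1, h0, alexander_extend] at h3
    exact sub_left_injective h3
  · obtain ⟨⟨h0, h1⟩, h2⟩ := (typeL_iff e (extend_row_left y)).1 (Finset.mem_filter.1 hz).2
    change y.alexander - 1 = x.alexander
    rw [← alexander_extend, ← h2, alexander_of_steps e h1, h0]

end Stabilization
end GridCover

theorem mainTheorem3 (m n : ℕ) [NeZero m] (T : GridCover.Stabilization n)
    (hT : T.G.IsKnotDiagram) (S : GridCover.SignAssignment (m * (n + 1)))
    (φ : GridCover.Framing (n + 1) m) (e : Fin m ≃ ZMod m) :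
    T.stabilizationMap S φ e ∘ₗ T.boundaryH S φ
        = T.boundarySum S φ ∘ₗ T.stabilizationMap S φ e ∧
      ∀ d : ℚ, (T.gradedH m d).map (T.stabilizationMap S φ e) ≤ T.gradedSum m d := by
  exact ⟨GridCover.Stabilization.stabilizationMap_boundaryH S φ e,
    GridCover.Stabilization.map_gradedH_le S φ e⟩
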